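/- **Model.** Time is divided into slots $1,2,3,\dots$. Nodes join a multiple-access channel at the beginning of slots, each with one message, and a node is present from its arrival up to and including the slot in which its message gets through. In each slot every present node broadcasts or stays idle. If exactly one node broadcasts and the slot is not jammed, its message gets through; otherwise nothing gets through. There is no collision detection: the feedback of a slot only tells whether a message got through (and, to the adversary, which node's). An *algorithm* is one randomized rule run by all nodes with independent private randomness: whether a node broadcasts in a slot depends only on its private randomness and on whether a message got through in each of the previous slots since its arrival (no identifiers, no global clock). An *adaptive adversary* (possibly randomized, with randomness independent of the nodes') decides before each slot, from the feedback of all previous slots, how many nodes to inject at the beginning of the slot and whether to jam it. A slot is *active* if some node is present in it. Let $n_t,d_t,a_t$ be the numbers of arrived nodes, of jammed slots and of active slots among the first $t$ slots. For $f,g:\mathbb R^+\to\mathbb R^+$, an algorithm *achieves $(f,g)$-throughput* if for every integer $t\ge1$ and every adaptive adversary, $a_t\le n_tf(t)+d_tg(t)$ with high probability in $n_t$; that is, there is a constant $c\ge1$ such that for all $t\ge 1$, all adversaries and all integers $n\ge1$, $$\Pr\left[\,n_t\ge n\ \text{ and }\ a_t>n_tf(t)+d_tg(t)\,\right]\le n^{-c}.$$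 **Sub-logarithmic functions.** Given a constant $y_0>0$, a function $u$ on $\mathbb R^+$ is *sub-logarithmic* if (1) $u(x)\in O(\log x)$ and $u$ is non-decreasing; (2) $u(x)\ge y_0$ for all sufficiently large $x$; (3) for every $c>0$ there is $c_0$ with $|u(cn)-u(n)|\le c_0$ for all $n\in\mathbb N^+$; (4) for every $c>0$, $u(x^c)\in\Theta(u(x))$. **Theorem.** There is an absolute constant $y_0>0$ such that the following holds. Let $g:\mathbb R^+\to\mathbb R^+$ be such that $g(x)\ge1$ for all sufficiently large $x$, $\log^2 g$ is sub-logarithmic, and $\frac{\log x}{\log^2 g(x)}$ is, up to constant factors as $x\to\infty$, non-decreasing (i.e. some non-decreasing function lies in $\Theta\left(\frac{\log x}{\log^2 g(x)}\right)$). Then there are a function $f:\mathbb R^+\to\mathbb R^+$ with $f(x)\in\Theta\left(\frac{\log x}{\log^2 g(x)}\right)$ as $x\to\infty$ and an algorithm that achieves $(f,g)$-throughput. -/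

import Mathlib

open MeasureTheory Filter Asymptotics

/-- `f : ℝ⁺ → ℝ⁺` is sub-logarithmic, with `y₀` as the large constant that `f` eventually reaches.
Only the values of `f` on the positive reals matter. -/
structure SubLogarithmic (y₀ : ℝ) (f : ℝ → ℝ) : Prop where
  isBigO_log : f =O[atTop] Real.log
  monotone : MonotoneOn f (Set.Ioi 0)
  eventually_large : ∃ x₀ : ℝ, ∀ x : ℝ, x₀ ≤ x → y₀ ≤ f x
  dilation : ∀ c : ℝ, 0 < c → ∃ c₀ : ℝ, ∀ n : ℕ, 0 < n → |f (c * n) - f n| ≤ c₀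
  power : ∀ c : ℝ, 0 < c → (fun x : ℝ => f (x ^ c)) =Θ[atTop] f

/-- A contention resolution algorithm without collision detection. Every node runs the same rule with
its own private random tape. In each slot in which it is present, a node decides whether to broadcast
from its tape and from the list of binary feedbacks (`true`: a message got through, `false`: silence,
collision or jamming, which it cannot tell apart) of the slots since its arrival, most recent first.
In particular nodes have no identifiers and no global clock. -/
structure Algorithm where
  Tape : Type
  [tapeSpace : MeasurableSpace Tape]
  law : Measure Tape
  [isProb : IsProbabilityMeasure law]
  broadcast : List Bool → Tape → Bool
  measurable_broadcast : ∀ h : List Bool, Measurable (broadcast h)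

attribute [instance] Algorithm.tapeSpace Algorithm.isProb

/-- An adaptive, possibly randomized, adversary. Before each slot it sees the channel feedback of all
previous slots, most recent first (`some j`: the message of node `j` got through; `none`: no success),
and chooses how many nodes to inject at the beginning of the slot, and whether to jam the slot.
It does not see the tapes of the nodes, and cannot tell silence from collision. -/
structure Adversary where
  Seed : Type
  [seedSpace : MeasurableSpace Seed]
  law : Measure Seed
  [isProb : IsProbabilityMeasure law]
  act : List (Option ℕ) → Seed → ℕ × Bool
  measurable_act : ∀ h : List (Option ℕ), Measurable (act h)

attribute [instance] Adversary.seedSpace Adversary.isProb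

/-- The situation at the end of a slot. Nodes are numbered `0, 1, 2, …` in the order of arrival. -/
structure Config where
  /-- number of nodes injected so far -/
  arrived : ℕ
  /-- the nodes that are still in the system -/
  present : Finset ℕ
  /-- the feedbacks that each node has heard since its arrival, most recent first -/
  heard : ℕ → List Bool
  /-- the feedback of all slots so far, most recent first -/
  history : List (Option ℕ)
  /-- number of jammed slots so far -/
  jammed : ℕ
  /-- number of active slots so far -/
  active : ℕ

/-- The situation before the first slot. -/
def Config.init : Config where
  arrived := 0
  present := ∅
  heard := fun _ => []
  history := []
  jammed := 0
  active := 0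

open Classical in
/-- The outcome of a slot in which the nodes in `S` broadcast: the message of `j` gets through if `j`
is the only broadcasting node and the slot is not jammed. -/
noncomputable def slotOutcome (jam : Bool) (S : Finset ℕ) : Option ℕ :=
  if h : jam = false ∧ ∃ j, S = {j} then some h.2.choose else none

theorem slotOutcome_eq_some_iff (jam : Bool) (S : Finset ℕ) (j : ℕ) :
    slotOutcome jam S = some j ↔ jam = false ∧ S = {j} := by
  unfold slotOutcome
  split_ifs with h
  · have hs := h.2.choose_spec
    constructor
    · intro e
      refine ⟨h.1, ?_⟩
      rw [← Option.some.inj e]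
      exact hs
    · rintro ⟨-, e⟩
      have : h.2.choose = j := by
        have h2 : ({j} : Finset ℕ) = {h.2.choose} := e.symm.trans hs
        exact (Finset.singleton_injective h2).symm
      rw [this]
  · constructor
    · intro e
      cases e
    · rintro ⟨h1, h2⟩
      exact absurd ⟨h1, j, h2⟩ h

/-- One slot, in which the adversary injects `a.1` nodes and jams the slot if `a.2 = true`. The new
nodes are present in this slot already; a node whose message gets through leaves after the slot. -/
noncomputable def Config.step (A : Algorithm) (tapes : ℕ → A.Tape) (a : ℕ × Bool) (C : Config) :
    Config :=
  let arrived' : ℕ := C.arrived + a.1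
  let inSystem : Finset ℕ := C.present ∪ Finset.Ico C.arrived arrived'
  let senders : Finset ℕ := inSystem.filter fun j => A.broadcast (C.heard j) (tapes j) = true
  let out : Option ℕ := slotOutcome a.2 senders
  { arrived := arrived'
    present := inSystem.filter fun j => out ≠ some j
    heard := fun j => if j < arrived' then out.isSome :: C.heard j else []
    history := out :: C.history
    jammed := C.jammed + if a.2 = true then 1 else 0
    active := C.active + if inSystem.Nonempty then 1 else 0 }

/-- The situation after the first `t` slots. -/
noncomputable def runSlots (A : Algorithm) (E : Adversary) (seed : E.Seed) (tapes : ℕ → A.Tape) :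
    ℕ → Config
  | 0 => Config.init
  | t + 1 =>
    let C := runSlots A E seed tapes t
    C.step A tapes (E.act C.history seed)

/-- The probability space of an execution: the adversary's seed and the tapes of the nodes `0, 1, …`
are independent, and all the tapes have the same law. -/
noncomputable def execLaw (A : Algorithm) (E : Adversary) : Measure (E.Seed × (ℕ → A.Tape)) :=
  E.law.prod (Measure.infinitePi fun _ : ℕ => A.law)

/-- `(f, g)`-throughput: for every `t ≥ 1` and every adversary, the number of active slots among the
first `t` is at most `n_t * f t + d_t * g t` with high probability in the number `n_t` of arrivals.
As `n_t` is itself random (the adversary is adaptive), the last clause says that for every `n ≥ 1` the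
bound fails while `n_t ≥ n` with probability at most `1 / n ^ c`, for a constant `c ≥ 1`. -/
def AchievesThroughput (A : Algorithm) (f g : ℝ → ℝ) : Prop :=
  ∃ c : ℝ, 1 ≤ c ∧ ∀ (E : Adversary) (t : ℕ), 1 ≤ t → ∀ n : ℕ, 1 ≤ n →
    execLaw A E {p | n ≤ (runSlots A E p.1 p.2 t).arrived ∧
      ((runSlots A E p.1 p.2 t).arrived : ℝ) * f t + ((runSlots A E p.1 p.2 t).jammed : ℝ) * g t
        < ((runSlots A E p.1 p.2 t).active : ℝ)}
      ≤ ENNReal.ofReal (1 / (n : ℝ) ^ c)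

/-! Silence, collision and jamming look alike, so nodes can coordinate only through successes. A
node that hears its first success learns which slots are control slots; a later success in a control
slot turns every node that knows them into a synchronized node, and all synchronized nodes share the
age `a` of this restart. They act as a batch: they broadcast with probability about `log a / a` in
control slots and `1 / a` in sparse data slots. For a batch of `N` nodes, control slots hardly ever
succeed before age about `N / 2`; in between, at ages of order `N`, the data slots succeed with
constant probability and let a constant fraction of the batch leave; then a control slot soon
restarts the rest. So synchronized nodes cost a constant number of slots per success, unless
arrivals or jams disturb them.

The price `f` comes from the nodes in backoff. Octave `k` of the own slots of a node is cut into `2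
^ β k` blocks, and in each block the node makes at most one attempt at a hidden, uniform place,
besides some attempts at a harmonic rate. On the one hand the total noise of a node up to time `T`
is `O(2 ^ β * log T)`, so an arrival spoils few slots and costs about `F = 2 ^ β`. On the other hand
let `2 ^ j` be a small power of `g`. An adversary that can afford only `T / (C * G)` jams covers a
small part of each long block in the last `2 * j` octaves, so that a block fails with probability
about `2 ^ (-j)`. There are about `2 * j * 2 ^ β` blocks, and all fail with probability about `2 ^
(-2 * j ^ 2 * 2 ^ β)`. This is a high negative power of `T` once `2 ^ β` is of order `log T / log²
g`, the order claimed for `f`.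

The run is divided into epochs (between restarts, or while the channel is empty) and gaps (between
successes). Three failures are possible: an epoch longer than `C` times what its nodes, arrivals and
jams account for (`LongEpoch.cases`, `Pr_longEpoch_le`), a restart before the data phase is over
(`Pr_earlyRestart_le`), and a long unpaid gap in the data phase (`Pr_silentGap_le`). Each has
probability `O(T ^ (-6))` at length `T`, conditionally on the past. For the first, the ingredients
are that backoff makes little noise (`Pr_noise_le`, by credits), that a quiet epoch with
synchronized nodes or many users ends (`Pr_busy_le`), and that a rarely blocked node gets through
(`Pr_lone_le`, by a supermartingale).

As there are at most two gaps per arrival, a second moment argument for adaptive sums of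
heavy-tailed delays (`Pr_totalBad_le`) bounds the total length of all failures by `O(n)` outside an
event of probability `O(1 / n)`. All remaining active slots are charged deterministically to
arrivals, jams and successes (`active_le_of_waste`). The whole analysis is done for a fixed seed of
the adversary, on a finitely branching tree of coin flips; `achievesThroughput_of_Pr` transfers it
to the measure-theoretic model. -/

/-! ### Trees of independent coins -/

/-- A random process driven by independent coins: at the node `p` of the tree (the list of the coin sets
drawn so far, most recent first) the coins in `V p` are flipped, coin `j` showing heads with
probability `q p j`, and the process moves to `S :: p` where `S` is the set of heads. -/
structure CoinTree where
  V : List (Finset ℕ) → Finset ℕ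
  q : List (Finset ℕ) → ℕ → ℝ
  q_nonneg : ∀ p j, 0 ≤ q p j
  q_le_one : ∀ p j, q p j ≤ 1

namespace CoinTree

variable (τ : CoinTree)

/-- Probability that `S` is the set of heads at `p`. -/
noncomputable def wt (p : List (Finset ℕ)) (S : Finset ℕ) : ℝ :=
  (∏ j ∈ S, τ.q p j) * ∏ j ∈ τ.V p \ S, (1 - τ.q p j)

/-- One-step conditional expectation. -/
noncomputable def E (F : List (Finset ℕ) → ℝ) (p : List (Finset ℕ)) : ℝ :=
  ∑ S ∈ (τ.V p).powerset, τ.wt p S * F (S :: p)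

/-- Conditional expectation over `k` steps. -/
noncomputable def ev (k : ℕ) (F : List (Finset ℕ) → ℝ) : List (Finset ℕ) → ℝ := τ.E^[k] F

open Classical in
/-- Conditional probability that `Q` holds after `k` steps. -/
noncomputable def Pr (k : ℕ) (Q : List (Finset ℕ) → Prop) : List (Finset ℕ) → ℝ :=
  τ.ev k fun p => if Q p then 1 else 0

/-- `S` is a possible set of heads at `p`. -/
def Possible (p : List (Finset ℕ)) (S : Finset ℕ) : Prop :=
  S ⊆ τ.V p ∧ ∀ j ∈ S, 0 < τ.q p j

/-- `p'` can be reached from `p` in `k` steps. -/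
inductive Ext (p : List (Finset ℕ)) : ℕ → List (Finset ℕ) → Prop
  | refl : Ext p 0 p
  | step {k p'} (S : Finset ℕ) (h : Ext p k p') (hS : τ.Possible p' S) : Ext p (k + 1) (S :: p')

variable {τ}

theorem Ext.drop_eq {p p' : List (Finset ℕ)} {k : ℕ} (h : τ.Ext p k p') : p'.drop k = p := by
  induction h with
  | refl => rfl
  | step S h hS ih => simpa using ih

theorem Ext.length_eq {p p' : List (Finset ℕ)} {k : ℕ} (h : τ.Ext p k p') :
    p'.length = p.length + k := by
  induction h with
  | refl => rfl
  | step S h hS ih => simp [ih]; omega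

theorem Ext.trans {p p' p'' : List (Finset ℕ)} {k l : ℕ} (h : τ.Ext p k p') (h' : τ.Ext p' l p'') :
    τ.Ext p (k + l) p'' := by
  induction h' with
  | refl => exact h
  | step S h' hS ih => exact Ext.step S ih hS

theorem Ext.drop {p p' : List (Finset ℕ)} {k : ℕ} (h : τ.Ext p k p') (i : ℕ) (hi : i ≤ k) :
    τ.Ext p (k - i) (p'.drop i) ∧ τ.Ext (p'.drop i) i p' := by
  induction h generalizing i with
  | refl =>
    obtain rfl : i = 0 := by omega
    exact ⟨Ext.refl, Ext.refl⟩
  | @step k p' S h hS ih =>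
    cases i with
    | zero => exact ⟨Ext.step S h hS, Ext.refl⟩
    | succ i =>
      obtain ⟨h1, h2⟩ := ih i (by omega)
      refine ⟨?_, ?_⟩
      · simpa using h1
      · simpa using Ext.step S h2 hS

theorem Ext.cases_step {p p' : List (Finset ℕ)} {k : ℕ} (h : τ.Ext p (k + 1) p') :
    ∃ S p₁, p' = S :: p₁ ∧ τ.Ext p k p₁ ∧ τ.Possible p₁ S := by
  cases h with
  | step S h hS => exact ⟨S, _, rfl, h, hS⟩

theorem Ext.eq_of_zero {p p' : List (Finset ℕ)} (h : τ.Ext p 0 p') : p' = p := by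
  cases h; rfl

variable (τ)

theorem wt_nonneg (p : List (Finset ℕ)) (S : Finset ℕ) : 0 ≤ τ.wt p S :=
  mul_nonneg (Finset.prod_nonneg fun j _ => τ.q_nonneg p j)
    (Finset.prod_nonneg fun j _ => by linarith [τ.q_le_one p j])

/-- Product functions of the coins factorize. -/
theorem sum_wt_mul_prod (p : List (Finset ℕ)) (a b : ℕ → ℝ) :
    ∑ S ∈ (τ.V p).powerset, τ.wt p S * ((∏ j ∈ S, a j) * ∏ j ∈ τ.V p \ S, b j)
      = ∏ j ∈ τ.V p, (τ.q p j * a j + (1 - τ.q p j) * b j) := by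
  rw [Finset.prod_add]
  refine Finset.sum_congr rfl fun S _ => ?_
  rw [wt, Finset.prod_mul_distrib, Finset.prod_mul_distrib]
  ring

theorem sum_wt (p : List (Finset ℕ)) : ∑ S ∈ (τ.V p).powerset, τ.wt p S = 1 := by
  have := τ.sum_wt_mul_prod p (fun _ => 1) (fun _ => 1)
  simpa using this

theorem E_const (c : ℝ) : τ.E (fun _ => c) = fun _ => c := by
  funext p
  simp only [E, ← Finset.sum_mul, τ.sum_wt, one_mul]

theorem E_add (F F' : List (Finset ℕ) → ℝ) :
    τ.E (fun p => F p + F' p) = fun p => τ.E F p + τ.E F' p := by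
  funext p
  simp only [E, mul_add, Finset.sum_add_distrib]

theorem E_const_mul (c : ℝ) (F : List (Finset ℕ) → ℝ) :
    τ.E (fun p => c * F p) = fun p => c * τ.E F p := by
  funext p
  simp only [E, Finset.mul_sum]
  exact Finset.sum_congr rfl fun S _ => by ring

theorem wt_eq_zero {p : List (Finset ℕ)} {S : Finset ℕ} (h : ¬ ∀ j ∈ S, 0 < τ.q p j) :
    τ.wt p S = 0 := by
  push Not at h
  obtain ⟨j, hj, hq⟩ := h
  rw [wt, Finset.prod_eq_zero hj (le_antisymm hq (τ.q_nonneg p j)), zero_mul]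

/-- Impossible sets of heads have weight zero. This is what allows invariants of reachable paths to
be used under expectations. -/
theorem E_mono {F F' : List (Finset ℕ) → ℝ} {p : List (Finset ℕ)}
    (h : ∀ S, τ.Possible p S → F (S :: p) ≤ F' (S :: p)) : τ.E F p ≤ τ.E F' p := by
  refine Finset.sum_le_sum fun S hS => ?_
  by_cases h' : ∀ j ∈ S, 0 < τ.q p j
  · exact mul_le_mul_of_nonneg_left (h S ⟨Finset.mem_powerset.1 hS, h'⟩) (τ.wt_nonneg p S)
  · rw [τ.wt_eq_zero h']; simp

@[simp] theorem ev_zero (F : List (Finset ℕ) → ℝ) : τ.ev 0 F = F := rfl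

/-- This form peels off the last of the steps, the primed one below the first. -/
theorem ev_succ (k : ℕ) (F : List (Finset ℕ) → ℝ) : τ.ev (k + 1) F = τ.ev k (τ.E F) := by
  simp only [ev, Function.iterate_succ_apply]

theorem ev_succ' (k : ℕ) (F : List (Finset ℕ) → ℝ) : τ.ev (k + 1) F = τ.E (τ.ev k F) := by
  simp only [ev, Function.iterate_succ_apply']

theorem ev_add (k l : ℕ) (F : List (Finset ℕ) → ℝ) : τ.ev (k + l) F = τ.ev k (τ.ev l F) := by
  simp only [ev, Function.iterate_add_apply]

theorem ev_mono {F F' : List (Finset ℕ) → ℝ} {p : List (Finset ℕ)} {k : ℕ}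
    (h : ∀ p', τ.Ext p k p' → F p' ≤ F' p') : τ.ev k F p ≤ τ.ev k F' p := by
  induction k generalizing F F' with
  | zero => exact h p Ext.refl
  | succ k ih =>
    rw [ev_succ, ev_succ]
    exact ih fun p' hp' => τ.E_mono fun S hS => h _ (Ext.step S hp' hS)

theorem ev_const (k : ℕ) (c : ℝ) (p : List (Finset ℕ)) : τ.ev k (fun _ => c) p = c := by
  induction k with
  | zero => rfl
  | succ k ih => rw [ev_succ, E_const, ih]

theorem ev_congr {F F' : List (Finset ℕ) → ℝ} {p : List (Finset ℕ)} {k : ℕ}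
    (h : ∀ p', τ.Ext p k p' → F p' = F' p') : τ.ev k F p = τ.ev k F' p :=
  le_antisymm (τ.ev_mono fun p' hp' => (h p' hp').le) (τ.ev_mono fun p' hp' => (h p' hp').ge)

theorem ev_fun_add (k : ℕ) (F F' : List (Finset ℕ) → ℝ) :
    τ.ev k (fun p => F p + F' p) = fun p => τ.ev k F p + τ.ev k F' p := by
  induction k generalizing F F' with
  | zero => rfl
  | succ k ih => rw [ev_succ, E_add, ih, ev_succ, ev_succ]

theorem ev_const_mul (k : ℕ) (c : ℝ) (F : List (Finset ℕ) → ℝ) :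
    τ.ev k (fun p => c * F p) = fun p => c * τ.ev k F p := by
  induction k generalizing F with
  | zero => rfl
  | succ k ih => rw [ev_succ, E_const_mul, ih, ev_succ]

theorem ev_sum {ι : Type*} (k : ℕ) (s : Finset ι) (F : ι → List (Finset ℕ) → ℝ)
    (p : List (Finset ℕ)) :
    τ.ev k (fun p => ∑ i ∈ s, F i p) p = ∑ i ∈ s, τ.ev k (F i) p := by
  classical
  induction s using Finset.induction_on with
  | empty => simpa using τ.ev_const k 0 p
  | insert i s hi ih =>
    simp only [Finset.sum_insert hi]
    rw [ev_fun_add]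
    exact congrArg _ ih

theorem ev_nonneg {F : List (Finset ℕ) → ℝ} (k : ℕ) (p : List (Finset ℕ))
    (h : ∀ p', 0 ≤ F p') : 0 ≤ τ.ev k F p := by
  rw [← τ.ev_const k 0 p]
  exact τ.ev_mono fun p' _ => h p'

/-- A quantity that decreases in conditional expectation decreases in expectation. -/
theorem ev_le_of_supermartingale {p : List (Finset ℕ)} (Φ : ℕ → List (Finset ℕ) → ℝ) (n : ℕ)
    (h : ∀ k p', k < n → τ.Ext p k p' → τ.E (Φ (k + 1)) p' ≤ Φ k p') : τ.ev n (Φ n) p ≤ Φ 0 p := by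
  induction n with
  | zero => exact le_rfl
  | succ n ih =>
    rw [ev_succ]
    exact (τ.ev_mono fun p' hp' => h n p' (Nat.lt_succ_self n) hp').trans
      (ih fun k p' hk => h k p' (hk.trans (Nat.lt_succ_self n)))

/-- A bound that depends only on the first `k` of `k + l` steps. -/
theorem ev_le_ev_drop {F F' : List (Finset ℕ) → ℝ} {p : List (Finset ℕ)} (k l : ℕ)
    (h : ∀ p', τ.Ext p (k + l) p' → F p' ≤ F' (p'.drop l)) : τ.ev (k + l) F p ≤ τ.ev k F' p := by
  rw [ev_add]
  refine τ.ev_mono fun p' hp' => ?_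
  rw [← τ.ev_const l (F' p') p']
  refine τ.ev_mono fun p'' hp'' => ?_
  simpa only [hp''.drop_eq] using h p'' (hp'.trans hp'')

theorem Pr_mono {Q Q' : List (Finset ℕ) → Prop} {p : List (Finset ℕ)} {k : ℕ}
    (h : ∀ p', τ.Ext p k p' → Q p' → Q' p') : τ.Pr k Q p ≤ τ.Pr k Q' p := by
  refine τ.ev_mono fun p' hp' => ?_
  split_ifs with h1 h2 h2
  · exact le_rfl
  · exact absurd (h p' hp' h1) h2
  · norm_num
  · exact le_rfl

theorem Pr_le_one (k : ℕ) (Q : List (Finset ℕ) → Prop) (p : List (Finset ℕ)) : τ.Pr k Q p ≤ 1 := by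
  rw [← τ.ev_const k 1 p]
  exact τ.ev_mono fun p' _ => by split_ifs <;> norm_num

theorem Pr_or (k : ℕ) (Q Q' : List (Finset ℕ) → Prop) (p : List (Finset ℕ)) :
    τ.Pr k (fun p => Q p ∨ Q' p) p ≤ τ.Pr k Q p + τ.Pr k Q' p := by
  classical
  refine le_trans (τ.ev_mono (F' := fun p => (if Q p then (1 : ℝ) else 0) + if Q' p then 1 else 0)
    fun p' _ => ?_) (le_of_eq ?_)
  · by_cases h1 : Q p' <;> by_cases h2 : Q' p' <;> simp [h1, h2]
  · rw [ev_fun_add]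
    simp only [Pr]

theorem Pr_exists {ι : Type*} (k : ℕ) (s : Finset ι) (Q : ι → List (Finset ℕ) → Prop)
    (p : List (Finset ℕ)) :
    τ.Pr k (fun p => ∃ i ∈ s, Q i p) p ≤ ∑ i ∈ s, τ.Pr k (Q i) p := by
  classical
  induction s using Finset.induction_on with
  | empty =>
    simp only [Finset.notMem_empty, false_and, exists_false, Finset.sum_empty, Pr, if_false]
    exact (τ.ev_const k 0 p).le
  | insert i s hi ih =>
    rw [Finset.sum_insert hi]
    refine le_trans ?_ (add_le_add le_rfl ih)
    refine le_trans (τ.Pr_mono ?_) (τ.Pr_or k (Q i) (fun p => ∃ i ∈ s, Q i p) p)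
    rintro p' - ⟨i', hi', h⟩
    rcases Finset.mem_insert.1 hi' with rfl | hi'
    · exact Or.inl h
    · exact Or.inr ⟨i', hi', h⟩

theorem Pr_le_Pr_drop {Q Q' : List (Finset ℕ) → Prop} {p : List (Finset ℕ)} (k l : ℕ)
    (h : ∀ p', τ.Ext p (k + l) p' → Q p' → Q' (p'.drop l)) : τ.Pr (k + l) Q p ≤ τ.Pr k Q' p := by
  refine τ.ev_le_ev_drop k l fun p' hp' => ?_
  split_ifs with h1 h2 h2
  · exact le_rfl
  · exact absurd (h p' hp' h1) h2
  · norm_num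
  · exact le_rfl

/-- If an event implies an event with small conditional probability after the first `k` steps. -/
theorem Pr_add_le {Q : List (Finset ℕ) → Prop} {p : List (Finset ℕ)} {k l : ℕ} {δ : ℝ}
    (h : ∀ p', τ.Ext p k p' → τ.Pr l Q p' ≤ δ) : τ.Pr (k + l) Q p ≤ δ := by
  rw [Pr, ev_add, ← τ.ev_const k δ p]
  exact τ.ev_mono h

/-- Markov's inequality for a supermartingale. -/
theorem Pr_le_of_supermartingale {p : List (Finset ℕ)} {Q : List (Finset ℕ) → Prop}
    (Φ : ℕ → List (Finset ℕ) → ℝ) (n : ℕ)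
    (h : ∀ k p', k < n → τ.Ext p k p' → τ.E (Φ (k + 1)) p' ≤ Φ k p') (c : ℝ) (hc : 0 < c)
    (h0 : ∀ p', 0 ≤ Φ n p') (hQ : ∀ p', τ.Ext p n p' → Q p' → c ≤ Φ n p') :
    τ.Pr n Q p ≤ Φ 0 p / c := by
  classical
  rw [le_div_iff₀ hc, mul_comm]
  have : c * τ.Pr n Q p = τ.ev n (fun p => c * if Q p then 1 else 0) p := by
    rw [ev_const_mul, Pr]
  rw [this]
  refine le_trans (τ.ev_mono fun p' hp' => ?_) (τ.ev_le_of_supermartingale Φ n h)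
  by_cases h1 : Q p'
  · simpa [h1] using hQ p' hp' h1
  · simpa [h1] using h0 p'

/-! ### Single steps -/

/-- Probability of a prescribed pattern on a subset of the coins. -/
theorem sum_wt_filter_eq (p : List (Finset ℕ)) {B T : Finset ℕ} (hB : B ⊆ τ.V p) (hT : T ⊆ B) :
    ∑ S ∈ (τ.V p).powerset, τ.wt p S * (if S ∩ B = T then 1 else 0)
      = (∏ j ∈ T, τ.q p j) * ∏ j ∈ B \ T, (1 - τ.q p j) := by
  classical
  -- A head in `B \ T` and a tail in `T` are both given factor zero, so the product is the indicator
  -- of the pattern.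
  have h := τ.sum_wt_mul_prod p (fun j => if j ∈ B \ T then 0 else 1) (fun j => if j ∈ T then 0 else 1)
  have h1 : ∀ S ∈ (τ.V p).powerset, ((∏ j ∈ S, (if j ∈ B \ T then (0 : ℝ) else 1)) *
      ∏ j ∈ τ.V p \ S, (if j ∈ T then (0 : ℝ) else 1)) = if S ∩ B = T then 1 else 0 := by
    intro S hS
    rw [Finset.mem_powerset] at hS
    split_ifs with hST
    · rw [Finset.prod_eq_one, Finset.prod_eq_one, one_mul]
      · intro j hj
        rw [if_neg]
        intro hjT
        rw [← hST] at hjT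
        exact (Finset.mem_sdiff.1 hj).2 (Finset.mem_inter.1 hjT).1
      · intro j hj
        rw [if_neg]
        intro hjT
        rw [Finset.mem_sdiff, ← hST] at hjT
        exact hjT.2 (Finset.mem_inter.2 ⟨hj, hjT.1⟩)
    · by_contra hne
      have hne1 := left_ne_zero_of_mul hne
      have hne2 := right_ne_zero_of_mul hne
      rw [Finset.prod_ne_zero_iff] at hne1 hne2
      apply hST
      ext j
      rw [Finset.mem_inter]
      constructor
      · rintro ⟨hjS, hjB⟩
        by_contra hjT
        exact hne1 j hjS (if_pos (Finset.mem_sdiff.2 ⟨hjB, hjT⟩))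
      · intro hjT
        refine ⟨?_, hT hjT⟩
        by_contra hjS
        exact hne2 j (Finset.mem_sdiff.2 ⟨hB (hT hjT), hjS⟩) (if_pos hjT)
  rw [Finset.sum_congr rfl fun S hS => by rw [← h1 S hS], h]
  have hV : τ.V p = B ∪ (τ.V p \ B) := by rw [Finset.union_sdiff_of_subset hB]
  rw [hV, Finset.prod_union Finset.disjoint_sdiff]
  have hB' : B = T ∪ (B \ T) := by rw [Finset.union_sdiff_of_subset hT]
  have e1 : ∏ j ∈ τ.V p \ B, (τ.q p j * (if j ∈ B \ T then (0 : ℝ) else 1)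
      + (1 - τ.q p j) * (if j ∈ T then (0 : ℝ) else 1)) = 1 := by
    refine Finset.prod_eq_one fun j hj => ?_
    rw [Finset.mem_sdiff] at hj
    rw [if_neg (fun h => hj.2 (Finset.mem_sdiff.1 h).1), if_neg (fun h => hj.2 (hT h))]
    ring
  rw [e1, mul_one]
  conv_lhs => rw [hB']
  rw [Finset.prod_union Finset.disjoint_sdiff]
  congr 1
  · refine Finset.prod_congr rfl fun j hj => ?_
    rw [← hB', if_neg (fun h => (Finset.mem_sdiff.1 h).2 hj), if_pos hj]
    ring
  · refine Finset.prod_congr rfl fun j hj => ?_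
    rw [← hB', if_pos hj, if_neg (Finset.mem_sdiff.1 hj).2]
    ring

theorem one_sub_sum_le_prod (B : Finset ℕ) (f : ℕ → ℝ) (h0 : ∀ j ∈ B, 0 ≤ f j)
    (h1 : ∀ j ∈ B, f j ≤ 1) : 1 - ∑ j ∈ B, f j ≤ ∏ j ∈ B, (1 - f j) := by
  classical
  induction B using Finset.induction_on with
  | empty => simp
  | insert i s hi ih =>
    rw [Finset.sum_insert hi, Finset.prod_insert hi]
    have h2 := ih (fun j hj => h0 j (Finset.mem_insert_of_mem hj))
      (fun j hj => h1 j (Finset.mem_insert_of_mem hj))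
    have h3 : 0 ≤ ∑ j ∈ s, f j := Finset.sum_nonneg fun j hj => h0 j (Finset.mem_insert_of_mem hj)
    have h4 := h0 i (Finset.mem_insert_self _ _)
    have h5 := h1 i (Finset.mem_insert_self _ _)
    nlinarith

/-- Multiply `1 + 2x ≤ exp (2x)` by `1 - x` and use `(1 - x)(1 + 2x) ≥ 1`. The latter needs `x ≤ 1 /
2`, the reason why present nodes never broadcast with a larger probability. -/
theorem four_pow_neg_le {x : ℝ} (h0 : 0 ≤ x) (h1 : x ≤ 1 / 2) : Real.exp (-(2 * x)) ≤ 1 - x := by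
  have h := Real.add_one_le_exp (2 * x)
  have h2 : (1 - x) * (2 * x + 1) ≥ 1 := by nlinarith
  rw [Real.exp_neg, inv_le_iff_one_le_mul₀ (Real.exp_pos _)]
  have : 0 ≤ 1 - x := by linarith
  nlinarith [mul_le_mul_of_nonneg_left h this]

/-- Exactly one head among the coins in `B`: probability at least `H exp (-2H)`. -/
theorem le_prob_single (p : List (Finset ℕ)) {B : Finset ℕ} (hB : B ⊆ τ.V p)
    (hq : ∀ j ∈ B, τ.q p j ≤ 1 / 2) :
    (∑ j ∈ B, τ.q p j) * Real.exp (-(2 * ∑ j ∈ B, τ.q p j))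
      ≤ ∑ S ∈ (τ.V p).powerset, τ.wt p S * (if (S ∩ B).card = 1 then 1 else 0) := by
  classical
  have h1 : ∀ S ∈ (τ.V p).powerset, τ.wt p S * (if (S ∩ B).card = 1 then (1 : ℝ) else 0)
      = ∑ j ∈ B, τ.wt p S * (if S ∩ B = {j} then 1 else 0) := by
    intro S _
    rw [← Finset.mul_sum]
    congr 1
    split_ifs with h
    · obtain ⟨j, hj⟩ := Finset.card_eq_one.1 h
      have hjB : j ∈ B := by
        have : j ∈ S ∩ B := by rw [hj]; simp
        exact (Finset.mem_inter.1 this).2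
      rw [Finset.sum_eq_single_of_mem j hjB, if_pos hj]
      intro i _ hij
      rw [if_neg]
      rw [hj]
      intro h'
      exact hij (Finset.singleton_injective h').symm
    · symm
      refine Finset.sum_eq_zero fun j _ => ?_
      rw [if_neg]
      intro h'
      exact h (by rw [h']; simp)
  rw [Finset.sum_congr rfl h1, Finset.sum_comm, Finset.sum_mul]
  refine Finset.sum_le_sum fun j hj => ?_
  rw [τ.sum_wt_filter_eq p hB (Finset.singleton_subset_iff.2 hj), Finset.prod_singleton]
  refine mul_le_mul_of_nonneg_left ?_ (τ.q_nonneg p j)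
  -- Keeping `j` itself in the sum only weakens the bound and makes the factor the same for all `j`.
  calc Real.exp (-(2 * ∑ j ∈ B, τ.q p j)) ≤ Real.exp (-(2 * ∑ j ∈ B \ {j}, τ.q p j)) := by
        apply Real.exp_le_exp.2
        have := Finset.sum_le_sum_of_subset_of_nonneg (f := τ.q p) (Finset.sdiff_subset (s := B) (t := {j}))
          fun i _ _ => τ.q_nonneg p i
        linarith
    _ = ∏ i ∈ B \ {j}, Real.exp (-(2 * τ.q p i)) := by
        rw [← Real.exp_sum, Finset.sum_neg_distrib, Finset.mul_sum]
    _ ≤ ∏ i ∈ B \ {j}, (1 - τ.q p i) := by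
        refine Finset.prod_le_prod (fun i _ => (Real.exp_pos _).le) fun i hi => ?_
        exact four_pow_neg_le (τ.q_nonneg p i) (hq i (Finset.mem_sdiff.1 hi).1)

/-- Exponential moment of the number of heads among the coins in `B`. -/
theorem sum_wt_exp_neg_card (p : List (Finset ℕ)) {B : Finset ℕ} (hB : B ⊆ τ.V p) :
    ∑ S ∈ (τ.V p).powerset, τ.wt p S * Real.exp (-((S ∩ B).card : ℝ))
      ≤ Real.exp (-((∑ j ∈ B, τ.q p j) / 2)) := by
  classical
  -- A coin in `B` contributes `1 - q + q / e ≤ 1 - q / 2 ≤ exp (-(q / 2))`.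
  have h := τ.sum_wt_mul_prod p (fun j => if j ∈ B then Real.exp (-1) else 1) (fun _ => 1)
  have h1 : ∀ S ∈ (τ.V p).powerset, ((∏ j ∈ S, (if j ∈ B then Real.exp (-1) else (1 : ℝ))) *
      ∏ j ∈ τ.V p \ S, (1 : ℝ)) = Real.exp (-((S ∩ B).card : ℝ)) := by
    intro S _
    rw [Finset.prod_const_one, mul_one, ← Finset.prod_filter, Finset.prod_const,
      Finset.filter_mem_eq_inter, ← Real.exp_nat_mul]
    ring_nf
  rw [Finset.sum_congr rfl fun S hS => by rw [← h1 S hS], h]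
  have hV : τ.V p = B ∪ (τ.V p \ B) := by rw [Finset.union_sdiff_of_subset hB]
  rw [hV, Finset.prod_union Finset.disjoint_sdiff]
  have e1 : ∏ j ∈ τ.V p \ B, (τ.q p j * (if j ∈ B then Real.exp (-1) else 1)
      + (1 - τ.q p j) * 1) = 1 := by
    refine Finset.prod_eq_one fun j hj => ?_
    rw [if_neg (Finset.mem_sdiff.1 hj).2]
    ring
  rw [e1, mul_one, show -((∑ j ∈ B, τ.q p j) / 2) = ∑ j ∈ B, -(τ.q p j / 2) by
    rw [Finset.sum_neg_distrib, Finset.sum_div], Real.exp_sum]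
  refine Finset.prod_le_prod (fun j hj => ?_) fun j hj => ?_
  · have := τ.q_nonneg p j
    have := τ.q_le_one p j
    rw [if_pos (by assumption)]
    have := Real.exp_pos (-1)
    have : 0 ≤ τ.q p j * Real.exp (-1) := by positivity
    linarith
  · rw [if_pos hj]
    have h2 : Real.exp (-1) ≤ 1 / 2 := by
      rw [Real.exp_neg, one_div]
      exact inv_anti₀ (by norm_num) (by linarith [Real.add_one_le_exp (1 : ℝ)])
    have := τ.q_nonneg p j
    have h3 := Real.add_one_le_exp (-(τ.q p j / 2))
    have h4 := mul_le_mul_of_nonneg_left h2 this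
    linarith

/-- Probability that `w` shows heads and some other coin in `B` does. -/
theorem sum_wt_collision_le (p : List (Finset ℕ)) {B : Finset ℕ} (hB : B ⊆ τ.V p) {w : ℕ}
    (hw : w ∈ B) :
    ∑ S ∈ (τ.V p).powerset, τ.wt p S * (if w ∈ S ∧ S ∩ B ≠ {w} then 1 else 0)
      ≤ τ.q p w * min 1 (∑ j ∈ B \ {w}, τ.q p j) := by
  classical
  have h1 := τ.sum_wt_filter_eq p (B := {w}) (T := {w}) (Finset.singleton_subset_iff.2 (hB hw))
    (Finset.Subset.refl _)
  have h2 := τ.sum_wt_filter_eq p hB (T := {w}) (Finset.singleton_subset_iff.2 hw)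
  -- The event is "heads at `w`" minus "heads at `w` alone within `B`"; both are patterns of known
  -- probability.
  have h3 : ∑ S ∈ (τ.V p).powerset, τ.wt p S * (if w ∈ S ∧ S ∩ B ≠ {w} then (1 : ℝ) else 0)
      = ∑ S ∈ (τ.V p).powerset, τ.wt p S * (if S ∩ {w} = {w} then (1 : ℝ) else 0)
        - ∑ S ∈ (τ.V p).powerset, τ.wt p S * (if S ∩ B = {w} then (1 : ℝ) else 0) := by
    rw [← Finset.sum_sub_distrib]
    refine Finset.sum_congr rfl fun S _ => ?_
    rw [← mul_sub]
    congr 1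
    have e : (S ∩ {w} = {w}) ↔ w ∈ S := by
      rw [Finset.inter_eq_right, Finset.singleton_subset_iff]
    by_cases hS : w ∈ S
    · by_cases hSB : S ∩ B = {w} <;> simp [hS, hSB]
    · have : S ∩ B ≠ {w} := fun h' => hS (by
        have : w ∈ S ∩ B := by rw [h']; simp
        exact (Finset.mem_inter.1 this).1)
      simp [hS, this]
  rw [h3, h1, h2]
  simp only [Finset.prod_singleton, Finset.sdiff_self, Finset.prod_empty, mul_one]
  rw [← mul_one_sub]
  refine mul_le_mul_of_nonneg_left (le_min ?_ ?_) (τ.q_nonneg p w)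
  · have := Finset.prod_nonneg (s := B \ {w}) (f := fun j => 1 - τ.q p j)
      fun j _ => by linarith [τ.q_le_one p j]
    linarith
  · have := one_sub_sum_le_prod (B \ {w}) (τ.q p) (fun j _ => τ.q_nonneg p j)
      (fun j _ => τ.q_le_one p j)
    linarith

end CoinTree

/-! ### Sums of heavy-tailed delays -/

theorem sum_Icc_one_div_sq_le (N : ℕ) : ∑ T ∈ Finset.Icc 1 N, 1 / (T : ℝ) ^ 2 ≤ 2 := by
  have h : ∀ N : ℕ, 1 ≤ N → ∑ T ∈ Finset.Icc 1 N, 1 / (T : ℝ) ^ 2 ≤ 2 - 1 / (N : ℝ) := by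
    intro N hN
    induction N, hN using Nat.le_induction with
    | base => norm_num
    | succ N hN ih =>
      rw [Finset.sum_Icc_succ_top (by omega)]
      have hN : (0 : ℝ) < N := Nat.cast_pos.2 hN
      have h1 : 1 / ((N + 1 : ℕ) : ℝ) ^ 2 ≤ 1 / (N : ℝ) - 1 / ((N + 1 : ℕ) : ℝ) := by
        rw [div_sub_div _ _ (by positivity) (by positivity), div_le_div_iff₀ (by positivity) (by positivity)]
        push_cast
        nlinarith
      linarith
  rcases Nat.eq_zero_or_pos N with rfl | hpos
  · norm_num
  have : 0 ≤ 1 / (N : ℝ) := by positivity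
  linarith [h N hpos]

namespace CoinTree

/-- The state of the process after the first `s` of its steps. -/
def pre (q : List (Finset ℕ)) (s : ℕ) : List (Finset ℕ) := q.drop (q.length - s)

theorem pre_of_drop {q p : List (Finset ℕ)} {s l : ℕ} (hq : q.length = s + l) (hp : q.drop l = p)
    (i : ℕ) (hi : i ≤ s) : pre q i = pre p i := by
  have hpl : p.length = s := by rw [← hp, List.length_drop]; omega
  rw [pre, pre, ← hp, List.drop_drop, hp, hpl, hq]
  congr 1
  omega

theorem pre_self (p : List (Finset ℕ)) : pre p p.length = p := by simp [pre]

open Classical in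
/-- Number of starts strictly before the end of `p`. -/
noncomputable def numStarts (start : List (Finset ℕ) → Prop) : List (Finset ℕ) → ℕ
  | [] => 0
  | _ :: p => numStarts start p + if start p then 1 else 0

open Classical in
/-- Total length of the bad segments. -/
noncomputable def totalBad (Bad : ℕ → List (Finset ℕ) → Prop) : List (Finset ℕ) → ℝ
  | [] => 0
  | S :: p => totalBad Bad p + ∑ T ∈ Finset.Icc 1 (p.length + 1), (T : ℝ) * if Bad T (S :: p) then 1 else 0

open Classical in
/-- The delay due to the segment that starts at time `s`. -/
noncomputable def delay (Bad : ℕ → List (Finset ℕ) → Prop) (n s : ℕ) (q : List (Finset ℕ)) : ℝ :=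
  ∑ T ∈ Finset.Icc 1 (n - s), (T : ℝ) * if Bad T (pre q (s + T)) then 1 else 0

theorem delay_nonneg (Bad : ℕ → List (Finset ℕ) → Prop) (n s : ℕ) (q : List (Finset ℕ)) :
    0 ≤ delay Bad n s q :=
  Finset.sum_nonneg fun T _ => by positivity

open Classical in
theorem numStarts_eq (start : List (Finset ℕ) → Prop) (q : List (Finset ℕ)) :
    (numStarts start q : ℝ) = ∑ s ∈ Finset.range q.length, if start (pre q s) then 1 else 0 := by
  induction q with
  | nil => simp [numStarts]
  | cons S p ih =>
    rw [numStarts, List.length_cons, Finset.sum_range_succ]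
    push_cast
    rw [ih]
    congr 1
    · refine Finset.sum_congr rfl fun s hs => ?_
      rw [pre_of_drop (q := S :: p) (p := p) (s := p.length) (l := 1) rfl rfl s
        (Finset.mem_range.1 hs).le]
    · rw [pre_of_drop (q := S :: p) (p := p) (s := p.length) (l := 1) rfl rfl _ le_rfl, pre_self]

/-- Regroups the bad segments, recorded by their ends, according to their starts; a delay can then
be conditioned on the state at its start. -/
theorem totalBad_eq (Bad : ℕ → List (Finset ℕ) → Prop) (q : List (Finset ℕ)) :
    totalBad Bad q = ∑ s ∈ Finset.range q.length, delay Bad q.length s q := by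
  classical
  induction q with
  | nil => simp [totalBad]
  | cons S p ih =>
    have h : ∀ s ∈ Finset.range (p.length + 1), delay Bad (p.length + 1) s (S :: p)
        = delay Bad p.length s p
          + ((p.length + 1 - s : ℕ) : ℝ) * if Bad (p.length + 1 - s) (S :: p) then 1 else 0 := by
      intro s hs
      have hs' : s ≤ p.length := by have := Finset.mem_range.1 hs; omega
      have e : p.length + 1 - s = (p.length - s) + 1 := by omega
      rw [delay, e, Finset.sum_Icc_succ_top (by omega), delay]
      congr 1
      · refine Finset.sum_congr rfl fun T hT => ?_
        have := Finset.mem_Icc.1 hT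
        rw [pre_of_drop (q := S :: p) (p := p) (s := p.length) (l := 1) rfl rfl _ (by omega)]
      · rw [show s + (p.length - s + 1) = (S :: p).length by simp; omega, pre_self]
    rw [totalBad, ih, List.length_cons, Finset.sum_congr rfl h, Finset.sum_add_distrib,
      Finset.sum_range_succ]
    have e0 : delay Bad p.length p.length p = 0 := by simp [delay]
    rw [e0, add_zero]
    congr 1
    refine Finset.sum_nbij' (fun T => p.length + 1 - T) (fun s => p.length + 1 - s) ?_ ?_ ?_ ?_ ?_
    · intro T hT
      have := Finset.mem_Icc.1 hT
      exact Finset.mem_range.2 (by omega)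
    · intro s hs
      have := Finset.mem_range.1 hs
      exact Finset.mem_Icc.2 (by omega)
    · intro T hT
      have := Finset.mem_Icc.1 hT
      omega
    · intro s hs
      have := Finset.mem_range.1 hs
      omega
    · intro T hT
      have := Finset.mem_Icc.1 hT
      rw [show p.length + 1 - (p.length + 1 - T) = T by omega]

variable {τ : CoinTree} {start : List (Finset ℕ) → Prop} {Bad : ℕ → List (Finset ℕ) → Prop}
  {A κ m₀ : ℝ} {t : ℕ}

open Classical in
/-- Centered sum of the delays of the segments that start before time `s`. -/
noncomputable def drift (start : List (Finset ℕ) → Prop) (Bad : ℕ → List (Finset ℕ) → Prop) (μ : ℝ)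
    (n s : ℕ) (q : List (Finset ℕ)) : ℝ :=
  ∑ s' ∈ Finset.range s, if start (pre q s') then delay Bad n s' q - μ else 0

open Classical in
noncomputable def startsBefore (start : List (Finset ℕ) → Prop) (s : ℕ) (q : List (Finset ℕ)) : ℝ :=
  ∑ s' ∈ Finset.range s, if start (pre q s') then 1 else 0

theorem startsBefore_nonneg (s : ℕ) (q : List (Finset ℕ)) : 0 ≤ startsBefore start s q :=
  Finset.sum_nonneg fun s' _ => by split_ifs <;> norm_num

/-- The first term is the squared one-sided deviation relative to the (random) number of starts; it
exceeds `κ ^ 2` on the event to be bounded. The second term is a reserve: when a start increases the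
denominator, its decrease pays for the variance of the new delay. -/
noncomputable def weight (start : List (Finset ℕ) → Prop) (Bad : ℕ → List (Finset ℕ) → Prop)
    (μ A' m₀ : ℝ) (n s : ℕ) (q : List (Finset ℕ)) : ℝ :=
  max 0 (drift start Bad μ n s q) ^ 2 / (m₀ + startsBefore start s q) ^ 2
    + A' / (m₀ + startsBefore start s q)

-- Several lengths may be bad for one start, so cross terms occur. Cauchy–Schwarz with the weights
-- `1 / T` and `T ^ 2` removes them.
open Classical in
theorem delay_sq_le_sum (n s : ℕ) (q : List (Finset ℕ)) :
    delay Bad n s q ^ 2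
      ≤ 2 * ∑ T ∈ Finset.Icc 1 (n - s), (T : ℝ) ^ 4 * if Bad T (pre q (s + T)) then 1 else 0 := by
  have h := Finset.sum_mul_sq_le_sq_mul_sq (Finset.Icc 1 (n - s)) (fun T : ℕ => 1 / (T : ℝ))
    (fun T : ℕ => (T : ℝ) ^ 2 * if Bad T (pre q (s + T)) then 1 else 0)
  have e1 : ∑ T ∈ Finset.Icc 1 (n - s), 1 / (T : ℝ) *
      ((T : ℝ) ^ 2 * if Bad T (pre q (s + T)) then 1 else 0) = delay Bad n s q := by
    refine Finset.sum_congr rfl fun T hT => ?_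
    have : (T : ℝ) ≠ 0 := Nat.cast_ne_zero.2 (by have := Finset.mem_Icc.1 hT; omega)
    field_simp
  have e2 : ∀ T : ℕ, ((T : ℝ) ^ 2 * if Bad T (pre q (s + T)) then (1 : ℝ) else 0) ^ 2
      = (T : ℝ) ^ 4 * if Bad T (pre q (s + T)) then 1 else 0 := by
    intro T
    split_ifs <;> ring
  have e3 : ∀ T : ℕ, (1 / (T : ℝ)) ^ 2 = 1 / (T : ℝ) ^ 2 := fun T => by rw [div_pow, one_pow]
  rw [e1] at h
  simp only [e2, e3] at h
  refine h.trans (mul_le_mul_of_nonneg_right (sum_Icc_one_div_sq_le _) ?_)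
  exact Finset.sum_nonneg fun T _ => by positivity

/-- Badness at length `T` depends only on the next `T` steps, and a tail `T ^ (-6)` is summable even
after multiplication by `T ^ 4`, as needed for second moments. -/
theorem ev_delay_le {p : List (Finset ℕ)} {s l : ℕ} (hp : p.length = s) (hA : 0 ≤ A)
    (hP : ∀ T, 1 ≤ T → T ≤ l → τ.Pr T (Bad T) p ≤ A / (T : ℝ) ^ 6) (k : ℕ) (hk : k ≤ 4) :
    τ.ev l (fun q => ∑ T ∈ Finset.Icc 1 (s + l - s), (T : ℝ) ^ k *
      (open Classical in if Bad T (pre q (s + T)) then (1 : ℝ) else 0)) p ≤ 2 * A := by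
  classical
  rw [ev_sum]
  have h : ∀ T ∈ Finset.Icc 1 (s + l - s), τ.ev l (fun q => (T : ℝ) ^ k *
      (if Bad T (pre q (s + T)) then (1 : ℝ) else 0)) p ≤ A * (1 / (T : ℝ) ^ 2) := by
    intro T hT
    have hT := Finset.mem_Icc.1 hT
    have hT0 : (1 : ℝ) ≤ T := Nat.one_le_cast.2 hT.1
    rw [ev_const_mul]
    have h1 : τ.ev l (fun q => if Bad T (pre q (s + T)) then (1 : ℝ) else 0) p
        ≤ τ.Pr T (Bad T) p := by
      obtain ⟨r, rfl⟩ : ∃ r, l = T + r := ⟨l - T, by omega⟩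
      refine le_of_eq_of_le ?_ (τ.Pr_le_Pr_drop (Q := fun q => Bad T (pre q (s + T))) T r ?_)
      · simp only [Pr]
      · intro q hq hB
        have : pre q (s + T) = q.drop r := by
          rw [pre, hq.length_eq]
          congr 1
          omega
        rwa [this] at hB
    calc (T : ℝ) ^ k * τ.ev l (fun q => if Bad T (pre q (s + T)) then (1 : ℝ) else 0) p
        ≤ (T : ℝ) ^ 4 * (A / (T : ℝ) ^ 6) := by
          refine mul_le_mul (pow_le_pow_right₀ hT0 hk) (h1.trans (hP T hT.1 (by omega))) ?_ (by positivity)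
          exact τ.ev_nonneg _ _ fun p' => by split_ifs <;> norm_num
      _ = A * (1 / (T : ℝ) ^ 2) := by field_simp
  refine (Finset.sum_le_sum h).trans ?_
  rw [← Finset.mul_sum]
  nlinarith [sum_Icc_one_div_sq_le (s + l - s)]

/-- Given the state at time `s`, the old weight is a constant, and a start at `s` adds a delay with
mean at most `2 * A` and second moment at most `4 * A`. The centring absorbs the linear term, and
the reserve in the weight absorbs the rest. -/
theorem ev_weight_succ_le {s l : ℕ} {p : List (Finset ℕ)} (hm : 0 < m₀) (hA : 0 ≤ A)
    (hp : τ.Ext [] s p)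
    (hP : start p → ∀ T, 1 ≤ T → T ≤ l → τ.Pr T (Bad T) p ≤ A / (T : ℝ) ^ 6)
    (hS : ∀ p T, 1 ≤ T → Bad T p → ∀ i, 0 < i → i < T → ¬ start (p.drop i)) :
    τ.ev l (weight start Bad (2 * A) (4 * A + 4 * A ^ 2) m₀ (s + l) (s + 1)) p
      ≤ τ.ev l (weight start Bad (2 * A) (4 * A + 4 * A ^ 2) m₀ (s + l) s) p := by
  classical
  have hlen : p.length = s := by simpa using hp.length_eq
  have hpre : ∀ q, τ.Ext p l q → ∀ i ≤ s, pre q i = pre p i := fun q hq i hi =>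
    pre_of_drop (hq.length_eq.trans (by rw [hlen])) hq.drop_eq i hi
  have hpre' : ∀ q, τ.Ext p l q → pre q s = p := fun q hq => by
    rw [hpre q hq s le_rfl, ← hlen, pre_self]
  by_cases hst : start p
  swap
  · refine le_of_eq (τ.ev_congr fun q hq => ?_)
    have h1 : drift start Bad (2 * A) (s + l) (s + 1) q = drift start Bad (2 * A) (s + l) s q := by
      rw [drift, Finset.sum_range_succ, hpre' q hq, if_neg hst, add_zero, drift]
    have h2 : startsBefore start (s + 1) q = startsBefore start s q := by
      rw [startsBefore, Finset.sum_range_succ, hpre' q hq, if_neg hst, add_zero, startsBefore]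
    rw [weight, weight, h1, h2]
  -- No bad segment contains a later start in its interior. As there is a start at time `s`, the
  -- delays of earlier segments are already determined by `p`.
  obtain ⟨d, hd⟩ : ∃ d, ∀ q, τ.Ext p l q → drift start Bad (2 * A) (s + l) s q = d := by
    refine ⟨drift start Bad (2 * A) s s p, fun q hq => ?_⟩
    refine Finset.sum_congr rfl fun s' hs' => ?_
    have hs' := Finset.mem_range.1 hs'
    rw [hpre q hq s' hs'.le]
    split_ifs
    swap
    · rfl
    congr 1
    have hsub : Finset.Icc 1 (s - s') ⊆ Finset.Icc 1 (s + l - s') :=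
      Finset.Icc_subset_Icc_right (by omega)
    rw [delay, delay, ← Finset.sum_subset hsub]
    · refine Finset.sum_congr rfl fun T hT => ?_
      have := Finset.mem_Icc.1 hT
      rw [hpre q hq _ (by omega)]
    · intro T hT hT'
      rw [Finset.mem_Icc] at hT hT'
      rw [if_neg, mul_zero]
      intro hB
      refine hS _ T hT.1 hB (s' + T - s) (by omega) (by omega) ?_
      have : (pre q (s' + T)).drop (s' + T - s) = p := by
        rw [pre, List.drop_drop, hq.length_eq, hlen, ← hpre' q hq, pre, hq.length_eq, hlen]
        congr 1
        omega
      rwa [this]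
  obtain ⟨M, hM0, hM⟩ : ∃ M : ℝ, 0 < M ∧ ∀ q, τ.Ext p l q → m₀ + startsBefore start s q = M := by
    refine ⟨m₀ + startsBefore start s p, by have := startsBefore_nonneg (start := start) s p; linarith,
      fun q hq => ?_⟩
    congr 1
    refine Finset.sum_congr rfl fun s' hs' => ?_
    rw [hpre q hq s' (Finset.mem_range.1 hs').le]
  have hL : ∀ q, τ.Ext p l q → weight start Bad (2 * A) (4 * A + 4 * A ^ 2) m₀ (s + l) s q
      = max 0 d ^ 2 / M ^ 2 + (4 * A + 4 * A ^ 2) / M := by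
    intro q hq
    rw [weight, hd q hq, hM q hq]
  rw [τ.ev_congr hL, ev_const]
  set a := max 0 d with ha
  have ha0 : 0 ≤ a := le_max_left _ _
  have hda : d ≤ a := le_max_right _ _
  set A' := 4 * A + 4 * A ^ 2 with hA'
  have hA'0 : 0 ≤ A' := by positivity
  have hub : ∀ q, τ.Ext p l q → weight start Bad (2 * A) A' m₀ (s + l) (s + 1) q
      ≤ ((a ^ 2 - 4 * A * a + 4 * A ^ 2) / (M + 1) ^ 2 + A' / (M + 1))
        + ((2 * a / (M + 1) ^ 2) * (∑ T ∈ Finset.Icc 1 (s + l - s), (T : ℝ) ^ 1 *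
            if Bad T (pre q (s + T)) then (1 : ℝ) else 0)
          + (2 / (M + 1) ^ 2) * ∑ T ∈ Finset.Icc 1 (s + l - s), (T : ℝ) ^ 4 *
            if Bad T (pre q (s + T)) then (1 : ℝ) else 0) := by
    intro q hq
    have h1 : drift start Bad (2 * A) (s + l) (s + 1) q = d + (delay Bad (s + l) s q - 2 * A) := by
      rw [drift, Finset.sum_range_succ, hpre' q hq, if_pos hst]
      congr 1
      exact hd q hq
    have h2 : m₀ + startsBefore start (s + 1) q = M + 1 := by
      rw [startsBefore, Finset.sum_range_succ, hpre' q hq, if_pos hst, ← add_assoc]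
      congr 1
      exact hM q hq
    have hx := delay_nonneg Bad (s + l) s q
    have hx2 := delay_sq_le_sum (Bad := Bad) (s + l) s q
    simp only [pow_one]
    rw [weight, h1, h2]
    change _ ≤ _ + (2 * a / (M + 1) ^ 2 * delay Bad (s + l) s q + _)
    set x := delay Bad (s + l) s q
    set y := ∑ T ∈ Finset.Icc 1 (s + l - s), (T : ℝ) ^ 4 *
            if Bad T (pre q (s + T)) then (1 : ℝ) else 0
    -- Replacing `d` by its positive part makes the coefficient `2 * a` of `x` nonnegative, so that
    -- only an upper bound on the mean of `x` is needed.
    have h3 : max 0 (d + (x - 2 * A)) ^ 2 ≤ (a ^ 2 - 4 * A * a + 4 * A ^ 2) + 2 * a * x + 2 * y := by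
      have h4 : max 0 (d + (x - 2 * A)) ^ 2 ≤ (a + (x - 2 * A)) ^ 2 := by
        rcases le_total (d + (x - 2 * A)) 0 with h | h
        · rw [max_eq_left h]; nlinarith [sq_nonneg (a + (x - 2 * A))]
        · rw [max_eq_right h]
          exact pow_le_pow_left₀ h (by linarith) 2
      nlinarith [mul_nonneg hA hx]
    have h5 : max 0 (d + (x - 2 * A)) ^ 2 / (M + 1) ^ 2
        ≤ ((a ^ 2 - 4 * A * a + 4 * A ^ 2) + 2 * a * x + 2 * y) / (M + 1) ^ 2 :=
      div_le_div_of_nonneg_right h3 (by positivity)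
    refine (add_le_add h5 le_rfl).trans (le_of_eq ?_)
    ring
  refine (τ.ev_mono hub).trans ?_
  generalize hc : (a ^ 2 - 4 * A * a + 4 * A ^ 2) / (M + 1) ^ 2 + A' / (M + 1) = c
  simp only [ev_fun_add, ev_const_mul, ev_const]
  rw [← hc]
  have k1 := ev_delay_le hlen hA (hP hst) 1 (by norm_num)
  have k4 := ev_delay_le hlen hA (hP hst) 4 (by norm_num)
  have k1' := mul_le_mul_of_nonneg_left k1 (show 0 ≤ 2 * a / (M + 1) ^ 2 by positivity)
  have k4' := mul_le_mul_of_nonneg_left k4 (show 0 ≤ 2 / (M + 1) ^ 2 by positivity)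
  refine (add_le_add le_rfl (add_le_add k1' k4')).trans ?_
  have e : (a ^ 2 - 4 * A * a + 4 * A ^ 2) / (M + 1) ^ 2 + A' / (M + 1)
      + (2 * a / (M + 1) ^ 2 * (2 * A) + 2 / (M + 1) ^ 2 * (2 * A))
      = a ^ 2 / (M + 1) ^ 2 + A' * (1 / (M + 1) + 1 / (M + 1) ^ 2) := by
    rw [hA']; field_simp; ring
  rw [e]
  -- The drop of the reserve from `A' / M` to `A' / (M + 1)` covers the new variance `A' / (M + 1) ^
  -- 2`.
  have e2 : 1 / (M + 1) + 1 / (M + 1) ^ 2 ≤ 1 / M := by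
    rw [div_add_div _ _ (by positivity) (by positivity), div_le_div_iff₀ (by positivity) hM0]
    nlinarith
  have e3 : a ^ 2 / (M + 1) ^ 2 ≤ a ^ 2 / M ^ 2 := by
    apply div_le_div_of_nonneg_left (by positivity) (by positivity)
    exact pow_le_pow_left₀ hM0.le (by linarith) 2
  have e4 := mul_le_mul_of_nonneg_left e2 hA'0
  rw [mul_one_div] at e4
  linarith

/-- The total delay of the bad segments is linear in the number of segments, up to a probability that
is inversely proportional to the number of segments. -/
theorem Pr_totalBad_le (hm : 0 < m₀) (hA : 0 ≤ A) (hκ : 0 < κ)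
    (hP : ∀ p T, τ.Ext [] p.length p → start p → 1 ≤ T → p.length + T ≤ t →
      τ.Pr T (Bad T) p ≤ A / (T : ℝ) ^ 6)
    (hS : ∀ p T, 1 ≤ T → Bad T p → ∀ i, 0 < i → i < T → ¬ start (p.drop i))
    (hS' : ∀ p T, 1 ≤ T → T ≤ p.length → Bad T p → start (p.drop T)) :
    τ.Pr t (fun q => κ * (m₀ + numStarts start q) < totalBad Bad q - 2 * A * numStarts start q) []
      ≤ (4 * A + 4 * A ^ 2) / (κ ^ 2 * m₀) := by
  classical
  set A' := 4 * A + 4 * A ^ 2 with hA'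
  have hA'0 : 0 ≤ A' := by positivity
  -- Every weight is a function of the complete path; `s` only says which starts are counted. The
  -- induction conditions on the path up to time `s`.
  have h1 : ∀ s ≤ t, τ.ev t (weight start Bad (2 * A) A' m₀ t s) [] ≤ A' / m₀ := by
    intro s hs
    induction s with
    | zero =>
      refine le_of_eq ?_
      rw [← τ.ev_const t (A' / m₀) []]
      refine τ.ev_congr fun q _ => ?_
      simp [weight, drift, startsBefore]
    | succ s ih =>
      refine le_trans ?_ (ih (by omega))
      obtain ⟨l, rfl⟩ : ∃ l, t = s + l := ⟨t - s, by omega⟩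
      rw [ev_add, ev_add]
      refine τ.ev_mono fun p hp => ?_
      have hl : p.length = s := by simpa using hp.length_eq
      refine ev_weight_succ_le hm hA hp (fun hst T h1 h2 => hP p T (by rwa [hl]) hst h1 (by omega)) hS
  have h2 : τ.Pr t (fun q => κ * (m₀ + numStarts start q)
      < totalBad Bad q - 2 * A * numStarts start q) []
      ≤ τ.ev t (fun q => κ⁻¹ ^ 2 * weight start Bad (2 * A) A' m₀ t t q) [] := by
    refine τ.ev_mono fun q hq => ?_
    have hlen : q.length = t := by simpa using hq.length_eq
    have hms : (numStarts start q : ℝ) = startsBefore start t q := by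
      rw [numStarts_eq, startsBefore, hlen]
    have hm' := startsBefore_nonneg (start := start) t q
    have hw : 0 ≤ A' / (m₀ + startsBefore start t q) := by positivity
    split_ifs with h
    swap
    · rw [weight]; positivity
    have hdr : drift start Bad (2 * A) t t q = totalBad Bad q - 2 * A * numStarts start q := by
      rw [totalBad_eq, numStarts_eq, hlen, drift, Finset.mul_sum, ← Finset.sum_sub_distrib]
      refine Finset.sum_congr rfl fun s hs => ?_
      have hs := Finset.mem_range.1 hs
      split_ifs with hst
      · ring
      · rw [delay, Finset.sum_eq_zero]
        · ring
        · intro T hT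
          have hT := Finset.mem_Icc.1 hT
          rw [if_neg, mul_zero]
          intro hB
          apply hst
          have h3 := hS' (pre q (s + T)) T hT.1 (by rw [pre, List.length_drop]; omega) hB
          rw [pre, List.drop_drop] at h3
          rw [pre]
          convert h3 using 2
          omega
    rw [weight, hdr, ← hms]
    rw [← hms] at hw
    have hmn : (0 : ℝ) ≤ numStarts start q := Nat.cast_nonneg _
    have h0 : 0 < m₀ + (numStarts start q : ℝ) := by linarith
    rw [max_eq_right (by nlinarith [mul_pos hκ h0])]
    have h4 : κ ^ 2 ≤ (totalBad Bad q - 2 * A * numStarts start q) ^ 2 / (m₀ + numStarts start q) ^ 2 := by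
      rw [le_div_iff₀ (by positivity), ← mul_pow]
      exact pow_le_pow_left₀ (by positivity) h.le 2
    have h5 : κ⁻¹ ^ 2 * κ ^ 2 = 1 := by field_simp
    have h6 : 0 < κ⁻¹ ^ 2 := by positivity
    nlinarith
  refine h2.trans ?_
  rw [ev_const_mul]
  refine (mul_le_mul_of_nonneg_left (h1 t le_rfl) (by positivity)).trans (le_of_eq ?_)
  field_simp

end CoinTree

/-! ### The algorithm -/

/-- Local state of a node. `fresh`: in the slot of its arrival (it only draws the parity of the slots
that it is going to use). `back joined own y flag`: a node in backoff, which uses every other slot; `joined`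
tells whether it knows the control slots, `own` whether the next slot is one of its own, which will be
the `y`-th one, and `flag` whether it has broadcast since the current block of own slots has begun.
`sync x`: a node that knows that the last success in a control slot happened `x` slots ago. -/
inductive NodeState
  | fresh : NodeState
  | back (joined own : Bool) (y : ℕ) (flag : Bool) : NodeState
  | sync (x : ℕ) : NodeState

namespace NodeState

/-- Length of the block that contains the own slot `y`: the slots from `2 ^ k` to `2 ^ (k + 1) - 1` are
divided into `2 ^ β k` blocks. -/
def blockLen (β : ℕ → ℕ) (y : ℕ) : ℕ := 2 ^ (Nat.log 2 y - β (Nat.log 2 y))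

/-- Probability that a node in backoff broadcasts in its own slot `y`. -/
noncomputable def backProb (β : ℕ → ℕ) (y : ℕ) (flag : Bool) : ℝ :=
  -- The probabilities `1 / (L + 1), 1 / L, …, 1 / 2` place the first attempt uniformly: each of the
  -- `L` slots of a block is chosen with probability `1 / (L + 1)`, and none with the same
  -- probability.
  if flag then 1 / (y + 1) else 1 / ((blockLen β y - y % blockLen β y : ℕ) + 1)

/-- Probability that a synchronized node broadcasts in the slot `a` after a restart. Odd slots are for
control, and the multiples of `2 ^ 15` are for data. -/
noncomputable def syncProb (a : ℕ) : ℝ :=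
  if a % 2 = 1 then min (1 / 2) (1024 * Real.log a / a) else if 2 ^ 15 ∣ a then 1 / a else 0

/-- Probability that the coin of a node shows heads. -/
noncomputable def coinProb (β : ℕ → ℕ) : NodeState → ℝ
  | fresh => 1 / 2
  | back _ own y flag => if own then backProb β y flag else 0
  | sync x => syncProb (x + 1)

open Classical in
/-- Transition, given whether the slot was successful, and the coin. -/
noncomputable def next (β : ℕ → ℕ) (s : NodeState) (b c : Bool) : NodeState :=
  match s with
  | fresh => if b then back true true 1 false else back false c 1 false
  | back joined own y flag =>
    if b = true ∧ (joined = false ∨ own = true) then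
      if joined then sync 0 else back true true 1 false
    else if own then
      back joined false (y + 1) (if blockLen β (y + 1) ∣ y + 1 then false else flag || c)
    else back joined true y flag
  -- The slot just heard had age `x + 1`, so it was a control slot exactly if `x` is even.
  | sync x => if b = true ∧ x % 2 = 0 then sync 0 else sync (x + 1)

theorem blockLen_pos (β : ℕ → ℕ) (y : ℕ) : 0 < blockLen β y := by unfold blockLen; positivity

theorem backProb_nonneg (β : ℕ → ℕ) (y : ℕ) (flag : Bool) : 0 ≤ backProb β y flag := by
  unfold backProb; split_ifs <;> positivity

theorem backProb_le_half (β : ℕ → ℕ) {y : ℕ} (hy : 1 ≤ y) (flag : Bool) :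
    backProb β y flag ≤ 1 / 2 := by
  unfold backProb
  split_ifs
  · apply one_div_le_one_div_of_le (by norm_num)
    have : (1 : ℝ) ≤ y := by exact_mod_cast hy
    linarith
  · apply one_div_le_one_div_of_le (by norm_num)
    have h := Nat.mod_lt y (blockLen_pos β y)
    have : (1 : ℝ) ≤ (blockLen β y - y % blockLen β y : ℕ) := by
      exact_mod_cast (by omega : 1 ≤ blockLen β y - y % blockLen β y)
    linarith

theorem backProb_le_one (β : ℕ → ℕ) (y : ℕ) (flag : Bool) : backProb β y flag ≤ 1 := by
  unfold backProb
  split_ifs <;> exact div_le_one_of_le₀ (by linarith [Nat.cast_nonneg (α := ℝ) y, Nat.cast_nonneg (α := ℝ) (blockLen β y - y % blockLen β y)]) (by positivity)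

theorem syncProb_nonneg (a : ℕ) : 0 ≤ syncProb a := by
  unfold syncProb
  split_ifs
  · exact le_min (by norm_num) (div_nonneg (mul_nonneg (by norm_num) (Real.log_natCast_nonneg a)) (Nat.cast_nonneg a))
  · positivity
  · exact le_rfl

theorem syncProb_le_half {a : ℕ} (ha : 1 ≤ a) : syncProb a ≤ 1 / 2 := by
  unfold syncProb
  split_ifs with h1 h2
  · exact min_le_left _ _
  · have h3 := Nat.le_of_dvd ha h2
    apply one_div_le_one_div_of_le (by norm_num)
    exact_mod_cast (by omega : 2 ≤ a)
  · norm_num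

theorem coinProb_nonneg (β : ℕ → ℕ) (s : NodeState) : 0 ≤ coinProb β s := by
  cases s with
  | fresh => norm_num [coinProb]
  | back j o y f =>
    simp only [coinProb]
    split_ifs
    · exact backProb_nonneg β y f
    · exact le_rfl
  | sync x => exact syncProb_nonneg _

theorem coinProb_le_one (β : ℕ → ℕ) (s : NodeState) : coinProb β s ≤ 1 := by
  cases s with
  | fresh => norm_num [coinProb]
  | back j o y f =>
    simp only [coinProb]
    split_ifs
    · exact backProb_le_one β y f
    · norm_num
  | sync x => exact (syncProb_le_half (by omega)).trans (by norm_num)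

instance : MeasurableSpace NodeState := ⊤

instance : DiscreteMeasurableSpace NodeState := ⟨fun _ => trivial⟩

open Classical in
/-- The state of a node after it has heard `h`. Its `i`-th coin is thrown with the random number `u i`. -/
noncomputable def ofHeard (β : ℕ → ℕ) : List Bool → (ℕ → unitInterval) → NodeState
  | [], _ => fresh
  | b :: h, u => next β (ofHeard β h u) b (decide ((u h.length : ℝ) < coinProb β (ofHeard β h u)))

theorem measurable_ofHeard (β : ℕ → ℕ) (h : List Bool) : Measurable (ofHeard β h) := by
  classical
  induction h with
  | nil => exact measurable_const
  | cons b h ih =>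
    have e : ofHeard β (b :: h) = fun u => if (u h.length : ℝ) < coinProb β (ofHeard β h u) then
        next β (ofHeard β h u) b true else next β (ofHeard β h u) b false := by
      funext u
      rw [ofHeard]
      split_ifs with hc <;> simp [hc]
    rw [e]
    refine Measurable.ite ?_ ?_ ?_
    · refine measurableSet_lt ?_ ?_
      · exact measurable_subtype_coe.comp (measurable_pi_apply _)
      · exact (Measurable.of_discrete (f := coinProb β)).comp ih
    · exact (Measurable.of_discrete (f := fun s => next β s b true)).comp ih
    · exact (Measurable.of_discrete (f := fun s => next β s b false)).comp ih

end NodeState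

open NodeState

open Classical in
/-- The contention resolution algorithm whose backoff is governed by `β`. -/
noncomputable def backoffAlgorithm (β : ℕ → ℕ) : Algorithm where
  Tape := ℕ → unitInterval
  law := Measure.infinitePi fun _ => volume
  broadcast h u := decide (ofHeard β h u ≠ fresh ∧ (u h.length : ℝ) < coinProb β (ofHeard β h u))
  measurable_broadcast h := by
    refine measurable_to_bool ?_
    have hs : (fun u => decide (ofHeard β h u ≠ fresh ∧ (u h.length : ℝ) < coinProb β (ofHeard β h u)))
        ⁻¹' {true} = {u | ofHeard β h u = fresh}ᶜ ∩ {u | (u h.length : ℝ) < coinProb β (ofHeard β h u)} := by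
      ext u; simp
    rw [hs]
    refine MeasurableSet.inter (MeasurableSet.compl ?_) (measurableSet_lt ?_ ?_)
    · exact measurable_ofHeard β h (MeasurableSet.of_discrete (s := {fresh}))
    · exact measurable_subtype_coe.comp (measurable_pi_apply _)
    · exact (Measurable.of_discrete (f := coinProb β)).comp (measurable_ofHeard β h)

/-! ### The channel against a deterministic adversary -/

/-- State of the channel, with counters. An epoch begins when a success in a control slot restarts the
synchronized nodes, or when the channel is empty; a gap begins at each success or epoch. -/
structure Chan where
  arrived : ℕ
  present : Finset ℕ
  st : ℕ → NodeState
  hist : List (Option ℕ)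
  jammed : ℕ
  active : ℕ
  /-- age of the epoch -/
  X : ℕ
  /-- number of synchronized nodes at the beginning of the epoch -/
  eP : ℕ
  /-- number of other nodes at the beginning of the epoch -/
  eJ : ℕ
  /-- arrivals, jammed slots and successes in the epoch -/
  eArr : ℕ
  eJam : ℕ
  eSucc : ℕ
  /-- length, arrivals and jammed slots of the gap -/
  gL : ℕ
  gArr : ℕ
  gJam : ℕ

namespace Chan

def init : Chan where
  arrived := 0
  present := ∅
  st := fun _ => fresh
  hist := []
  jammed := 0
  active := 0
  X := 0
  eP := 0
  eJ := 0
  eArr := 0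
  eJam := 0
  eSucc := 0
  gL := 0
  gArr := 0
  gJam := 0

variable (β : ℕ → ℕ) (e : List (Option ℕ) → ℕ × Bool) (σ : Chan) (S : Finset ℕ)

def inj : ℕ := (e σ.hist).1
def jam : Bool := (e σ.hist).2
/-- Nodes in the system in the next slot. -/
def V : Finset ℕ := σ.present ∪ Finset.Ico σ.arrived (σ.arrived + σ.inj e)

open Classical in
/-- Outcome of the next slot if `S` is the set of nodes whose coins show heads. -/
noncomputable def out : Option ℕ := slotOutcome (σ.jam e) (S.filter fun j => σ.st j ≠ fresh)

noncomputable def present' : Finset ℕ := (σ.V e).filter fun j => σ.out e S ≠ some j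

open Classical in
noncomputable def st' (j : ℕ) : NodeState :=
  if j < σ.arrived + σ.inj e then next β (σ.st j) (σ.out e S).isSome (decide (j ∈ S)) else fresh

/-- The next slot ends the epoch. -/
def Restart : Prop := σ.present' e S = ∅ ∨ ((σ.out e S).isSome = true ∧ σ.X % 2 = 0)

/-- The next slot ends the gap. -/
def Closing : Prop := σ.Restart e S ∨ (σ.out e S).isSome = true

open Classical in
noncomputable def step : Chan where
  arrived := σ.arrived + σ.inj e
  present := σ.present' e S
  st := σ.st' β e S
  hist := σ.out e S :: σ.hist
  jammed := σ.jammed + if σ.jam e = true then 1 else 0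
  active := σ.active + if (σ.V e).Nonempty then 1 else 0
  X := if σ.Restart e S then 0 else σ.X + 1
  eP := if σ.Restart e S then ((σ.present' e S).filter fun j => σ.st' β e S j = sync 0).card else σ.eP
  eJ := if σ.Restart e S then
    ((σ.present' e S).filter fun j => σ.st' β e S j = back true true 1 false).card else σ.eJ
  eArr := if σ.Restart e S then 0 else σ.eArr + σ.inj e
  eJam := if σ.Restart e S then 0 else σ.eJam + if σ.jam e = true then 1 else 0
  eSucc := if σ.Restart e S then 0 else σ.eSucc + if (σ.out e S).isSome = true then 1 else 0
  gL := if σ.Closing e S then 0 else σ.gL + 1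
  gArr := if σ.Closing e S then 0 else σ.gArr + σ.inj e
  gJam := if σ.Closing e S then 0 else σ.gJam + if σ.jam e = true then 1 else 0

/-- State of the channel after the coin sets in `p`. -/
noncomputable def of : List (Finset ℕ) → Chan
  | [] => init
  | S :: p => (of p).step β e S

theorem of_cons (p : List (Finset ℕ)) : of β e (S :: p) = (of β e p).step β e S := rfl

/-- The coins of the nodes. -/
noncomputable def tree : CoinTree where
  V p := (of β e p).V e
  q p j := coinProb β ((of β e p).st j)
  q_nonneg _ _ := coinProb_nonneg _ _
  q_le_one _ _ := coinProb_le_one _ _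

/-- Age of a node. -/
noncomputable def age : List (Finset ℕ) → ℕ → ℕ
  | [], _ => 0
  | _ :: p, j => if j < (of β e p).arrived + (of β e p).inj e then age p j + 1 else 0

open Classical in
/-- The coin sets of an execution. -/
noncomputable def pathOf (ω : ℕ → ℕ → unitInterval) : ℕ → List (Finset ℕ)
  | 0 => []
  | t + 1 => ((of β e (pathOf ω t)).V e).filter
      (fun j => (ω j (age β e (pathOf ω t) j) : ℝ) < coinProb β ((of β e (pathOf ω t)).st j)) :: pathOf ω t

variable {β e}

theorem present_lt_arrived (p : List (Finset ℕ)) : ∀ j ∈ (of β e p).present, j < (of β e p).arrived := by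
  induction p with
  | nil => intro j hj; simp [of, init] at hj
  | cons S p ih =>
    intro j hj
    rw [of_cons] at hj ⊢
    simp only [step, present', V, Finset.mem_filter, Finset.mem_union, Finset.mem_Ico] at hj ⊢
    rcases hj.1 with h | h
    · exact Nat.lt_add_right _ (ih j h)
    · exact h.2

theorem lt_of_mem_V {p : List (Finset ℕ)} {j : ℕ} (hj : j ∈ (of β e p).V e) :
    j < (of β e p).arrived + (of β e p).inj e := by
  simp only [V, Finset.mem_union, Finset.mem_Ico] at hj
  rcases hj with h | h
  · exact Nat.lt_add_right _ (present_lt_arrived p j h)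
  · exact h.2

theorem age_eq_zero (p : List (Finset ℕ)) (j : ℕ) (hj : (of β e p).arrived ≤ j) :
    age β e p j = 0 := by
  cases p with
  | nil => rfl
  | cons S p =>
    rw [of_cons] at hj
    simp only [step] at hj
    rw [age, if_neg (by omega)]

theorem age_le_length (p : List (Finset ℕ)) (j : ℕ) : age β e p j ≤ p.length := by
  induction p with
  | nil => exact le_rfl
  | cons S p ih => rw [age, List.length_cons]; split_ifs <;> omega

/-- The tree describes the execution of the algorithm against an adversary with a fixed seed. -/
theorem runSlots_eq {E : Adversary} {seed : E.Seed} (he : e = fun h => E.act h seed)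
    (ω : ℕ → ℕ → unitInterval) (t : ℕ) :
    let C := runSlots (backoffAlgorithm β) E seed ω t
    let σ := of β e (pathOf β e ω t)
    C.arrived = σ.arrived ∧ C.present = σ.present ∧ C.history = σ.hist ∧ C.jammed = σ.jammed ∧
    C.active = σ.active ∧ (∀ j, (C.heard j).length = age β e (pathOf β e ω t) j) ∧
    -- Nodes that have left are excluded: on the tree their coins never show heads, whereas the
    -- automaton on their tape runs on.
    ∀ j, (j ∈ σ.present ∨ σ.arrived ≤ j) → ofHeard β (C.heard j) (ω j) = σ.st j := by
  induction t with
  | zero =>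
    refine ⟨rfl, rfl, rfl, rfl, rfl, fun j => rfl, fun j _ => rfl⟩
  | succ t ih =>
    classical
    obtain ⟨h1, h2, h3, h4, h5, h6, h7⟩ := ih
    intro C' σ'
    set C := runSlots (backoffAlgorithm β) E seed ω t with hC
    set p := pathOf β e ω t with hp
    set σ := of β e p with hσ
    set S := (σ.V e).filter (fun j => (ω j (age β e p j) : ℝ) < coinProb β (σ.st j)) with hS
    have hpath : pathOf β e ω (t + 1) = S :: p := rfl
    have hσ' : σ' = σ.step β e S := rfl
    have hact : E.act C.history seed = (σ.inj e, σ.jam e) := by rw [h3, inj, jam, he]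
    have hC' : C' = C.step (backoffAlgorithm β) ω (σ.inj e, σ.jam e) := by
      rw [← hact]; rfl
    have hV : C.present ∪ Finset.Ico C.arrived (C.arrived + σ.inj e) = σ.V e := by rw [h1, h2]; rfl
    have hst : ∀ j ∈ σ.V e, ofHeard β (C.heard j) (ω j) = σ.st j := by
      intro j hj
      simp only [V, Finset.mem_union, Finset.mem_Ico] at hj
      exact h7 j (hj.imp id fun h => h.1)
    have hcoin : ∀ j ∈ σ.V e, (((ω j (C.heard j).length : ℝ) < coinProb β (ofHeard β (C.heard j) (ω j))) ↔ j ∈ S) := by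
      intro j hj
      rw [hst j hj, h6 j, hS, Finset.mem_filter]
      exact ⟨fun h => ⟨hj, h⟩, fun h => h.2⟩
    have hsend : ((C.present ∪ Finset.Ico C.arrived (C.arrived + σ.inj e)).filter fun j =>
        (backoffAlgorithm β).broadcast (C.heard j) (ω j) = true) = S.filter fun j => σ.st j ≠ fresh := by
      rw [hV]
      ext j
      simp only [Finset.mem_filter, backoffAlgorithm, decide_eq_true_eq]
      constructor
      · rintro ⟨hj, h8, h9⟩
        exact ⟨(hcoin j hj).1 h9, by rwa [hst j hj] at h8⟩
      · rintro ⟨hj, h8⟩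
        have hj' : j ∈ σ.V e := (Finset.mem_filter.1 hj).1
        exact ⟨hj', by rwa [hst j hj'], (hcoin j hj').2 hj⟩
    have hout : slotOutcome (σ.jam e) ((C.present ∪ Finset.Ico C.arrived (C.arrived + σ.inj e)).filter fun j =>
        (backoffAlgorithm β).broadcast (C.heard j) (ω j) = true) = σ.out e S := by
      rw [hsend]; unfold out; congr!
    rw [hC', hσ', hpath]
    simp only [Config.step, step]
    refine ⟨by rw [h1], ?_, ?_, by rw [h4], ?_, ?_, ?_⟩
    · rw [hout, hV, present']
    · rw [hout, h3]
    · rw [hV, h5]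
    · intro j
      rw [h1, age]
      split_ifs with hj
      · rw [List.length_cons, h6]
      · rfl
    · intro j hj
      rw [hout, h1, st']
      split_ifs with hlt
      · have hjV : j ∈ σ.V e := by
          rcases hj with hj | hj
          · exact (Finset.mem_filter.1 hj).1
          · omega
        rw [ofHeard, hst j hjV]
        congr 1
        rw [h6]
        simp only [hS, Finset.mem_filter, hjV, true_and]
      · rfl

/-! ### Probabilities of paths -/

open Classical in
/-- The values of the random numbers that are compatible with the path `p`. -/
noncomputable def box (β : ℕ → ℕ) (e : List (Option ℕ) → ℕ × Bool) : List (Finset ℕ) → ℕ → ℕ → Set unitInterval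
  | [], _, _ => Set.univ
  | S :: p, j, i =>
    if j ∈ (of β e p).V e ∧ i = age β e p j then
      if j ∈ S then {u | (u : ℝ) < coinProb β ((of β e p).st j)}
      else {u | ¬ (u : ℝ) < coinProb β ((of β e p).st j)}
    else box β e p j i

theorem mem_box (ω : ℕ → ℕ → unitInterval) (p : List (Finset ℕ)) (h : pathOf β e ω p.length = p) (j i : ℕ) :
    ω j i ∈ box β e p j i := by
  induction p with
  | nil => trivial
  | cons S p ih =>
    rw [List.length_cons, pathOf, List.cons.injEq] at h
    obtain ⟨h1, h2⟩ := h
    rw [h2] at h1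
    rw [box]
    split_ifs with h3 h4
    · rw [← h1, Finset.mem_filter] at h4
      rw [h3.2]
      exact h4.2
    · rw [← h1, Finset.mem_filter] at h4
      rw [h3.2]
      exact fun h => h4 ⟨h3.1, h⟩
    · exact ih h2

/-- A node uses one coin per slot, numbered by its age; the next one has not been constrained yet.
This is the independence of successive slots. -/
theorem box_eq_univ (p : List (Finset ℕ)) (j i : ℕ) (h : age β e p j ≤ i) : box β e p j i = Set.univ := by
  induction p with
  | nil => rfl
  | cons S p ih =>
    rw [age] at h
    rw [box]
    split_ifs at h with hj
    · rw [if_neg (by omega)]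
      exact ih (by omega)
    · rw [if_neg (fun h' => hj (lt_of_mem_V h'.1))]
      exact ih (by rw [age_eq_zero p j (by omega)]; exact Nat.zero_le _)

/-- Probability of a path. -/
noncomputable def pathProb (β : ℕ → ℕ) (e : List (Option ℕ) → ℕ × Bool) : List (Finset ℕ) → ℝ
  | [] => 1
  | S :: p => pathProb β e p * (tree β e).wt p S

theorem pathProb_nonneg (p : List (Finset ℕ)) : 0 ≤ pathProb β e p := by
  induction p with
  | nil => norm_num [pathProb]
  | cons S p ih => exact mul_nonneg ih ((tree β e).wt_nonneg p S)

theorem measurableSet_box (p : List (Finset ℕ)) (j i : ℕ) : MeasurableSet (box β e p j i) := by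
  induction p with
  | nil => exact MeasurableSet.univ
  | cons S p ih =>
    rw [box]
    split_ifs
    · exact measurableSet_lt measurable_subtype_coe measurable_const
    · exact (measurableSet_lt measurable_subtype_coe measurable_const).compl
    · exact ih

theorem volume_lt (x : ℝ) (h0 : 0 ≤ x) (h1 : x ≤ 1) :
    volume {u : unitInterval | (u : ℝ) < x} = ENNReal.ofReal x :=
  unitInterval.volume_Iio ⟨x, h0, h1⟩

theorem volume_not_lt (x : ℝ) (h0 : 0 ≤ x) (h1 : x ≤ 1) :
    volume {u : unitInterval | ¬ (u : ℝ) < x} = ENNReal.ofReal (1 - x) := by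
  rw [← unitInterval.volume_Ici ⟨x, h0, h1⟩]
  congr 1
  ext u
  exact not_lt

/-- Factor contributed by the coin of node `j` at `p`. -/
noncomputable def coinFactor (β : ℕ → ℕ) (e : List (Option ℕ) → ℕ × Bool) (p : List (Finset ℕ))
    (S : Finset ℕ) (j : ℕ) : ENNReal :=
  open Classical in if j ∈ S then ENNReal.ofReal ((tree β e).q p j) else ENNReal.ofReal (1 - (tree β e).q p j)

theorem prod_coinFactor {p : List (Finset ℕ)} {S : Finset ℕ} (hS : S ⊆ (tree β e).V p) :
    ∏ j ∈ (tree β e).V p, coinFactor β e p S j = ENNReal.ofReal ((tree β e).wt p S) := by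
  classical
  have h : (tree β e).V p = S ∪ ((tree β e).V p \ S) := by rw [Finset.union_sdiff_of_subset hS]
  rw [h, Finset.prod_union Finset.disjoint_sdiff, CoinTree.wt,
    ENNReal.ofReal_mul (Finset.prod_nonneg fun j _ => (tree β e).q_nonneg p j),
    ENNReal.ofReal_prod_of_nonneg (fun j _ => (tree β e).q_nonneg p j),
    ENNReal.ofReal_prod_of_nonneg (fun j _ => by linarith [(tree β e).q_le_one p j])]
  congr 1
  · exact Finset.prod_congr rfl fun j hj => by rw [coinFactor, if_pos hj]
  · refine Finset.prod_congr rfl fun j hj => ?_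
    rw [coinFactor, if_neg (Finset.mem_sdiff.1 hj).2]

/-- Each random number is constrained by at most one slot of the path, so every slot multiplies the
volume by its own coin factors. The ranges `n` and `N` need only be large enough. -/
theorem prod_volume_box (p : List (Finset ℕ)) (hp : (tree β e).Ext [] p.length p) (n N : ℕ)
    (hn : (of β e p).arrived ≤ n) (hN : p.length ≤ N) :
    ∏ j ∈ Finset.range n, ∏ i ∈ Finset.range N, volume (box β e p j i)
      = ENNReal.ofReal (pathProb β e p) := by
  classical
  induction p with
  | nil => simp [box, pathProb]
  | cons S p ih =>
    obtain ⟨S', p', h1, h2, h3⟩ := hp.cases_step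
    obtain ⟨rfl, rfl⟩ := List.cons.inj h1
    have hn' : (of β e p).arrived + (of β e p).inj e ≤ n := hn
    have hN' : p.length + 1 ≤ N := hN
    have key : ∀ j ∈ Finset.range n, ∏ i ∈ Finset.range N, volume (box β e (S :: p) j i)
        = (∏ i ∈ Finset.range N, volume (box β e p j i)) *
          if j ∈ (tree β e).V p then coinFactor β e p S j else 1 := by
      intro j _
      by_cases hj : j ∈ (tree β e).V p
      · have hmem : age β e p j ∈ Finset.range N :=
          Finset.mem_range.2 (lt_of_le_of_lt (age_le_length p j) hN')
        rw [if_pos hj, ← Finset.mul_prod_erase _ _ hmem, ← Finset.mul_prod_erase _ _ hmem,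
          box_eq_univ p j _ le_rfl, measure_univ, one_mul, mul_comm]
        congr 1
        · refine Finset.prod_congr rfl fun i hi => ?_
          rw [box, if_neg]
          exact fun h => (Finset.mem_erase.1 hi).1 h.2
        · rw [box, if_pos ⟨hj, rfl⟩, coinFactor]
          split_ifs
          · exact volume_lt _ (coinProb_nonneg _ _) (coinProb_le_one _ _)
          · exact volume_not_lt _ (coinProb_nonneg _ _) (coinProb_le_one _ _)
      · rw [if_neg hj, mul_one]
        refine Finset.prod_congr rfl fun i _ => ?_
        rw [box, if_neg]
        exact fun h => hj h.1
    rw [Finset.prod_congr rfl key, Finset.prod_mul_distrib, ih h2 (by omega) (by omega),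
      Finset.prod_ite_mem, Finset.inter_eq_right.2, prod_coinFactor h3.1, pathProb,
      ENNReal.ofReal_mul (pathProb_nonneg p)]
    intro j hj
    exact Finset.mem_range.2 (lt_of_lt_of_le (lt_of_mem_V hj) hn')

/-- The law of the random numbers of all nodes. -/
noncomputable def tapesLaw : Measure (ℕ → ℕ → unitInterval) :=
  Measure.infinitePi fun _ => Measure.infinitePi fun _ => volume

theorem tapesLaw_path_le (p : List (Finset ℕ)) (hp : (tree β e).Ext [] p.length p) :
    tapesLaw {ω | pathOf β e ω p.length = p} ≤ ENNReal.ofReal (pathProb β e p) := by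
  rw [← prod_volume_box p hp (of β e p).arrived p.length le_rfl le_rfl]
  have hsub : {ω | pathOf β e ω p.length = p} ⊆ Set.pi (Finset.range (of β e p).arrived)
      (fun j => Set.pi (Finset.range p.length) (box β e p j)) :=
    fun ω hω j _ i _ => mem_box ω p hω j i
  refine (measure_mono hsub).trans (le_of_eq ?_)
  rw [tapesLaw, Measure.infinitePi_pi]
  · refine Finset.prod_congr rfl fun j _ => ?_
    rw [Measure.infinitePi_pi]
    exact fun i _ => measurableSet_box p j i
  · intro j _
    exact MeasurableSet.pi (Finset.countable_toSet _) fun i _ => measurableSet_box p j i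

theorem possible_pathOf (ω : ℕ → ℕ → unitInterval) (t : ℕ) :
    (tree β e).Ext [] t (pathOf β e ω t) := by
  classical
  induction t with
  | zero => exact CoinTree.Ext.refl
  | succ t ih =>
    refine CoinTree.Ext.step _ ih ⟨Finset.filter_subset _ _, fun j hj => ?_⟩
    exact lt_of_le_of_lt (ω j _).2.1 (Finset.mem_filter.1 hj).2

-- Only an upper bound is wanted, so a union over the possible next sets of heads suffices, and
-- subadditivity makes measurability of the event unnecessary.
open Classical in
theorem tapesLaw_le_ev (Q : List (Finset ℕ) → Prop) (k : ℕ) (p : List (Finset ℕ))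
    (hp : (tree β e).Ext [] p.length p) :
    tapesLaw {ω | pathOf β e ω p.length = p ∧ Q (pathOf β e ω (p.length + k))}
      ≤ ENNReal.ofReal (pathProb β e p * (tree β e).ev k (fun p => if Q p then 1 else 0) p) := by
  induction k generalizing p with
  | zero =>
    simp only [CoinTree.ev_zero]
    by_cases hQ : Q p
    · rw [if_pos hQ, mul_one]
      exact (measure_mono fun ω hω => hω.1).trans (tapesLaw_path_le p hp)
    · refine le_of_eq_of_le ?_ (zero_le)
      convert measure_empty (μ := tapesLaw)
      ext ω
      simp only [add_zero, Set.mem_ofPred_eq, Set.mem_empty_iff_false, iff_false, not_and]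
      intro h
      rwa [h]
  | succ k ih =>
    have hsub : {ω | pathOf β e ω p.length = p ∧ Q (pathOf β e ω (p.length + (k + 1)))}
        ⊆ ⋃ S ∈ ((tree β e).V p).powerset.filter (fun S => (tree β e).Possible p S),
          {ω | pathOf β e ω (S :: p).length = S :: p ∧ Q (pathOf β e ω ((S :: p).length + k))} := by
      rintro ω ⟨h1, h2⟩
      have h3 := possible_pathOf (β := β) (e := e) ω (p.length + 1)
      obtain ⟨S, p', h4, h5, h6⟩ := h3.cases_step
      have h7 : p' = p := by
        have : pathOf β e ω (p.length + 1) = _ :: pathOf β e ω p.length := rfl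
        rw [this, h1] at h4
        exact (List.cons.inj h4).2.symm
      rw [h7] at h4 h6
      simp only [Set.mem_iUnion]
      refine ⟨S, Finset.mem_filter.2 ⟨Finset.mem_powerset.2 h6.1, h6⟩, h4, ?_⟩
      rw [List.length_cons, show p.length + 1 + k = p.length + (k + 1) by ring]
      exact h2
    refine (measure_mono hsub).trans ((measure_biUnion_finset_le _ _).trans ?_)
    refine (Finset.sum_le_sum fun S hS => ih (S :: p)
      (CoinTree.Ext.step S hp (Finset.mem_filter.1 hS).2)).trans ?_
    have hev : ∀ p', 0 ≤ (tree β e).ev k (fun p => if Q p then 1 else 0) p' := fun p' =>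
      (tree β e).ev_nonneg k p' fun p => by split_ifs <;> norm_num
    rw [← ENNReal.ofReal_sum_of_nonneg fun S _ => mul_nonneg (pathProb_nonneg _) (hev _),
      CoinTree.ev_succ', CoinTree.E, Finset.mul_sum]
    apply ENNReal.ofReal_le_ofReal
    refine (Finset.sum_le_sum_of_subset_of_nonneg (Finset.filter_subset _ _) fun S _ _ =>
      mul_nonneg (pathProb_nonneg _) (hev _)).trans (le_of_eq ?_)
    exact Finset.sum_congr rfl fun S _ => by rw [pathProb]; ring

theorem tapesLaw_le_Pr (Q : List (Finset ℕ) → Prop) (t : ℕ) :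
    tapesLaw {ω | Q (pathOf β e ω t)} ≤ ENNReal.ofReal ((tree β e).Pr t Q []) := by
  classical
  have h := tapesLaw_le_ev (β := β) (e := e) Q t [] CoinTree.Ext.refl
  rw [pathProb, one_mul] at h
  refine le_trans (le_of_eq ?_) (h.trans (le_of_eq ?_))
  · congr 1
    ext ω
    simp [pathOf]
  · simp only [CoinTree.Pr]

end Chan

/-! ### Measurability of executions -/

/-- One slot, as a function of the set of senders. -/
noncomputable def Config.stepWith (C : Config) (a : ℕ × Bool) (S : Finset ℕ) : Config where
  arrived := C.arrived + a.1
  present := (C.present ∪ Finset.Ico C.arrived (C.arrived + a.1)).filter fun j => slotOutcome a.2 S ≠ some j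
  heard := fun j => if j < C.arrived + a.1 then (slotOutcome a.2 S).isSome :: C.heard j else []
  history := slotOutcome a.2 S :: C.history
  jammed := C.jammed + if a.2 = true then 1 else 0
  active := C.active + if (C.present ∪ Finset.Ico C.arrived (C.arrived + a.1)).Nonempty then 1 else 0

/-- The senders of a slot. -/
def Config.senders (A : Algorithm) (tapes : ℕ → A.Tape) (a : ℕ × Bool) (C : Config) : Finset ℕ :=
  (C.present ∪ Finset.Ico C.arrived (C.arrived + a.1)).filter
    fun j => A.broadcast (C.heard j) (tapes j) = true

theorem measurableSet_senders (A : Algorithm) (a : ℕ × Bool) (C : Config) (S : Finset ℕ) :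
    MeasurableSet {tapes : ℕ → A.Tape | C.senders A tapes a = S} := by
  have h : {tapes : ℕ → A.Tape | C.senders A tapes a = S} = ⋂ j : ℕ,
      {tapes | ((j ∈ C.present ∪ Finset.Ico C.arrived (C.arrived + a.1)) ∧
        A.broadcast (C.heard j) (tapes j) = true) ↔ j ∈ S} := by
    ext tapes
    simp only [Set.mem_ofPred_eq, Set.mem_iInter, Finset.ext_iff, Config.senders, Finset.mem_filter]
  rw [h]
  refine MeasurableSet.iInter fun j => ?_
  have hm : MeasurableSet {tapes : ℕ → A.Tape | A.broadcast (C.heard j) (tapes j) = true} :=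
    ((A.measurable_broadcast (C.heard j)).comp (measurable_pi_apply j)) (measurableSet_singleton true)
  by_cases hj : j ∈ C.present ∪ Finset.Ico C.arrived (C.arrived + a.1) <;> by_cases hS : j ∈ S
  · simpa only [hj, hS, true_and, iff_true] using hm
  · simp only [hj, hS, true_and, iff_false]
    exact hm.compl
  · simp [hj, hS]
  · simp [hj, hS]

/-- A slot is determined by the previous configuration, an action in `ℕ × Bool` and a finite set of
senders, so countably many configurations occur. Any predicate of the configuration is then
measurable, as conditioning on the seed requires. -/
theorem countable_measurable_runSlots (A : Algorithm) (E : Adversary) (t : ℕ) :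
    (Set.range fun x : E.Seed × (ℕ → A.Tape) => runSlots A E x.1 x.2 t).Countable ∧
    ∀ C, MeasurableSet {x : E.Seed × (ℕ → A.Tape) | runSlots A E x.1 x.2 t = C} := by
  induction t with
  | zero =>
    refine ⟨?_, fun C => ?_⟩
    · refine Set.Countable.mono ?_ (Set.countable_singleton Config.init)
      rintro _ ⟨x, rfl⟩
      rfl
    · by_cases h : Config.init = C <;> simp [runSlots, h]
  | succ t ih =>
    obtain ⟨h1, h2⟩ := ih
    set R := Set.range fun x : E.Seed × (ℕ → A.Tape) => runSlots A E x.1 x.2 t with hR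
    have hstep : ∀ x : E.Seed × (ℕ → A.Tape), runSlots A E x.1 x.2 (t + 1)
        = (runSlots A E x.1 x.2 t).stepWith (E.act (runSlots A E x.1 x.2 t).history x.1)
          ((runSlots A E x.1 x.2 t).senders A x.2 (E.act (runSlots A E x.1 x.2 t).history x.1)) :=
      fun x => rfl
    refine ⟨?_, fun C => ?_⟩
    · have hc : (⋃ C ∈ R, ⋃ a : ℕ × Bool, ⋃ S : Finset ℕ, {C.stepWith a S}).Countable :=
        h1.biUnion fun C _ => Set.countable_iUnion fun a => Set.countable_iUnion fun S =>
          Set.countable_singleton _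
      refine hc.mono ?_
      rintro _ ⟨x, rfl⟩
      simp only [Set.mem_iUnion]
      exact ⟨_, ⟨x, rfl⟩, _, _, hstep x⟩
    · have hset : {x : E.Seed × (ℕ → A.Tape) | runSlots A E x.1 x.2 (t + 1) = C}
          = ⋃ C' ∈ R, ⋃ a : ℕ × Bool, ⋃ S : Finset ℕ,
            {x | C'.stepWith a S = C ∧ runSlots A E x.1 x.2 t = C' ∧ E.act C'.history x.1 = a ∧
              C'.senders A x.2 a = S} := by
        ext x
        simp only [Set.mem_ofPred_eq, Set.mem_iUnion]
        constructor
        · intro h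
          exact ⟨_, ⟨x, rfl⟩, _, _, (hstep x).symm.trans h, rfl, rfl, rfl⟩
        · rintro ⟨C', -, a, S, h3, h4, h5, h6⟩
          rw [hstep x, h4, h5, h6, h3]
      rw [hset]
      refine MeasurableSet.biUnion h1 fun C' _ => MeasurableSet.iUnion fun a =>
        MeasurableSet.iUnion fun S => ?_
      by_cases hCS : C'.stepWith a S = C
      · simp only [hCS, true_and]
        refine (h2 C').inter (MeasurableSet.inter ?_ ?_)
        · exact (E.measurable_act C'.history).comp measurable_fst (measurableSet_singleton a)
        · exact measurable_snd (measurableSet_senders A a C' S)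
      · simp [hCS]

theorem measurableSet_runSlots (A : Algorithm) (E : Adversary) (t : ℕ) (P : Config → Prop) :
    MeasurableSet {x : E.Seed × (ℕ → A.Tape) | P (runSlots A E x.1 x.2 t)} := by
  obtain ⟨h1, h2⟩ := countable_measurable_runSlots A E t
  have : {x : E.Seed × (ℕ → A.Tape) | P (runSlots A E x.1 x.2 t)}
      = ⋃ C ∈ (Set.range fun x : E.Seed × (ℕ → A.Tape) => runSlots A E x.1 x.2 t),
        {x | P C ∧ runSlots A E x.1 x.2 t = C} := by
    ext x
    simp only [Set.mem_ofPred_eq, Set.mem_iUnion]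
    constructor
    · exact fun h => ⟨_, ⟨x, rfl⟩, h, rfl⟩
    · rintro ⟨C, -, h, h'⟩
      rwa [h']
  rw [this]
  refine MeasurableSet.biUnion h1 fun C _ => ?_
  by_cases hP : P C
  · simpa only [hP, true_and] using h2 C
  · simp [hP]

/-- It suffices to consider deterministic adversaries, on the tree of coins. -/
theorem achievesThroughput_of_Pr (β : ℕ → ℕ) (f g : ℝ → ℝ)
    (h : ∀ (e : List (Option ℕ) → ℕ × Bool) (t : ℕ), 1 ≤ t → ∀ n : ℕ, 1 ≤ n →
      (Chan.tree β e).Pr t (fun p => n ≤ (Chan.of β e p).arrived ∧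
        ((Chan.of β e p).arrived : ℝ) * f t + ((Chan.of β e p).jammed : ℝ) * g t
          < ((Chan.of β e p).active : ℝ)) [] ≤ 1 / n) :
    AchievesThroughput (backoffAlgorithm β) f g := by
  refine ⟨1, le_rfl, fun E t ht n hn => ?_⟩
  rw [Real.rpow_one]
  rw [execLaw, Measure.prod_apply (measurableSet_runSlots (backoffAlgorithm β) E t fun C =>
    n ≤ C.arrived ∧ (C.arrived : ℝ) * f t + (C.jammed : ℝ) * g t < (C.active : ℝ))]
  have hle : ∀ seed : E.Seed, (Measure.infinitePi fun _ : ℕ => (backoffAlgorithm β).law)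
      (Prod.mk seed ⁻¹' {p | n ≤ (runSlots (backoffAlgorithm β) E p.1 p.2 t).arrived ∧
      ((runSlots (backoffAlgorithm β) E p.1 p.2 t).arrived : ℝ) * f t
        + ((runSlots (backoffAlgorithm β) E p.1 p.2 t).jammed : ℝ) * g t
        < ((runSlots (backoffAlgorithm β) E p.1 p.2 t).active : ℝ)}) ≤ ENNReal.ofReal (1 / (n : ℝ)) := by
    intro seed
    refine le_trans ?_ (ENNReal.ofReal_le_ofReal (h (fun h => E.act h seed) t ht n hn))
    refine le_trans (le_of_eq ?_) (Chan.tapesLaw_le_Pr _ t)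
    rw [Chan.tapesLaw]
    congr 1
    ext ω
    obtain ⟨h1, -, -, h4, h5, -⟩ := Chan.runSlots_eq (β := β) (E := E) (seed := seed) rfl ω t
    simp only [Set.mem_preimage, Set.mem_ofPred_eq]
    rw [h1, h4, h5]
    rfl
  calc ∫⁻ seed, _ ∂E.law ≤ ∫⁻ _, ENNReal.ofReal (1 / (n : ℝ)) ∂E.law := lintegral_mono hle
    _ = ENNReal.ofReal (1 / (n : ℝ)) := by simp

/-! ### Invariants of the channel -/

namespace Chan

section Nodes
open Classical

/-- Synchronized nodes. -/
noncomputable def syncs (σ : Chan) : Finset ℕ := σ.present.filter fun j => ∃ x, σ.st j = sync x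

/-- Nodes in backoff that have not heard a success. -/
noncomputable def waits (σ : Chan) : Finset ℕ :=
  σ.present.filter fun j => ∃ o y f, σ.st j = back false o y f

/-- Nodes in backoff. -/
noncomputable def backs (σ : Chan) : Finset ℕ :=
  σ.present.filter fun j => ∃ i o y f, σ.st j = back i o y f

/-- Nodes in backoff that use the slots before which `X % 2 = r`. -/
noncomputable def users (r : ℕ) (σ : Chan) : Finset ℕ :=
  σ.present.filter fun j => ∃ i y f, σ.st j = back i (decide (σ.X % 2 = r)) y f

end Nodes

/-- The shape of the reachable states. -/
structure Inv (σ : Chan) : Prop where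
  lt_arrived : ∀ j ∈ σ.present, j < σ.arrived
  fresh_of_le : ∀ j, σ.arrived ≤ j → σ.st j = fresh
  ne_fresh : ∀ j ∈ σ.present, σ.st j ≠ fresh
  sync_eq : ∀ j ∈ σ.present, ∀ x, σ.st j = sync x → x = σ.X
  join_own : ∀ j ∈ σ.present, ∀ o y f, σ.st j = back true o y f → o = decide (σ.X % 2 = 0)
  y_pos : ∀ j ∈ σ.present, ∀ i o y f, σ.st j = back i o y f → 1 ≤ y
  start : σ.X = 0 → ∀ j ∈ σ.present, σ.st j = sync 0 ∨ σ.st j = back true true 1 false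
  gap_start : σ.gL = 0 → ∀ j ∈ σ.present, ∀ o y f, σ.st j ≠ back false o y f
  gL_le : σ.gL ≤ σ.X
  gArr_le : σ.gArr ≤ σ.eArr
  gJam_le : σ.gJam ≤ σ.eJam
  eArr_le : σ.eArr ≤ σ.arrived
  eJam_le : σ.eJam ≤ σ.jammed
  eP_le : σ.eP ≤ (syncs σ).card + σ.eSucc
  eP_le' : σ.eP ≤ (syncs σ).card + σ.X / 2 ^ 15
  syncs_le : (syncs σ).card ≤ σ.eP
  waits_le : (waits σ).card ≤ σ.gArr
  backs_le : (backs σ).card ≤ σ.eJ + σ.eArr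
  X_eq : σ.present = ∅ → σ.X = 0
  succ_le : σ.present.card + σ.eSucc ≤ σ.arrived
  eSucc_zero : σ.X = 0 → σ.eSucc = 0
  eArr_zero : σ.X = 0 → σ.eArr = 0
  eJam_zero : σ.X = 0 → σ.eJam = 0

variable {β : ℕ → ℕ} {e : List (Option ℕ) → ℕ × Bool} {σ : Chan} {S : Finset ℕ}

theorem out_eq_some {j : ℕ} (h : σ.out e S = some j) : j ∈ S ∧ σ.st j ≠ fresh ∧ σ.jam e = false := by
  classical
  rw [out, slotOutcome_eq_some_iff] at h
  have : j ∈ S.filter fun j => σ.st j ≠ fresh := by rw [h.2]; simp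
  exact ⟨(Finset.mem_filter.1 this).1, (Finset.mem_filter.1 this).2, h.1⟩

theorem mem_present' {j : ℕ} : j ∈ σ.present' e S ↔ j ∈ σ.V e ∧ σ.out e S ≠ some j := by
  simp [present']

theorem mem_V {j : ℕ} : j ∈ σ.V e ↔ j ∈ σ.present ∨ σ.arrived ≤ j ∧ j < σ.arrived + σ.inj e := by
  simp [V]

theorem Inv.lt_of_mem_V (h : Inv σ) {j : ℕ} (hj : j ∈ σ.V e) : j < σ.arrived + σ.inj e := by
  rcases mem_V.1 hj with h' | h'
  · exact Nat.lt_add_right _ (h.lt_arrived j h')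
  · exact h'.2

theorem Inv.st'_eq (h : Inv σ) {j : ℕ} (hj : j ∈ σ.V e) :
    σ.st' β e S j = next β (σ.st j) (σ.out e S).isSome (decide (j ∈ S)) := by
  classical
  rw [st', if_pos (h.lt_of_mem_V hj)]

/-- A node that is in the system was present or is fresh. -/
theorem Inv.cases_V (h : Inv σ) {j : ℕ} (hj : j ∈ σ.V e) :
    j ∈ σ.present ∨ (σ.st j = fresh ∧ j ∈ Finset.Ico σ.arrived (σ.arrived + σ.inj e)) := by
  rcases mem_V.1 hj with h' | h'
  · exact Or.inl h'
  · exact Or.inr ⟨h.fresh_of_le j h'.1, Finset.mem_Ico.2 h'⟩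

theorem next_fresh_true (c : Bool) : next β fresh true c = back true true 1 false := by simp [next]
theorem next_fresh_false (c : Bool) : next β fresh false c = back false c 1 false := by simp [next]
theorem next_wait_true (o : Bool) (y : ℕ) (f c : Bool) :
    next β (back false o y f) true c = back true true 1 false := by simp [next]
theorem next_join_own_true (y : ℕ) (f c : Bool) :
    next β (back true true y f) true c = sync 0 := by simp [next]
theorem next_join_other (y : ℕ) (f b c : Bool) :
    next β (back true false y f) b c = back true true y f := by simp [next]
open Classical in
theorem next_own_false (i : Bool) (y : ℕ) (f c : Bool) : next β (back i true y f) false c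
    = back i false (y + 1) (if blockLen β (y + 1) ∣ y + 1 then false else f || c) := by
  simp only [next]; simp
theorem next_other_false (i : Bool) (y : ℕ) (f c : Bool) :
    next β (back i false y f) false c = back i true y f := by simp [next]

/-- After a success in a control slot all nodes are at the start of the epoch. -/
theorem Inv.next_of_control (h : Inv σ) {j : ℕ} (hj : j ∈ σ.V e) (hX : σ.X % 2 = 0) (c : Bool) :
    (next β (σ.st j) true c = sync 0 ∧ j ∈ σ.present ∧ j ∉ waits σ) ∨
    (next β (σ.st j) true c = back true true 1 false ∧
      (j ∈ waits σ ∨ j ∈ Finset.Ico σ.arrived (σ.arrived + σ.inj e))) := by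
  classical
  rcases h.cases_V hj with hp | ⟨hf, hI⟩
  · rcases hst : σ.st j with _ | ⟨i, o, y, f⟩ | x
    · exact absurd hst (h.ne_fresh j hp)
    · cases i with
      | false =>
        refine Or.inr ⟨next_wait_true _ _ _ _, Or.inl ?_⟩
        exact Finset.mem_filter.2 ⟨hp, _, _, _, hst⟩
      | true =>
        have := h.join_own j hp _ _ _ hst
        rw [hX] at this
        simp only [decide_true] at this
        subst this
        refine Or.inl ⟨next_join_own_true _ _ _, hp, fun hw => ?_⟩
        obtain ⟨_, o, y, f, hw⟩ := Finset.mem_filter.1 hw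
        rw [hst] at hw
        simp at hw
    · have := h.sync_eq j hp x hst
      refine Or.inl ⟨by simp [next, this, hX], hp, fun hw => ?_⟩
      obtain ⟨_, o, y, f, hw⟩ := Finset.mem_filter.1 hw
      rw [hst] at hw
      simp at hw
  · rw [hf]
    exact Or.inr ⟨next_fresh_true _, Or.inr hI⟩

/-- The successor of a node state in a slot that does not restart. -/
theorem Inv.next_of_not_control (h : Inv σ) {j : ℕ} (hj : j ∈ σ.V e) {b : Bool}
    (hb : ¬ (b = true ∧ σ.X % 2 = 0)) (c : Bool) :
    (j ∈ syncs σ ∧ next β (σ.st j) b c = sync (σ.X + 1)) ∨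
    (∃ o y f, (j ∈ waits σ ∨ j ∈ Finset.Ico σ.arrived (σ.arrived + σ.inj e)) ∧ 1 ≤ y ∧ b = false ∧
      next β (σ.st j) b c = back false o y f) ∨
    (∃ y f, (j ∈ backs σ ∨ j ∈ Finset.Ico σ.arrived (σ.arrived + σ.inj e)) ∧ 1 ≤ y ∧
      next β (σ.st j) b c = back true (decide ((σ.X + 1) % 2 = 0)) y f) := by
  classical
  rcases h.cases_V hj with hp | ⟨hf, hI⟩
  · rcases hst : σ.st j with _ | ⟨i, o, y, f⟩ | x
    · exact absurd hst (h.ne_fresh j hp)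
    · have hy := h.y_pos j hp _ _ _ _ hst
      have hbk : j ∈ backs σ := Finset.mem_filter.2 ⟨hp, _, _, _, _, hst⟩
      cases i with
      | false =>
        have hw : j ∈ waits σ := Finset.mem_filter.2 ⟨hp, _, _, _, hst⟩
        cases b with
        | true =>
          refine Or.inr (Or.inr ⟨1, false, Or.inl hbk, le_rfl, ?_⟩)
          rw [next_wait_true]
          simp only [true_and] at hb
          congr 1
          symm; simp only [decide_eq_true_eq]; omega
        | false =>
          cases o with
          | true => exact Or.inr (Or.inl ⟨_, _, _, Or.inl hw, by omega, rfl, next_own_false _ _ _ _⟩)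
          | false => exact Or.inr (Or.inl ⟨_, _, _, Or.inl hw, hy, rfl, next_other_false _ _ _ _⟩)
      | true =>
        have ho := h.join_own j hp _ _ _ hst
        cases o with
        | true =>
          have hX : σ.X % 2 = 0 := by simpa using ho.symm
          have hb' : b = false := by
            cases b with
            | true => exact absurd ⟨rfl, hX⟩ hb
            | false => rfl
          subst hb'
          refine Or.inr (Or.inr ⟨y + 1, (if blockLen β (y + 1) ∣ y + 1 then false else f || c),
            Or.inl hbk, by omega, (next_own_false _ _ _ _).trans ?_⟩)
          congr 1
          symm; simp only [decide_eq_false_iff_not]; omega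
        | false =>
          have hX : ¬ σ.X % 2 = 0 := by simpa using ho.symm
          refine Or.inr (Or.inr ⟨y, f, Or.inl hbk, hy, (next_join_other _ _ _ _).trans ?_⟩)
          congr 1
          symm; simp only [decide_eq_true_eq]; omega
    · have := h.sync_eq j hp x hst
      refine Or.inl ⟨Finset.mem_filter.2 ⟨hp, _, hst⟩, ?_⟩
      rw [this]
      simp only [next]
      rw [if_neg hb]
  · rw [hf]
    cases b with
    | true =>
      refine Or.inr (Or.inr ⟨1, false, Or.inr hI, le_rfl, ?_⟩)
      rw [next_fresh_true]
      simp only [true_and] at hb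
      congr 1
      symm; simp only [decide_eq_true_eq]; omega
    | false => exact Or.inr (Or.inl ⟨_, _, _, Or.inr hI, le_rfl, rfl, next_fresh_false _⟩)

theorem isSome_out_iff : (σ.out e S).isSome = true ↔ ∃ j, σ.out e S = some j := Option.isSome_iff_exists

theorem Inv.card_V (h : Inv σ) : (σ.V e).card = σ.present.card + σ.inj e := by
  rw [V, Finset.card_union_of_disjoint, Nat.card_Ico]
  · omega
  · rw [Finset.disjoint_left]
    intro j hj hj'
    have := h.lt_arrived j hj
    have := Finset.mem_Ico.1 hj'
    omega

theorem card_present' (hS : S ⊆ σ.V e) :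
    (σ.present' e S).card + (if (σ.out e S).isSome = true then 1 else 0) = (σ.V e).card := by
  split_ifs with h
  · obtain ⟨j, hj⟩ := isSome_out_iff.1 h
    have hjV : j ∈ σ.V e := hS (out_eq_some hj).1
    have : σ.present' e S = (σ.V e).erase j := by
      ext i
      rw [mem_present', hj, Finset.mem_erase]
      simp only [ne_eq, Option.some.injEq]
      tauto
    rw [this, Finset.card_erase_add_one hjV]
  · have : σ.present' e S = σ.V e := by
      ext i
      rw [mem_present']
      refine ⟨fun h => h.1, fun hi => ⟨hi, fun h' => h ?_⟩⟩
      rw [h']; rfl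
    rw [this, add_zero]

theorem syncProb_eq_zero {a : ℕ} (h1 : a % 2 ≠ 1) (h2 : ¬ 2 ^ 15 ∣ a) : syncProb a = 0 := by
  rw [syncProb, if_neg h1, if_neg h2]

/-- In a slot that does not end the epoch, only a successful node leaves the set of synchronized nodes. -/
theorem Inv.syncs_step (h : Inv σ) (hR : ¬ σ.Restart e S) :
    syncs (σ.step β e S) = (syncs σ).filter fun j => σ.out e S ≠ some j := by
  classical
  have hb : ¬ ((σ.out e S).isSome = true ∧ σ.X % 2 = 0) := fun h' => hR (Or.inr h')
  ext j
  simp only [syncs, Finset.mem_filter]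
  constructor
  · rintro ⟨hj, x, hx⟩
    have hj' := mem_present'.1 hj
    have hx : σ.st' β e S j = sync x := hx
    rw [h.st'_eq hj'.1] at hx
    rcases h.next_of_not_control (β := β) hj'.1 hb (decide (j ∈ S)) with ⟨h1, -⟩ | ⟨o, y, f, -, -, -, h2⟩ | ⟨y, f, -, -, h2⟩
    · exact ⟨Finset.mem_filter.1 h1, hj'.2⟩
    · rw [h2] at hx; simp at hx
    · rw [h2] at hx; simp at hx
  · rintro ⟨⟨hj, x, hx⟩, hne⟩
    have hjV : j ∈ σ.V e := mem_V.2 (Or.inl hj)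
    refine ⟨mem_present'.2 ⟨hjV, hne⟩, σ.X + 1, ?_⟩
    change σ.st' β e S j = _
    rw [h.st'_eq hjV, hx, h.sync_eq j hj x hx]
    simp only [next]
    rw [if_neg hb]

theorem Inv.card_syncs_step (h : Inv σ) (hR : ¬ σ.Restart e S) :
    (syncs σ).card ≤ (syncs (σ.step β e S)).card + (if (σ.out e S).isSome = true then 1 else 0) := by
  rw [h.syncs_step hR]
  split_ifs with hs
  · obtain ⟨i, hi⟩ := isSome_out_iff.1 hs
    have : (syncs σ).erase i ⊆ (syncs σ).filter fun j => σ.out e S ≠ some j := by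
      intro j hj
      rw [Finset.mem_erase] at hj
      refine Finset.mem_filter.2 ⟨hj.2, ?_⟩
      rw [hi]
      intro h'
      exact hj.1 (Option.some.inj h').symm
    have h1 := Finset.card_le_card this
    have h2 := Finset.pred_card_le_card_erase (s := syncs σ) (a := i)
    omega
  · rw [Finset.filter_true_of_mem, add_zero]
    intro j _ h'
    apply hs
    rw [h']; rfl

/-- A success that does not restart falls in a slot of even age, where synchronized nodes broadcast
only at multiples of `2 ^ 15`. Hence at most `X / 2 ^ 15` of them can leave during an epoch of age
`X`. -/
theorem Inv.card_syncs_step' (h : Inv σ) (hR : ¬ σ.Restart e S)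
    (hp : ∀ j ∈ S, 0 < coinProb β (σ.st j)) :
    (syncs σ).card ≤ (syncs (σ.step β e S)).card + (if 2 ^ 15 ∣ σ.X + 1 then 1 else 0) := by
  classical
  have h1 := h.card_syncs_step (β := β) hR
  by_cases hs : (σ.out e S).isSome = true
  · rw [if_pos hs] at h1
    split_ifs with hd
    · exact h1
    · rw [h.syncs_step hR, Finset.filter_true_of_mem, add_zero]
      intro j hj h'
      obtain ⟨hj1, x, hx⟩ := Finset.mem_filter.1 hj
      have h2 := hp j (out_eq_some h').1
      rw [hx, h.sync_eq j hj1 x hx, coinProb, syncProb_eq_zero _ hd] at h2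
      · exact lt_irrefl _ h2
      · intro h3
        exact hR (Or.inr ⟨hs, by omega⟩)
  · rw [if_neg hs, add_zero] at h1
    exact h1.trans (Nat.le_add_right _ _)

/-- At a restart every remaining node is in one of the two initial states of an epoch and the
counters are recomputed from scratch. In other slots `next_of_not_control` lists the possible
transitions; a success turns all waiting nodes into nodes that know the control slots, so waiting
nodes arrived in the present gap. -/
theorem Inv.step (h : Inv σ) (hS : S ⊆ σ.V e) (hp : ∀ j ∈ S, 0 < coinProb β (σ.st j)) :
    Inv (σ.step β e S) := by
  classical
  have hcard := card_present' hS
  rw [h.card_V] at hcard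
  have hsl := h.succ_le
  have hfresh : ∀ j, σ.arrived + σ.inj e ≤ j → σ.st' β e S j = fresh := fun j hj => by
    rw [st', if_neg (by omega)]
  by_cases hR : σ.Restart e S
  · have hst : ∀ j ∈ σ.present' e S, σ.st' β e S j = sync 0 ∨ σ.st' β e S j = back true true 1 false := by
      intro j hj
      rcases hR with hR | ⟨hs, hX⟩
      · rw [hR] at hj; simp at hj
      · rw [h.st'_eq (mem_present'.1 hj).1, hs]
        rcases h.next_of_control (β := β) (mem_present'.1 hj).1 hX (decide (j ∈ S)) with h1 | h1
        · exact Or.inl h1.1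
        · exact Or.inr h1.1
    have hC : σ.Closing e S := Or.inl hR
    have e1 : syncs (σ.step β e S) = (σ.present' e S).filter fun j => σ.st' β e S j = sync 0 := by
      ext j
      simp only [syncs, Finset.mem_filter]
      refine and_congr_right fun hj => ⟨fun ⟨x, hx⟩ => ?_, fun hx => ⟨0, hx⟩⟩
      rcases hst j hj with h1 | h1
      · exact h1
      · change σ.st' β e S j = _ at hx
        rw [h1] at hx; simp at hx
    have e2 : backs (σ.step β e S) = (σ.present' e S).filter fun j => σ.st' β e S j = back true true 1 false := by
      ext j
      simp only [backs, Finset.mem_filter]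
      refine and_congr_right fun hj => ⟨fun ⟨i, o, y, f, hx⟩ => ?_, fun hx => ⟨_, _, _, _, hx⟩⟩
      rcases hst j hj with h1 | h1
      · change σ.st' β e S j = _ at hx
        rw [h1] at hx; simp at hx
      · exact h1
    have e3 : waits (σ.step β e S) = ∅ := by
      rw [waits, Finset.filter_eq_empty_iff]
      rintro j hj ⟨o, y, f, hx⟩
      change σ.st' β e S j = _ at hx
      rcases hst j hj with h1 | h1 <;> rw [h1] at hx <;> simp at hx
    refine ⟨?_, hfresh, ?_, ?_, ?_, ?_, fun _ => hst, ?_, ?_, ?_, ?_, ?_, ?_, ?_, ?_, ?_, ?_, ?_, ?_, ?_, ?_, ?_, ?_⟩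
    · exact fun j hj => h.lt_of_mem_V (mem_present'.1 hj).1
    · intro j hj hx
      change σ.st' β e S j = _ at hx
      rcases hst j hj with h1 | h1 <;> rw [h1] at hx <;> simp at hx
    · intro j hj x hx
      change σ.st' β e S j = _ at hx
      simp only [Chan.step, if_pos hR]
      rcases hst j hj with h1 | h1 <;> rw [h1] at hx <;> simp at hx
      exact hx.symm
    · intro j hj o y f hx
      change σ.st' β e S j = _ at hx
      simp only [Chan.step, if_pos hR]
      rcases hst j hj with h1 | h1 <;> rw [h1] at hx <;> simp at hx
      simp [← hx.1]
    · intro j hj i o y f hx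
      change σ.st' β e S j = _ at hx
      rcases hst j hj with h1 | h1 <;> rw [h1] at hx <;> simp at hx
      omega
    · intro _ j hj o y f hx
      change σ.st' β e S j = _ at hx
      rcases hst j hj with h1 | h1 <;> rw [h1] at hx <;> simp at hx
    · simp [Chan.step, if_pos hR, if_pos hC]
    · simp [Chan.step, if_pos hR, if_pos hC]
    · simp [Chan.step, if_pos hR, if_pos hC]
    · simp [Chan.step, if_pos hR]
    · simp [Chan.step, if_pos hR]
    · rw [e1]; simp [Chan.step, if_pos hR]
    · rw [e1]; simp [Chan.step, if_pos hR]
    · rw [e1]; simp [Chan.step, if_pos hR]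
    · rw [e3]; simp
    · rw [e2]; simp [Chan.step, if_pos hR]
    · intro _; simp [Chan.step, if_pos hR]
    · simp only [Chan.step, if_pos hR]; omega
    · intro _; simp [Chan.step, if_pos hR]
    · intro _; simp [Chan.step, if_pos hR]
    · intro _; simp [Chan.step, if_pos hR]
  · have hb : ¬ ((σ.out e S).isSome = true ∧ σ.X % 2 = 0) := fun h' => hR (Or.inr h')
    have hX : (σ.step β e S).X = σ.X + 1 := by simp only [Chan.step, if_neg hR]
    have hst : ∀ j ∈ σ.present' e S, _ := fun j hj =>
      h.next_of_not_control (β := β) (mem_present'.1 hj).1 hb (decide (j ∈ S))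
    have hst' : ∀ j ∈ σ.present' e S, (σ.step β e S).st j
        = next β (σ.st j) (σ.out e S).isSome (decide (j ∈ S)) := fun j hj =>
      h.st'_eq (mem_present'.1 hj).1
    have hC : σ.Closing e S ↔ (σ.out e S).isSome = true := ⟨fun h' => h'.resolve_left hR, Or.inr⟩
    have h1 := h.card_syncs_step (β := β) hR
    have h2 := h.card_syncs_step' hR hp
    refine ⟨?_, hfresh, ?_, ?_, ?_, ?_, ?_, ?_, ?_, ?_, ?_, ?_, ?_, ?_, ?_, ?_, ?_, ?_, ?_, ?_, ?_, ?_, ?_⟩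
    · exact fun j hj => h.lt_of_mem_V (mem_present'.1 hj).1
    · intro j hj hx
      rw [hst' j hj] at hx
      rcases hst j hj with ⟨-, h2⟩ | ⟨o, y, f, -, -, -, h2⟩ | ⟨y, f, -, -, h2⟩ <;> rw [h2] at hx <;> simp at hx
    · intro j hj x hx
      rw [hst' j hj] at hx
      rcases hst j hj with ⟨-, h2⟩ | ⟨o, y, f, -, -, -, h2⟩ | ⟨y, f, -, -, h2⟩ <;> rw [h2] at hx <;> simp at hx
      rw [hX]; exact hx.symm
    · intro j hj o y f hx
      rw [hst' j hj] at hx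
      rcases hst j hj with ⟨-, h2⟩ | ⟨o, y, f, -, -, -, h2⟩ | ⟨y, f, -, -, h2⟩ <;> rw [h2] at hx <;> simp at hx
      rw [hX]; exact hx.1.symm
    · intro j hj i o y f hx
      rw [hst' j hj] at hx
      rcases hst j hj with ⟨-, h2⟩ | ⟨o, y, f, -, hy, -, h2⟩ | ⟨y, f, -, hy, h2⟩ <;> rw [h2] at hx <;> simp at hx
      · rw [← hx.2.2.1]; exact hy
      · rw [← hx.2.2.1]; exact hy
    · intro h0; rw [hX] at h0; omega
    · intro h0 j hj o y f hx
      rw [hst' j hj] at hx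
      rcases hst j hj with ⟨-, h2⟩ | ⟨o, y, f, -, -, hbf, h2⟩ | ⟨y, f, -, -, h2⟩ <;> rw [h2] at hx <;> simp at hx
      have : ¬ σ.Closing e S := by rw [hC, hbf]; simp
      simp [Chan.step, if_neg this] at h0
    · rw [hX]; simp only [Chan.step]; have := h.gL_le; split_ifs <;> omega
    · simp only [Chan.step, if_neg hR]; have := h.gArr_le; split_ifs <;> omega
    · simp only [Chan.step, if_neg hR]; have := h.gJam_le; split_ifs <;> omega
    · simp only [Chan.step, if_neg hR]; have := h.eArr_le; omega
    · simp only [Chan.step, if_neg hR]; have := h.eJam_le; omega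
    · have := h.eP_le
      have e1 : (σ.step β e S).eP = σ.eP := by simp only [Chan.step, if_neg hR]
      have e2 : (σ.step β e S).eSucc = σ.eSucc + if (σ.out e S).isSome = true then 1 else 0 := by
        simp only [Chan.step, if_neg hR]
      omega
    · have := h.eP_le'
      have e1 : (σ.step β e S).eP = σ.eP := by simp only [Chan.step, if_neg hR]
      have e3 := Nat.succ_div (a := σ.X) (b := 2 ^ 15)
      rw [e1, hX]
      split_ifs at e3 h2 <;> omega
    · have := h.syncs_le
      have e1 : (σ.step β e S).eP = σ.eP := by simp only [Chan.step, if_neg hR]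
      rw [e1, h.syncs_step hR]
      exact (Finset.card_filter_le _ _).trans this
    · by_cases hs : (σ.out e S).isSome = true
      · have : waits (σ.step β e S) = ∅ := by
          rw [waits, Finset.filter_eq_empty_iff]
          rintro j hj ⟨o, y, f, hx⟩
          rw [hst' j hj] at hx
          rcases hst j hj with ⟨-, h2⟩ | ⟨o, y, f, -, -, hbf, h2⟩ | ⟨y, f, -, -, h2⟩ <;> rw [h2] at hx <;> simp at hx
          rw [hbf] at hs; simp at hs
        rw [this]; simp
      · have hsub : waits (σ.step β e S) ⊆ waits σ ∪ Finset.Ico σ.arrived (σ.arrived + σ.inj e) := by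
          intro j hj
          obtain ⟨hj, o, y, f, hx⟩ := Finset.mem_filter.1 hj
          rw [hst' j hj] at hx
          rw [Finset.mem_union]
          rcases hst j hj with ⟨-, h2⟩ | ⟨o, y, f, h3, -, hbf, h2⟩ | ⟨y, f, -, -, h2⟩
          · rw [h2] at hx; simp at hx
          · exact h3
          · rw [h2] at hx; simp at hx
        have h3 := (Finset.card_le_card hsub).trans (Finset.card_union_le _ _)
        rw [Nat.card_Ico] at h3
        have := h.waits_le
        have h4 : ¬ σ.Closing e S := by rwa [hC]
        have e4 : (σ.step β e S).gArr = σ.gArr + σ.inj e := by simp only [Chan.step, if_neg h4]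
        rw [e4]
        omega
    · have hsub : backs (σ.step β e S) ⊆ backs σ ∪ Finset.Ico σ.arrived (σ.arrived + σ.inj e) := by
        intro j hj
        obtain ⟨hj, i, o, y, f, hx⟩ := Finset.mem_filter.1 hj
        rw [hst' j hj] at hx
        rw [Finset.mem_union]
        rcases hst j hj with ⟨-, h2⟩ | ⟨o, y, f, h3, -, hbf, h2⟩ | ⟨y, f, h3, -, h2⟩
        · rw [h2] at hx; simp at hx
        · refine h3.imp (fun h4 => ?_) id
          obtain ⟨h5, o, y, f, h6⟩ := Finset.mem_filter.1 h4
          exact Finset.mem_filter.2 ⟨h5, _, _, _, _, h6⟩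
        · exact h3
      have h3 := (Finset.card_le_card hsub).trans (Finset.card_union_le _ _)
      rw [Nat.card_Ico] at h3
      have := h.backs_le
      have e4 : (σ.step β e S).eArr = σ.eArr + σ.inj e := by simp only [Chan.step, if_neg hR]
      have e5 : (σ.step β e S).eJ = σ.eJ := by simp only [Chan.step, if_neg hR]
      rw [e4, e5]
      omega
    · intro h0
      exact absurd (Or.inl h0) hR
    · simp only [Chan.step, if_neg hR]; omega
    · intro h0; rw [hX] at h0; omega
    · intro h0; rw [hX] at h0; omega
    · intro h0; rw [hX] at h0; omega

theorem inv_init : Inv init := by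
  refine ⟨?_, ?_, ?_, ?_, ?_, ?_, ?_, ?_, ?_, ?_, ?_, ?_, ?_, ?_, ?_, ?_, ?_, ?_, ?_, ?_, ?_, ?_, ?_⟩ <;>
    simp [init, syncs, waits, backs]

theorem inv_of {k : ℕ} {p : List (Finset ℕ)} (h : (tree β e).Ext [] k p) : Inv (of β e p) := by
  induction h with
  | refl => exact inv_init
  | step S h hS ih => exact ih.step hS.1 hS.2

end Chan

/-! ### Sums and clocks along a path -/

namespace CoinTree

/-- Sum of a quantity over the steps of a path. -/
noncomputable def acc (w : List (Finset ℕ) → Finset ℕ → ℝ) : List (Finset ℕ) → ℝ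
  | [] => 0
  | S :: p => acc w p + w p S

theorem acc_mono_of_le {w w' : List (Finset ℕ) → Finset ℕ → ℝ} {τ : CoinTree} {p p' : List (Finset ℕ)}
    {k : ℕ} (hp : τ.Ext p k p')
    (h : ∀ i, i < k → ∀ S, w (p'.drop (i + 1)) S ≤ w' (p'.drop (i + 1)) S) :
    acc w p' - acc w p ≤ acc w' p' - acc w' p := by
  induction hp with
  | refl => simp
  | step S hp hS ih =>
    have h1 := ih fun i hi S' => by simpa using h (i + 1) (by omega) S'
    have h2 := h 0 (by omega) S
    simp only [zero_add, List.drop_succ_cons, List.drop_zero] at h2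
    simp only [acc]
    linarith

theorem acc_add (w w' : List (Finset ℕ) → Finset ℕ → ℝ) (p : List (Finset ℕ)) :
    acc (fun p S => w p S + w' p S) p = acc w p + acc w' p := by
  induction p with
  | nil => simp [acc]
  | cons S p ih => simp only [acc, ih]; ring

theorem acc_const_mul (c : ℝ) (w : List (Finset ℕ) → Finset ℕ → ℝ) (p : List (Finset ℕ)) :
    acc (fun p S => c * w p S) p = c * acc w p := by
  induction p with
  | nil => simp [acc]
  | cons S p ih => simp only [acc, ih]; ring

theorem acc_le_of_ext {w : List (Finset ℕ) → Finset ℕ → ℝ} (hw : ∀ p S, 0 ≤ w p S) {τ : CoinTree}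
    {p p' : List (Finset ℕ)} {k : ℕ} (hp : τ.Ext p k p') : acc w p ≤ acc w p' := by
  induction hp with
  | refl => exact le_rfl
  | step S hp hS ih => exact ih.trans (le_add_of_nonneg_right (hw _ _))

/-- A counter that advances or is reset in each step. -/
structure IsClock (c : List (Finset ℕ) → ℕ) : Prop where
  nil : c [] = 0
  cons : ∀ S p, c (S :: p) = 0 ∨ c (S :: p) = c p + 1

theorem IsClock.drop {c : List (Finset ℕ) → ℕ} (hc : IsClock c) (p : List (Finset ℕ)) (i : ℕ)
    (hi : i ≤ c p) : c (p.drop i) + i = c p := by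
  induction i generalizing p with
  | zero => simp
  | succ i ih =>
    cases p with
    | nil => rw [hc.nil] at hi; omega
    | cons S p =>
      rcases hc.cons S p with h | h
      · omega
      · rw [List.drop_succ_cons]
        have := ih p (by omega)
        omega

theorem IsClock.le_length {c : List (Finset ℕ) → ℕ} (hc : IsClock c) (p : List (Finset ℕ)) :
    c p ≤ p.length := by
  induction p with
  | nil => rw [hc.nil]; simp
  | cons S p ih => rcases hc.cons S p with h | h <;> simp only [List.length_cons] <;> omega

/-- The clock at the beginning of a stretch without reset. -/
theorem IsClock.of_ext {c : List (Finset ℕ) → ℕ} (hc : IsClock c) {τ : CoinTree}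
    {p p' : List (Finset ℕ)} {k : ℕ} (h : τ.Ext p k p') (hk : k ≤ c p') : c p' = c p + k := by
  have := hc.drop p' k hk
  rw [h.drop_eq] at this
  exact this.symm

open Classical in
/-- Many steps in which the clock is reset with probability at least `1 - exp (-q)`. -/
theorem Pr_clock_le (τ : CoinTree) {c : List (Finset ℕ) → ℕ} (hc : IsClock c)
    (good : List (Finset ℕ) → Prop) (p : List (Finset ℕ)) (x : ℕ) (q N : ℝ) (hq : 0 ≤ q)
    (h : ∀ k p', k < x → τ.Ext p k p' → good p' →
      ∑ S ∈ (τ.V p').powerset, τ.wt p' S * (if c (S :: p') = 0 then 0 else 1) ≤ Real.exp (-q)) :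
    τ.Pr x (fun p' => c p' = c p + x ∧ N ≤ acc (fun p _ => if good p then 1 else 0) p'
      - acc (fun p _ => if good p then 1 else 0) p) p ≤ Real.exp (-(q * N)) := by
  set g := acc (fun p _ => if good p then (1 : ℝ) else 0) with hg
  have h1 := τ.Pr_le_of_supermartingale (p := p) (Q := fun p' => c p' = c p + x ∧ N ≤ g p' - g p)
    -- While the clock has not been reset, each good step gains a factor `exp q` and survives with
    -- probability at most `exp (-q)`.
    (fun k p' => if c p' = c p + k then Real.exp (q * (g p' - g p)) else 0) x ?_ (Real.exp (q * N))
    (Real.exp_pos _) ?_ ?_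
  · refine h1.trans (le_of_eq ?_)
    simp [Real.exp_neg]
  · intro k p' hk hp'
    by_cases hcl : c p' = c p + k
    · rw [if_pos hcl]
      have e1 : ∀ S, (if c (S :: p') = c p + (k + 1) then Real.exp (q * (g (S :: p') - g p)) else 0)
          = Real.exp (q * ((g p' + if good p' then 1 else 0) - g p)) * if c (S :: p') = 0 then 0 else 1 := by
        intro S
        rcases hc.cons S p' with h2 | h2
        · rw [if_pos h2, if_neg (show ¬ c (S :: p') = c p + (k + 1) by omega), mul_zero]
        · rw [if_pos (show c (S :: p') = c p + (k + 1) by omega),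
            if_neg (show ¬ c (S :: p') = 0 by omega), mul_one]
          rfl
      have e2 : τ.E (fun p' => if c p' = c p + (k + 1) then Real.exp (q * (g p' - g p)) else 0) p'
          = Real.exp (q * ((g p' + if good p' then 1 else 0) - g p)) *
            ∑ S ∈ (τ.V p').powerset, τ.wt p' S * (if c (S :: p') = 0 then 0 else 1) := by
        rw [E, Finset.mul_sum]
        refine Finset.sum_congr rfl fun S _ => ?_
        rw [e1]; ring
      rw [e2]
      by_cases hgd : good p'
      · rw [if_pos hgd]
        refine (mul_le_mul_of_nonneg_left (h k p' hk hp' hgd) (Real.exp_pos _).le).trans (le_of_eq ?_)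
        rw [← Real.exp_add]
        congr 1; ring
      · rw [if_neg hgd, add_zero]
        refine mul_le_of_le_one_right (Real.exp_pos _).le ?_
        refine (Finset.sum_le_sum (g := fun S => τ.wt p' S) fun S _ =>
          mul_le_of_le_one_right (τ.wt_nonneg _ _) ?_).trans_eq (τ.sum_wt p')
        split_ifs <;> norm_num
    · rw [if_neg hcl, E]
      refine le_of_eq (Finset.sum_eq_zero fun S _ => ?_)
      rw [if_neg, mul_zero]
      rcases hc.cons S p' with h2 | h2 <;> omega
  · intro p'
    split_ifs
    · exact (Real.exp_pos _).le
    · exact le_rfl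
  · rintro p' - ⟨h2, h3⟩
    rw [if_pos h2]
    exact Real.exp_le_exp.2 (mul_le_mul_of_nonneg_left h3 hq)

/-- The expected number of heads is at most about twice the number of heads. -/
theorem Pr_sum_prob_le (τ : CoinTree) (B : List (Finset ℕ) → Finset ℕ) (hB : ∀ p, B p ⊆ τ.V p)
    (p : List (Finset ℕ)) (k : ℕ) (L : ℝ) :
    τ.Pr k (fun p' => 2 * (acc (fun p S => ((S ∩ B p).card : ℝ)) p' - acc (fun p S => ((S ∩ B p).card : ℝ)) p)
      + 2 * L < acc (fun p _ => ∑ j ∈ B p, τ.q p j) p' - acc (fun p _ => ∑ j ∈ B p, τ.q p j) p) p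
      ≤ Real.exp (-L) := by
  set n := acc (fun p S => ((S ∩ B p).card : ℝ)) with hn
  set w := acc (fun p _ => ∑ j ∈ B p, τ.q p j) with hw
  have h1 := τ.Pr_le_of_supermartingale (p := p)
    (Q := fun p' => 2 * (n p' - n p) + 2 * L < w p' - w p)
    -- If `h` heads are expected in a step, its mean factor is at most `exp (h / 2) * exp (-(h / 2))
    -- = 1`.
    (fun k p' => Real.exp ((w p' - w p) / 2 - (n p' - n p))) k ?_ (Real.exp L) (Real.exp_pos _) ?_ ?_
  · refine h1.trans (le_of_eq ?_)
    simp [Real.exp_neg]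
  · intro m p' _ _
    have e1 : τ.E (fun p' => Real.exp ((w p' - w p) / 2 - (n p' - n p))) p'
        = Real.exp ((w p' - w p) / 2 - (n p' - n p) + (∑ j ∈ B p', τ.q p' j) / 2)
          * ∑ S ∈ (τ.V p').powerset, τ.wt p' S * Real.exp (-((S ∩ B p').card : ℝ)) := by
      rw [E, Finset.mul_sum]
      refine Finset.sum_congr rfl fun S _ => ?_
      rw [mul_left_comm, ← Real.exp_add]
      congr 2
      have e3 : n (S :: p') = n p' + ((S ∩ B p').card : ℝ) := rfl
      have e4 : w (S :: p') = w p' + ∑ j ∈ B p', τ.q p' j := rfl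
      rw [e3, e4]; ring
    rw [e1]
    refine (mul_le_mul_of_nonneg_left (τ.sum_wt_exp_neg_card p' (hB p')) (Real.exp_pos _).le).trans
      (le_of_eq ?_)
    rw [← Real.exp_add]
    congr 1; ring
  · exact fun _ => (Real.exp_pos _).le
  · intro p' _ h2
    exact Real.exp_le_exp.2 (by linarith)

end CoinTree

/-! ### Nodes in backoff: parity classes and ages -/

namespace Chan

open CoinTree

/-- Slots since the beginning of the epoch (`r = 0`) or of the gap. -/
def clock (r : ℕ) (σ : Chan) : ℕ := if r = 0 then σ.X else σ.gL

variable {β : ℕ → ℕ} {e : List (Option ℕ) → ℕ × Bool} {σ : Chan} {S : Finset ℕ}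

theorem isClock_X : IsClock fun p => (of β e p).X := by
  classical
  refine ⟨rfl, fun S p => ?_⟩
  rw [of_cons, step]
  by_cases h : (of β e p).Restart e S <;> simp [h]

theorem isClock_gL : IsClock fun p => (of β e p).gL := by
  classical
  refine ⟨rfl, fun S p => ?_⟩
  rw [of_cons, step]
  by_cases h : (of β e p).Closing e S <;> simp [h]

theorem isClock_clock (r : ℕ) : IsClock fun p => clock r (of β e p) := by
  by_cases h : r = 0
  · simp only [clock, if_pos h]; exact isClock_X
  · simp only [clock, if_neg h]; exact isClock_gL

/-- The slot does not disturb the nodes in backoff that use the slots of parity `r`. -/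
def Quiet (e : List (Option ℕ) → ℕ × Bool) (r : ℕ) (σ : Chan) (S : Finset ℕ) : Prop :=
  ¬ σ.Restart e S ∧ (r = 0 ∨ ¬ σ.Closing e S)

theorem quiet_of_clock {r : ℕ} (h : clock r (σ.step β e S) ≠ 0) : Quiet e r σ S := by
  classical
  by_cases hr : r = 0
  · rw [clock, if_pos hr] at h
    refine ⟨fun h' => h ?_, Or.inl hr⟩
    simp [step, h']
  · rw [clock, if_neg hr] at h
    have : ¬ σ.Closing e S := fun h' => h (by simp [step, h'])
    exact ⟨fun h' => this (Or.inl h'), Or.inr this⟩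

theorem step_of_not_restart (h : ¬ σ.Restart e S) : (σ.step β e S).X = σ.X + 1 ∧
    (σ.step β e S).eP = σ.eP ∧ (σ.step β e S).eJ = σ.eJ ∧ (σ.step β e S).eArr = σ.eArr + σ.inj e ∧
    (σ.step β e S).eJam = σ.eJam + (if σ.jam e = true then 1 else 0) ∧
    (σ.step β e S).eSucc = σ.eSucc + (if (σ.out e S).isSome = true then 1 else 0) := by
  classical
  simp [step, h]

theorem step_of_not_closing (h : ¬ σ.Closing e S) : (σ.step β e S).gL = σ.gL + 1 ∧
    (σ.step β e S).gArr = σ.gArr + σ.inj e ∧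
    (σ.step β e S).gJam = σ.gJam + (if σ.jam e = true then 1 else 0) := by
  classical
  simp [step, h]

/-- The ways in which the state of a user of the slots of parity `r` changes in a quiet slot. -/
theorem Inv.users_step (h : Inv σ) (hp : ∀ j ∈ S, 0 < coinProb β (σ.st j))
    {r : ℕ} (hQ : Quiet e r σ S) {j : ℕ} {i o : Bool} {y : ℕ} {f : Bool}
    (hj : j ∈ σ.present) (hst : σ.st j = back i o y f) (ho : o = decide (σ.X % 2 = r)) :
    j ∈ σ.present' e S ∧
    ((σ.X % 2 = r ∧ (σ.out e S) = none ∧ σ.st' β e S j = back i false (y + 1)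
      (if blockLen β (y + 1) ∣ y + 1 then false else f || decide (j ∈ S))) ∨
    (σ.X % 2 ≠ r ∧ σ.st' β e S j = back i true y f) ∨
    (σ.X % 2 ≠ r ∧ i = false ∧ (σ.out e S).isSome = true ∧ σ.st' β e S j = back true true 1 false)) := by
  classical
  have hjV : j ∈ σ.V e := mem_V.2 (Or.inl hj)
  rw [mem_present', h.st'_eq hjV, hst]
  obtain ⟨hR, hC⟩ := hQ
  by_cases hX : σ.X % 2 = r
  · have ho : o = true := by rw [ho]; simpa using hX
    subst ho
    have hout : ¬ (σ.out e S).isSome = true := by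
      intro hs
      rcases hC with hC | hC
      · exact hR (Or.inr ⟨hs, by omega⟩)
      · exact hC (Or.inr hs)
    have hnone : σ.out e S = none := by simpa using hout
    refine ⟨⟨hjV, by rw [hnone]; simp⟩, Or.inl ⟨hX, hnone, ?_⟩⟩
    rw [hnone]
    exact (next_own_false _ _ _ _).trans (by congr)
  · have ho : o = false := by rw [ho]; simpa using hX
    subst ho
    refine ⟨⟨hjV, fun h' => ?_⟩, Or.inr ?_⟩
    · have := hp j (out_eq_some h').1
      rw [hst] at this
      simp [coinProb] at this
    · by_cases hs : (σ.out e S).isSome = true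
      · rw [hs]
        cases i with
        | false => exact Or.inr ⟨hX, rfl, rfl, next_wait_true _ _ _ _⟩
        | true => exact Or.inl ⟨hX, next_join_other _ _ _ _⟩
      · have hs : (σ.out e S).isSome = false := by simpa using hs
        rw [hs]
        exact Or.inl ⟨hX, next_other_false _ _ _ _⟩

theorem mem_users {r j : ℕ} : j ∈ users r σ ↔ j ∈ σ.present ∧ ∃ i y f,
    σ.st j = back i (decide (σ.X % 2 = r)) y f := by
  classical
  simp [users]

/-- A user could leave only by a success in its own parity, which is not quiet: it ends the epoch
for `r = 0` and the gap for `r = 1`. A waiting user of the control parity that hears a success in a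
slot of the other parity joins, but keeps its parity. -/
theorem Inv.users_subset (h : Inv σ) (hp : ∀ j ∈ S, 0 < coinProb β (σ.st j))
    {r : ℕ} (hr : r < 2) (hQ : Quiet e r σ S) : users r σ ⊆ users r (σ.step β e S) := by
  intro j hj
  obtain ⟨hj, i, y, f, hst⟩ := mem_users.1 hj
  obtain ⟨h1, h2⟩ := h.users_step hp hQ hj hst rfl
  refine mem_users.2 ⟨h1, ?_⟩
  have hX := (step_of_not_restart (β := β) hQ.1).1
  rw [hX]
  change ∃ i y f, σ.st' β e S j = _
  rcases h2 with ⟨h3, -, h4⟩ | ⟨h3, h4⟩ | ⟨h3, -, -, h4⟩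
  · rw [decide_eq_false (show ¬ (σ.X + 1) % 2 = r by omega)]
    exact ⟨_, _, _, h4⟩
  · rw [decide_eq_true (show (σ.X + 1) % 2 = r by omega)]
    exact ⟨_, _, _, h4⟩
  · rw [decide_eq_true (show (σ.X + 1) % 2 = r by omega)]
    exact ⟨_, _, _, h4⟩

/-- Own slots are used at a limited rate. -/
def AgeLe (σ : Chan) : Prop := ∀ j ∈ σ.present, ∀ i o y f, σ.st j = back i o y f → y ≤ σ.X + 1

theorem ageLe_of {k : ℕ} {p : List (Finset ℕ)} (hp : (tree β e).Ext [] k p) : AgeLe (of β e p) := by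
  classical
  induction hp with
  | refl => intro j hj; simp [of, init] at hj
  | @step k p S hp hS ih =>
    have hI := inv_of hp
    have hI' := inv_of (hp.step S hS)
    intro j hj i o y f hst
    by_cases hR : (of β e p).Restart e S
    · have hX : (of β e (S :: p)).X = 0 := by rw [of_cons]; simp [step, hR]
      rcases hI'.start hX j hj with h1 | h1 <;> rw [h1] at hst <;> simp at hst
      omega
    · have hX : (of β e (S :: p)).X = (of β e p).X + 1 := (step_of_not_restart hR).1
      have hjV : j ∈ (of β e p).V e := (mem_present'.1 hj).1
      have e1 : (of β e (S :: p)).st j = (of β e p).st' β e S j := rfl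
      rw [e1, hI.st'_eq hjV] at hst
      rcases hI.cases_V hjV with h1 | ⟨h1, -⟩
      · rcases hst' : (of β e p).st j with _ | ⟨i', o', y', f'⟩ | x
        · exact absurd hst' (hI.ne_fresh j h1)
        · have := ih j h1 _ _ _ _ hst'
          rw [hst'] at hst
          simp only [next] at hst
          split_ifs at hst <;> simp only [back.injEq] at hst <;> omega
        · rw [hst'] at hst
          simp only [next] at hst
          split_ifs at hst
      · rw [h1] at hst
        simp only [next] at hst
        split_ifs at hst <;> simp only [back.injEq] at hst <;> omega

/-- Ages of the nodes that wait for a first success. -/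
theorem wait_age_le {k : ℕ} {p : List (Finset ℕ)} (hp : (tree β e).Ext [] k p) :
    ∀ j ∈ (of β e p).present, ∀ o y f, (of β e p).st j = back false o y f → y ≤ (of β e p).gL + 1 := by
  classical
  induction hp with
  | refl => intro j hj; simp [of, init] at hj
  | @step k p S hp hS ih =>
    have hI := inv_of hp
    have hI' := inv_of (hp.step S hS)
    intro j hj o y f hst
    by_cases hC : (of β e p).Closing e S
    · have hg : (of β e (S :: p)).gL = 0 := by rw [of_cons]; simp [step, hC]
      exact absurd hst (hI'.gap_start hg j hj o y f)
    · have hg : (of β e (S :: p)).gL = (of β e p).gL + 1 := (step_of_not_closing hC).1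
      have hjV : j ∈ (of β e p).V e := (mem_present'.1 hj).1
      have e1 : (of β e (S :: p)).st j = (of β e p).st' β e S j := rfl
      rw [e1, hI.st'_eq hjV] at hst
      rcases hI.cases_V hjV with h1 | ⟨h1, -⟩
      · rcases hst' : (of β e p).st j with _ | ⟨i', o', y', f'⟩ | x
        · exact absurd hst' (hI.ne_fresh j h1)
        · have := ih j h1
          rw [hst'] at hst
          cases i' with
          | false =>
            have := this _ _ _ hst'
            simp only [next] at hst
            split_ifs at hst <;> simp only [back.injEq] at hst <;> omega
          | true =>
            simp only [next] at hst
            split_ifs at hst <;> simp only [back.injEq, Bool.true_eq_false, false_and] at hst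
        · rw [hst'] at hst
          simp only [next] at hst
          split_ifs at hst
      · rw [h1] at hst
        simp only [next] at hst
        split_ifs at hst <;> simp only [back.injEq] at hst <;> omega

/-- Nodes that know the control slots own the slots with `X` even, so only waiting nodes use the
other parity. -/
theorem Inv.wait_of_mem_users (h : Inv σ) {j : ℕ} (hj : j ∈ users 1 σ) :
    j ∈ σ.present ∧ ∃ y f, σ.st j = back false (decide (σ.X % 2 = 1)) y f := by
  obtain ⟨hj, i, y, f, hst⟩ := mem_users.1 hj
  cases i with
  | false => exact ⟨hj, y, f, hst⟩
  | true =>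
    have := h.join_own j hj _ _ _ hst
    rw [decide_eq_decide] at this
    omega

theorem users_age_le {r : ℕ} (hr : r < 2) {k : ℕ} {p : List (Finset ℕ)} (hp : (tree β e).Ext [] k p)
    {j : ℕ} (hj : j ∈ users r (of β e p)) {i o : Bool} {y : ℕ} {f : Bool}
    (hst : (of β e p).st j = back i o y f) : y ≤ clock r (of β e p) + 1 := by
  rcases (by omega : r = 0 ∨ r = 1) with rfl | rfl
  · exact ageLe_of hp j (mem_users.1 hj).1 _ _ _ _ hst
  · obtain ⟨h1, y', f', h2⟩ := (inv_of hp).wait_of_mem_users hj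
    have := wait_age_le hp j h1 _ _ _ h2
    rw [hst] at h2
    simp only [back.injEq] at h2
    rw [h2.2.2.1]
    exact this

end Chan

/-! ### Credits of a node in backoff -/

namespace NodeState

/-- Number of blocks that begin in the own slots `1, …, y`. -/
def starts (β : ℕ → ℕ) (y : ℕ) : ℕ := ((Finset.Icc 1 y).filter fun i => blockLen β i ∣ i).card

/-- Bound on the sum of the broadcast probabilities of a node in its first `Y` own slots. -/
noncomputable def cap (β : ℕ → ℕ) (Y : ℕ) : ℝ := starts β Y + 1 + (harmonic Y : ℝ)

/-- Credit of a node, for the broadcasts that it has made since it knows the control slots (or arrived);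
`C` is the credit for the time before. -/
noncomputable def credit (β : ℕ → ℕ) (C : ℝ) : NodeState → ℝ
  | fresh => 0
  | back i _ y f => (if i then C else 0) + starts β y + (if f then 1 else 0) + (harmonic y : ℝ)
  | sync _ => 0

/-- Broadcast probability of a node that has broadcast in the current block. -/
noncomputable def flagProb : NodeState → ℝ
  | back _ true y true => 1 / (y + 1)
  | _ => 0

theorem starts_mono (β : ℕ → ℕ) : Monotone (starts β) := fun _ _ h =>
  Finset.card_le_card (Finset.filter_subset_filter _ (Finset.Icc_subset_Icc_right h))

theorem starts_succ (β : ℕ → ℕ) (y : ℕ) :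
    starts β (y + 1) = starts β y + if blockLen β (y + 1) ∣ y + 1 then 1 else 0 := by
  unfold starts
  rw [← Finset.insert_Icc_right_eq_Icc_add_one (by omega), Finset.filter_insert]
  split_ifs
  · rw [Finset.card_insert_of_notMem (by simp)]
  · rfl

theorem harmonic_cast_succ (y : ℕ) : (harmonic (y + 1) : ℝ) = (harmonic y : ℝ) + 1 / (y + 1) := by
  rw [harmonic_succ]; push_cast; rw [one_div]

theorem harmonic_cast_mono : Monotone fun y : ℕ => (harmonic y : ℝ) := by
  refine monotone_nat_of_le_succ fun y => ?_
  rw [harmonic_cast_succ]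
  have : (0 : ℝ) ≤ 1 / (y + 1) := by positivity
  linarith

theorem harmonic_cast_nonneg (y : ℕ) : (0 : ℝ) ≤ (harmonic y : ℝ) := by
  have := harmonic_cast_mono (Nat.zero_le y)
  simpa using this

theorem cap_nonneg (β : ℕ → ℕ) (Y : ℕ) : 0 ≤ cap β Y := by
  unfold cap; have := harmonic_cast_nonneg Y; positivity

theorem credit_nonneg (β : ℕ → ℕ) {C : ℝ} (hC : 0 ≤ C) (s : NodeState) : 0 ≤ credit β C s := by
  cases s with
  | fresh => exact le_rfl
  | back i o y f =>
    have := harmonic_cast_nonneg y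
    simp only [credit]
    positivity
  | sync x => exact le_rfl

theorem credit_back_le (β : ℕ → ℕ) {y Y : ℕ} (h : y ≤ Y) (i o f : Bool) :
    credit β (cap β Y) (back i o y f) ≤ (if i then cap β Y else 0) + cap β Y := by
  have h1 : (starts β y : ℝ) ≤ starts β Y := by exact_mod_cast starts_mono β h
  have h2 : (harmonic y : ℝ) ≤ harmonic Y := harmonic_cast_mono h
  have h3 : (if f = true then (1 : ℝ) else 0) ≤ 1 := by split_ifs <;> norm_num
  have h4 : cap β Y = starts β Y + 1 + (harmonic Y : ℝ) := rfl
  simp only [credit]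
  linarith

/-- The first broadcast of a block is paid by the flag that it sets, or by the new block if the flag
is cleared at once; the flagged broadcasts are paid in expectation by the growth of the harmonic
number. -/
theorem credit_own (β : ℕ → ℕ) (C : ℝ) (i o : Bool) (y : ℕ) (f c : Bool) :
    credit β C (back i o y f) + ((if f then 1 / (y + 1 : ℝ) else 0) + if f = false ∧ c = true then 1 else 0)
      ≤ credit β C (back i false (y + 1) (if blockLen β (y + 1) ∣ y + 1 then false else f || c)) := by
  simp only [credit]
  rw [starts_succ, harmonic_cast_succ]
  have : (0 : ℝ) ≤ ((y : ℝ) + 1)⁻¹ := by positivity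
  by_cases h : blockLen β (y + 1) ∣ y + 1 <;> cases f <;> cases c <;> simp [h] <;> linarith

end NodeState

/-! ### Noise of the nodes in backoff -/

namespace Chan

open CoinTree

variable {β : ℕ → ℕ} {e : List (Option ℕ) → ℕ × Bool} {σ : Chan} {S : Finset ℕ}

open Classical in
/-- Users of the slots of parity `r` that are about to broadcast for the first time in their blocks. -/
noncomputable def pickers (r : ℕ) (σ : Chan) : Finset ℕ :=
  (users r σ).filter fun j => σ.X % 2 = r ∧ ∃ i o y, σ.st j = back i o y false

theorem pickers_subset {r : ℕ} : pickers r σ ⊆ users r σ := by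
  intro j hj
  simp only [pickers, Finset.mem_filter] at hj
  exact hj.1

/-- Expected number of broadcasts in the next slot by the users of the slots of parity `r`. -/
noncomputable def haz (β : ℕ → ℕ) (r : ℕ) (σ : Chan) : ℝ :=
  if σ.X % 2 = r then ∑ j ∈ users r σ, coinProb β (σ.st j) else 0

theorem haz_nonneg (β : ℕ → ℕ) (r : ℕ) (σ : Chan) : 0 ≤ haz β r σ := by
  unfold haz
  split_ifs
  · exact Finset.sum_nonneg fun j _ => coinProb_nonneg _ _
  · exact le_rfl

/-- Only the actual first broadcasts in the blocks are limited by the block structure, so for these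
the expected number has to be compared with the number of heads. The flagged part is bounded path by
path. -/
theorem haz_le (r : ℕ) : haz β r σ ≤ ∑ j ∈ pickers r σ, coinProb β (σ.st j) +
    ∑ j ∈ users r σ, if σ.X % 2 = r then flagProb (σ.st j) else 0 := by
  classical
  unfold haz
  by_cases h : σ.X % 2 = r
  · simp only [if_pos h]
    rw [pickers, Finset.sum_filter, ← Finset.sum_add_distrib]
    refine Finset.sum_le_sum fun j hj => ?_
    obtain ⟨-, i, y, f, hst⟩ := mem_users.1 hj
    rw [hst, h]
    cases f <;> simp [coinProb, flagProb, backProb]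
  · simp only [if_neg h]
    rw [Finset.sum_const_zero, add_zero]
    exact Finset.sum_nonneg fun j _ => coinProb_nonneg _ _

/-- Sum over the past slots of the expected numbers of broadcasts by users of the slots of parity `r`. -/
noncomputable def noise (β : ℕ → ℕ) (e : List (Option ℕ) → ℕ × Bool) (r : ℕ) :
    List (Finset ℕ) → ℝ :=
  acc fun p _ => haz β r (of β e p)

/-- Broadcasts are paid by the credits of the users. -/
theorem acc_le_credit {r : ℕ} (hr : r < 2) {p₀ p : List (Finset ℕ)} {k Y : ℕ}
    (h₀ : (tree β e).Ext [] p₀.length p₀) (hp : (tree β e).Ext p₀ k p)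
    (hc : clock r (of β e p) = clock r (of β e p₀) + k) (hY : clock r (of β e p₀) + k < Y) :
    acc (fun p S => ((S ∩ pickers r (of β e p)).card : ℝ) +
        ∑ j ∈ users r (of β e p), if (of β e p).X % 2 = r then flagProb ((of β e p).st j) else 0) p
      - acc (fun p S => ((S ∩ pickers r (of β e p)).card : ℝ) +
        ∑ j ∈ users r (of β e p), if (of β e p).X % 2 = r then flagProb ((of β e p).st j) else 0) p₀
      ≤ ∑ j ∈ users r (of β e p), credit β (cap β Y) ((of β e p).st j) := by
  classical
  induction hp with
  | refl => rw [sub_self]; exact Finset.sum_nonneg fun j _ => credit_nonneg β (cap_nonneg β Y) _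
  | @step k p S hp hS ih =>
    have hcl : clock r (of β e p) = clock r (of β e p₀) + k := by
      rcases (isClock_clock (β := β) (e := e) r).cons S p with h | h
      · rw [hc] at h; omega
      · rw [hc] at h; omega
    have h1 := ih hcl (by omega)
    have hext := h₀.trans hp
    have hI := inv_of hext
    have hQ : Quiet e r (of β e p) S := quiet_of_clock (β := β) (by
      rw [← of_cons, hc]; omega)
    have hsub := hI.users_subset hS.2 hr hQ
    simp only [acc]
    have h2 : ∑ j ∈ users r (of β e p), credit β (cap β Y) ((of β e (S :: p)).st j)
        ≤ ∑ j ∈ users r (of β e (S :: p)), credit β (cap β Y) ((of β e (S :: p)).st j) :=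
      Finset.sum_le_sum_of_subset_of_nonneg hsub fun j _ _ => credit_nonneg β (cap_nonneg β Y) _
    have h3 : ((S ∩ pickers r (of β e p)).card : ℝ) = ∑ j ∈ users r (of β e p),
        if j ∈ S ∧ (of β e p).X % 2 = r ∧ ∃ i o y, (of β e p).st j = back i o y false then 1 else 0 := by
      rw [← Finset.sum_filter, Finset.sum_const, nsmul_eq_mul, mul_one]
      congr 2
      ext j
      simp only [pickers, Finset.mem_inter, Finset.mem_filter]
      tauto
    have h4 : ∀ j ∈ users r (of β e p), credit β (cap β Y) ((of β e p).st j) +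
        ((if j ∈ S ∧ (of β e p).X % 2 = r ∧ ∃ i o y, (of β e p).st j = back i o y false then 1 else 0)
          + if (of β e p).X % 2 = r then flagProb ((of β e p).st j) else 0)
        ≤ credit β (cap β Y) ((of β e (S :: p)).st j) := by
      intro j hju
      obtain ⟨hj, i, y, f, hst⟩ := mem_users.1 hju
      change _ ≤ credit β (cap β Y) ((of β e p).st' β e S j)
      obtain ⟨-, h5⟩ := hI.users_step hS.2 hQ hj hst rfl
      have hy : y ≤ Y := by have := users_age_le hr hext hju hst; omega
      rcases h5 with ⟨h6, -, h7⟩ | ⟨h6, h7⟩ | ⟨h6, h8, -, h7⟩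
      · rw [h7, hst]
        refine le_trans (le_of_eq ?_) (credit_own β (cap β Y) i true y f (decide (j ∈ S)))
        rw [decide_eq_true h6]
        cases f <;> simp [flagProb, h6, credit]
      · rw [h7, hst]
        simp only [h6, false_and, and_false, if_false, add_zero]
        simp [credit]
      -- A waiting node has joined and its counter starts again. Its old credit, at most `cap β Y`,
      -- is covered by the extra term in the credit of joined nodes.
      · rw [h7, hst, h8]
        simp only [h6, false_and, and_false, if_false, add_zero]
        refine (credit_back_le β hy _ _ _).trans ?_
        have : 0 ≤ (harmonic 1 : ℝ) := harmonic_cast_nonneg 1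
        simp only [credit, if_true, Bool.false_eq_true, if_false]
        have : (0 : ℝ) ≤ starts β 1 := Nat.cast_nonneg _
        linarith
    have h5 := Finset.sum_le_sum h4
    rw [Finset.sum_add_distrib, Finset.sum_add_distrib, ← h3] at h5
    linarith

/-- Users that are never disturbed make few broadcasts. -/
theorem Pr_noise_le {r : ℕ} (hr : r < 2) {p₀ : List (Finset ℕ)}
    (h₀ : (tree β e).Ext [] p₀.length p₀) (k Y : ℕ) (hY : clock r (of β e p₀) + k < Y) (L : ℝ) :
    (tree β e).Pr k (fun p => clock r (of β e p) = clock r (of β e p₀) + k ∧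
      4 * cap β Y * (users r (of β e p)).card + 2 * L < noise β e r p - noise β e r p₀) p₀
      ≤ Real.exp (-L) := by
  refine le_trans ((tree β e).Pr_mono ?_)
    ((tree β e).Pr_sum_prob_le (fun p => pickers r (of β e p)) ?_ p₀ k L)
  -- Outside the exceptional event the expected first broadcasts are at most twice the actual ones
  -- plus `2 * L`. Actual first broadcasts and flagged rates together are at most `2 * cap β Y` per
  -- user, whence the factor four.
  · rintro p hp ⟨hc, hn⟩
    have h1 := acc_le_credit hr h₀ hp hc hY
    rw [acc_add, acc_add] at h1
    have h2 : noise β e r p - noise β e r p₀ ≤ _ :=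
      acc_mono_of_le (w' := fun p _ => ∑ j ∈ pickers r (of β e p), coinProb β ((of β e p).st j) +
        ∑ j ∈ users r (of β e p), if (of β e p).X % 2 = r then flagProb ((of β e p).st j) else 0)
        hp fun i _ S => haz_le r
    rw [acc_add, acc_add] at h2
    set F := acc fun p (_ : Finset ℕ) => ∑ j ∈ users r (of β e p),
      if (of β e p).X % 2 = r then flagProb ((of β e p).st j) else 0 with hF
    have hF0 : F p₀ ≤ F p := acc_le_of_ext (fun p S => Finset.sum_nonneg fun j _ => by
      split_ifs
      · unfold flagProb; split <;> positivity
      · exact le_rfl) hp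
    have h3 : ∑ j ∈ users r (of β e p), credit β (cap β Y) ((of β e p).st j)
        ≤ (users r (of β e p)).card * (2 * cap β Y) := by
      rw [← nsmul_eq_mul]
      refine Finset.sum_le_card_nsmul _ _ _ fun j hju => ?_
      obtain ⟨hj, i, y, f, hst⟩ := mem_users.1 hju
      rw [hst]
      have hy := users_age_le hr (h₀.trans hp) hju hst
      refine (credit_back_le β (show y ≤ Y by omega) _ _ _).trans ?_
      have := cap_nonneg β Y
      split_ifs <;> linarith
    change _ < acc (fun p _ => ∑ j ∈ pickers r (of β e p), coinProb β ((of β e p).st j)) p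
      - acc (fun p _ => ∑ j ∈ pickers r (of β e p), coinProb β ((of β e p).st j)) p₀
    linarith
  · intro p j hj
    exact mem_V.2 (Or.inl (mem_users.1 (pickers_subset hj)).1)

/-! ### Persistence within an epoch -/

theorem epoch_persist {p₀ p : List (Finset ℕ)} {k : ℕ} (h₀ : (tree β e).Ext [] p₀.length p₀)
    (hp : (tree β e).Ext p₀ k p) (hX : (of β e p).X = (of β e p₀).X + k) :
    (of β e p).eP = (of β e p₀).eP ∧ (of β e p).eJ = (of β e p₀).eJ ∧
    (of β e p₀).eArr ≤ (of β e p).eArr ∧ (of β e p₀).eJam ≤ (of β e p).eJam ∧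
    ((of β e p).eJam : ℝ) - (of β e p₀).eJam =
      acc (fun p _ => if (of β e p).jam e = true then 1 else 0) p
        - acc (fun p _ => if (of β e p).jam e = true then 1 else 0) p₀ ∧
    (of β e p₀).eSucc ≤ (of β e p).eSucc ∧
    syncs (of β e p) ⊆ syncs (of β e p₀) := by
  classical
  induction hp with
  | refl => simp
  | @step k p S hp hS ih =>
    have hX' : (of β e p).X = (of β e p₀).X + k := by
      rcases (isClock_X (β := β) (e := e)).cons S p with h | h <;> simp only [hX] at h <;> omega
    obtain ⟨h1, h2, h3, h4, h5, h6, h7⟩ := ih hX'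
    have hR : ¬ (of β e p).Restart e S := fun h => by
      have : (of β e (S :: p)).X = 0 := by rw [of_cons]; simp [step, h]
      omega
    obtain ⟨s1, s2, s3, s4, s5, s6⟩ := step_of_not_restart (β := β) hR
    have hI := inv_of (h₀.trans hp)
    rw [of_cons, s2, s3, s4, s5, s6]
    refine ⟨h1, h2, by omega, by omega, ?_, by omega, ?_⟩
    · simp only [acc]
      push_cast
      linarith
    · rw [hI.syncs_step hR]
      exact (Finset.filter_subset _ _).trans h7

theorem users_persist {r : ℕ} (hr : r < 2) {p₀ p : List (Finset ℕ)} {k : ℕ}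
    (h₀ : (tree β e).Ext [] p₀.length p₀) (hp : (tree β e).Ext p₀ k p)
    (hc : clock r (of β e p) = clock r (of β e p₀) + k) :
    users r (of β e p₀) ⊆ users r (of β e p) := by
  induction hp with
  | refl => exact Finset.Subset.refl _
  | @step k p S hp hS ih =>
    have hc' : clock r (of β e p) = clock r (of β e p₀) + k := by
      rcases (isClock_clock (β := β) (e := e) r).cons S p with h | h <;> simp only [hc] at h <;> omega
    refine (ih hc').trans ((inv_of (h₀.trans hp)).users_subset hS.2 hr (quiet_of_clock (β := β) ?_))
    rw [← of_cons, hc]; omega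

end Chan

/-! ### Epochs with synchronized nodes or many users -/

namespace Chan

open CoinTree

variable {β : ℕ → ℕ} {e : List (Option ℕ) → ℕ × Bool} {σ : Chan} {S : Finset ℕ}

theorem Inv.filter_senders (h : Inv σ) [DecidablePred fun j => σ.st j ≠ fresh] (hS : S ⊆ σ.V e) :
    (S.filter fun j => σ.st j ≠ fresh) = S ∩ σ.present := by
  ext j
  rw [Finset.mem_filter, Finset.mem_inter]
  refine and_congr_right fun hj => ⟨fun hf => ?_, fun hp => h.ne_fresh j hp⟩
  rcases h.cases_V (hS hj) with h1 | ⟨h1, -⟩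
  · exact h1
  · exact absurd h1 hf

theorem Inv.out_eq_some_iff (h : Inv σ) (hS : S ⊆ σ.V e) (j : ℕ) :
    σ.out e S = some j ↔ σ.jam e = false ∧ S ∩ σ.present = {j} := by
  classical
  rw [out, slotOutcome_eq_some_iff, h.filter_senders hS]

theorem Inv.isSome_out_iff (h : Inv σ) (hS : S ⊆ σ.V e) :
    (σ.out e S).isSome = true ↔ σ.jam e = false ∧ (S ∩ σ.present).card = 1 := by
  rw [Option.isSome_iff_exists]
  simp only [h.out_eq_some_iff hS, Finset.card_eq_one]
  tauto

theorem Inv.coinProb_le_half (h : Inv σ) {j : ℕ} (hj : j ∈ σ.present) :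
    coinProb β (σ.st j) ≤ 1 / 2 := by
  rcases hst : σ.st j with _ | ⟨i, o, y, f⟩ | x
  · exact absurd hst (h.ne_fresh j hj)
  · simp only [coinProb]
    split_ifs
    · exact backProb_le_half β (h.y_pos j hj _ _ _ _ hst) f
    · norm_num
  · exact syncProb_le_half (by omega)

theorem haz_le_sum_present (r : ℕ) : haz β r σ ≤ ∑ j ∈ σ.present, coinProb β (σ.st j) := by
  unfold haz
  split_ifs
  · exact Finset.sum_le_sum_of_subset_of_nonneg (fun j hj => (mem_users.1 hj).1)
      fun j _ _ => coinProb_nonneg _ _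
  · exact Finset.sum_nonneg fun j _ => coinProb_nonneg _ _

theorem mem_syncs {j : ℕ} : j ∈ syncs σ ↔ j ∈ σ.present ∧ ∃ x, σ.st j = sync x := by
  classical
  simp [syncs]

/-- In a slot of parity `r` the nodes in backoff of the other parity are silent, and the
synchronized nodes all have the same probability. -/
theorem Inv.sum_present_le (h : Inv σ) {r : ℕ} (hr : σ.X % 2 = r) :
    ∑ j ∈ σ.present, coinProb β (σ.st j) ≤ haz β r σ + (syncs σ).card * syncProb (σ.X + 1) := by
  classical
  have h1 : ∑ j ∈ syncs σ, coinProb β (σ.st j) = (syncs σ).card * syncProb (σ.X + 1) := by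
    rw [← nsmul_eq_mul]
    refine Finset.sum_eq_card_nsmul fun j hj => ?_
    obtain ⟨hj, x, hx⟩ := mem_syncs.1 hj
    rw [hx, h.sync_eq j hj x hx, coinProb]
  rw [haz, if_pos hr, ← h1, ← Finset.sum_union_inter]
  refine le_trans ?_ (le_add_of_nonneg_right (Finset.sum_nonneg fun j _ => coinProb_nonneg _ _))
  have hsub : users r σ ∪ syncs σ ⊆ σ.present := fun j hj => by
    rcases Finset.mem_union.1 hj with h' | h'
    · exact (mem_users.1 h').1
    · exact (mem_syncs.1 h').1
  refine le_of_eq (Finset.sum_subset hsub fun j hj hj' => ?_).symm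
  rcases hst : σ.st j with _ | ⟨i, o, y, f⟩ | x
  · exact absurd hst (h.ne_fresh j hj)
  · cases o with
    | false => simp [coinProb]
    | true =>
      refine absurd (Finset.mem_union_left _ (mem_users.2 ⟨hj, i, y, f, ?_⟩)) hj'
      rw [hst, decide_eq_true hr]
  · exact absurd (Finset.mem_union_right _ (mem_syncs.2 ⟨hj, x, hst⟩)) hj'

open Classical in
/-- In an unjammed slot with expected number of broadcasts `H` the clock is reset with probability at
least `H exp (-2H)`. -/
theorem prob_quiet_le {r : ℕ} {p : List (Finset ℕ)} (hp : (tree β e).Ext [] p.length p)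
    (hr : (of β e p).X % 2 = r) (hj : (of β e p).jam e = false) {H : ℝ}
    (hH : H = ∑ j ∈ (of β e p).present, coinProb β ((of β e p).st j)) :
    ∑ S ∈ ((tree β e).V p).powerset, (tree β e).wt p S *
      (if clock r (of β e (S :: p)) = 0 then 0 else 1) ≤ 1 - H * Real.exp (-(2 * H)) := by
  have hI := inv_of hp
  have hB : (of β e p).present ⊆ (tree β e).V p := fun j hj => mem_V.2 (Or.inl hj)
  have h1 := (tree β e).le_prob_single p hB fun j hj => hI.coinProb_le_half hj
  have h2 : ∑ S ∈ ((tree β e).V p).powerset, (tree β e).wt p S *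
      (if clock r (of β e (S :: p)) = 0 then 0 else 1) ≤
      ∑ S ∈ ((tree β e).V p).powerset, ((tree β e).wt p S -
        (tree β e).wt p S * (if (S ∩ (of β e p).present).card = 1 then 1 else 0)) := by
    refine Finset.sum_le_sum fun S hS => ?_
    have hw := (tree β e).wt_nonneg p S
    by_cases hc : (S ∩ (of β e p).present).card = 1
    · have hs := (hI.isSome_out_iff (Finset.mem_powerset.1 hS)).2 ⟨hj, hc⟩
      have hcl : clock r (of β e (S :: p)) = 0 := by
        by_contra hne
        obtain ⟨h3, h4⟩ := quiet_of_clock (β := β) (σ := of β e p) hne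
        rcases h4 with h4 | h4
        · exact h3 (Or.inr ⟨hs, by omega⟩)
        · exact h4 (Or.inr hs)
      rw [if_pos hcl, if_pos hc]; simp
    · rw [if_neg hc]
      split_ifs <;> linarith
  rw [Finset.sum_sub_distrib, (tree β e).sum_wt] at h2
  rw [hH]
  refine h2.trans (sub_le_sub_left ?_ _)
  exact h1

theorem one_div_le_backProb (y : ℕ) (hy : 1 ≤ y) (f : Bool) : 1 / ((y : ℝ) + 1) ≤ backProb β y f := by
  unfold backProb
  split_ifs
  · exact le_rfl
  · apply one_div_le_one_div_of_le (by positivity)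
    have h1 : blockLen β y ≤ y := by
      unfold blockLen
      exact (Nat.pow_le_pow_right (by norm_num) (Nat.sub_le _ _)).trans (Nat.pow_log_le_self 2 (by omega))
    have : ((blockLen β y - y % blockLen β y : ℕ) : ℝ) ≤ y := by
      exact_mod_cast (Nat.sub_le _ _).trans h1
    linarith

/-- `H exp (-2H)` on a range of `H`. -/
theorem le_mul_exp_neg {h H l : ℝ} (hl : H ≤ l / 4) (h1 : h ≤ H) (h2 : h / 8 ≤ Real.exp (-(l / 2)))
    (h0 : 0 ≤ h) : h / 8 ≤ H * Real.exp (-(2 * H)) := by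
  -- Below one, the exponential is at least `exp (-2) ≥ 1 / 8`. Above one, the factor `H` can be
  -- dropped and `H ≤ l / 4` bounds the exponential.
  by_cases hH : H ≤ 1
  · have h3 : Real.exp (-2) ≤ Real.exp (-(2 * H)) := Real.exp_le_exp.2 (by linarith)
    have h4 : 1 / 8 ≤ Real.exp (-2) := by
      have e1 : Real.exp (-2) = (Real.exp 1 * Real.exp 1)⁻¹ := by
        rw [← Real.exp_add, ← Real.exp_neg]; norm_num
      rw [e1, one_div]
      apply inv_anti₀ (by positivity)
      have := Real.exp_one_lt_d9
      have := Real.exp_pos 1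
      nlinarith
    calc h / 8 = h * (1 / 8) := by ring
      _ ≤ H * Real.exp (-(2 * H)) := mul_le_mul h1 (h4.trans h3) (by norm_num) (h0.trans h1)
  · have h3 : Real.exp (-(l / 2)) ≤ Real.exp (-(2 * H)) := Real.exp_le_exp.2 (by linarith)
    have h4 := Real.exp_pos (-(2 * H))
    nlinarith

theorem log_le_two_log {x a : ℕ} (hx : 4 ≤ x) (ha : x ≤ 2 * a) : Real.log x ≤ 2 * Real.log a := by
  have h1 : (x : ℝ) ≤ (a : ℝ) ^ 2 := by
    have : x ≤ a ^ 2 := by nlinarith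
    exact_mod_cast this
  have h2 := Real.log_le_log (by positivity) h1
  rwa [Real.log_pow] at h2

/-- A slot of the second half of the first `x` slots of an epoch, in which the next slot is likely to be
successful. -/
def Busy (β : ℕ → ℕ) (e : List (Option ℕ) → ℕ × Bool) (r x : ℕ) (σ : Chan) : Prop :=
  σ.X % 2 = r ∧ x ≤ 2 * σ.X ∧ σ.X < x ∧ σ.jam e = false ∧ haz β r σ ≤ Real.log x / 8 ∧
  σ.eP * 2 ^ 14 ≤ x ∧ (r = 1 → σ.eP = 0) ∧
  ((r = 0 ∧ (syncs σ).Nonempty) ∨ 1024 * Real.log x ≤ (users r σ).card)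

-- The expected number `H` of broadcasts lies between `512 * log x / x` and `log x / 4`. One
-- synchronized node alone gives the lower bound, and so do `1024 * log x` users with probability at
-- least `1 / (2 * x)` each. Above, the users contribute at most `log x / 8` by assumption, and the
-- at most `x / 2 ^ 14` synchronized nodes as much again. At the upper end `exp (-2 * H) ≥ 1 / √x`,
-- which is still enough by `hx`.
open Classical in
theorem prob_quiet_le_of_busy {r x : ℕ} (hr : r < 2) (hx : 1024 * Real.log x ≤ √x) (hx2 : 2 ^ 10 ≤ x)
    {p : List (Finset ℕ)} (hp : (tree β e).Ext [] p.length p) (hb : Busy β e r x (of β e p)) :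
    ∑ S ∈ ((tree β e).V p).powerset, (tree β e).wt p S *
      (if clock r (of β e (S :: p)) = 0 then 0 else 1) ≤ Real.exp (-(64 * Real.log x / x)) := by
  obtain ⟨b1, b2, b3, b4, b5, b6, b7, b8⟩ := hb
  set σ := of β e p with hσ
  have hI : Inv σ := inv_of hp
  have hA : AgeLe σ := ageLe_of hp
  have hx0 : (0 : ℝ) < x := by exact_mod_cast (by omega : 0 < x)
  have hlog : 0 ≤ Real.log x := Real.log_natCast_nonneg x
  have hlogx : 1024 * Real.log x ≤ x := hx.trans (by
    rw [Real.sqrt_le_left hx0.le]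
    have : (1 : ℝ) ≤ x := by exact_mod_cast (by omega : 1 ≤ x)
    nlinarith)
  have ha1 : 1 ≤ σ.X + 1 := by omega
  have hap : (0 : ℝ) < (σ.X + 1 : ℕ) := by positivity
  have hax : ((σ.X + 1 : ℕ) : ℝ) ≤ x := by exact_mod_cast (by omega : σ.X + 1 ≤ x)
  have hxa : (x : ℝ) ≤ 2 * (σ.X + 1 : ℕ) := by exact_mod_cast (by omega : x ≤ 2 * (σ.X + 1))
  have hla : Real.log x ≤ 2 * Real.log (σ.X + 1 : ℕ) := log_le_two_log (by omega) (by omega)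
  refine (prob_quiet_le hp b1 b4 rfl).trans ?_
  set H := ∑ j ∈ σ.present, coinProb β (σ.st j) with hH
  have hup : H ≤ Real.log x / 4 := by
    refine (hI.sum_present_le b1).trans ?_
    have hs : (syncs σ).card ≤ σ.eP := hI.syncs_le
    have : ((syncs σ).card : ℝ) * syncProb (σ.X + 1) ≤ Real.log x / 8 := by
      rcases (by omega : r = 1 ∨ r = 0) with h | h
      · have := b7 h
        have : (syncs σ).card = 0 := by omega
        rw [this]; simp; positivity
      · have h1 : syncProb (σ.X + 1) ≤ 1024 * Real.log x / (σ.X + 1 : ℕ) := by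
          rw [syncProb, if_pos (by omega)]
          refine (min_le_right _ _).trans ?_
          gcongr
        have h2 : ((syncs σ).card : ℝ) * 2 ^ 14 ≤ x := by
          exact_mod_cast (Nat.mul_le_mul_right _ hs).trans b6
        calc ((syncs σ).card : ℝ) * syncProb (σ.X + 1)
            ≤ (x / 2 ^ 14) * (1024 * Real.log x / (σ.X + 1 : ℕ)) := by
              refine mul_le_mul ?_ h1 (syncProb_nonneg _) (by positivity)
              rw [le_div_iff₀ (by norm_num)]; exact h2
          _ ≤ Real.log x / 8 := by
              rw [div_mul_div_comm, div_le_div_iff₀ (by positivity) (by norm_num)]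
              nlinarith [mul_le_mul_of_nonneg_right hxa hlog]
    linarith
  have hlow : 512 * Real.log x / x ≤ H := by
    rcases b8 with ⟨hr0, j, hj⟩ | hu
    · obtain ⟨hj, y, hy⟩ := mem_syncs.1 hj
      have h1 : coinProb β (σ.st j) ≤ H :=
        Finset.single_le_sum (f := fun j => coinProb β (σ.st j)) (fun j _ => coinProb_nonneg _ _) hj
      refine le_trans ?_ h1
      rw [hy, hI.sync_eq j hj y hy, coinProb, syncProb, if_pos (by omega)]
      refine le_min ?_ ?_
      · rw [div_le_iff₀ hx0]; linarith
      · rw [div_le_div_iff₀ hx0 hap]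
        have h2 : 512 * Real.log x ≤ 1024 * Real.log (σ.X + 1 : ℕ) := by linarith
        exact mul_le_mul h2 hax hap.le (by positivity)
    · refine le_trans ?_ (haz_le_sum_present r)
      rw [haz, if_pos b1]
      have h1 : ∀ j ∈ users r σ, 1 / (2 * (x : ℝ)) ≤ coinProb β (σ.st j) := by
        intro j hj
        obtain ⟨hj, i, y, f, hst⟩ := mem_users.1 hj
        rw [hst, decide_eq_true b1]
        simp only [coinProb, if_true]
        refine le_trans ?_ (one_div_le_backProb y (hI.y_pos j hj _ _ _ _ hst) f)
        apply one_div_le_one_div_of_le (by positivity)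
        have h2 : y ≤ σ.X + 1 := hA j hj _ _ _ _ hst
        have : (y : ℝ) + 1 ≤ x + 1 := by exact_mod_cast (by omega : y + 1 ≤ x + 1)
        have : (1 : ℝ) ≤ x := by exact_mod_cast (by omega : 1 ≤ x)
        linarith
      have h2 := Finset.card_nsmul_le_sum _ _ _ h1
      rw [nsmul_eq_mul] at h2
      refine le_trans ?_ h2
      calc 512 * Real.log x / x = 1024 * Real.log x * (1 / (2 * x)) := by field_simp; ring
        _ ≤ _ := by gcongr
  have h2 : 512 * Real.log x / x / 8 ≤ Real.exp (-(Real.log x / 2)) := by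
    have e1 : Real.exp (-(Real.log x / 2)) = (√x)⁻¹ := by
      rw [Real.exp_neg, ← Real.log_sqrt hx0.le, Real.exp_log (Real.sqrt_pos.2 hx0)]
    rw [e1, ← one_div, div_div, div_le_div_iff₀ (by positivity) (Real.sqrt_pos.2 hx0)]
    have h3 := Real.mul_self_sqrt hx0.le
    have h4 := Real.sqrt_nonneg (x : ℝ)
    nlinarith
  have h3 := le_mul_exp_neg hup hlow h2 (by positivity)
  have h4 := Real.add_one_le_exp (-(64 * Real.log x / x))
  have h5 : 512 * Real.log x / x / 8 = 64 * Real.log x / x := by ring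
  linarith

/-- Number of slots of a parity in a stretch of an epoch. -/
theorem le_acc_parity {r : ℕ} (hr : r < 2) {p₀ p : List (Finset ℕ)} {k : ℕ} (x : ℕ)
    (hp : (tree β e).Ext p₀ k p) (hX : (of β e p).X = k) :
    ((k : ℝ) - (x + 1) / 2) / 2 - (if k % 2 = r then 0 else 1 / 2)
      ≤ acc (fun p _ => if (of β e p).X % 2 = r ∧ x ≤ 2 * (of β e p).X then 1 else 0) p
        - acc (fun p _ => if (of β e p).X % 2 = r ∧ x ≤ 2 * (of β e p).X then 1 else 0) p₀ + 1 / 2 := by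
  have key : ((k : ℝ) - (x + 1) / 2) / 2 - (if k % 2 = r then 1 / 2 else 0)
      ≤ acc (fun p _ => if (of β e p).X % 2 = r ∧ x ≤ 2 * (of β e p).X then 1 else 0) p
        - acc (fun p _ => if (of β e p).X % 2 = r ∧ x ≤ 2 * (of β e p).X then 1 else 0) p₀ := by
    induction hp with
    | refl =>
      have : (0 : ℝ) ≤ x := Nat.cast_nonneg x
      rw [sub_self]
      split_ifs <;> push_cast <;> linarith
    | @step k p S hp hS ih =>
      have hX' : (of β e p).X = k := by
        rcases (isClock_X (β := β) (e := e)).cons S p with h | h <;> simp only [hX] at h <;> omega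
      have hm := acc_le_of_ext (w := fun p (_ : Finset ℕ) =>
        if (of β e p).X % 2 = r ∧ x ≤ 2 * (of β e p).X then (1 : ℝ) else 0)
        (fun p S => by split_ifs <;> norm_num) hp
      have h1 := ih hX'
      simp only [acc]
      rw [hX']
      by_cases hk : k % 2 = r
      · rw [if_pos hk] at h1
        rw [if_neg (show ¬ (k + 1) % 2 = r by omega)]
        by_cases hkx : x ≤ 2 * k
        · rw [if_pos ⟨hk, hkx⟩]
          push_cast
          linarith
        · rw [if_neg (fun h => hkx h.2)]
          have : (2 * (k : ℝ) + 1) ≤ x := by exact_mod_cast (by omega : 2 * k + 1 ≤ x)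
          push_cast
          linarith
      · rw [if_neg hk] at h1
        rw [if_pos (show (k + 1) % 2 = r by omega), if_neg (fun h => hk h.1)]
        push_cast
        linarith
  split_ifs at key ⊢ <;> linarith

/-- It is unlikely that an epoch with little noise goes on although there are synchronized nodes or many
nodes in backoff. -/
theorem Pr_busy_le {r : ℕ} (hr : r < 2) {p₀ : List (Finset ℕ)} (h₀ : (tree β e).Ext [] p₀.length p₀)
    (hX₀ : (of β e p₀).X = 0) {x : ℕ} (hx : 1024 * Real.log x ≤ √x) (hx2 : 2 ^ 10 ≤ x) :
    (tree β e).Pr x (fun p => clock r (of β e p) = x ∧ (of β e p).X = x ∧ (of β e p).eP * 2 ^ 14 ≤ x ∧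
      (r = 1 → (of β e p).eP = 0) ∧ ((of β e p).eJam : ℝ) * 2 ^ 10 ≤ x ∧
      (noise β e r p - noise β e r p₀) * 2 ^ 10 ≤ x * Real.log x ∧
      ((r = 0 ∧ (syncs (of β e p)).Nonempty) ∨
        1024 * Real.log x ≤ (users r (of β e (p.drop (x / 2)))).card)) p₀ ≤ Real.exp (-(8 * Real.log x)) := by
  classical
  have hI₀ := inv_of h₀
  have hc0 : clock r (of β e p₀) = 0 := by
    have := hI₀.gL_le
    unfold clock
    split_ifs <;> omega
  have hx0 : (0 : ℝ) < x := by exact_mod_cast (by omega : 0 < x)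
  have hlog : 0 ≤ Real.log x := Real.log_natCast_nonneg x
  have hmain := (tree β e).Pr_clock_le (isClock_clock (β := β) (e := e) r)
    (fun p => Busy β e r x (of β e p)) p₀ x (64 * Real.log x / x) (x / 8) (by positivity)
    (fun k p' _ hp' hb => by
      have := h₀.trans hp'
      rw [← hp'.length_eq] at this
      exact prob_quiet_le_of_busy hr hx hx2 (by simpa using this) hb)
  have e1 : 64 * Real.log x / x * (x / 8) = 8 * Real.log x := by field_simp; ring
  rw [e1] at hmain
  refine le_trans ((tree β e).Pr_mono ?_) hmain
  rintro p hp ⟨c1, c2, c3, c4, c5, c6, c7⟩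
  refine ⟨by rw [c1, hc0, zero_add], ?_⟩
  have hcX : (of β e p).X = (of β e p₀).X + x := by rw [c2, hX₀, zero_add]
  obtain ⟨-, -, -, -, hjam, -, -⟩ := epoch_persist h₀ hp hcX
  have hlogp : 0 < Real.log x := Real.log_pos (by exact_mod_cast (by omega : 1 < x))
  -- A slot of the right parity in the second half is busy, or jammed, or has noise at least `log x
  -- / 8`. There are about `x / 4` such slots, at most `x / 2 ^ 10` are jammed and at most `x / 2 ^
  -- 7` noisy, so at least `x / 8` are busy.
  have hpt : ∀ i, i < x → ∀ S : Finset ℕ,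
      (fun p (_ : Finset ℕ) => if (of β e p).X % 2 = r ∧ x ≤ 2 * (of β e p).X then (1 : ℝ) else 0)
        (p.drop (i + 1)) S ≤
      (fun p (_ : Finset ℕ) => (if Busy β e r x (of β e p) then (1 : ℝ) else 0) +
        ((if (of β e p).jam e = true then 1 else 0) + 8 / Real.log x * haz β r (of β e p)))
        (p.drop (i + 1)) S := by
    intro i hi S
    obtain ⟨d1, d2⟩ := hp.drop (i + 1) (by omega)
    have d3 := (isClock_X (β := β) (e := e)).drop p (i + 1) (by omega)
    simp only at d3 ⊢
    have hh := haz_nonneg β r (of β e (p.drop (i + 1)))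
    have hh' : 0 ≤ 8 / Real.log x * haz β r (of β e (p.drop (i + 1))) := by positivity
    by_cases hpar : (of β e (p.drop (i + 1))).X % 2 = r ∧ x ≤ 2 * (of β e (p.drop (i + 1))).X
    swap
    · rw [if_neg hpar]
      split_ifs <;> linarith
    rw [if_pos hpar]
    by_cases hj : (of β e (p.drop (i + 1))).jam e = true
    · rw [if_pos hj]
      split_ifs <;> linarith
    by_cases hz : haz β r (of β e (p.drop (i + 1))) ≤ Real.log x / 8
    · have hd0 : (tree β e).Ext [] (p.drop (i + 1)).length (p.drop (i + 1)) := by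
        have := h₀.trans d1
        rwa [← d1.length_eq] at this
      obtain ⟨g1, -, -, -, -, -, g7⟩ := epoch_persist hd0 d2 (by omega)
      have hbusy : Busy β e r x (of β e (p.drop (i + 1))) := by
        refine ⟨hpar.1, hpar.2, by omega, by simpa using hj, hz, by rw [← g1]; exact c3,
          fun h => by rw [← g1]; exact c4 h, ?_⟩
        refine c7.imp (fun h => ⟨h.1, h.2.mono g7⟩) fun h => h.trans ?_
        have hle : i + 1 ≤ x / 2 := by omega
        obtain ⟨d4, -⟩ := hp.drop (x / 2) (by omega)
        have d5 : (tree β e).Ext (p.drop (x / 2)) (x / 2 - (i + 1)) (p.drop (i + 1)) := by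
          have := (hp.drop (x / 2) (by omega)).2.drop (i + 1) hle
          exact this.1
        have d6 : (tree β e).Ext [] (p.drop (x / 2)).length (p.drop (x / 2)) := by
          have := h₀.trans d4
          rwa [← d4.length_eq] at this
        have k1 := (isClock_clock (β := β) (e := e) r).drop p (i + 1) (by omega)
        have k2 := (isClock_clock (β := β) (e := e) r).drop p (x / 2) (by omega)
        exact_mod_cast Finset.card_le_card (users_persist hr d6 d5 (by omega))
      rw [if_pos hbusy]
      split_ifs <;> linarith
    · have : 1 ≤ 8 / Real.log x * haz β r (of β e (p.drop (i + 1))) := by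
        push Not at hz
        rw [div_mul_eq_mul_div, le_div_iff₀ hlogp]
        linarith
      split_ifs <;> linarith
  have hsum := acc_mono_of_le
    (w := fun p _ => if (of β e p).X % 2 = r ∧ x ≤ 2 * (of β e p).X then 1 else 0)
    (w' := fun p _ => (if Busy β e r x (of β e p) then 1 else 0) +
      ((if (of β e p).jam e = true then 1 else 0) + 8 / Real.log x * haz β r (of β e p))) hp hpt
  rw [acc_add, acc_add, acc_add, acc_add, acc_const_mul, acc_const_mul] at hsum
  have hpar := le_acc_parity hr x hp c2
  have hjam0 : ((of β e p₀).eJam : ℝ) = 0 := by exact_mod_cast hI₀.eJam_zero hX₀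
  rw [hjam0, sub_zero] at hjam
  have hn : 8 / Real.log x * (noise β e r p - noise β e r p₀) * 2 ^ 7 ≤ x := by
    rw [div_mul_eq_mul_div, div_mul_eq_mul_div, div_le_iff₀ hlogp]
    linarith
  have hxr : (2 : ℝ) ^ 10 ≤ x := by exact_mod_cast hx2
  rw [mul_sub] at hn
  unfold noise at hn
  have h9 : (if x % 2 = r then (0 : ℝ) else 1 / 2) ≤ 1 / 2 := by split_ifs <;> norm_num
  linarith

end Chan

/-! ### Blocks and the potential of a single node -/

namespace NodeState

variable {β : ℕ → ℕ}

theorem log_octave {k y : ℕ} (h1 : 2 ^ k ≤ y) (h2 : y < 2 ^ (k + 1)) : Nat.log 2 y = k :=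
  Nat.log_eq_of_pow_le_of_lt_pow h1 h2

theorem blockLen_octave {k y : ℕ} (h1 : 2 ^ k ≤ y) (h2 : y < 2 ^ (k + 1)) :
    blockLen β y = 2 ^ (k - β k) := by
  rw [blockLen, log_octave h1 h2]

theorem card_starts_octave (hβ : ∀ k, β k ≤ k) (k : ℕ) :
    ((Finset.Ico (2 ^ k) (2 ^ (k + 1))).filter fun i => blockLen β i ∣ i).card = 2 ^ β k := by
  have h : ((Finset.Ico (2 ^ k) (2 ^ (k + 1))).filter fun i => blockLen β i ∣ i)
      = (Finset.Ico (2 ^ β k) (2 ^ (β k + 1))).image fun m => 2 ^ (k - β k) * m := by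
    have e1 : 2 ^ (k - β k) * 2 ^ β k = 2 ^ k := by rw [← pow_add, Nat.sub_add_cancel (hβ k)]
    have e2 : 2 ^ (k - β k) * 2 ^ (β k + 1) = 2 ^ (k + 1) := by rw [pow_succ, ← mul_assoc, e1, pow_succ]
    have hpos : 0 < 2 ^ (k - β k) := by positivity
    ext i
    rw [Finset.mem_filter, Finset.mem_image, Finset.mem_Ico]
    constructor
    · rintro ⟨⟨h1, h2⟩, h3⟩
      rw [blockLen_octave h1 h2] at h3
      obtain ⟨m, rfl⟩ := h3
      refine ⟨m, Finset.mem_Ico.2 ⟨?_, ?_⟩, rfl⟩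
      · rw [← e1] at h1; exact Nat.le_of_mul_le_mul_left h1 hpos
      · rw [← e2] at h2; exact Nat.lt_of_mul_lt_mul_left h2
    · rintro ⟨m, hm, rfl⟩
      obtain ⟨h1, h2⟩ := Finset.mem_Ico.1 hm
      have h3 : 2 ^ k ≤ 2 ^ (k - β k) * m := by rw [← e1]; exact Nat.mul_le_mul_left _ h1
      have h4 : 2 ^ (k - β k) * m < 2 ^ (k + 1) := by rw [← e2]; exact Nat.mul_lt_mul_of_pos_left h2 hpos
      exact ⟨⟨h3, h4⟩, by rw [blockLen_octave h3 h4]; exact dvd_mul_right _ _⟩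
  rw [h, Finset.card_image_of_injective, Nat.card_Ico, pow_succ]
  · omega
  · intro a b hab
    exact Nat.eq_of_mul_eq_mul_left (by positivity) hab

/-- Number of blocks that begin in the octaves `k0, …, k1 - 1`, after own slot `y`. -/
def remaining (β : ℕ → ℕ) (k0 k1 y : ℕ) : ℕ :=
  ((Finset.Ico (2 ^ k0) (2 ^ k1)).filter fun i => blockLen β i ∣ i ∧ y < i).card

theorem remaining_eq_sum (hβ : ∀ k, β k ≤ k) {k0 k1 y : ℕ} (h : k0 ≤ k1) (hy : y < 2 ^ k0) :
    remaining β k0 k1 y = ∑ k ∈ Finset.Ico k0 k1, 2 ^ β k := by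
  induction k1, h using Nat.le_induction with
  | base => simp [remaining]
  | succ k1 h ih =>
    rw [Finset.sum_Ico_succ_top h, ← ih, ← card_starts_octave hβ k1]
    have hle : 2 ^ k0 ≤ 2 ^ k1 := Nat.pow_le_pow_right (by norm_num) h
    unfold remaining
    rw [← Finset.card_union_of_disjoint]
    · congr 1
      ext i
      simp only [Finset.mem_filter, Finset.mem_union, Finset.mem_Ico]
      have : 2 ^ k1 < 2 ^ (k1 + 1) := Nat.pow_lt_pow_right (by norm_num) (by omega)
      constructor
      · rintro ⟨⟨h1, h2⟩, h3, h4⟩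
        by_cases h5 : i < 2 ^ k1
        · exact Or.inl ⟨⟨h1, h5⟩, h3, h4⟩
        · exact Or.inr ⟨⟨by omega, h2⟩, h3⟩
      · rintro (⟨⟨h1, h2⟩, h3, h4⟩ | ⟨⟨h1, h2⟩, h3⟩)
        · exact ⟨⟨h1, by omega⟩, h3, h4⟩
        · exact ⟨⟨by omega, h2⟩, h3, by omega⟩
    · rw [Finset.disjoint_left]
      intro i hi hi'
      have h1 := (Finset.mem_Ico.1 (Finset.mem_filter.1 hi).1).2
      have h2 := (Finset.mem_Ico.1 (Finset.mem_filter.1 hi').1).1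
      omega

theorem remaining_succ (k0 k1 y : ℕ) : remaining β k0 k1 y = remaining β k0 k1 (y + 1) +
    if blockLen β (y + 1) ∣ y + 1 ∧ 2 ^ k0 ≤ y + 1 ∧ y + 1 < 2 ^ k1 then 1 else 0 := by
  unfold remaining
  split_ifs with h
  · rw [← Finset.card_insert_of_notMem (a := y + 1)]
    · congr 1
      ext i
      simp only [Finset.mem_insert, Finset.mem_filter, Finset.mem_Ico]
      constructor
      · rintro ⟨h1, h2, h3⟩
        by_cases h4 : i = y + 1
        · exact Or.inl h4
        · exact Or.inr ⟨h1, h2, by omega⟩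
      · rintro (rfl | ⟨h1, h2, h3⟩)
        · exact ⟨⟨h.2.1, h.2.2⟩, h.1, by omega⟩
        · exact ⟨h1, h2, by omega⟩
    · simp
  · rw [add_zero]
    congr 1
    ext i
    simp only [Finset.mem_filter, Finset.mem_Ico]
    constructor
    · rintro ⟨h1, h2, h3⟩
      refine ⟨h1, h2, ?_⟩
      by_contra h4
      obtain rfl : i = y + 1 := by omega
      exact h ⟨h2, h1⟩
    · rintro ⟨h1, h2, h3⟩
      exact ⟨h1, h2, by omega⟩

theorem remaining_eq_zero {k0 k1 y : ℕ} (h : 2 ^ k1 ≤ y) : remaining β k0 k1 y = 0 := by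
  unfold remaining
  rw [Finset.card_eq_zero, Finset.filter_eq_empty_iff]
  intro i hi hi'
  have := (Finset.mem_Ico.1 hi).2
  omega

/-- Blocks begin at the powers of two. -/
theorem blockLen_dvd_two_pow (k : ℕ) : blockLen β (2 ^ k) ∣ 2 ^ k := by
  rw [blockLen, Nat.log_pow (by norm_num)]
  exact Nat.pow_dvd_pow 2 (Nat.sub_le _ _)

/-- The next own slot is the first one of a block, or belongs to the same block. -/
theorem blockLen_succ {y : ℕ} (hy : 1 ≤ y) : (blockLen β (y + 1) ∣ y + 1 ∧ blockLen β y ∣ y + 1) ∨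
    (¬ blockLen β (y + 1) ∣ y + 1 ∧ blockLen β (y + 1) = blockLen β y) := by
  have h1 : 2 ^ Nat.log 2 y ≤ y := Nat.pow_log_le_self 2 (by omega)
  have h2 : y < 2 ^ (Nat.log 2 y + 1) := Nat.lt_pow_succ_log_self (by norm_num) y
  by_cases h : y + 1 < 2 ^ (Nat.log 2 y + 1)
  · have e : blockLen β (y + 1) = blockLen β y := by
      rw [blockLen_octave (k := Nat.log 2 y) (by omega) h]; rfl
    rw [e]
    by_cases hd : blockLen β y ∣ y + 1
    · exact Or.inl ⟨hd, hd⟩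
    · exact Or.inr ⟨hd, rfl⟩
  · have e : y + 1 = 2 ^ (Nat.log 2 y + 1) := by omega
    refine Or.inl ⟨?_, ?_⟩
    · rw [e]; exact blockLen_dvd_two_pow _
    · rw [e, blockLen]
      exact Nat.pow_dvd_pow 2 (by omega)

/-- Own slots of the block that have not passed. -/
def blockRest (β : ℕ → ℕ) (y : ℕ) : ℕ := blockLen β y - y % blockLen β y

theorem blockRest_pos (y : ℕ) : 1 ≤ blockRest β y := by
  have := Nat.mod_lt y (blockLen_pos β y)
  unfold blockRest; omega

theorem blockRest_eq_one {y : ℕ} (h : blockLen β y ∣ y + 1) : blockRest β y = 1 := by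
  have h0 := blockLen_pos β y
  unfold blockRest
  have h1 := Nat.mod_lt y h0
  obtain ⟨c, hc⟩ := h
  have h2 := Nat.div_add_mod y (blockLen β y)
  by_contra hne
  have h3 : blockLen β y * (y / blockLen β y) < blockLen β y * c := by omega
  have h4 := Nat.lt_of_mul_lt_mul_left h3
  have h5 : blockLen β y * (y / blockLen β y + 1) ≤ blockLen β y * c := Nat.mul_le_mul_left _ h4
  rw [mul_add, mul_one] at h5
  omega

theorem blockRest_succ {y : ℕ} (h : ¬ blockLen β y ∣ y + 1) (he : blockLen β (y + 1) = blockLen β y) :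
    blockRest β y = blockRest β (y + 1) + 1 := by
  have h0 := blockLen_pos β y
  have h1 := Nat.mod_lt y h0
  have h2 : (y + 1) % blockLen β y = y % blockLen β y + 1 := by
    rw [Nat.add_mod]
    have h3 : y % blockLen β y + 1 ≠ blockLen β y := by
      intro h3
      apply h
      have := Nat.div_add_mod y (blockLen β y)
      exact ⟨y / blockLen β y + 1, by rw [mul_add, mul_one]; omega⟩
    have h4 : 1 < blockLen β y := by
      by_contra h5
      apply h
      rw [show blockLen β y = 1 by omega]
      exact one_dvd _
    rw [Nat.mod_eq_of_lt h4, Nat.mod_eq_of_lt (by omega)]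
  unfold blockRest
  rw [he, h2]
  have h4 : y % blockLen β y + 1 < blockLen β y := by
    rw [← h2]; exact Nat.mod_lt _ h0
  omega

/-- Weight of a blocked broadcast in own slot `y`. -/
noncomputable def rate (β : ℕ → ℕ) (j y : ℕ) : ℝ := 2 ^ j / blockLen β y

/-- Potential of a node in own slot `y` that fails to get through. -/
noncomputable def potential (β : ℕ → ℕ) (j k0 k1 y : ℕ) (f : Bool) : ℝ :=
  (1 / 2 ^ j) ^ remaining β k0 k1 y *
    if 2 ^ k0 ≤ y ∧ y < 2 ^ k1 ∧ f = false then 1 / (rate β j y * (blockRest β y + 1)) else 1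

theorem rate_pos (β : ℕ → ℕ) (j y : ℕ) : 0 < rate β j y := by
  have := blockLen_pos β y
  unfold rate; positivity

theorem potential_nonneg (β : ℕ → ℕ) (j k0 k1 y : ℕ) (f : Bool) : 0 ≤ potential β j k0 k1 y f := by
  have := rate_pos β j y
  unfold potential
  split_ifs <;> positivity

/-- When a block of length `L` begins, the factor lost from `remaining` is replaced by `L / (2 ^ j *
(L + 1)) ≤ 2 ^ (-j)`. After an attempt, or outside the window, the second factor is one. -/
theorem potential_succ_le {j k0 k1 y : ℕ} {f : Bool}
    (h : blockLen β (y + 1) ∣ y + 1 ∨ f = true ∨ ¬ (2 ^ k0 ≤ y + 1 ∧ y + 1 < 2 ^ k1)) :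
    potential β j k0 k1 (y + 1) (if blockLen β (y + 1) ∣ y + 1 then false else f)
      ≤ (1 / 2 ^ j) ^ remaining β k0 k1 y := by
  rw [potential, remaining_succ k0 k1 y]
  have hρ : (0 : ℝ) < 1 / 2 ^ j := by positivity
  by_cases h1 : 2 ^ k0 ≤ y + 1 ∧ y + 1 < 2 ^ k1
  · by_cases h2 : blockLen β (y + 1) ∣ y + 1
    · rw [if_pos h2, if_pos ⟨h1.1, h1.2, rfl⟩, if_pos ⟨h2, h1⟩, pow_succ]
      refine mul_le_mul_of_nonneg_left ?_ (by positivity)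
      apply one_div_le_one_div_of_le (by positivity)
      have h3 : (0 : ℝ) < blockLen β (y + 1) := by exact_mod_cast blockLen_pos β (y + 1)
      have h4 : blockRest β (y + 1) = blockLen β (y + 1) := by
        rw [blockRest, Nat.mod_eq_zero_of_dvd h2, Nat.sub_zero]
      rw [rate, h4, div_mul_eq_mul_div, le_div_iff₀ h3]
      have : (0 : ℝ) < 2 ^ j := by positivity
      nlinarith
    · have h3 : f = true := by tauto
      rw [if_neg h2, h3, if_neg (by simp), if_neg (fun h => h2 h.1), mul_one, add_zero]
  · rw [if_neg (fun h => h1 ⟨h.1, h.2.1⟩), if_neg (fun h => h1 h.2), mul_one, add_zero]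

/-- If no attempt is made, the rest of the block shrinks by one slot and the factor grows from `1 /
(rate * (r + 1))` to `1 / (rate * r)`. At the end of the block `r = 1`, and `1 / rate ≥ 1` because
blocks have length at least `2 ^ j`. -/
theorem potential_succ_le_of_window {j k0 k1 y : ℕ} (hy : 1 ≤ y) (h0 : 2 ^ k0 ≤ y) (h1 : y < 2 ^ k1)
    (hj : 2 ^ j ≤ blockLen β y) :
    potential β j k0 k1 (y + 1) false
      ≤ (1 / 2 ^ j) ^ remaining β k0 k1 y * (1 / (rate β j y * blockRest β y)) := by
  have hρ : (0 : ℝ) < 1 / 2 ^ j := by positivity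
  rcases blockLen_succ (β := β) hy with ⟨h2, h3⟩ | ⟨h2, h3⟩
  · have h4 := potential_succ_le (β := β) (j := j) (k0 := k0) (k1 := k1) (y := y) (f := false) (Or.inl h2)
    rw [if_pos h2] at h4
    refine h4.trans (le_mul_of_one_le_right (by positivity) ?_)
    rw [blockRest_eq_one h3, Nat.cast_one, mul_one, one_le_div (rate_pos β j y), rate,
      div_le_one (by exact_mod_cast blockLen_pos β y)]
    exact_mod_cast hj
  · have h5 : y + 1 < 2 ^ k1 := by
      by_contra h5
      have : y + 1 = 2 ^ k1 := by omega
      rw [this] at h2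
      exact h2 (blockLen_dvd_two_pow k1)
    rw [potential, remaining_succ k0 k1 y, if_pos ⟨by omega, h5, rfl⟩, if_neg (fun h => h2 h.1), add_zero]
    refine le_of_eq ?_
    have h6 := blockRest_succ (β := β) (y := y) (by rwa [← h3]) h3
    rw [h6, rate, rate, h3]
    push_cast
    rfl

/-- Nodes proceed from `fresh` to `sync`. -/
def rank : NodeState → ℕ
  | fresh => 0
  | back false _ _ _ => 1
  | back true _ _ _ => 2
  | sync _ => 3

theorem rank_le_next (s : NodeState) (b c : Bool) : rank s ≤ rank (next β s b c) := by
  classical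
  cases s with
  | fresh => exact Nat.zero_le _
  | back i o y f =>
    cases i <;> simp only [next] <;> split_ifs <;> simp [rank]
  | sync x =>
    simp only [next]
    split_ifs <;> simp [rank]

end NodeState

/-! ### The potential along a path -/

namespace Chan

open CoinTree

variable {β : ℕ → ℕ} {e : List (Option ℕ) → ℕ × Bool} {σ : Chan} {S : Finset ℕ}

/-- Bound on the probability that a broadcast of `w` does not get through. -/
noncomputable def block (β : ℕ → ℕ) (e : List (Option ℕ) → ℕ × Bool) (w : ℕ) (σ : Chan) : ℝ :=
  if σ.jam e = true then 1 else min 1 (∑ j ∈ σ.present \ {w}, coinProb β (σ.st j))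

theorem block_nonneg (w : ℕ) : 0 ≤ block β e w σ := by
  unfold block
  split_ifs
  · norm_num
  · exact le_min zero_le_one (Finset.sum_nonneg fun j _ => coinProb_nonneg _ _)

/-- Weight of the next slot for the potential of `w`. -/
noncomputable def toll (β : ℕ → ℕ) (e : List (Option ℕ) → ℕ × Bool) (j k0 k1 w : ℕ) (σ : Chan) : ℝ :=
  match σ.st w with
  | back _ true y _ => if 2 ^ k0 ≤ y ∧ y < 2 ^ k1 then rate β j y * block β e w σ else 0
  | _ => 0

theorem toll_nonneg (j k0 k1 w : ℕ) : 0 ≤ toll β e j k0 k1 w σ := by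
  unfold toll
  split
  · split_ifs
    · exact mul_nonneg (rate_pos _ _ _).le (block_nonneg w)
    · exact le_rfl
  · exact le_rfl

open Classical in
/-- Potential of `w` until it hears a success that concerns it. -/
noncomputable def lonePot (β : ℕ → ℕ) (j k0 k1 ρ w : ℕ) (σ : Chan) : ℝ :=
  if w ∈ σ.present ∧ rank (σ.st w) = ρ then
    match σ.st w with
    | back _ _ y f => potential β j k0 k1 y f
    | _ => 0
  else 0

theorem lonePot_nonneg (j k0 k1 ρ w : ℕ) : 0 ≤ lonePot β j k0 k1 ρ w σ := by
  unfold lonePot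
  split_ifs
  · split
    · exact potential_nonneg _ _ _ _ _ _
    · exact le_rfl
  · exact le_rfl

theorem lonePot_le {j k0 k1 ρ w : ℕ} {i o : Bool} {y : ℕ} {f : Bool} (h : σ.st w = back i o y f) :
    lonePot β j k0 k1 ρ w σ ≤ potential β j k0 k1 y f := by
  unfold lonePot
  rw [h]
  split_ifs
  · exact le_rfl
  · exact potential_nonneg _ _ _ _ _ _

theorem lonePot_eq_zero {j k0 k1 ρ w : ℕ} (h : rank (σ.st w) ≠ ρ) : lonePot β j k0 k1 ρ w σ = 0 := by
  unfold lonePot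
  rw [if_neg (fun h' => h h'.2)]

theorem lonePot_eq {j k0 k1 ρ w : ℕ} {i o : Bool} {y : ℕ} {f : Bool} (h : σ.st w = back i o y f)
    (hw : w ∈ σ.present) (hρ : rank (σ.st w) = ρ) :
    lonePot β j k0 k1 ρ w σ = potential β j k0 k1 y f := by
  unfold lonePot
  rw [if_pos ⟨hw, hρ⟩, h]

open Classical in
theorem Inv.sum_wt_blocked_le {p : List (Finset ℕ)} (hI : Inv (of β e p)) {w : ℕ}
    (hw : w ∈ (of β e p).present) :
    ∑ S ∈ ((tree β e).V p).powerset, (tree β e).wt p S *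
      (if w ∈ S ∧ (of β e p).out e S = none then 1 else 0)
      ≤ coinProb β ((of β e p).st w) * block β e w (of β e p) := by
  have hB : (of β e p).present ⊆ (tree β e).V p := fun j hj => mem_V.2 (Or.inl hj)
  unfold block
  split_ifs with hj
  · rw [mul_one]
    have h1 := (tree β e).sum_wt_filter_eq p (B := {w}) (T := {w})
      (Finset.singleton_subset_iff.2 (hB hw)) (Finset.Subset.refl _)
    simp only [Finset.prod_singleton, Finset.sdiff_self, Finset.prod_empty, mul_one] at h1
    refine le_trans ?_ h1.le
    refine Finset.sum_le_sum fun S _ => mul_le_mul_of_nonneg_left ?_ ((tree β e).wt_nonneg _ _)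
    by_cases hS : w ∈ S
    · have : S ∩ {w} = {w} := by
        ext i; simp only [Finset.mem_inter, Finset.mem_singleton]
        constructor
        · exact fun h => h.2
        · rintro rfl; exact ⟨hS, rfl⟩
      rw [if_pos this]
      split_ifs <;> norm_num
    · rw [if_neg (fun h => hS h.1)]
      split_ifs <;> norm_num
  · have h1 := (tree β e).sum_wt_collision_le p hB hw
    refine le_trans ?_ h1
    refine Finset.sum_le_sum fun S hS => mul_le_mul_of_nonneg_left ?_ ((tree β e).wt_nonneg _ _)
    by_cases hwS : w ∈ S ∧ (of β e p).out e S = none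
    · have : S ∩ (of β e p).present ≠ {w} := fun h' => by
        have := (hI.out_eq_some_iff (e := e) (Finset.mem_powerset.1 hS) w).2 ⟨by simpa using hj, h'⟩
        rw [hwS.2] at this
        simp at this
      rw [if_pos hwS, if_pos ⟨hwS.1, this⟩]
    · rw [if_neg hwS]
      split_ifs <;> norm_num

theorem exp_neg_mul_le {x : ℝ} : 1 + x ≤ Real.exp x := by
  have := Real.add_one_le_exp x; linarith

/-- With `r` slots left in the block and blocking probability `b`, the potential becomes one
(relative to the future blocks) with probability at most `b / (r + 1)`, and `1 / (R * r)` with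
probability at most `r / (r + 1)`. The mean is the old value `1 / (R * (r + 1))` times `1 + R * b`,
at most the exponential of the toll. A success that changes the rank of `w` makes the potential
zero. -/
theorem lonePot_step_le {j k0 k1 ρ w : ℕ} {p : List (Finset ℕ)} (hp : (tree β e).Ext [] p.length p)
    (hj : ∀ y, 2 ^ k0 ≤ y → y < 2 ^ k1 → 2 ^ j ≤ blockLen β y)
    (hw : w < (of β e p).arrived) (hρ : ρ ≤ rank ((of β e p).st w)) :
    ∑ S ∈ ((tree β e).V p).powerset, (tree β e).wt p S * lonePot β j k0 k1 ρ w (of β e (S :: p))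
      ≤ Real.exp (toll β e j k0 k1 w (of β e p)) * lonePot β j k0 k1 ρ w (of β e p) := by
  classical
  have hI := inv_of hp
  set σ := of β e p with hσ
  have hst : ∀ S, (of β e (S :: p)).st w = next β (σ.st w) (σ.out e S).isSome (decide (w ∈ S)) := by
    intro S
    change σ.st' β e S w = _
    rw [st', if_pos (Nat.lt_add_right _ hw)]
  have hsum : ∀ (F : Finset ℕ → ℝ) (c : ℝ), (∀ S, F S ≤ c) →
      ∑ S ∈ ((tree β e).V p).powerset, (tree β e).wt p S * F S ≤ c := by
    intro F c hF
    refine (Finset.sum_le_sum fun S _ =>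
      mul_le_mul_of_nonneg_left (hF S) ((tree β e).wt_nonneg _ _)).trans_eq ?_
    rw [← Finset.sum_mul, (tree β e).sum_wt, one_mul]
  have htoll := toll_nonneg (β := β) (e := e) (σ := σ) j k0 k1 w
  by_cases halive : w ∈ σ.present ∧ rank (σ.st w) = ρ
  swap
  · refine (hsum _ 0 fun S => ?_).trans (mul_nonneg (Real.exp_pos _).le (lonePot_nonneg _ _ _ _ _))
    refine le_of_eq ?_
    by_cases hwp : w ∈ (of β e (S :: p)).present
    · have hwV := (mem_present'.1 hwp).1
      have h1 : w ∈ σ.present := by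
        rcases mem_V.1 hwV with h | h
        · exact h
        · exact absurd hw (Nat.not_lt.2 h.1)
      have h2 : rank (σ.st w) ≠ ρ := fun h => halive ⟨h1, h⟩
      have h3 := rank_le_next (β := β) (σ.st w) (σ.out e S).isSome (decide (w ∈ S))
      rw [← hst] at h3
      exact lonePot_eq_zero (by omega)
    · unfold lonePot
      rw [if_neg (fun h => hwp h.1)]
  obtain ⟨hwp, hr⟩ := halive
  have h1e : ∀ c : ℝ, 0 ≤ c → c ≤ Real.exp (toll β e j k0 k1 w σ) * c := fun c hc =>
    le_mul_of_one_le_left hc (Real.one_le_exp htoll)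
  rcases hs : σ.st w with _ | ⟨i, o, y, f⟩ | x
  · exact absurd hs (hI.ne_fresh w hwp)
  · rw [lonePot_eq hs hwp hr]
    have hpn := potential_nonneg β j k0 k1 y f
    cases o with
    | false =>
      refine (hsum _ _ fun S => ?_).trans (h1e _ hpn)
      have h2 := hst S
      rw [hs] at h2
      by_cases hb : (σ.out e S).isSome = true
      · rw [hb] at h2
        cases i with
        | false =>
          rw [next_wait_true] at h2
          rw [lonePot_eq_zero]
          · exact hpn
          · rw [h2, ← hr, hs]; simp [rank]
        | true =>
          rw [next_join_other] at h2
          exact lonePot_le h2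
      · rw [Bool.not_eq_true] at hb
        rw [hb, next_other_false] at h2
        exact lonePot_le h2
    | true =>
      have hstep : ∀ S, lonePot β j k0 k1 ρ w (of β e (S :: p)) ≤ if σ.out e S = none then
          potential β j k0 k1 (y + 1) (if blockLen β (y + 1) ∣ y + 1 then false else f || decide (w ∈ S))
          else 0 := by
        intro S
        have h2 := hst S
        rw [hs] at h2
        by_cases hb : (σ.out e S).isSome = true
        · rw [if_neg (fun h => by rw [h] at hb; simp at hb)]
          rw [hb] at h2
          refine le_of_eq (lonePot_eq_zero ?_)
          rw [h2, ← hr, hs]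
          cases i with
          | false => rw [next_wait_true]; simp [rank]
          | true => rw [next_join_own_true]; simp [rank]
        · have hb' : σ.out e S = none := by simpa using hb
          rw [if_pos hb']
          rw [hb'] at h2
          have h3 := h2.trans (next_own_false i y f (decide (w ∈ S)))
          refine (lonePot_le h3).trans (le_of_eq ?_)
          congr
      have hρpos : (0 : ℝ) < (1 / 2 ^ j) ^ remaining β k0 k1 y := by positivity
      by_cases hwin : 2 ^ k0 ≤ y ∧ y < 2 ^ k1 ∧ f = false
      swap
      · have e1 : potential β j k0 k1 y f = (1 / 2 ^ j) ^ remaining β k0 k1 y := by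
          rw [potential, if_neg hwin, mul_one]
        rw [e1]
        refine (hsum _ _ fun S => (hstep S).trans ?_).trans (h1e _ hρpos.le)
        by_cases ho : σ.out e S = none
        swap
        · rw [if_neg ho]; exact hρpos.le
        rw [if_pos ho]
        refine potential_succ_le ?_
        by_cases hf : f = true
        · exact Or.inr (Or.inl (by simp [hf]))
        · by_cases hy : 2 ^ k0 ≤ y + 1 ∧ y + 1 < 2 ^ k1
          · left
            have hf' : f = false := by simpa using hf
            have h3 : ¬ 2 ^ k0 ≤ y := fun h => hwin ⟨h, by omega, hf'⟩
            rw [show y + 1 = 2 ^ k0 by omega]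
            exact blockLen_dvd_two_pow k0
          · exact Or.inr (Or.inr hy)
      · obtain ⟨w1, w2, rfl⟩ := hwin
        have hy1 : 1 ≤ y := hI.y_pos w hwp _ _ _ _ hs
        set P := ((1 : ℝ) / 2 ^ j) ^ remaining β k0 k1 y with hP
        set R := rate β j y with hR
        have hRpos : 0 < R := rate_pos β j y
        set r : ℝ := ((blockRest β y : ℕ) : ℝ) with hrr
        have hr1 : 1 ≤ r := by rw [hrr]; exact_mod_cast blockRest_pos (β := β) y
        have hq : coinProb β (σ.st w) = 1 / (r + 1) := by
          rw [hs]; simp [coinProb, backProb, hrr, blockRest]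
        have hb := block_nonneg (β := β) (e := e) (σ := σ) w
        have hT : toll β e j k0 k1 w σ = R * block β e w σ := by
          unfold toll
          rw [hs]
          simp only
          rw [if_pos ⟨w1, w2⟩]
        have hpot : potential β j k0 k1 y false = P * (1 / (R * (r + 1))) := by
          rw [potential, if_pos ⟨w1, w2, rfl⟩]
        -- Two outcomes keep the potential positive: a blocked attempt, or no attempt. Any success
        -- in an own slot of `w` changes its rank or removes it.
        have hpt : ∀ S, lonePot β j k0 k1 ρ w (of β e (S :: p)) ≤
            (if w ∈ S ∧ σ.out e S = none then 1 else 0) * P +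
            (if S ∩ {w} = ∅ then 1 else 0) * (P * (1 / (R * r))) := by
          intro S
          refine (hstep S).trans ?_
          have hpos : 0 ≤ P * (1 / (R * r)) := by positivity
          have e3 : S ∩ {w} = ∅ ↔ w ∉ S := by
            rw [← Finset.disjoint_iff_inter_eq_empty, Finset.disjoint_singleton_right]
          by_cases ho : σ.out e S = none
          · rw [if_pos ho]
            by_cases hwS : w ∈ S
            · rw [if_pos (show w ∈ S ∧ σ.out e S = none from ⟨hwS, ho⟩),
                if_neg (show ¬ S ∩ {w} = ∅ from fun h => (e3.1 h) hwS), one_mul, zero_mul, add_zero]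
              refine potential_succ_le (Or.inr (Or.inl ?_))
              simp [hwS]
            · rw [if_neg (show ¬ (w ∈ S ∧ σ.out e S = none) from fun h => hwS h.1),
                if_pos (show S ∩ {w} = ∅ from e3.2 hwS), zero_mul, zero_add, one_mul]
              have h4 := potential_succ_le_of_window (β := β) (j := j) (k0 := k0) hy1 w1 w2 (hj y w1 w2)
              have h9 : (if blockLen β (y + 1) ∣ y + 1 then false else false || decide (w ∈ S)) = false := by
                simp [hwS]
              rw [h9]
              exact h4
          · rw [if_neg ho, if_neg (fun h => ho h.2), zero_mul, zero_add]
            split_ifs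
            · rw [one_mul]; exact hpos
            · simp
        have h5 := Finset.sum_le_sum fun S (_ : S ∈ ((tree β e).V p).powerset) =>
          mul_le_mul_of_nonneg_left (hpt S) ((tree β e).wt_nonneg p S)
        refine h5.trans ?_
        have e4 : ∑ S ∈ ((tree β e).V p).powerset, (tree β e).wt p S *
            ((if w ∈ S ∧ σ.out e S = none then 1 else 0) * P +
            (if S ∩ {w} = ∅ then 1 else 0) * (P * (1 / (R * r))))
            = (∑ S ∈ ((tree β e).V p).powerset, (tree β e).wt p S *
                (if w ∈ S ∧ σ.out e S = none then 1 else 0)) * P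
              + (∑ S ∈ ((tree β e).V p).powerset, (tree β e).wt p S *
                (if S ∩ {w} = ∅ then 1 else 0)) * (P * (1 / (R * r))) := by
          rw [Finset.sum_mul, Finset.sum_mul, ← Finset.sum_add_distrib]
          exact Finset.sum_congr rfl fun S _ => by ring
        rw [e4]
        have h6 := hI.sum_wt_blocked_le hwp
        have h7 := (tree β e).sum_wt_filter_eq p (B := {w}) (T := ∅)
          (Finset.singleton_subset_iff.2 (mem_V.2 (Or.inl hwp))) (Finset.empty_subset _)
        simp only [Finset.prod_empty, one_mul, Finset.sdiff_empty, Finset.prod_singleton] at h7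
        have h8 : (tree β e).q p w = 1 / (r + 1) := hq
        rw [h8] at h7
        rw [hq] at h6
        rw [h7, hT, hpot]
        have hPn : 0 ≤ P := hρpos.le
        calc _ ≤ 1 / (r + 1) * block β e w σ * P + (1 - 1 / (r + 1)) * (P * (1 / (R * r))) := by
              gcongr
          _ = (1 + R * block β e w σ) * (P * (1 / (R * (r + 1)))) := by
              field_simp
              ring
          _ ≤ _ := mul_le_mul_of_nonneg_right (exp_neg_mul_le) (by positivity)
  · rw [hs] at hr
    refine (hsum _ 0 fun S => ?_).trans (mul_nonneg (Real.exp_pos _).le (lonePot_nonneg _ _ _ _ _))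
    have h2 := hst S
    unfold lonePot
    rw [h2, hs]
    simp only [next]
    split_ifs <;> simp

/-- A node that is rarely blocked gets through. -/
theorem Pr_lone_le {j k0 k1 w : ℕ} {p₀ : List (Finset ℕ)} (h₀ : (tree β e).Ext [] p₀.length p₀)
    (hj : ∀ y, 2 ^ k0 ≤ y → y < 2 ^ k1 → 2 ^ j ≤ blockLen β y)
    {i o : Bool} {y : ℕ} {f : Bool} (hw : w ∈ (of β e p₀).present)
    (hst : (of β e p₀).st w = back i o y f) (hy : y < 2 ^ k0) (k : ℕ) (D : ℝ) :
    (tree β e).Pr k (fun p => w ∈ (of β e p).present ∧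
      (∃ o y f, (of β e p).st w = back i o y f ∧ 2 ^ k1 ≤ y) ∧
      acc (fun p _ => toll β e j k0 k1 w (of β e p)) p
        - acc (fun p _ => toll β e j k0 k1 w (of β e p)) p₀ ≤ D) p₀
      ≤ (1 / 2 ^ j) ^ remaining β k0 k1 y * Real.exp D := by
  set A := acc (fun p _ => toll β e j k0 k1 w (of β e p)) with hA
  set ρ := rank ((of β e p₀).st w) with hρ
  have hinv : ∀ m p', (tree β e).Ext p₀ m p' → w < (of β e p').arrived ∧ ρ ≤ rank ((of β e p').st w) := by
    intro m p' hp'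
    induction hp' with
    | refl => exact ⟨(inv_of h₀).lt_arrived w hw, le_rfl⟩
    | @step m p' S hp' hS ih =>
      refine ⟨Nat.lt_add_right _ ih.1, ih.2.trans ?_⟩
      change _ ≤ rank ((of β e p').st' β e S w)
      rw [st', if_pos (Nat.lt_add_right _ ih.1)]
      exact rank_le_next _ _ _
  have h1 := (tree β e).Pr_le_of_supermartingale (p := p₀) (Q := fun p => w ∈ (of β e p).present ∧
      (∃ o y f, (of β e p).st w = back i o y f ∧ 2 ^ k1 ≤ y) ∧ A p - A p₀ ≤ D)
    -- Discounted by the tolls paid, the potential is a supermartingale. After the window it equals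
    -- one for a node that is still stuck, so the event makes the product at least `exp (-D)`.
    (fun _ p => Real.exp (-(A p - A p₀)) * lonePot β j k0 k1 ρ w (of β e p)) k ?_ (Real.exp (-D))
    (Real.exp_pos _) ?_ ?_
  · refine h1.trans ?_
    rw [sub_self, neg_zero, Real.exp_zero, one_mul, Real.exp_neg, div_inv_eq_mul]
    refine mul_le_mul_of_nonneg_right ?_ (Real.exp_pos _).le
    refine (lonePot_le hst).trans (le_of_eq ?_)
    rw [potential, if_neg (fun h => absurd h.1 (by omega)), mul_one]
  · intro m p' _ hp'
    obtain ⟨h2, h3⟩ := hinv m p' hp'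
    have hext : (tree β e).Ext [] p'.length p' := by
      have := h₀.trans hp'
      rwa [← hp'.length_eq] at this
    have h4 := lonePot_step_le (j := j) (k0 := k0) (k1 := k1) hext hj h2 h3
    have e1 : (tree β e).E (fun p => Real.exp (-(A p - A p₀)) * lonePot β j k0 k1 ρ w (of β e p)) p'
        = Real.exp (-(A p' - A p₀)) * Real.exp (-toll β e j k0 k1 w (of β e p')) *
          ∑ S ∈ ((tree β e).V p').powerset, (tree β e).wt p' S * lonePot β j k0 k1 ρ w (of β e (S :: p')) := by
      rw [E, Finset.mul_sum]
      refine Finset.sum_congr rfl fun S _ => ?_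
      have e2 : A (S :: p') = A p' + toll β e j k0 k1 w (of β e p') := rfl
      rw [e2, ← Real.exp_add]
      rw [show -(A p' + toll β e j k0 k1 w (of β e p') - A p₀)
        = -(A p' - A p₀) + -toll β e j k0 k1 w (of β e p') by ring]
      ring
    rw [e1]
    refine (mul_le_mul_of_nonneg_left h4 (by positivity)).trans (le_of_eq ?_)
    rw [mul_assoc, ← mul_assoc (Real.exp (-toll β e j k0 k1 w (of β e p'))), ← Real.exp_add,
      neg_add_cancel, Real.exp_zero, one_mul]
  · exact fun p' => mul_nonneg (Real.exp_pos _).le (lonePot_nonneg _ _ _ _ _)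
  · rintro p' hp' ⟨h2, ⟨o', y', f', h3, h4⟩, h5⟩
    have h6 : rank ((of β e p').st w) = ρ := by
      rw [h3, hρ, hst]; cases i <;> rfl
    rw [lonePot_eq h3 h2 h6, potential, remaining_eq_zero h4, if_neg (fun h => absurd h.2.1 (by omega)),
      pow_zero, mul_one, mul_one]
    exact Real.exp_le_exp.2 (by linarith)

end Chan

/-! ### Undisturbed users within an epoch -/

namespace Chan

open CoinTree

variable {β : ℕ → ℕ} {e : List (Option ℕ) → ℕ × Bool} {σ : Chan} {S : Finset ℕ}

theorem ext_nil_drop {p₀ p : List (Finset ℕ)} {k : ℕ} (h₀ : (tree β e).Ext [] p₀.length p₀)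
    (hp : (tree β e).Ext p₀ k p) : (tree β e).Ext [] p.length p := by
  have := h₀.trans hp
  rwa [← hp.length_eq] at this

/-- A node that knows the control slots has started to use them in the epoch. -/
theorem exists_join_start {k : ℕ} {p : List (Finset ℕ)} (hp : (tree β e).Ext [] k p) {j : ℕ}
    (hj : j ∈ (of β e p).present) {o : Bool} {y : ℕ} {f : Bool}
    (hst : (of β e p).st j = back true o y f) :
    ∃ i ≤ (of β e p).X, j ∈ (of β e (p.drop i)).present ∧
      (of β e (p.drop i)).st j = back true true 1 false := by
  classical
  induction hp generalizing o y f with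
  | refl => simp [of, init] at hj
  | @step k p S hp hS ih =>
    have hI := inv_of hp
    have hI' := inv_of (hp.step S hS)
    by_cases hR : (of β e p).Restart e S
    · have hX : (of β e (S :: p)).X = 0 := by rw [of_cons]; simp [step, hR]
      refine ⟨0, by omega, hj, ?_⟩
      rcases hI'.start hX j hj with h1 | h1
      · rw [hst] at h1; simp at h1
      · exact h1
    · have hX : (of β e (S :: p)).X = (of β e p).X + 1 := (step_of_not_restart hR).1
      have hjV : j ∈ (of β e p).V e := (mem_present'.1 hj).1
      by_cases h1 : (of β e (S :: p)).st j = back true true 1 false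
      · exact ⟨0, by omega, hj, h1⟩
      have e1 : (of β e (S :: p)).st j = (of β e p).st' β e S j := rfl
      rw [e1, hI.st'_eq hjV] at hst h1
      suffices h : j ∈ (of β e p).present ∧ ∃ o y f, (of β e p).st j = back true o y f by
        obtain ⟨h2, o, y, f, h3⟩ := h
        obtain ⟨i, h4, h5, h6⟩ := ih h2 h3
        exact ⟨i + 1, by omega, by simpa using h5, by simpa using h6⟩
      rcases hI.cases_V hjV with h2 | ⟨h2, -⟩
      · refine ⟨h2, ?_⟩
        rcases hst' : (of β e p).st j with _ | ⟨i', o', y', f'⟩ | x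
        · exact absurd hst' (hI.ne_fresh j h2)
        · cases i' with
          | true => exact ⟨_, _, _, rfl⟩
          | false =>
            rw [hst'] at hst h1
            by_cases hb : ((of β e p).out e S).isSome = true
            · rw [hb, next_wait_true] at h1
              exact absurd rfl h1
            · rw [Bool.not_eq_true] at hb
              rw [hb] at hst
              cases o' with
              | true => rw [next_own_false] at hst; simp at hst
              | false => rw [next_other_false] at hst; simp at hst
        · rw [hst'] at hst
          simp only [next] at hst
          split_ifs at hst
      · rw [h2] at hst h1
        by_cases hb : ((of β e p).out e S).isSome = true
        · rw [hb, next_fresh_true] at h1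
          exact absurd rfl h1
        · rw [Bool.not_eq_true] at hb
          rw [hb, next_fresh_false] at hst
          simp at hst

/-- Without success nobody leaves. -/
theorem gap_persist {p₀ p : List (Finset ℕ)} {k : ℕ} (h₀ : (tree β e).Ext [] p₀.length p₀)
    (hp : (tree β e).Ext p₀ k p) (hg : (of β e p).gL = (of β e p₀).gL + k) {j : ℕ}
    (hj : j ∈ (of β e p₀).present) :
    j ∈ (of β e p).present ∧ rank ((of β e p₀).st j) ≤ rank ((of β e p).st j) := by
  classical
  induction hp with
  | refl => exact ⟨hj, le_rfl⟩
  | @step k p S hp hS ih =>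
    have hg' : (of β e p).gL = (of β e p₀).gL + k := by
      rcases (isClock_gL (β := β) (e := e)).cons S p with h | h <;> simp only [hg] at h <;> omega
    obtain ⟨h1, h2⟩ := ih hg'
    have hC : ¬ (of β e p).Closing e S := fun h => by
      have : (of β e (S :: p)).gL = 0 := by rw [of_cons]; simp [step, h]
      omega
    have hjV : j ∈ (of β e p).V e := mem_V.2 (Or.inl h1)
    refine ⟨mem_present'.2 ⟨hjV, fun h => hC (Or.inr (by rw [h]; rfl))⟩, h2.trans ?_⟩
    change _ ≤ rank ((of β e p).st' β e S j)
    rw [(inv_of (h₀.trans hp)).st'_eq hjV]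
    exact rank_le_next _ _ _

/-- Progress of an undisturbed user. -/
theorem user_progress {r : ℕ} (hr : r < 2) {p₀ p : List (Finset ℕ)} {k : ℕ}
    (h₀ : (tree β e).Ext [] p₀.length p₀) (hp : (tree β e).Ext p₀ k p)
    (hc : clock r (of β e p) = clock r (of β e p₀) + k) {i : Bool}
    (hi : i = true ∨ (of β e p).gL = (of β e p₀).gL + k) {w : ℕ} (hw : w ∈ (of β e p₀).present)
    (hst : ∃ f, (of β e p₀).st w = back i (decide ((of β e p₀).X % 2 = r)) 1 f) :
    w ∈ (of β e p).present ∧ ∃ y f, (of β e p).st w = back i (decide ((of β e p).X % 2 = r)) y f ∧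
      k + (if (of β e p).X % 2 = r then 1 else 2) ≤ 2 * y := by
  induction hp with
  | refl =>
    obtain ⟨f, hf⟩ := hst
    refine ⟨hw, 1, f, hf, ?_⟩
    split_ifs <;> omega
  | @step k p S hp hS ih =>
    have hc' : clock r (of β e p) = clock r (of β e p₀) + k := by
      rcases (isClock_clock (β := β) (e := e) r).cons S p with h | h <;> simp only [hc] at h <;> omega
    have hi' : i = true ∨ (of β e p).gL = (of β e p₀).gL + k := by
      refine hi.imp id fun hg => ?_
      rcases (isClock_gL (β := β) (e := e)).cons S p with h | h <;> simp only [hg] at h <;> omega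
    obtain ⟨h1, y, f, h2, h3⟩ := ih hc' hi'
    have hQ : Quiet e r (of β e p) S := quiet_of_clock (β := β) (by
      rw [← of_cons, hc]; omega)
    obtain ⟨h4, h5⟩ := (inv_of (h₀.trans hp)).users_step hS.2 hQ h1 h2 rfl
    have hX : (of β e (S :: p)).X = (of β e p).X + 1 := (step_of_not_restart (β := β) hQ.1).1
    refine ⟨h4, ?_⟩
    rw [hX]
    change ∃ y f, (of β e p).st' β e S w = _ ∧ _
    rcases h5 with ⟨h6, -, h7⟩ | ⟨h6, h7⟩ | ⟨h6, h8, h9, -⟩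
    · rw [decide_eq_false (show ¬ ((of β e p).X + 1) % 2 = r by omega),
        if_neg (show ¬ ((of β e p).X + 1) % 2 = r by omega)]
      rw [if_pos h6] at h3
      exact ⟨_, _, h7, by omega⟩
    · rw [decide_eq_true (show ((of β e p).X + 1) % 2 = r by omega),
        if_pos (show ((of β e p).X + 1) % 2 = r by omega)]
      rw [if_neg h6] at h3
      exact ⟨_, _, h7, by omega⟩
    · exfalso
      rcases hi with h10 | h10
      · rw [h8] at h10; simp at h10
      · have hC : (of β e p).Closing e S := Or.inr h9
        have : (of β e (S :: p)).gL = 0 := by rw [of_cons]; simp [step, hC]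
        omega

/-- If `w` has not got through, although there is little noise and no synchronized node in the octaves
`k0, …, k1 - 1` of its slots. -/
theorem lone_of_quiet {r : ℕ} (hr : r < 2) {p₀ p : List (Finset ℕ)} {k0 k1 j : ℕ}
    (h₀ : (tree β e).Ext [] p₀.length p₀) (hp : (tree β e).Ext p₀ (2 * 2 ^ k1) p)
    (hX : (of β e p).X = (of β e p₀).X + 2 * 2 ^ k1)
    (hc : clock r (of β e p) = clock r (of β e p₀) + 2 * 2 ^ k1) {i : Bool}
    (hi : i = true ∨ (of β e p).gL = (of β e p₀).gL + 2 * 2 ^ k1) {w : ℕ}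
    (hw : w ∈ (of β e p₀).present)
    (hst : ∃ f, (of β e p₀).st w = back i (decide ((of β e p₀).X % 2 = r)) 1 f)
    (hs : ∀ i, i ≤ 2 * 2 ^ k1 → 2 ^ k0 ≤ (of β e (p.drop i)).X + 1 → syncs (of β e (p.drop i)) = ∅)
    {ρ D : ℝ} (hρ0 : 0 ≤ ρ) (hρ : ∀ y, 2 ^ k0 ≤ y → y < 2 ^ k1 → rate β j y ≤ ρ)
    (hD : ρ * (((of β e p).eJam : ℝ) - (of β e p₀).eJam + (noise β e r p - noise β e r p₀)) ≤ D) :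
    w ∈ (of β e p).present ∧ (∃ o y f, (of β e p).st w = back i o y f ∧ 2 ^ k1 ≤ y) ∧
      acc (fun p _ => toll β e j k0 k1 w (of β e p)) p
        - acc (fun p _ => toll β e j k0 k1 w (of β e p)) p₀ ≤ D := by
  classical
  obtain ⟨h1, y, f, h2, h3⟩ := user_progress hr h₀ hp hc hi hw hst
  refine ⟨h1, ⟨_, y, f, h2, by split_ifs at h3 <;> omega⟩, ?_⟩
  obtain ⟨-, -, -, -, hjam, -, -⟩ := epoch_persist h₀ hp hX
  refine le_trans ?_ hD
  have hpt : ∀ i, i < 2 * 2 ^ k1 → ∀ S : Finset ℕ,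
      (fun p (_ : Finset ℕ) => toll β e j k0 k1 w (of β e p)) (p.drop (i + 1)) S ≤
      (fun p (_ : Finset ℕ) => ρ * ((if (of β e p).jam e = true then 1 else 0) + haz β r (of β e p)))
        (p.drop (i + 1)) S := by
    intro i' hi' S
    obtain ⟨d1, d2⟩ := hp.drop (i' + 1) (by omega)
    have k1' := (isClock_clock (β := β) (e := e) r).drop p (i' + 1) (by omega)
    have k2' : i = true ∨ (of β e (p.drop (i' + 1))).gL = (of β e p₀).gL + (2 * 2 ^ k1 - (i' + 1)) := by
      refine hi.imp id fun hg => ?_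
      have := (isClock_gL (β := β) (e := e)).drop p (i' + 1) (by omega)
      omega
    obtain ⟨g1, y, f, g2, -⟩ := user_progress hr h₀ d1 (by omega) k2' hw hst
    have hI := inv_of (h₀.trans d1)
    have hA := ageLe_of (h₀.trans d1)
    have hns := hs (i' + 1) (by omega)
    simp only
    set σ := of β e (p.drop (i' + 1)) with hσ
    have hh := haz_nonneg β r σ
    have hj0 : (0 : ℝ) ≤ if σ.jam e = true then 1 else 0 := by split_ifs <;> norm_num
    have hpos : 0 ≤ ρ * ((if σ.jam e = true then 1 else 0) + haz β r σ) := by positivity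
    unfold toll
    rw [g2]
    by_cases hpar : σ.X % 2 = r
    swap
    · rw [decide_eq_false hpar]; exact hpos
    rw [decide_eq_true hpar]
    simp only
    by_cases hwin : 2 ^ k0 ≤ y ∧ y < 2 ^ k1
    swap
    · rw [if_neg hwin]; exact hpos
    rw [if_pos hwin]
    have hy : y ≤ σ.X + 1 := hA w g1 _ _ _ _ g2
    -- While `y` is in the window the age is at least `2 ^ k0 - 1`, where no synchronized node is
    -- left, so an unjammed attempt can collide only with users of the same parity.
    have hb : block β e w σ ≤ (if σ.jam e = true then 1 else 0) + haz β r σ := by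
      unfold block
      split_ifs with hj
      · linarith
      · rw [zero_add]
        refine (min_le_right _ _).trans ?_
        have h4 := hI.sum_present_le (β := β) hpar
        rw [hns (by omega), Finset.card_empty, Nat.cast_zero, zero_mul, add_zero] at h4
        exact (Finset.sum_le_sum_of_subset_of_nonneg Finset.sdiff_subset fun j _ _ =>
          coinProb_nonneg _ _).trans h4
    exact mul_le_mul (hρ y hwin.1 hwin.2) hb (block_nonneg w) hρ0
  have hsum := acc_mono_of_le
    (w := fun p (_ : Finset ℕ) => toll β e j k0 k1 w (of β e p))
    (w' := fun p _ => ρ * ((if (of β e p).jam e = true then 1 else 0) + haz β r (of β e p))) hp hpt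
  rw [acc_const_mul, acc_const_mul, acc_add, acc_add] at hsum
  rw [hjam]
  unfold noise
  linarith

end Chan

/-! ### Anatomy of a long epoch -/

namespace Chan

open CoinTree

variable {β : ℕ → ℕ} {e : List (Option ℕ) → ℕ × Bool} {σ : Chan} {S : Finset ℕ}

/-- Number of broadcasts allowed for a small group of nodes in backoff. -/
noncomputable def smallNoise (β : ℕ → ℕ) (T : ℕ) : ℝ :=
  4 * cap β (T + 1) * (1024 * Real.log T) + 12 * Real.log T

/-- Parameters for which an epoch of length `T` is unlikely, unless it began with many nodes or the
adversary spent much. -/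
structure EpochScale (β : ℕ → ℕ) (F G C ρ D : ℝ) (T j k0 k1 s : ℕ) : Prop where
  le_self : ∀ k, β k ≤ k
  large : 2 ^ 12 ≤ T
  F_pos : 0 < F
  G_pos : 0 < G
  C_ge : 2 ^ 18 ≤ C
  k1_le : 64 * 2 ^ k1 ≤ T
  k0_pos : 1 ≤ k0
  k0_le : k0 ≤ k1
  long_blocks : ∀ y, 2 ^ k0 ≤ y → y < 2 ^ k1 → 2 ^ j ≤ blockLen β y
  rate_nonneg : 0 ≤ ρ
  rate_le : ∀ y, 2 ^ k0 ≤ y → y < 2 ^ k1 → rate β j y ≤ ρ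
  s_lt : s + 1 ≤ 2 ^ k0
  s_pow : 7 * Real.log T ≤ 8 * Real.log s
  s_ge : 2 ^ 10 ≤ s
  log_le_sqrt : ∀ x : ℕ, s ≤ x → 1024 * Real.log x ≤ √x
  jam_le : (T : ℝ) * 2 ^ 10 ≤ C * G * s
  noise_le : (4 * cap β (T + 1) * (T / (C * F)) + 12 * Real.log T) * 2 ^ 10
    ≤ (T / 4 : ℕ) * Real.log (T / 4 : ℕ)
  smallNoise_le : smallNoise β T * 2 ^ 10 ≤ s * Real.log s
  toll_le : ρ * (T / (C * G) + smallNoise β T) ≤ D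
  lone_le : (1 / 2 ^ j) ^ (∑ k ∈ Finset.Ico k0 k1, 2 ^ β k) * Real.exp D ≤ Real.exp (-(7 * Real.log T))

/-- The epoch is too long for what happened in it. -/
def LongEpoch (F G C : ℝ) (T : ℕ) (σ : Chan) : Prop :=
  σ.X = T ∧ C * (σ.eP + F * (σ.eJ + σ.eArr) + G * σ.eJam) < T

/-- There was more noise than the users of the slots of parity `r` should make. -/
def Noisy (β : ℕ → ℕ) (e : List (Option ℕ) → ℕ × Bool) (p₀ : List (Finset ℕ)) (T r k : ℕ)
    (p : List (Finset ℕ)) : Prop :=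
  clock r (of β e p) = k ∧
    4 * cap β (T + 1) * (users r (of β e p)).card + 12 * Real.log T < noise β e r p - noise β e r p₀

/-- The event of `Pr_busy_le`. -/
def Unlucky (β : ℕ → ℕ) (e : List (Option ℕ) → ℕ × Bool) (p₀ : List (Finset ℕ)) (r x : ℕ)
    (p : List (Finset ℕ)) : Prop :=
  clock r (of β e p) = x ∧ (of β e p).X = x ∧ (of β e p).eP * 2 ^ 14 ≤ x ∧
      (r = 1 → (of β e p).eP = 0) ∧ ((of β e p).eJam : ℝ) * 2 ^ 10 ≤ x ∧
      (noise β e r p - noise β e r p₀) * 2 ^ 10 ≤ x * Real.log x ∧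
      ((r = 0 ∧ (syncs (of β e p)).Nonempty) ∨
        1024 * Real.log x ≤ (users r (of β e (p.drop (x / 2)))).card)

/-- The event of `Pr_lone_le`. -/
def Stuck (β : ℕ → ℕ) (e : List (Option ℕ) → ℕ × Bool) (D : ℝ) (j k0 k1 : ℕ) (i : Bool) (w : ℕ)
    (p : List (Finset ℕ)) : Prop :=
  w ∈ (of β e p).present ∧ (∃ o y f, (of β e p).st w = back i o y f ∧ 2 ^ k1 ≤ y) ∧
    acc (fun p _ => toll β e j k0 k1 w (of β e p)) p
      - acc (fun p _ => toll β e j k0 k1 w (of β e p)) (p.drop (2 * 2 ^ k1)) ≤ D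

/-- A node that has just learned the control slots. -/
noncomputable def joiner (σ : Chan) : ℕ :=
  sInf {j | j ∈ σ.present ∧ σ.st j = back true true 1 false}

theorem joiner_spec {j : ℕ} (h : j ∈ σ.present ∧ σ.st j = back true true 1 false) :
    joiner σ ∈ σ.present ∧ σ.st (joiner σ) = back true true 1 false :=
  Nat.sInf_mem (s := {j | j ∈ σ.present ∧ σ.st j = back true true 1 false}) ⟨j, h⟩

/-- The event of `Pr_lone_le` for a node that knows the control slots. -/
def StuckJoiner (β : ℕ → ℕ) (e : List (Option ℕ) → ℕ × Bool) (D : ℝ) (j k0 k1 : ℕ)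
    (p : List (Finset ℕ)) : Prop :=
  (∃ i, i ∈ (of β e (p.drop (2 * 2 ^ k1))).present ∧
    (of β e (p.drop (2 * 2 ^ k1))).st i = back true true 1 false) ∧
  Stuck β e D j k0 k1 true (joiner (of β e (p.drop (2 * 2 ^ k1)))) p

theorem exists_last {P : ℕ → Prop} {a b : ℕ} (hab : a ≤ b) (ha : P a) (hb : ¬ P b) :
    ∃ x, a ≤ x ∧ x < b ∧ P x ∧ ¬ P (x + 1) := by
  by_contra h
  push Not at h
  have : ∀ n, a + n ≤ b → P (a + n) := by
    intro n
    induction n with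
    | zero => exact fun _ => ha
    | succ n ih => exact fun hn => h (a + n) (by omega) (by omega) (ih (by omega))
  exact hb (by have := this (b - a) (by omega); rwa [Nat.add_sub_cancel' hab] at this)

theorem card_users_le {r : ℕ} (h : Inv σ) : (users r σ).card ≤ σ.eJ + σ.eArr := by
  classical
  refine (Finset.card_le_card fun j hj => ?_).trans h.backs_le
  obtain ⟨h1, i, y, f, h2⟩ := mem_users.1 hj
  exact Finset.mem_filter.2 ⟨h1, _, _, _, _, h2⟩

theorem noise_mono {r : ℕ} {p₀ p : List (Finset ℕ)} {k : ℕ} (hp : (tree β e).Ext p₀ k p) :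
    noise β e r p₀ ≤ noise β e r p :=
  acc_le_of_ext (fun _ _ => haz_nonneg _ _ _) hp

theorem eP_le_card_syncs {p : List (Finset ℕ)} {k : ℕ} (hp : (tree β e).Ext [] k p)
    (h0 : (of β e p).X = 0) : (of β e p).eP ≤ (syncs (of β e p)).card := by
  have hI := inv_of hp
  have := hI.eP_le
  rw [hI.eSucc_zero h0] at this
  exact this

/-- The event of `Pr_lone_le` for a node that waits for the first success. -/
def StuckWaiter (β : ℕ → ℕ) (e : List (Option ℕ) → ℕ × Bool) (D : ℝ) (j k0 k1 w : ℕ)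
    (p : List (Finset ℕ)) : Prop :=
  (∃ o f, w ∈ (of β e (p.drop (2 * 2 ^ k1))).present ∧
    (of β e (p.drop (2 * 2 ^ k1))).st w = back false o 1 f) ∧
  Stuck β e D j k0 k1 false w p

/-- If an epoch is too long, one of several unlikely events has happened. -/
theorem LongEpoch.cases {F G C ρ D : ℝ} {T j k0 k1 s : ℕ} (H : EpochScale β F G C ρ D T j k0 k1 s)
    {p₀ p : List (Finset ℕ)} (h₀ : (tree β e).Ext [] p₀.length p₀) (hX₀ : (of β e p₀).X = 0)
    (hV₀ : ((of β e p₀).V e).Nonempty) (hp : (tree β e).Ext p₀ T p)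
    (hL : LongEpoch F G C T (of β e p)) :
    Noisy β e p₀ T 0 T p ∨ Noisy β e p₀ T 0 (T - T / 2) (p.drop (T / 2)) ∨
    (∃ r ∈ Finset.range 2, Noisy β e p₀ T r (T / 4) (p.drop (T - T / 4))) ∨
    (∃ r ∈ Finset.range 2, Noisy β e p₀ T r (T / 4 - T / 4 / 2) (p.drop (T - (T / 4 - T / 4 / 2)))) ∨
    Unlucky β e p₀ 0 T p ∨
    (∃ x ∈ Finset.Icc s (T / 4), Unlucky β e p₀ 0 x (p.drop (T - x))) ∨
    (∃ r ∈ Finset.range 2, Unlucky β e p₀ r (T / 4) (p.drop (T - T / 4))) ∨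
    (∃ x ∈ Finset.range (T / 4 + 1), StuckJoiner β e D j k0 k1 (p.drop (T - (x + 2 * 2 ^ k1)))) ∨
    StuckWaiter β e D j k0 k1 (of β e p₀).arrived (p.drop (T - (1 + 2 * 2 ^ k1))) := by
  classical
  obtain ⟨hXp, hcost⟩ := hL
  have hT := H.large
  have hCpos : 0 < C := lt_of_lt_of_le (by norm_num) H.C_ge
  have hF := H.F_pos
  have hG := H.G_pos
  set q := T / 4 with hq
  set K := 2 * 2 ^ k1 with hK
  have hk1 := H.k1_le
  have h2k0 : 2 ≤ 2 ^ k0 := by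
    calc 2 = 2 ^ 1 := rfl
      _ ≤ 2 ^ k0 := Nat.pow_le_pow_right (by norm_num) H.k0_pos
  have h2k01 : 2 ^ k0 ≤ 2 ^ k1 := Nat.pow_le_pow_right (by norm_num) H.k0_le
  have hs1 := H.s_lt
  have hs2 := H.s_ge
  have hlogT : 0 ≤ Real.log T := Real.log_natCast_nonneg T
  -- prefixes
  have P1 : ∀ x, x ≤ T → (tree β e).Ext p₀ x (p.drop (T - x)) ∧
      (tree β e).Ext [] (p.drop (T - x)).length (p.drop (T - x)) ∧ (of β e (p.drop (T - x))).X = x := by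
    intro x hx
    obtain ⟨d1, d2⟩ := hp.drop (T - x) (by omega)
    rw [show T - (T - x) = x by omega] at d1
    refine ⟨d1, ext_nil_drop h₀ d1, ?_⟩
    have := (isClock_X (β := β) (e := e)).drop p (T - x) (by omega)
    omega
  have P2 : ∀ x x', x ≤ x' → x' ≤ T → (tree β e).Ext (p.drop (T - x)) (x' - x) (p.drop (T - x')) := by
    intro x x' hx hx'
    have := ((hp.drop (T - x) (by omega)).2.drop (T - x') (by omega)).1
    rwa [show T - x - (T - x') = x' - x by omega] at this
  have hdropT : p.drop T = p₀ := hp.drop_eq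
  obtain ⟨p1, p2, p3, p4, p5, p6, p7⟩ := epoch_persist h₀ hp (by omega)
  have P3 : ∀ x x', x ≤ x' → x' ≤ T → _ := fun x x' hx hx' =>
    epoch_persist (P1 x (by omega)).2.1 (P2 x x' hx hx') (by
      rw [(P1 x (by omega)).2.2, (P1 x' hx').2.2]; omega)
  have P4 : ∀ x, x ≤ T → (of β e (p.drop (T - x))).eP = (of β e p).eP ∧
      (of β e (p.drop (T - x))).eJam ≤ (of β e p).eJam ∧
      (users 0 (of β e (p.drop (T - x)))).card ≤ (of β e p).eJ + (of β e p).eArr := by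
    intro x hx
    obtain ⟨g1, g2, g3, g4, -⟩ := P3 x T hx le_rfl
    rw [Nat.sub_self, List.drop_zero] at g1 g2 g3 g4
    refine ⟨g1.symm, g4, (card_users_le (inv_of (P1 x hx).2.1)).trans ?_⟩
    omega
  have P5 : ∀ x r, x ≤ T → (users r (of β e (p.drop (T - x)))).card ≤ (of β e p).eJ + (of β e p).eArr := by
    intro x r hx
    obtain ⟨g1, g2, g3, g4, -⟩ := P3 x T hx le_rfl
    rw [Nat.sub_self, List.drop_zero] at g2 g3
    exact (card_users_le (inv_of (P1 x hx).2.1)).trans (by omega)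
  -- the cost
  have cN : (of β e p).eP * 2 ^ 18 ≤ T := by
    have : ((of β e p).eP : ℝ) * 2 ^ 18 ≤ T := by
      have h1 : ((of β e p).eP : ℝ) * 2 ^ 18 ≤ C * (of β e p).eP := by
        rw [mul_comm]; exact mul_le_mul_of_nonneg_right H.C_ge (Nat.cast_nonneg _)
      have h2 : (0 : ℝ) ≤ C * (F * ((of β e p).eJ + (of β e p).eArr) + G * (of β e p).eJam) := by positivity
      nlinarith
    exact_mod_cast this
  have cM : ∀ x, T ≤ 16 * x → (of β e p).eP * 2 ^ 14 ≤ x := by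
    intro x hx
    have h1 : (of β e p).eP * 2 ^ 14 * 16 = (of β e p).eP * 2 ^ 18 := by ring
    refine Nat.le_of_mul_le_mul_right (c := 16) ?_ (by norm_num)
    rw [h1, mul_comm x]
    exact cN.trans hx
  have cJ : (((of β e p).eJ + (of β e p).eArr : ℕ) : ℝ) ≤ T / (C * F) := by
    rw [le_div_iff₀ (by positivity)]
    push_cast
    have h2 : (0 : ℝ) ≤ C * ((of β e p).eP + G * (of β e p).eJam) := by positivity
    nlinarith
  have cd : ((of β e p).eJam : ℝ) ≤ T / (C * G) := by
    rw [le_div_iff₀ (by positivity)]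
    have h2 : (0 : ℝ) ≤ C * ((of β e p).eP + F * ((of β e p).eJ + (of β e p).eArr)) := by positivity
    nlinarith
  have cdx : ∀ x : ℕ, s ≤ x → ((of β e p).eJam : ℝ) * 2 ^ 10 ≤ x := by
    intro x hx
    have h1 : (s : ℝ) ≤ x := by exact_mod_cast hx
    refine le_trans ?_ h1
    have h2 := H.jam_le
    have h3 : 0 < C * G := by positivity
    calc ((of β e p).eJam : ℝ) * 2 ^ 10 ≤ T / (C * G) * 2 ^ 10 := by gcongr
      _ = T * 2 ^ 10 / (C * G) := by ring
      _ ≤ s := by rw [div_le_iff₀ h3]; linarith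
  have hcap := cap_nonneg β (T + 1)
  have hlq : (q : ℝ) * Real.log q ≤ T * Real.log T := by
    have h1 : (q : ℝ) ≤ T := by exact_mod_cast Nat.div_le_self T 4
    have h2 : Real.log q ≤ Real.log T := Real.log_le_log (by exact_mod_cast (by omega : 0 < q)) h1
    exact mul_le_mul h1 h2 (Real.log_natCast_nonneg q) (by positivity)
  have bigNoise : ∀ (n : ℕ) (x : ℝ), n ≤ (of β e p).eJ + (of β e p).eArr →
      x ≤ 4 * cap β (T + 1) * n + 12 * Real.log T → x * 2 ^ 10 ≤ q * Real.log q := by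
    intro n x hn hx
    refine le_trans ?_ H.noise_le
    have : (n : ℝ) ≤ T / (C * F) := le_trans (by exact_mod_cast hn) cJ
    gcongr
    refine hx.trans ?_
    gcongr
  have smallN : ∀ (n : ℕ) (x : ℝ), ¬ 1024 * Real.log T ≤ n →
      x ≤ 4 * cap β (T + 1) * n + 12 * Real.log T → x ≤ smallNoise β T := by
    intro n x hn hx
    push Not at hn
    refine hx.trans ?_
    unfold smallNoise
    gcongr
  -- noise in the even slots
  by_cases E1 : Noisy β e p₀ T 0 T p
  · exact Or.inl E1
  refine Or.inr ?_
  have n1 : noise β e 0 p - noise β e 0 p₀ ≤ 4 * cap β (T + 1) * (users 0 (of β e p)).card + 12 * Real.log T := by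
    by_contra h
    exact E1 ⟨by simp [clock, hXp], not_le.1 h⟩
  by_cases E2 : Noisy β e p₀ T 0 (T - T / 2) (p.drop (T / 2))
  · exact Or.inl E2
  refine Or.inr ?_
  set h := T - T / 2 with hh
  have hTh : T / 2 = T - h := by omega
  rw [hTh] at E2
  have n2 : noise β e 0 (p.drop (T - h)) - noise β e 0 p₀ ≤
      4 * cap β (T + 1) * (users 0 (of β e (p.drop (T - h)))).card + 12 * Real.log T := by
    by_contra h'
    refine E2 ⟨?_, not_le.1 h'⟩
    rw [clock, if_pos rfl, (P1 h (by omega)).2.2]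
  by_cases E3 : ∃ r ∈ Finset.range 2, Noisy β e p₀ T r q (p.drop (T - q))
  · exact Or.inl E3
  refine Or.inr ?_
  by_cases E4 : ∃ r ∈ Finset.range 2, Noisy β e p₀ T r (q - q / 2) (p.drop (T - (q - q / 2)))
  · exact Or.inl E4
  refine Or.inr ?_
  have hu1 := P5 T 0 le_rfl
  rw [Nat.sub_self, List.drop_zero] at hu1
  -- many users
  by_cases hmany : 1024 * Real.log T ≤ (users 0 (of β e (p.drop (T / 2)))).card
  · left
    have := cdx T (by omega)
    exact ⟨by simp [clock, hXp], hXp, cM T (by omega), by simp, this,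
      (bigNoise _ _ hu1 n1).trans hlq, Or.inr hmany⟩
  refine Or.inr ?_
  rw [hTh] at hmany
  -- Noise accumulates, so if there are few users halfway, the noise of every earlier prefix is
  -- bounded by that of few users.
  have small : ∀ x, x ≤ h → noise β e 0 (p.drop (T - x)) - noise β e 0 p₀ ≤ smallNoise β T := by
    intro x hx
    have := noise_mono (r := 0) (P2 x h hx (by omega))
    have := smallN _ _ hmany n2
    linarith
  have hsq : s ≤ q := by omega
  by_cases E5 : ∃ x ∈ Finset.Icc s q, Unlucky β e p₀ 0 x (p.drop (T - x))
  · exact Or.inl E5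
  refine Or.inr ?_
  have nosync : ∀ x, s ≤ x → x ≤ q → (of β e p).eP * 2 ^ 14 ≤ x → ¬ (syncs (of β e (p.drop (T - x)))).Nonempty := by
    intro x hsx hxq hP hne
    refine E5 ⟨x, Finset.mem_Icc.2 ⟨hsx, hxq⟩, ?_⟩
    obtain ⟨g1, g2, -⟩ := P4 x (by omega)
    refine ⟨by rw [clock, if_pos rfl, (P1 x (by omega)).2.2], (P1 x (by omega)).2.2, by rw [g1]; exact hP,
      by simp, ?_, ?_, Or.inl ⟨rfl, hne⟩⟩
    · refine le_trans ?_ (cdx x hsx)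
      gcongr
    · have h1 := small x (by omega)
      have h2 := H.smallNoise_le
      have h3 : (s : ℝ) ≤ x := by exact_mod_cast hsx
      have h4 : Real.log s ≤ Real.log x := Real.log_le_log (by exact_mod_cast (by omega : 0 < s)) h3
      have h5 : (s : ℝ) * Real.log s ≤ x * Real.log x :=
        mul_le_mul h3 h4 (Real.log_natCast_nonneg s) (by positivity)
      linarith
  -- Otherwise take the last age `x` at which some synchronized node is left. As they can leave only
  -- at multiples of `2 ^ 15`, the batch had at most `(x + 1) / 2 ^ 15` nodes. So at age `x` it is
  -- small enough for `nosync` to apply.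
  have nosync_s : ¬ (syncs (of β e (p.drop (T - s)))).Nonempty := by
    intro hne
    obtain ⟨x, hx1, hx2, hx3, hx4⟩ := exists_last (P := fun x => (syncs (of β e (p.drop (T - x)))).Nonempty)
      hsq hne (nosync q hsq le_rfl (cM q (by omega)))
    refine nosync x hx1 (by omega) ?_ hx3
    have h1 := (inv_of (P1 (x + 1) (by omega)).2.1).eP_le'
    rw [Finset.not_nonempty_iff_eq_empty.1 hx4, Finset.card_empty, (P4 (x + 1) (by omega)).1,
      (P1 (x + 1) (by omega)).2.2, zero_add] at h1
    have h2 : (of β e p).eP * 2 ^ 14 * 2 ≤ x + 1 := by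
      calc (of β e p).eP * 2 ^ 14 * 2 = (of β e p).eP * 2 ^ 15 := by ring
        _ ≤ (x + 1) / 2 ^ 15 * 2 ^ 15 := Nat.mul_le_mul_right _ h1
        _ ≤ x + 1 := Nat.div_mul_le_self _ _
    generalize (of β e p).eP * 2 ^ 14 = M at h2 ⊢
    omega
  have nosync' : ∀ x, s ≤ x → x ≤ T → syncs (of β e (p.drop (T - x))) = ∅ := by
    intro x hsx hxT
    obtain ⟨-, -, -, -, -, -, g7⟩ := P3 s x hsx hxT
    rw [Finset.not_nonempty_iff_eq_empty.1 nosync_s] at g7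
    exact Finset.subset_empty.1 g7
  by_cases E6 : ∃ r ∈ Finset.range 2, Unlucky β e p₀ r q (p.drop (T - q))
  · exact Or.inl E6
  refine Or.inr ?_
  have tollD : ∀ (a b : ℝ), a ≤ (of β e p).eJam → b ≤ smallNoise β T → ρ * (a + b) ≤ D := by
    intro a b ha hb
    refine le_trans (mul_le_mul_of_nonneg_left ?_ H.rate_nonneg) H.toll_le
    linarith
  -- a node that knows the control slots
  by_cases hjoin : ∃ w ∈ (of β e (p.drop (T - q))).present, ∃ o y f,
      (of β e (p.drop (T - q))).st w = back true o y f
  · left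
    obtain ⟨w, hw, o, y, f, hst⟩ := hjoin
    -- The node began to use the control slots at some age `x ≤ q` of this epoch. It is followed
    -- through its window during the next `K` slots, which end before age `h`, where the noise is
    -- known to be small.
    obtain ⟨i, hi, hw', hst'⟩ := exists_join_start (P1 q (by omega)).2.1 hw hst
    rw [(P1 q (by omega)).2.2] at hi
    rw [List.drop_drop, show T - q + i = T - (q - i) by omega] at hw' hst'
    set x := q - i with hx
    refine ⟨x, Finset.mem_range.2 (by omega), ?_⟩
    have e1 : (p.drop (T - (x + K))).drop K = p.drop (T - x) := by
      rw [List.drop_drop]; congr 1; omega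
    refine ⟨by rw [e1]; exact ⟨w, hw', hst'⟩, ?_⟩
    rw [Stuck, e1]
    obtain ⟨hj1, hj2⟩ := joiner_spec ⟨hw', hst'⟩
    have hext := P2 x (x + K) (by omega) (by omega)
    rw [Nat.add_sub_cancel_left] at hext
    have hXx := (P1 x (by omega)).2.2
    have hXx' := (P1 (x + K) (by omega)).2.2
    have hpar : (of β e (p.drop (T - x))).X % 2 = 0 := by
      have := (inv_of (P1 x (by omega)).2.1).join_own _ hj1 _ _ _ hj2
      simpa using this
    refine lone_of_quiet (r := 0) (i := true) (by norm_num) (P1 x (by omega)).2.1 hext (by omega)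
      (by simp only [clock, if_true]; omega) (Or.inl rfl) hj1
      ⟨false, by rw [hj2, hpar]; simp⟩ ?_ H.rate_nonneg H.rate_le ?_
    · intro i hi hki
      rw [List.drop_drop, show T - (x + K) + i = T - (x + K - i) by omega] at hki ⊢
      rw [(P1 (x + K - i) (by omega)).2.2] at hki
      exact nosync' _ (by omega) (by omega)
    · refine tollD _ _ ?_ ?_
      · have : ((of β e (p.drop (T - (x + K)))).eJam : ℝ) ≤ (of β e p).eJam := by
          exact_mod_cast (P4 (x + K) (by omega)).2.1
        have : (0 : ℝ) ≤ (of β e (p.drop (T - x))).eJam := Nat.cast_nonneg _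
        linarith
      · have := small (x + K) (by omega)
        have := noise_mono (r := 0) (P1 x (by omega)).1
        linarith
  -- no success at all
  right
  have hwaits : ∀ w ∈ (of β e (p.drop (T - q))).present, rank ((of β e (p.drop (T - q))).st w) ≤ 1 := by
    intro w hw
    rcases hs : (of β e (p.drop (T - q))).st w with _ | ⟨i, o, y, f⟩ | x
    · simp [rank]
    · cases i with
      | false => simp [rank]
      | true => exact absurd ⟨w, hw, o, y, f, hs⟩ hjoin
    · have : w ∈ syncs (of β e (p.drop (T - q))) := mem_syncs.2 ⟨hw, x, hs⟩
      rw [nosync' q hsq (by omega)] at this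
      simp at this
  -- If the present gap began at age `x`, any node then present was synchronized or knew the control
  -- slots; it would still be there at age `q`, and no such node is. An empty channel forces age
  -- zero, so the epoch began empty and has seen no success up to age `q`.
  have key : ∀ x, x ≤ q → (of β e (p.drop (T - q))).gL = q - x → (of β e (p.drop (T - x))).present = ∅ := by
    intro x hx hg
    rw [Finset.eq_empty_iff_forall_notMem]
    intro w hw
    have hext := P2 x q hx (by omega)
    have hI := inv_of (P1 x (by omega)).2.1
    have hg0 : (of β e (p.drop (T - x))).gL = 0 := by
      have h1 := (isClock_gL (β := β) (e := e)).of_ext hext (by omega)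
      omega
    obtain ⟨g1, g2⟩ := gap_persist (P1 x (by omega)).2.1 hext (by omega) hw
    have g3 := hwaits w g1
    rcases hs : (of β e (p.drop (T - x))).st w with _ | ⟨i, o, y, f⟩ | y
    · exact hI.ne_fresh w hw hs
    · cases i with
      | false => exact hI.gap_start hg0 w hw _ _ _ hs
      | true =>
        rw [hs] at g2
        have : 2 ≤ rank ((of β e (p.drop (T - q))).st w) := g2
        omega
    · rw [hs] at g2
      have : 3 ≤ rank ((of β e (p.drop (T - q))).st w) := g2
      omega
  have hgLe : (of β e (p.drop (T - q))).gL ≤ q := by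
    have := (inv_of (P1 q (by omega)).2.1).gL_le
    rwa [(P1 q (by omega)).2.2] at this
  have hgq : (of β e (p.drop (T - q))).gL = q := by
    by_contra hne
    set x := q - (of β e (p.drop (T - q))).gL with hx
    have h1 := key x (by omega) (by omega)
    have h2 := (inv_of (P1 x (by omega)).2.1).X_eq h1
    rw [(P1 x (by omega)).2.2] at h2
    omega
  have hp0 : (of β e p₀).present = ∅ := by
    have := key 0 (by omega) (by omega)
    rwa [Nat.sub_zero, hdropT] at this
  have heP : (of β e p).eP = 0 := by
    have h1 := eP_le_card_syncs h₀ hX₀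
    have h2 : syncs (of β e p₀) = ∅ := by
      rw [Finset.eq_empty_iff_forall_notMem]
      intro w hw
      have := (mem_syncs.1 hw).1
      rw [hp0] at this
      simp at this
    rw [h2, Finset.card_empty] at h1
    omega
  have hsync0 : ∀ x, x ≤ T → syncs (of β e (p.drop (T - x))) = ∅ := by
    intro x hx
    have h1 := (inv_of (P1 x hx).2.1).syncs_le
    rw [(P4 x hx).1, heP] at h1
    exact Finset.card_eq_zero.1 (by omega)
  have hgx : ∀ x, x ≤ q → (of β e (p.drop (T - x))).gL = x := by
    intro x hx
    have := (isClock_gL (β := β) (e := e)).of_ext (P2 x q hx (by omega)) (by omega)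
    omega
  -- the first node
  obtain ⟨S, p', hp', hext', hS⟩ := (P1 1 (by omega)).1.cases_step
  rw [hext'.eq_of_zero] at hp' hS
  have hI₀ := inv_of h₀
  have hinj : 0 < (of β e p₀).inj e := by
    obtain ⟨i, hi⟩ := hV₀
    rcases mem_V.1 hi with h1 | h1
    · rw [hp0] at h1; simp at h1
    · omega
  set w := (of β e p₀).arrived with hw
  have hwV : w ∈ (of β e p₀).V e := mem_V.2 (Or.inr ⟨le_rfl, by omega⟩)
  have hC0 : ¬ (of β e p₀).Closing e S := fun hC => by
    have h1 := hgx 1 (by omega)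
    rw [hp', of_cons] at h1
    simp [step, hC] at h1
  have hout : ((of β e p₀).out e S).isSome = false := by
    by_contra h'
    exact hC0 (Or.inr (eq_true_of_ne_false h'))
  have hw1 : w ∈ (of β e (p.drop (T - 1))).present := by
    rw [hp']
    refine mem_present'.2 ⟨hwV, fun h' => ?_⟩
    rw [h'] at hout
    simp at hout
  have hst1 : (of β e (p.drop (T - 1))).st w = back false (decide (w ∈ S)) 1 false := by
    rw [hp']
    change (of β e p₀).st' β e S w = _
    rw [hI₀.st'_eq hwV, hout, hI₀.fresh_of_le w le_rfl, next_fresh_false]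
  have hX1 := (P1 1 (by omega)).2.2
  -- The coin of the arrival slot fixes the parity class of the first node: at age one, its next
  -- slot is its own exactly if `r = 1`.
  obtain ⟨r, hr, hrS⟩ : ∃ r, r < 2 ∧ decide (w ∈ S) = decide ((of β e (p.drop (T - 1))).X % 2 = r) := by
    rw [hX1]
    by_cases hwS : w ∈ S
    · exact ⟨1, by norm_num, by simp [hwS]⟩
    · exact ⟨0, by norm_num, by simp [hwS]⟩
  have hclk : ∀ x, x ≤ q → clock r (of β e (p.drop (T - x))) = x := by
    intro x hx
    unfold clock
    split_ifs
    · exact (P1 x (by omega)).2.2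
    · exact hgx x hx
  have hrm : r ∈ Finset.range 2 := Finset.mem_range.2 hr
  have n3 : noise β e r (p.drop (T - q)) - noise β e r p₀ ≤
      4 * cap β (T + 1) * (users r (of β e (p.drop (T - q)))).card + 12 * Real.log T := by
    by_contra h'
    exact E3 ⟨r, hrm, hclk q le_rfl, not_le.1 h'⟩
  have n4 : noise β e r (p.drop (T - (q - q / 2))) - noise β e r p₀ ≤
      4 * cap β (T + 1) * (users r (of β e (p.drop (T - (q - q / 2))))).card + 12 * Real.log T := by
    by_contra h'
    exact E4 ⟨r, hrm, hclk _ (by omega), not_le.1 h'⟩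
  -- Many users of this parity would be an unlucky event at age `q`; both parities are covered,
  -- since the epoch began without synchronized nodes.
  have hfew : ¬ 1024 * Real.log T ≤ (users r (of β e (p.drop (T - (q - q / 2))))).card := by
    intro hfew
    refine E6 ⟨r, hrm, hclk q le_rfl, (P1 q (by omega)).2.2, ?_, fun _ => ?_, ?_, ?_, Or.inr ?_⟩
    · rw [(P4 q (by omega)).1, heP, zero_mul]; exact Nat.zero_le _
    · rw [(P4 q (by omega)).1, heP]
    · refine le_trans ?_ (cdx q hsq)
      have : ((of β e (p.drop (T - q))).eJam : ℝ) ≤ (of β e p).eJam := by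
        exact_mod_cast (P4 q (by omega)).2.1
      gcongr
    · exact bigNoise _ _ (P5 q r (by omega)) n3
    · rw [List.drop_drop, show T - q + q / 2 = T - (q - q / 2) by omega]
      refine le_trans ?_ hfew
      have h1 : (q : ℝ) ≤ T := by exact_mod_cast Nat.div_le_self T 4
      have h2 : Real.log q ≤ Real.log T := Real.log_le_log (by exact_mod_cast (by omega : 0 < q)) h1
      linarith
  have hext := P2 1 (1 + K) (by omega) (by omega)
  rw [Nat.add_sub_cancel_left] at hext
  have e1 : (p.drop (T - (1 + K))).drop K = p.drop (T - 1) := by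
    rw [List.drop_drop]; congr 1; omega
  refine ⟨by rw [e1]; exact ⟨_, _, hw1, hst1⟩, ?_⟩
  rw [Stuck, e1]
  have hXx' := (P1 (1 + K) (by omega)).2.2
  have hq8 : 1 + K ≤ q - q / 2 := by omega
  refine lone_of_quiet hr (P1 1 (by omega)).2.1 hext (by omega)
    (by rw [hclk _ (by omega), hclk _ (by omega)]) (Or.inr (by rw [hgx _ (by omega), hgx _ (by omega)]))
    hw1 ⟨false, by rw [hst1, hrS]⟩ ?_ H.rate_nonneg H.rate_le ?_
  · intro i hi _
    rw [List.drop_drop, show T - (1 + K) + i = T - (1 + K - i) by omega]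
    exact hsync0 _ (by omega)
  · refine tollD _ _ ?_ ?_
    · have : ((of β e (p.drop (T - (1 + K)))).eJam : ℝ) ≤ (of β e p).eJam := by
        exact_mod_cast (P4 (1 + K) (by omega)).2.1
      have : (0 : ℝ) ≤ (of β e (p.drop (T - 1))).eJam := Nat.cast_nonneg _
      linarith
    · have h1 := smallN _ _ hfew n4
      have h2 := noise_mono (r := r) (P2 (1 + K) (q - q / 2) hq8 (by omega))
      have h3 := noise_mono (r := r) (P1 1 (by omega)).1
      linarith

end Chan

namespace CoinTree

variable (τ : CoinTree)

theorem Pr_drop {Q : List (Finset ℕ) → Prop} {p : List (Finset ℕ)} {k m : ℕ} (h : m ≤ k) :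
    τ.Pr k (fun p => Q (p.drop (k - m))) p ≤ τ.Pr m Q p := by
  have := τ.Pr_le_Pr_drop (p := p) (Q := fun p => Q (p.drop (k - m))) (Q' := Q) m (k - m)
    fun p' _ hQ => hQ
  rwa [Nat.add_sub_cancel' h] at this

theorem Pr_false (k : ℕ) (p : List (Finset ℕ)) : τ.Pr k (fun _ => False) p = 0 := by
  have := τ.ev_const k 0 p
  simpa [Pr] using this

theorem Pr_exists_le {ι : Type*} {k : ℕ} {s : Finset ι} {Q : ι → List (Finset ℕ) → Prop}
    {p : List (Finset ℕ)} {δ : ℝ} (h : ∀ i ∈ s, τ.Pr k (Q i) p ≤ δ) :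
    τ.Pr k (fun p => ∃ i ∈ s, Q i p) p ≤ s.card * δ := by
  refine (τ.Pr_exists k s Q p).trans ?_
  rw [← nsmul_eq_mul]
  exact Finset.sum_le_card_nsmul _ _ _ h

theorem Pr_or_le {k : ℕ} {Q Q' : List (Finset ℕ) → Prop} {p : List (Finset ℕ)} {a b : ℝ}
    (h : τ.Pr k Q p ≤ a) (h' : τ.Pr k Q' p ≤ b) : τ.Pr k (fun p => Q p ∨ Q' p) p ≤ a + b :=
  (τ.Pr_or k Q Q' p).trans (add_le_add h h')

end CoinTree

/-! ### Tail of the epoch lengths -/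

namespace Chan

open CoinTree

variable {β : ℕ → ℕ} {e : List (Option ℕ) → ℕ × Bool}

theorem clock_eq_zero {r : ℕ} {p : List (Finset ℕ)} {k : ℕ} (hp : (tree β e).Ext [] k p)
    (h : (of β e p).X = 0) : clock r (of β e p) = 0 := by
  have := (inv_of hp).gL_le
  unfold clock
  split_ifs <;> omega

/-- Long epochs are unlikely. -/
theorem Pr_longEpoch_le {F G C ρ D : ℝ} {T j k0 k1 s : ℕ} (H : EpochScale β F G C ρ D T j k0 k1 s)
    {p₀ : List (Finset ℕ)} (h₀ : (tree β e).Ext [] p₀.length p₀) (hX₀ : (of β e p₀).X = 0)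
    (hV₀ : ((of β e p₀).V e).Nonempty) :
    (tree β e).Pr T (fun p => LongEpoch F G C T (of β e p)) p₀ ≤ 12 * Real.exp (-(6 * Real.log T)) := by
  set ε := Real.exp (-(6 * Real.log T)) with hε
  have hT := H.large
  have hs := H.s_ge
  have hk1 := H.k1_le
  have hs1 := H.s_lt
  have h2k01 : 2 ^ k0 ≤ 2 ^ k1 := Nat.pow_le_pow_right (by norm_num) H.k0_le
  have h2k0 : 1 < 2 ^ k0 := Nat.one_lt_two_pow (by have := H.k0_pos; omega)
  have hT0 : (0 : ℝ) < T := by exact_mod_cast (by omega : 0 < T)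
  have hlogT : 0 ≤ Real.log T := Real.log_natCast_nonneg T
  have hε0 : 0 < ε := Real.exp_pos _
  -- Events that may occur at any of up to `T` ages are given probability `T ^ (-7)`, so that the
  -- union bound leaves `T ^ (-6)`.
  have hTε : (T : ℝ) * Real.exp (-(7 * Real.log T)) = ε := by
    conv_lhs => rw [← Real.exp_log hT0]
    rw [← Real.exp_add, hε, Real.log_exp]
    congr 1; ring
  have h7 : Real.exp (-(7 * Real.log T)) ≤ ε := Real.exp_le_exp.2 (by linarith)
  have noisy : ∀ r < 2, ∀ x ≤ T, (tree β e).Pr x (Noisy β e p₀ T r x) p₀ ≤ ε := by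
    intro r hr x hx
    refine le_trans ((tree β e).Pr_mono ?_) (Pr_noise_le hr h₀ x (T + 1)
      (by rw [clock_eq_zero h₀ hX₀]; omega) (6 * Real.log T))
    rintro p' - ⟨h1, h2⟩
    refine ⟨by rw [h1, clock_eq_zero h₀ hX₀, zero_add], ?_⟩
    linarith
  have unlucky : ∀ r < 2, ∀ x, s ≤ x → (tree β e).Pr x (Unlucky β e p₀ r x) p₀
      ≤ Real.exp (-(7 * Real.log T)) := by
    intro r hr x hx
    refine (Pr_busy_le hr h₀ hX₀ (H.log_le_sqrt x hx) (by omega)).trans (Real.exp_le_exp.2 ?_)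
    have h1 := H.s_pow
    have h2 : Real.log s ≤ Real.log x := Real.log_le_log (by exact_mod_cast (by omega : 0 < s))
      (by exact_mod_cast hx)
    linarith
  have stuck : ∀ p', (tree β e).Ext [] p'.length p' → ∀ i o f w, w ∈ (of β e p').present →
      (of β e p').st w = back i o 1 f →
      (tree β e).Pr (2 * 2 ^ k1) (Stuck β e D j k0 k1 i w) p' ≤ Real.exp (-(7 * Real.log T)) := by
    intro p' hp' i o f w hw hst
    refine le_trans ((tree β e).Pr_mono ?_) ((Pr_lone_le hp' H.long_blocks hw hst h2k0 (2 * 2 ^ k1) D).trans ?_)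
    · rintro p'' hp'' ⟨h1, h2, h3⟩
      rw [hp''.drop_eq] at h3
      exact ⟨h1, h2, h3⟩
    · rw [remaining_eq_sum H.le_self H.k0_le h2k0]
      exact H.lone_le
  have b1 := noisy 0 (by norm_num) T le_rfl
  have b2 : (tree β e).Pr T (fun p => Noisy β e p₀ T 0 (T - T / 2) (p.drop (T / 2))) p₀ ≤ ε := by
    have h1 := (tree β e).Pr_drop (p := p₀) (Q := Noisy β e p₀ T 0 (T - T / 2)) (show T - T / 2 ≤ T by omega)
    rw [show T - (T - T / 2) = T / 2 by omega] at h1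
    exact h1.trans (noisy 0 (by norm_num) _ (by omega))
  have b3 := (tree β e).Pr_exists_le (k := T) (p := p₀) (s := Finset.range 2)
    (Q := fun r p => Noisy β e p₀ T r (T / 4) (p.drop (T - T / 4))) fun r hr =>
      ((tree β e).Pr_drop (by omega)).trans (noisy r (Finset.mem_range.1 hr) _ (by omega))
  have b4 := (tree β e).Pr_exists_le (k := T) (p := p₀) (s := Finset.range 2)
    (Q := fun r p => Noisy β e p₀ T r (T / 4 - T / 4 / 2) (p.drop (T - (T / 4 - T / 4 / 2)))) fun r hr =>
      ((tree β e).Pr_drop (by omega)).trans (noisy r (Finset.mem_range.1 hr) _ (by omega))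
  have b5 := (unlucky 0 (by norm_num) T (by omega)).trans h7
  have b6 := (tree β e).Pr_exists_le (k := T) (p := p₀) (s := Finset.Icc s (T / 4))
    (Q := fun x p => Unlucky β e p₀ 0 x (p.drop (T - x))) fun x hx =>
      ((tree β e).Pr_drop (by have := (Finset.mem_Icc.1 hx).2; omega)).trans
        (unlucky 0 (by norm_num) _ (Finset.mem_Icc.1 hx).1)
  have b7 := (tree β e).Pr_exists_le (k := T) (p := p₀) (s := Finset.range 2)
    (Q := fun r p => Unlucky β e p₀ r (T / 4) (p.drop (T - T / 4))) fun r hr =>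
      ((tree β e).Pr_drop (by omega)).trans ((unlucky r (Finset.mem_range.1 hr) _ (by omega)).trans h7)
  have b8 := (tree β e).Pr_exists_le (k := T) (p := p₀) (s := Finset.range (T / 4 + 1))
    (Q := fun x p => StuckJoiner β e D j k0 k1 (p.drop (T - (x + 2 * 2 ^ k1))))
    (δ := Real.exp (-(7 * Real.log T))) fun x hx => by
      have hx' := Finset.mem_range.1 hx
      refine ((tree β e).Pr_drop (Q := StuckJoiner β e D j k0 k1) (by omega)).trans
        ((tree β e).Pr_add_le fun p' hp' => ?_)
      by_cases hj : ∃ i, i ∈ (of β e p').present ∧ (of β e p').st i = back true true 1 false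
      · obtain ⟨i, hi⟩ := hj
        obtain ⟨h1, h2⟩ := joiner_spec hi
        refine le_trans ((tree β e).Pr_mono ?_) (stuck p' (ext_nil_drop h₀ hp') true true false _ h1 h2)
        rintro p'' hp'' ⟨-, h4⟩
        rwa [hp''.drop_eq] at h4
      · refine le_trans ((tree β e).Pr_mono (Q' := fun _ => False) ?_)
          (((tree β e).Pr_false _ _).le.trans (Real.exp_pos _).le)
        rintro p'' hp'' ⟨h3, -⟩
        rw [hp''.drop_eq] at h3
        exact hj h3
  have b9 : (tree β e).Pr T (fun p => StuckWaiter β e D j k0 k1 (of β e p₀).arrived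
      (p.drop (T - (1 + 2 * 2 ^ k1)))) p₀ ≤ ε := by
    refine ((tree β e).Pr_drop (Q := StuckWaiter β e D j k0 k1 (of β e p₀).arrived) (by omega)).trans
        (((tree β e).Pr_add_le fun p' hp' => ?_).trans h7)
    by_cases hj : ∃ o f, (of β e p₀).arrived ∈ (of β e p').present ∧
        (of β e p').st (of β e p₀).arrived = back false o 1 f
    · obtain ⟨o, f, h1, h2⟩ := hj
      refine le_trans ((tree β e).Pr_mono ?_) (stuck p' (ext_nil_drop h₀ hp') false o f _ h1 h2)
      exact fun p'' _ h => h.2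
    · refine le_trans ((tree β e).Pr_mono (Q' := fun _ => False) ?_)
          (((tree β e).Pr_false _ _).le.trans (Real.exp_pos _).le)
      rintro p'' hp'' ⟨h3, -⟩
      rw [hp''.drop_eq] at h3
      exact hj h3
  have hc1 : ((Finset.Icc s (T / 4)).card : ℝ) * Real.exp (-(7 * Real.log T)) ≤ ε := by
    rw [← hTε]
    refine mul_le_mul_of_nonneg_right ?_ (Real.exp_pos _).le
    rw [Nat.card_Icc]
    exact_mod_cast (by omega : T / 4 + 1 - s ≤ T)
  have hc2 : ((Finset.range (T / 4 + 1)).card : ℝ) * Real.exp (-(7 * Real.log T)) ≤ ε := by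
    rw [← hTε]
    refine mul_le_mul_of_nonneg_right ?_ (Real.exp_pos _).le
    rw [Finset.card_range]
    exact_mod_cast (by omega : T / 4 + 1 ≤ T)
  -- The nine cases contribute `1 + 1 + 2 + 2 + 1 + 1 + 2 + 1 + 1 = 12` times `ε`.
  have hall := (tree β e).Pr_or_le b1 ((tree β e).Pr_or_le b2 ((tree β e).Pr_or_le b3
    ((tree β e).Pr_or_le b4 ((tree β e).Pr_or_le b5 ((tree β e).Pr_or_le b6
    ((tree β e).Pr_or_le b7 ((tree β e).Pr_or_le b8 b9)))))))
  refine le_trans ((tree β e).Pr_mono fun p hp hL => LongEpoch.cases H h₀ hX₀ hV₀ hp hL) (hall.trans ?_)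
  simp only [Finset.card_range] at hc2 ⊢
  push_cast at hc1 hc2 ⊢
  linarith

end Chan

/-! ### Premature restarts -/

namespace Chan

open CoinTree

variable {β : ℕ → ℕ} {e : List (Option ℕ) → ℕ × Bool}

/-- A control slot ends the epoch while there are many synchronized nodes. -/
def EarlyRestart (β : ℕ → ℕ) (e : List (Option ℕ) → ℕ × Bool) (T : ℕ) : List (Finset ℕ) → Prop
  | [] => False
  | S :: p => (of β e p).X + 1 = T ∧ (of β e p).X % 2 = 0 ∧ ((of β e p).out e S).isSome = true ∧
      2 * T ≤ (of β e p).eP ∧ 2 * (of β e p).eSucc ≤ (of β e p).eP ∧ ((of β e p).V e).Nonempty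

/-- At least `T` broadcasters give an expected number of broadcasts of at least `T / 2` or `1024 *
log T`, depending on which term of the minimum is attained. Either exponential beats `T ^ (-6)`; the
first one through the sixth term of the series. -/
theorem exp_neg_syncProb_le {T n : ℕ} (hT : 1 ≤ T) (hodd : T % 2 = 1) (hn : T ≤ n) :
    Real.exp (1 - n * syncProb T / 2) ≤ 2 ^ 24 / (T : ℝ) ^ 6 := by
  have hT0 : (0 : ℝ) < T := by exact_mod_cast hT
  have hTn : (T : ℝ) ≤ n := by exact_mod_cast hn
  have he : Real.exp 1 ≤ 2.7182818286 := Real.exp_one_lt_d9.le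
  have hq : (T : ℝ) * syncProb T ≤ n * syncProb T :=
    mul_le_mul_of_nonneg_right hTn (syncProb_nonneg T)
  rw [le_div_iff₀ (by positivity)]
  have hs : syncProb T = min (1 / 2) (1024 * Real.log T / T) := by rw [syncProb, if_pos hodd]
  rcases min_choice (1 / 2 : ℝ) (1024 * Real.log T / T) with h | h
  · rw [hs, h] at hq
    have h1 : Real.exp (1 - n * syncProb T / 2) ≤ Real.exp 1 * Real.exp (-(T / 4)) := by
      rw [← Real.exp_add]
      refine Real.exp_le_exp.2 ?_
      rw [hs, h]; linarith
    have h2 := Real.pow_div_factorial_le_exp ((T : ℝ) / 4) (by positivity) 6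
    have h3 : (Nat.factorial 6 : ℝ) = 720 := by norm_num [Nat.factorial]
    rw [h3, div_pow, div_div, div_le_iff₀ (by norm_num)] at h2
    calc Real.exp (1 - n * syncProb T / 2) * (T : ℝ) ^ 6
        ≤ (Real.exp 1 * Real.exp (-(T / 4))) * (Real.exp (T / 4) * (4 ^ 6 * 720)) := by gcongr
      _ = Real.exp 1 * (4 ^ 6 * 720) * (Real.exp (-(T / 4)) * Real.exp (T / 4)) := by ring
      _ = Real.exp 1 * (4 ^ 6 * 720) := by rw [← Real.exp_add]; simp
      _ ≤ 2 ^ 24 := by linarith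
  · rw [hs, h, mul_div_cancel₀ _ hT0.ne'] at hq
    have hlog : 0 ≤ Real.log T := Real.log_natCast_nonneg T
    have h1 : Real.exp (1 - n * syncProb T / 2) ≤ Real.exp 1 * Real.exp (-(6 * Real.log T)) := by
      rw [← Real.exp_add]
      refine Real.exp_le_exp.2 ?_
      rw [hs, h]; linarith
    have h2 : (T : ℝ) ^ 6 = Real.exp (6 * Real.log T) := by
      rw [show (6 : ℝ) * Real.log T = ((6 : ℕ) : ℝ) * Real.log T by norm_num, Real.exp_nat_mul,
        Real.exp_log hT0]
    calc Real.exp (1 - n * syncProb T / 2) * (T : ℝ) ^ 6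
        ≤ (Real.exp 1 * Real.exp (-(6 * Real.log T))) * (T : ℝ) ^ 6 := by gcongr
      _ = Real.exp 1 * (Real.exp (-(6 * Real.log T)) * Real.exp (6 * Real.log T)) := by rw [h2]; ring
      _ = Real.exp 1 := by rw [← Real.exp_add]; simp
      _ ≤ 2 ^ 24 := by linarith

/-- At least half of the batch is left, so at least `T` synchronized nodes. A success requires that
at most one of them broadcasts, and the indicator of this is at most `exp (1 - N)`, with `N` their
number of heads. -/
theorem Pr_earlyRestart_le {p₀ : List (Finset ℕ)} (h₀ : (tree β e).Ext [] p₀.length p₀) {T : ℕ}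
    (hT : 1 ≤ T) : (tree β e).Pr T (EarlyRestart β e T) p₀ ≤ 2 ^ 24 / (T : ℝ) ^ 6 := by
  classical
  obtain ⟨k, rfl⟩ : ∃ k, T = k + 1 := ⟨T - 1, by omega⟩
  refine (tree β e).Pr_add_le fun p hp => ?_
  have hI := inv_of (ext_nil_drop h₀ hp)
  set σ := of β e p with hσ
  by_cases hc : σ.X + 1 = k + 1 ∧ σ.X % 2 = 0 ∧ 2 * (k + 1) ≤ σ.eP ∧ 2 * σ.eSucc ≤ σ.eP
  · obtain ⟨h1, h2, h3, h4⟩ := hc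
    have hn : k + 1 ≤ (syncs σ).card := by have := hI.eP_le; omega
    have hsub : syncs σ ⊆ (tree β e).V p := fun j hj => mem_V.2 (Or.inl (mem_syncs.1 hj).1)
    have hsum : ∑ j ∈ syncs σ, (tree β e).q p j = (syncs σ).card * syncProb (k + 1) := by
      rw [← nsmul_eq_mul, ← h1]
      refine Finset.sum_eq_card_nsmul fun j hj => ?_
      obtain ⟨hj, x, hx⟩ := mem_syncs.1 hj
      change coinProb β (σ.st j) = _
      rw [hx, hI.sync_eq j hj x hx, coinProb]
    have hE := (tree β e).sum_wt_exp_neg_card p hsub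
    rw [hsum] at hE
    refine le_trans ?_ (exp_neg_syncProb_le (n := (syncs σ).card) hT (by omega) hn)
    rw [sub_eq_add_neg, Real.exp_add]
    refine le_trans ?_ (mul_le_mul_of_nonneg_left hE (Real.exp_pos 1).le)
    change ∑ S ∈ _, _ ≤ _
    rw [Finset.mul_sum]
    refine Finset.sum_le_sum fun S hS => ?_
    rw [mul_left_comm]
    refine mul_le_mul_of_nonneg_left ?_ ((tree β e).wt_nonneg p S)
    beta_reduce
    split_ifs with hB
    · have hs := (hI.isSome_out_iff (Finset.mem_powerset.1 hS)).1 hB.2.2.1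
      have hcard : (S ∩ syncs σ).card ≤ 1 := by
        rw [← hs.2]
        exact Finset.card_le_card (Finset.inter_subset_inter_left fun j hj => (mem_syncs.1 hj).1)
      have hcard' : ((S ∩ syncs σ).card : ℝ) ≤ 1 := by exact_mod_cast hcard
      rw [← Real.exp_add]
      exact Real.one_le_exp (by linarith)
    · positivity
  · refine le_trans ((tree β e).Pr_mono (Q' := fun _ => False) ?_)
      (((tree β e).Pr_false _ _).le.trans (by positivity))
    intro p' hp' hB
    obtain ⟨S, p₁, rfl, h1, -⟩ := hp'.cases_step
    rw [h1.eq_of_zero] at hB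
    obtain ⟨b1, b2, -, b4, b5, -⟩ := hB
    exact hc ⟨b1, b2, b4, b5⟩

end Chan

/-! ### Gaps in the data phase -/

namespace Chan

open CoinTree

variable {β : ℕ → ℕ} {e : List (Option ℕ) → ℕ × Bool}

/-- A long gap while there are many synchronized nodes and the data slots are used at the right rate. -/
def SilentGap (F G : ℝ) (l₀ l : ℕ) (σ : Chan) : Prop :=
  σ.gL = l ∧ l₀ ≤ l ∧ σ.eP / 4 < σ.X ∧ σ.X ≤ 2 * (σ.eP / 4) ∧ l ≤ 4 * (σ.X - σ.eP / 4) ∧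
    2 * σ.eSucc ≤ σ.eP ∧ F * σ.gArr + G * σ.gJam < l / 2 ^ 28

/-- A data slot in which a success is likely. -/
def DataSlot (β : ℕ → ℕ) (e : List (Option ℕ) → ℕ × Bool) (l : ℕ) (σ : Chan) : Prop :=
  σ.X % 2 ^ 15 = 2 ^ 15 - 1 ∧ σ.jam e = false ∧ haz β 1 σ ≤ Real.log l / 16 ∧
    σ.eP / 4 ≤ σ.X ∧ σ.X + 1 ≤ 2 * (σ.eP / 4) ∧ 2 * σ.eSucc ≤ σ.eP

-- With `a` the age of the slot, between `a` and `4 * a` synchronized nodes broadcast with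
-- probability `1 / a`: `H` is at least one, and at most four plus the noise. The bound on the noise
-- turns `exp (-2 * H)` into a small negative power of `l`.
open Classical in
theorem prob_quiet_le_of_dataSlot {l : ℕ} {p : List (Finset ℕ)}
    (hp : (tree β e).Ext [] p.length p) (h : DataSlot β e l (of β e p)) :
    ∑ S ∈ ((tree β e).V p).powerset, (tree β e).wt p S *
      (if clock 1 (of β e (S :: p)) = 0 then 0 else 1)
      ≤ Real.exp (-Real.exp (-(8 + Real.log l / 8))) := by
  obtain ⟨h1, h2, h3, h4, h5, h6⟩ := h
  set σ := of β e p with hσ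
  have hI : Inv σ := inv_of hp
  have hodd : σ.X % 2 = 1 := by omega
  refine (prob_quiet_le hp hodd h2 rfl).trans ?_
  set H := ∑ j ∈ σ.present, coinProb β (σ.st j) with hH
  have hs : syncProb (σ.X + 1) = 1 / (σ.X + 1 : ℕ) := by
    rw [syncProb, if_neg (by omega), if_pos (by omega)]
  have ha : (0 : ℝ) < (σ.X + 1 : ℕ) := by positivity
  have hup : H ≤ 4 + Real.log l / 16 := by
    refine (hI.sum_present_le hodd).trans ?_
    have h7 : ((syncs σ).card : ℝ) ≤ 4 * (σ.X + 1 : ℕ) := by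
      exact_mod_cast hI.syncs_le.trans (by omega)
    have : ((syncs σ).card : ℝ) * syncProb (σ.X + 1) ≤ 4 := by
      rw [hs, mul_one_div, div_le_iff₀ ha]; exact h7
    linarith
  have hlow : 1 ≤ H := by
    have h7 : ((σ.X + 1 : ℕ) : ℝ) ≤ (syncs σ).card := by
      exact_mod_cast (by have := hI.eP_le; omega : σ.X + 1 ≤ (syncs σ).card)
    have h8 : ∑ j ∈ syncs σ, coinProb β (σ.st j) ≤ H :=
      Finset.sum_le_sum_of_subset_of_nonneg (fun j hj => (mem_syncs.1 hj).1)
        fun j _ _ => coinProb_nonneg _ _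
    refine le_trans ?_ h8
    have h9 : ∑ j ∈ syncs σ, coinProb β (σ.st j) = (syncs σ).card * syncProb (σ.X + 1) := by
      rw [← nsmul_eq_mul]
      refine Finset.sum_eq_card_nsmul fun j hj => ?_
      obtain ⟨hj, x, hx⟩ := mem_syncs.1 hj
      rw [hx, hI.sync_eq j hj x hx, coinProb]
    rw [h9, hs, mul_one_div, le_div_iff₀ ha, one_mul]
    exact h7
  have h7 : Real.exp (-(8 + Real.log l / 8)) ≤ H * Real.exp (-(2 * H)) := by
    have : Real.exp (-(8 + Real.log l / 8)) ≤ Real.exp (-(2 * H)) := Real.exp_le_exp.2 (by linarith)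
    nlinarith [Real.exp_pos (-(2 * H))]
  have h8 := Real.add_one_le_exp (-Real.exp (-(8 + Real.log l / 8)))
  linarith

theorem gJam_persist {p₀ p : List (Finset ℕ)} {k : ℕ}
    (hp : (tree β e).Ext p₀ k p) (hL : (of β e p).gL = (of β e p₀).gL + k) :
    ((of β e p).gJam : ℝ) - (of β e p₀).gJam =
      acc (fun p _ => if (of β e p).jam e = true then 1 else 0) p
        - acc (fun p _ => if (of β e p).jam e = true then 1 else 0) p₀ := by
  induction hp with
  | refl => simp
  | @step k p S hp hS ih =>
    have hL' : (of β e p).gL = (of β e p₀).gL + k := by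
      rcases (isClock_gL (β := β) (e := e)).cons S p with h | h <;> simp only [hL] at h <;> omega
    have hC : ¬ (of β e p).Closing e S := fun h => by
      have : (of β e (S :: p)).gL = 0 := by rw [of_cons]; simp [step, h]
      omega
    have := ih hL'
    rw [of_cons, (step_of_not_closing (β := β) hC).2.2]
    simp only [acc]
    push_cast
    linarith

/-- Each multiple of `m` passed by the age after `x₀` is one counted slot; the multiples up to `x₀`
are subtracted. -/
theorem div_le_acc_residue {m : ℕ} (hm : 0 < m) (x₀ : ℕ) {p₀ p : List (Finset ℕ)} {k : ℕ}
    (hp : (tree β e).Ext p₀ k p) (hX : (of β e p).X = (of β e p₀).X + k)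
    (hx₀ : (of β e p₀).X ≤ x₀) :
    (((of β e p).X / m : ℕ) : ℝ) ≤
      acc (fun p _ => if (of β e p).X % m = m - 1 ∧ x₀ ≤ (of β e p).X then 1 else 0) p
        - acc (fun p _ => if (of β e p).X % m = m - 1 ∧ x₀ ≤ (of β e p).X then 1 else 0) p₀
        + (x₀ / m : ℕ) := by
  induction hp with
  | refl =>
    rw [sub_self, zero_add]
    exact_mod_cast Nat.div_le_div_right hx₀
  | @step k p S hp hS ih =>
    have hX' : (of β e p).X = (of β e p₀).X + k := by
      rcases (isClock_X (β := β) (e := e)).cons S p with h | h <;> simp only [hX] at h <;> omega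
    have hm' := acc_le_of_ext (w := fun p (_ : Finset ℕ) =>
      if (of β e p).X % m = m - 1 ∧ x₀ ≤ (of β e p).X then (1 : ℝ) else 0)
      (fun p S => by split_ifs <;> norm_num) hp
    have h1 := ih hX'
    rw [show (of β e (S :: p)).X = (of β e p).X + 1 by omega]
    simp only [acc]
    by_cases hx : x₀ ≤ (of β e p).X
    · by_cases hr : (of β e p).X % m = m - 1
      · rw [if_pos ⟨hr, hx⟩]
        have : ((of β e p).X + 1) / m ≤ (of β e p).X / m + 1 := by
          rw [← Nat.add_div_right _ hm]
          exact Nat.div_le_div_right (by omega)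
        have : ((((of β e p).X + 1) / m : ℕ) : ℝ) ≤ ((of β e p).X / m : ℕ) + 1 := by exact_mod_cast this
        linarith
      · rw [if_neg (fun h => hr h.1)]
        have : ((of β e p).X + 1) / m = (of β e p).X / m := by
          rw [Nat.succ_div, if_neg, add_zero]
          intro hd
          obtain ⟨c, hc⟩ := hd
          apply hr
          have h2 := Nat.div_add_mod (of β e p).X m
          have h3 := Nat.mod_lt (of β e p).X hm
          set q := (of β e p).X / m
          set r := (of β e p).X % m
          have h4 : m * c = m * q + (r + 1) := by omega
          have h5 : c = q + 1 := by
            have : m * q < m * c := by omega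
            have := Nat.lt_of_mul_lt_mul_left this
            have : m * c ≤ m * (q + 1) := by rw [mul_add]; omega
            have := Nat.le_of_mul_le_mul_left this hm
            omega
          rw [h5, mul_add] at h4
          omega
        rw [this]
        linarith
    · rw [if_neg (fun h => hx h.2)]
      have : (((of β e p).X + 1) / m : ℕ) ≤ x₀ / m := Nat.div_le_div_right (by omega)
      have : ((((of β e p).X + 1) / m : ℕ) : ℝ) ≤ (x₀ / m : ℕ) := by exact_mod_cast this
      linarith

/-- Silent gaps are unlikely. -/
theorem Pr_silentGap_le {F G : ℝ} {l₀ l : ℕ} (hF : 0 < F) (hG : 1 ≤ G)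
    (hcap : cap β (l + 1) ≤ F * (8 * Real.log l)) (hl₀ : 2 ^ 28 ≤ l₀)
    (hlog : 6 * Real.log l ≤ Real.exp (-(8 + Real.log l / 8)) * (l / 2 ^ 19))
    {p₀ : List (Finset ℕ)} (h₀ : (tree β e).Ext [] p₀.length p₀) (hL₀ : (of β e p₀).gL = 0) :
    (tree β e).Pr l (fun p => SilentGap F G l₀ l (of β e p)) p₀ ≤ 2 * Real.exp (-(6 * Real.log l)) := by
  classical
  by_cases hl : l₀ ≤ l
  swap
  · refine le_trans ((tree β e).Pr_mono (Q' := fun _ => False) fun p _ h => hl h.2.1)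
      (((tree β e).Pr_false _ _).le.trans (by positivity))
  have hc0 : clock 1 (of β e p₀) = 0 := hL₀
  have hl0 : (0 : ℝ) < l := by exact_mod_cast (by omega : 0 < l)
  have hlogl : 0 < Real.log l := Real.log_pos (by exact_mod_cast (by omega : 1 < l))
  have b1 := Pr_noise_le (r := 1) (by norm_num) h₀ l (l + 1) (by rw [hc0]; omega) (6 * Real.log l)
  have b2 := (tree β e).Pr_clock_le (isClock_clock (β := β) (e := e) 1)
    (fun p => DataSlot β e l (of β e p)) p₀ l (Real.exp (-(8 + Real.log l / 8))) (l / 2 ^ 19)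
    (Real.exp_pos _).le (fun k p' _ hp' hb =>
      prob_quiet_le_of_dataSlot (ext_nil_drop h₀ hp') hb)
  have b3 := (tree β e).Pr_or_le b1 (b2.trans (Real.exp_le_exp.2 (neg_le_neg hlog)))
  rw [two_mul]
  refine le_trans ((tree β e).Pr_mono ?_) b3
  rintro p hp ⟨c1, -, c3, c4, c5, c6, c7⟩
  have hcl : clock 1 (of β e p) = clock 1 (of β e p₀) + l := by rw [hc0, zero_add]; exact c1
  by_cases hn : 4 * cap β (l + 1) * (users 1 (of β e p)).card + 2 * (6 * Real.log l)
      < noise β e 1 p - noise β e 1 p₀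
  · exact Or.inl ⟨hcl, hn⟩
  refine Or.inr ⟨hcl, ?_⟩
  have hpp := ext_nil_drop h₀ hp
  have hI := inv_of hpp
  have hgL := hI.gL_le
  have hX0 := (isClock_X (β := β) (e := e)).drop p l (by omega)
  rw [hp.drop_eq] at hX0
  set M := (of β e p).eP / 4 with hM
  set X := (of β e p).X with hX
  -- The last `d` slots of the gap belong to the data phase, and they make up at least a quarter of
  -- the gap.
  set d := min l (X - M) with hd
  have hpt : ∀ i, i < l → ∀ S : Finset ℕ,
      (fun p (_ : Finset ℕ) => if (of β e p).X % 2 ^ 15 = 2 ^ 15 - 1 ∧ X - d ≤ (of β e p).X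
        then (1 : ℝ) else 0) (p.drop (i + 1)) S ≤
      (fun p (_ : Finset ℕ) => (if DataSlot β e l (of β e p) then (1 : ℝ) else 0) +
        ((if (of β e p).jam e = true then 1 else 0) + 16 / Real.log l * haz β 1 (of β e p)))
        (p.drop (i + 1)) S := by
    intro i hi S
    obtain ⟨d1, d2⟩ := hp.drop (i + 1) (by omega)
    have d3 := (isClock_X (β := β) (e := e)).drop p (i + 1) (by omega)
    simp only at d3 ⊢
    have hh := haz_nonneg β 1 (of β e (p.drop (i + 1)))
    have hh' : 0 ≤ 16 / Real.log l * haz β 1 (of β e (p.drop (i + 1))) := by positivity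
    by_cases hpar : (of β e (p.drop (i + 1))).X % 2 ^ 15 = 2 ^ 15 - 1 ∧ X - d ≤ (of β e (p.drop (i + 1))).X
    swap
    · rw [if_neg hpar]
      split_ifs <;> linarith
    rw [if_pos hpar]
    by_cases hj : (of β e (p.drop (i + 1))).jam e = true
    · rw [if_pos hj]
      split_ifs <;> linarith
    by_cases hz : haz β 1 (of β e (p.drop (i + 1))) ≤ Real.log l / 16
    · obtain ⟨g1, -, -, -, -, g6, -⟩ := epoch_persist (ext_nil_drop h₀ d1) d2 (by omega)
      have hdata : DataSlot β e l (of β e (p.drop (i + 1))) := by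
        refine ⟨hpar.1, by simpa using hj, hz, ?_, ?_, by omega⟩
        · rw [← g1]; have := hpar.2; omega
        · rw [← g1]; omega
      rw [if_pos hdata]
      split_ifs <;> linarith
    · have : 1 ≤ 16 / Real.log l * haz β 1 (of β e (p.drop (i + 1))) := by
        push Not at hz
        rw [div_mul_eq_mul_div, le_div_iff₀ hlogl]
        linarith
      split_ifs <;> linarith
  have hsum := acc_mono_of_le
    (w := fun p _ => if (of β e p).X % 2 ^ 15 = 2 ^ 15 - 1 ∧ X - d ≤ (of β e p).X then (1 : ℝ) else 0)
    (w' := fun p _ => (if DataSlot β e l (of β e p) then 1 else 0) +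
      ((if (of β e p).jam e = true then 1 else 0) + 16 / Real.log l * haz β 1 (of β e p))) hp hpt
  rw [acc_add, acc_add, acc_add, acc_add, acc_const_mul, acc_const_mul] at hsum
  have hres := div_le_acc_residue (m := 2 ^ 15) (by norm_num) (X - d) hp (by omega) (by omega)
  have hjam := gJam_persist hp (by omega)
  have hjam0 : (0 : ℝ) ≤ (of β e p₀).gJam := Nat.cast_nonneg _
  -- One slot in `2 ^ 15` is a data slot, among at least `l / 4` slots. After removing the jammed
  -- and the noisy ones, more than `l / 2 ^ 19` remain.
  have hres2 : (l : ℝ) / 2 ^ 17 ≤ ((X / 2 ^ 15 : ℕ) : ℝ) - ((X - d) / 2 ^ 15 : ℕ) + 1 := by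
    have h1 : l ≤ 4 * d := by omega
    have h2 : l ≤ 2 ^ 17 * (X / 2 ^ 15 + 1 - (X - d) / 2 ^ 15) := by omega
    have h3 : (X - d) / 2 ^ 15 ≤ X / 2 ^ 15 + 1 := by omega
    have h4 : (l : ℝ) ≤ 2 ^ 17 * ((X / 2 ^ 15 : ℕ) + 1 - ((X - d) / 2 ^ 15 : ℕ)) := by
      have : (l : ℝ) ≤ ((2 ^ 17 * (X / 2 ^ 15 + 1 - (X - d) / 2 ^ 15) : ℕ) : ℝ) := by exact_mod_cast h2
      rwa [Nat.cast_mul, Nat.cast_sub h3, Nat.cast_add, Nat.cast_one, Nat.cast_pow, Nat.cast_ofNat] at this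
    linarith
  have hwait : ((users 1 (of β e p)).card : ℝ) ≤ (of β e p).gArr := by
    have : (users 1 (of β e p)).card ≤ (waits (of β e p)).card := by
      refine Finset.card_le_card fun j hj => ?_
      obtain ⟨h1, y, f, h2⟩ := hI.wait_of_mem_users hj
      exact Finset.mem_filter.2 ⟨h1, _, _, _, h2⟩
    exact_mod_cast this.trans hI.waits_le
  have hJ0 : (0 : ℝ) ≤ (of β e p).gJam := Nat.cast_nonneg _
  have hA0 : (0 : ℝ) ≤ (of β e p).gArr := Nat.cast_nonneg _
  have hJ1 : ((of β e p).gJam : ℝ) ≤ G * (of β e p).gJam := by nlinarith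
  have hFA : 0 ≤ F * (of β e p).gArr := by positivity
  -- The users of the data parity are waiting nodes, all of them arrivals of this gap; so the noisy
  -- slots are paid by `F * gArr`, which is below `l / 2 ^ 28` in a silent gap.
  have hnoise : 16 / Real.log l * (noise β e 1 p - noise β e 1 p₀) ≤ 512 * (F * (of β e p).gArr) + 192 := by
    rw [div_mul_eq_mul_div, div_le_iff₀ hlogl]
    have h1 : cap β (l + 1) * (users 1 (of β e p)).card ≤ F * (8 * Real.log l) * (of β e p).gArr :=
      mul_le_mul hcap hwait (Nat.cast_nonneg _) (by positivity)
    push Not at hn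
    nlinarith
  rw [mul_sub] at hnoise
  unfold noise at hnoise
  have hlr : (2 : ℝ) ^ 28 ≤ l := by exact_mod_cast hl₀.trans hl
  rw [← hX] at hres
  linarith

end Chan

/-! ### Growth of the total length of bad segments -/

namespace CoinTree

theorem totalBad_le_cons (Bad : ℕ → List (Finset ℕ) → Prop) (S : Finset ℕ) (p : List (Finset ℕ)) :
    totalBad Bad p ≤ totalBad Bad (S :: p) :=
  le_add_of_nonneg_right (Finset.sum_nonneg fun T _ => by positivity)

theorem totalBad_drop_le (Bad : ℕ → List (Finset ℕ) → Prop) (i : ℕ) (p : List (Finset ℕ)) :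
    totalBad Bad (p.drop i) ≤ totalBad Bad p := by
  induction i generalizing p with
  | zero => exact le_rfl
  | succ i ih =>
    cases p with
    | nil => exact le_rfl
    | cons S p => exact (ih p).trans (totalBad_le_cons Bad S p)

theorem add_le_totalBad_cons {Bad : ℕ → List (Finset ℕ) → Prop} {S : Finset ℕ} {p : List (Finset ℕ)}
    {T : ℕ} (h1 : 1 ≤ T) (h2 : T ≤ p.length + 1) (h : Bad T (S :: p)) :
    totalBad Bad p + T ≤ totalBad Bad (S :: p) := by
  classical
  refine add_le_add le_rfl ?_
  have := Finset.single_le_sum (f := fun T : ℕ => (T : ℝ) * if Bad T (S :: p) then 1 else 0)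
    (fun T _ => by positivity) (Finset.mem_Icc.2 ⟨h1, h2⟩)
  refine le_trans (le_of_eq ?_) this
  simp [h]

theorem drop_add_le_totalBad {Bad : ℕ → List (Finset ℕ) → Prop} {p : List (Finset ℕ)} {T i : ℕ}
    (h1 : 1 ≤ T) (h2 : T ≤ p.length) (h3 : 1 ≤ i) (h : Bad T p) :
    totalBad Bad (p.drop i) + T ≤ totalBad Bad p := by
  cases p with
  | nil => simp at h2; omega
  | cons S p =>
    refine le_trans ?_ (add_le_totalBad_cons h1 (by simpa using h2) h)
    obtain ⟨i, rfl⟩ : ∃ k, i = k + 1 := ⟨i - 1, by omega⟩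
    have := totalBad_drop_le Bad i p
    simpa using this

end CoinTree

namespace Chan

open CoinTree

variable {β : ℕ → ℕ} {e : List (Option ℕ) → ℕ × Bool}

/-! ### Starts of epochs and gaps -/

def EpochStart (β : ℕ → ℕ) (e : List (Option ℕ) → ℕ × Bool) (p : List (Finset ℕ)) : Prop :=
  (of β e p).X = 0 ∧ ((of β e p).V e).Nonempty

def GapStart (β : ℕ → ℕ) (e : List (Option ℕ) → ℕ × Bool) (p : List (Finset ℕ)) : Prop :=
  (of β e p).gL = 0 ∧ ((of β e p).V e).Nonempty

/-- An empty system counts as a restart in every slot, so idle slots never lengthen an epoch. -/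
theorem V_nonempty_of_not_restart {σ : Chan} {S : Finset ℕ} (h : ¬ σ.Restart e S) : (σ.V e).Nonempty := by
  by_contra hV
  rw [Finset.not_nonempty_iff_eq_empty] at hV
  refine h (Or.inl ?_)
  rw [present', hV]; simp

theorem not_start_of_clock {c : List (Finset ℕ) → ℕ} (hc : IsClock c) {p : List (Finset ℕ)} {T i : ℕ}
    (h : c p = T) (hi : i < T) : c (p.drop i) ≠ 0 := by
  have := hc.drop p i (by omega)
  omega

theorem epochStart_drop {p : List (Finset ℕ)} {T : ℕ} (hT : 1 ≤ T) (h : (of β e p).X = T) :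
    EpochStart β e (p.drop T) := by
  classical
  have h1 := (isClock_X (β := β) (e := e)).drop p T (by omega)
  have h2 := (isClock_X (β := β) (e := e)).drop p (T - 1) (by omega)
  refine ⟨by omega, ?_⟩
  rcases hq : p.drop (T - 1) with _ | ⟨S, q⟩
  · rw [hq] at h2; simp [of, init] at h2; omega
  · have e1 : p.drop T = q := by
      have : p.drop T = (p.drop (T - 1)).drop 1 := by rw [List.drop_drop]; congr 1; omega
      rw [this, hq]; rfl
    rw [e1]
    refine V_nonempty_of_not_restart (S := S) fun hR => ?_
    rw [hq, of_cons] at h2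
    simp [step, hR] at h2
    omega

theorem gapStart_drop {p : List (Finset ℕ)} {T : ℕ} (hT : 1 ≤ T) (h : (of β e p).gL = T) :
    GapStart β e (p.drop T) := by
  classical
  have h1 := (isClock_gL (β := β) (e := e)).drop p T (by omega)
  have h2 := (isClock_gL (β := β) (e := e)).drop p (T - 1) (by omega)
  refine ⟨by omega, ?_⟩
  rcases hq : p.drop (T - 1) with _ | ⟨S, q⟩
  · rw [hq] at h2; simp [of, init] at h2; omega
  · have e1 : p.drop T = q := by
      have : p.drop T = (p.drop (T - 1)).drop 1 := by rw [List.drop_drop]; congr 1; omega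
      rw [this, hq]; rfl
    rw [e1]
    refine V_nonempty_of_not_restart (S := S) fun hR => ?_
    rw [hq, of_cons] at h2
    have hC : (of β e q).Closing e S := Or.inl hR
    simp [step, hC] at h2
    omega

theorem EarlyRestart.not_epochStart {p : List (Finset ℕ)} {T : ℕ} (h : EarlyRestart β e T p) {i : ℕ}
    (h0 : 0 < i) (hi : i < T) : ¬ EpochStart β e (p.drop i) := by
  cases p with
  | nil => exact h.elim
  | cons S p =>
    obtain ⟨j, rfl⟩ : ∃ j, i = j + 1 := ⟨i - 1, by omega⟩
    exact fun hs => not_start_of_clock (isClock_X (β := β) (e := e)) (p := p) (T := T - 1)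
      (by have := h.1; omega) (by omega) hs.1

theorem EarlyRestart.epochStart {p : List (Finset ℕ)} {T : ℕ} (h : EarlyRestart β e T p) :
    EpochStart β e (p.drop T) := by
  cases p with
  | nil => exact h.elim
  | cons S p =>
    obtain ⟨h1, -, -, -, -, h6⟩ := h
    obtain ⟨k, rfl⟩ : ∃ k, T = k + 1 := ⟨T - 1, by omega⟩
    rw [List.drop_succ_cons]
    rcases Nat.eq_zero_or_pos k with rfl | hk
    · exact ⟨by simpa using h1, h6⟩
    · exact epochStart_drop hk (by omega)

/-- The age of the gap never exceeds that of the epoch, so each start of an epoch is a start of a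
gap. -/
theorem numStarts_epochStart_le {k : ℕ} {p : List (Finset ℕ)} (hp : (tree β e).Ext [] k p) :
    numStarts (EpochStart β e) p ≤ numStarts (GapStart β e) p := by
  induction hp with
  | refl => exact le_rfl
  | @step k p S hp hS ih =>
    simp only [numStarts]
    refine add_le_add ih ?_
    split_ifs with h1 h2
    · exact le_rfl
    · exact absurd ⟨by have := (inv_of hp).gL_le; have := h1.1; omega, h1.2⟩ h2
    · exact Nat.zero_le _
    · exact le_rfl

theorem inj_eq_zero_of_V {σ : Chan} (h : σ.V e = ∅) : σ.inj e = 0 ∧ σ.present = ∅ := by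
  rw [V, Finset.union_eq_empty, Finset.Ico_eq_empty_iff] at h
  exact ⟨by omega, h.1⟩

open Classical in
/-- There are at most twice as many gaps as nodes. -/
theorem numStarts_gapStart_le {k : ℕ} {p : List (Finset ℕ)} (hp : (tree β e).Ext [] k p) :
    numStarts (GapStart β e) p + (of β e p).present.card +
      (if (of β e p).gL = 0 ∧ (of β e p).present.Nonempty then 1 else 0) ≤ 2 * (of β e p).arrived := by
  -- Every arrival brings two units, one of which it holds while present. A success frees the unit
  -- of the leaving node, which is kept as the bonus if nodes remain and pays for the next gap. A
  -- gap that begins on an empty channel is paid by the second unit of an arrival.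
  induction hp with
  | refl => simp [numStarts, of, init]
  | @step k p S hp hS ih =>
    have hI := inv_of hp
    have hV := hI.card_V (e := e)
    have hcard := card_present' (σ := of β e p) (e := e) (S := S) hS.1
    have e1 : (of β e (S :: p)).arrived = (of β e p).arrived + (of β e p).inj e := rfl
    have e2 : (of β e (S :: p)).present = (of β e p).present' e S := rfl
    have e3 : (of β e (S :: p)).gL = if (of β e p).Closing e S then 0 else (of β e p).gL + 1 := rfl
    simp only [numStarts]
    rw [e1, e2, e3]
    rcases Finset.eq_empty_or_nonempty ((of β e p).V e) with hVe | hVn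
    · obtain ⟨h1, h2⟩ := inj_eq_zero_of_V hVe
      have h3 : ¬ GapStart β e p := fun h => by have := h.2; rw [hVe] at this; simp at this
      have h4 : (of β e p).present' e S = ∅ := by rw [present', hVe]; simp
      rw [if_neg h3, h4, h1]
      rw [h2] at ih
      simp at ih ⊢
      exact ih
    · have hVp : 0 < ((of β e p).V e).card := hVn.card_pos
      have hpn : (of β e p).present.Nonempty ↔ 0 < (of β e p).present.card := Finset.card_pos.symm
      have hs : (if GapStart β e p then 1 else 0) = if (of β e p).gL = 0 then 1 else 0 := by
        simp [GapStart, hVn]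
      rw [hs]
      by_cases hC : (of β e p).Closing e S
      · by_cases ho : ((of β e p).out e S).isSome = true
        · rw [if_pos ho] at hcard
          by_cases hg : (of β e p).gL = 0
          · simp only [hg, true_and, if_true] at ih ⊢
            have hle : (if (if (of β e p).Closing e S then 0 else 0 + 1) = 0 ∧
              ((of β e p).present' e S).Nonempty then 1 else 0) ≤ 1 := by split_ifs <;> omega
            rcases Nat.eq_zero_or_pos (of β e p).present.card with h0 | h0
            · rw [if_neg (by rw [hpn]; omega)] at ih
              omega
            · rw [if_pos (hpn.2 h0)] at ih
              omega
          · simp only [hg, false_and, if_false] at ih ⊢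
            have hle : (if (if (of β e p).Closing e S then 0 else (of β e p).gL + 1) = 0 ∧
              ((of β e p).present' e S).Nonempty then 1 else 0) ≤ 1 := by split_ifs <;> omega
            omega
        · rw [if_neg ho] at hcard
          exfalso
          rcases hC with (h | h) | h
          · rw [h] at hcard; simp at hcard; omega
          · exact ho h.1
          · exact ho h
      · have ho : ¬ ((of β e p).out e S).isSome = true := fun h => hC (Or.inr h)
        rw [if_neg ho] at hcard
        rw [if_neg hC, if_neg (show ¬ ((of β e p).gL + 1 = 0 ∧ _) from fun h => by omega)]
        by_cases hg : (of β e p).gL = 0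
        · simp only [hg, true_and, if_true] at ih ⊢
          rcases Nat.eq_zero_or_pos (of β e p).present.card with h0 | h0
          · rw [if_neg (by rw [hpn]; omega)] at ih
            omega
          · rw [if_pos (hpn.2 h0)] at ih
            omega
        · simp only [hg, false_and, if_false] at ih ⊢
          omega

/-! ### Accounting -/

/-- Total length of the silent gaps. -/
noncomputable def silence (β : ℕ → ℕ) (e : List (Option ℕ) → ℕ × Bool) (F G : ℝ) (l₀ : ℕ) :
    List (Finset ℕ) → ℝ :=
  totalBad fun l p => SilentGap F G l₀ l (of β e p)

variable {F G C : ℝ} {l₀ : ℕ}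

/-- A gap that is not short is paid for. -/
theorem gap_le (hG : 0 ≤ G) (hF : 0 ≤ F) {p : List (Finset ℕ)}
    (h1 : (of β e p).eP / 4 < (of β e p).X) (h2 : (of β e p).X ≤ 2 * ((of β e p).eP / 4))
    (h3 : (of β e p).gL ≤ 4 * ((of β e p).X - (of β e p).eP / 4))
    (h4 : 2 * (of β e p).eSucc ≤ (of β e p).eP) :
    ((of β e p).gL : ℝ) ≤ l₀ + 2 ^ 28 * (F * (of β e p).gArr + G * (of β e p).gJam)
      + (silence β e F G l₀ p - silence β e F G l₀ (p.drop (of β e p).gL)) := by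
  have hc : 0 ≤ F * (of β e p).gArr + G * (of β e p).gJam := by positivity
  have hs : silence β e F G l₀ (p.drop (of β e p).gL) ≤ silence β e F G l₀ p := totalBad_drop_le _ _ _
  have hl₀ : (0 : ℝ) ≤ l₀ := Nat.cast_nonneg _
  rcases Nat.eq_zero_or_pos (of β e p).gL with h | hpos
  · rw [h] at hs ⊢
    push_cast
    linarith
  by_cases hl : l₀ ≤ (of β e p).gL
  swap
  · have : ((of β e p).gL : ℝ) ≤ l₀ := by exact_mod_cast (not_le.1 hl).le
    linarith
  by_cases hcost : F * (of β e p).gArr + G * (of β e p).gJam < (of β e p).gL / 2 ^ 28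
  · have : SilentGap F G l₀ (of β e p).gL (of β e p) := ⟨rfl, hl, h1, h2, h3, h4, hcost⟩
    have := drop_add_le_totalBad (Bad := fun l p => SilentGap F G l₀ l (of β e p)) hpos
      ((isClock_gL (β := β) (e := e)).le_length p) hpos this
    unfold silence at hs ⊢
    linarith
  · push Not at hcost
    rw [div_le_iff₀ (by norm_num)] at hcost
    linarith

/-- Duration of the busy part of the data phase. -/
theorem data_phase_le (hG : 0 ≤ G) (hF : 0 ≤ F) {k : ℕ} {p : List (Finset ℕ)}
    (hp : (tree β e).Ext [] k p) (hs : 2 * (of β e p).eSucc ≤ (of β e p).eP)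
    (hX : (of β e p).X ≤ 2 * ((of β e p).eP / 4)) :
    ((of β e p).X : ℝ) - (of β e p).gL - ((of β e p).eP / 4 : ℕ) ≤ (l₀ + 1) * (of β e p).eSucc
      + ((of β e p).X - (of β e p).gL) / 4
      + 2 ^ 28 * (F * ((of β e p).eArr - (of β e p).gArr) + G * ((of β e p).eJam - (of β e p).gJam))
      + (silence β e F G l₀ (p.drop (of β e p).gL) - silence β e F G l₀ (p.drop (of β e p).X)) := by
  classical
  induction hp with
  | refl => simp [of, init]
  | @step k p S hp hS ih =>
    have hI := inv_of hp
    have hgX := hI.gL_le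
    by_cases hR : (of β e p).Restart e S
    · have hC : (of β e p).Closing e S := Or.inl hR
      have e1 : (of β e (S :: p)).X = 0 := by rw [of_cons]; simp [step, hR]
      have e2 : (of β e (S :: p)).gL = 0 := by rw [of_cons]; simp [step, hC]
      have e3 : (of β e (S :: p)).eSucc = 0 := by rw [of_cons]; simp [step, hR]
      have e4 : (of β e (S :: p)).eArr = 0 := by rw [of_cons]; simp [step, hR]
      have e5 : (of β e (S :: p)).eJam = 0 := by rw [of_cons]; simp [step, hR]
      have e6 : (of β e (S :: p)).gArr = 0 := by rw [of_cons]; simp [step, hC]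
      have e7 : (of β e (S :: p)).gJam = 0 := by rw [of_cons]; simp [step, hC]
      rw [e1, e2, e3, e4, e5, e6, e7]
      simp
    · obtain ⟨s1, s2, s3, s4, s5, s6⟩ := step_of_not_restart (β := β) hR
      rw [← of_cons] at s1 s2 s3 s4 s5 s6
      rw [s1, s2] at hX
      rw [s2, s6] at hs
      have ih := ih (by omega) (by omega)
      by_cases hC : (of β e p).Closing e S
      · have ho : ((of β e p).out e S).isSome = true := hC.resolve_left hR
        have e2 : (of β e (S :: p)).gL = 0 := by rw [of_cons]; simp [step, hC]
        have e6 : (of β e (S :: p)).gArr = 0 := by rw [of_cons]; simp [step, hC]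
        have e7 : (of β e (S :: p)).gJam = 0 := by rw [of_cons]; simp [step, hC]
        rw [if_pos ho] at s6 hs
        rw [e2, e6, e7, s1, s2, s4, s5, s6, List.drop_zero, List.drop_succ_cons]
        have m1 : silence β e F G l₀ p ≤ silence β e F G l₀ (S :: p) := totalBad_le_cons _ _ _
        have m2 : silence β e F G l₀ (p.drop (of β e p).X) ≤ silence β e F G l₀ p :=
          totalBad_drop_le _ _ _
        have c1 : 0 ≤ F * ((of β e p).inj e : ℝ) := by positivity
        have c2 : 0 ≤ G * (((if (of β e p).jam e = true then 1 else 0 : ℕ)) : ℝ) := by positivity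
        have c3 : 0 ≤ F * ((of β e p).eArr : ℝ) := by positivity
        have c4 : 0 ≤ G * ((of β e p).eJam : ℝ) := by positivity
        have c5 : 0 ≤ (l₀ : ℝ) * (of β e p).eSucc := by positivity
        have c6 : (0 : ℝ) ≤ (of β e p).eSucc := Nat.cast_nonneg _
        have c7 : (0 : ℝ) ≤ l₀ := Nat.cast_nonneg _
        have c8 : (0 : ℝ) ≤ (of β e p).gL := Nat.cast_nonneg _
        have c9 : (0 : ℝ) ≤ (of β e p).X := Nat.cast_nonneg _
        push_cast at c2 ⊢
        -- A gap that closes before the data phase leaves at most one on the left side, which the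
        -- success pays.
        by_cases hx : (of β e p).eP / 4 < (of β e p).X
        swap
        · have : ((of β e p).X : ℝ) ≤ ((of β e p).eP / 4 : ℕ) := by exact_mod_cast not_lt.1 hx
          nlinarith
        by_cases hg : (of β e p).gL ≤ 4 * ((of β e p).X - (of β e p).eP / 4)
        · have hgap := gap_le (l₀ := l₀) hG hF hx (by omega) hg (by omega)
          nlinarith
        -- Less than a quarter of the gap lies in the data phase. As the gap is no longer than the
        -- epoch, the part of the epoch in the data phase is at most `X / 4`; this is the purpose of
        -- the quarter term in the bound.
        · have h1 : 4 * (of β e p).X ≤ (of β e p).X + 4 * ((of β e p).eP / 4) := by omega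
          have h2 : 4 * ((of β e p).X : ℝ) ≤ (of β e p).X + 4 * ((of β e p).eP / 4 : ℕ) := by
            exact_mod_cast h1
          nlinarith
      · obtain ⟨g1, g2, g3⟩ := step_of_not_closing (β := β) hC
        rw [← of_cons] at g1 g2 g3
        have ho : ¬ ((of β e p).out e S).isSome = true := fun h => hC (Or.inr h)
        rw [if_neg ho] at s6
        rw [g1, g2, g3, s1, s2, s4, s5, s6, List.drop_succ_cons, List.drop_succ_cons]
        push_cast at ih ⊢
        linarith

/-- An epoch that outlives its data phase had few synchronized nodes, unless it was expensive. -/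
theorem eP_le_of_data_phase (hG : 0 ≤ G) (hF : 0 ≤ F) {p : List (Finset ℕ)}
    (hp : (tree β e).Ext [] p.length p) (hs : 2 * (of β e p).eSucc ≤ (of β e p).eP)
    (hX : 2 * ((of β e p).eP / 4) ≤ (of β e p).X) :
    (((of β e p).eP / 4 : ℕ) : ℝ) ≤ 2 * ((l₀ + 1) * ((of β e p).eSucc + 1)
      + 2 ^ 28 * (F * (of β e p).eArr + G * (of β e p).eJam)
      + (silence β e F G l₀ p - silence β e F G l₀ (p.drop (of β e p).X))) := by
  set M := (of β e p).eP / 4 with hM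
  have c1 : 0 ≤ F * ((of β e p).eArr : ℝ) := by positivity
  have c2 : 0 ≤ G * ((of β e p).eJam : ℝ) := by positivity
  have c3 : (0 : ℝ) ≤ (l₀ + 1) * ((of β e p).eSucc + 1) := by positivity
  have c4 : silence β e F G l₀ (p.drop (of β e p).X) ≤ silence β e F G l₀ p := totalBad_drop_le _ _ _
  rcases Nat.eq_zero_or_pos M with h0 | hpos
  · rw [h0]; push_cast; linarith
  -- The state at age `2 * M`, the end of the data phase; the completed gaps and the current one are
  -- added up there.
  set i := (of β e p).X - 2 * M with hi
  have hXq : (of β e (p.drop i)).X + i = (of β e p).X :=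
    (isClock_X (β := β) (e := e)).drop p i (by omega)
  obtain ⟨d1, d2⟩ := hp.drop i (by have := (isClock_X (β := β) (e := e)).le_length p; omega)
  generalize hq : p.drop i = q at hXq d1 d2
  have hXq' : (of β e q).X = 2 * M := by omega
  obtain ⟨g1, -, g3, g4, -, g6, -⟩ := epoch_persist (ext_nil_drop Ext.refl d1) d2 (by omega)
  have hM' : (of β e q).eP / 4 = M := by rw [← g1]
  have hgq := (inv_of d1).gL_le
  have h1 := data_phase_le (l₀ := l₀) hG hF d1 (by omega) (by omega)
  have h2 := gap_le (l₀ := l₀) (p := q) (e := e) (β := β) hG hF (by omega) (by omega) (by omega) (by omega)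
  have h3 : silence β e F G l₀ q ≤ silence β e F G l₀ p := by
    rw [← hq]; exact totalBad_drop_le _ _ _
  have h4 : q.drop (of β e q).X = p.drop (of β e p).X := by
    rw [← hq, List.drop_drop, hq]; congr 1; omega
  rw [h4, hM', hXq'] at h1
  have k1 : F * ((of β e q).eArr : ℝ) ≤ F * (of β e p).eArr :=
    mul_le_mul_of_nonneg_left (by exact_mod_cast g3) hF
  have k2 : G * ((of β e q).eJam : ℝ) ≤ G * (of β e p).eJam :=
    mul_le_mul_of_nonneg_left (by exact_mod_cast g4) hG
  have k3 : ((l₀ : ℝ) + 1) * (of β e q).eSucc ≤ (l₀ + 1) * (of β e p).eSucc :=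
    mul_le_mul_of_nonneg_left (by exact_mod_cast g6) (by positivity)
  have k4 : (0 : ℝ) ≤ (of β e q).gL := Nat.cast_nonneg _
  push_cast at h1
  nlinarith

end Chan

/-! ### Charging the active slots -/

namespace Chan

open CoinTree

variable {β : ℕ → ℕ} {e : List (Option ℕ) → ℕ × Bool} {F G C : ℝ} {l₀ : ℕ}

/-- Total length of the bad epochs and gaps. -/
noncomputable def waste (β : ℕ → ℕ) (e : List (Option ℕ) → ℕ × Bool) (F G C : ℝ) (l₀ : ℕ)
    (p : List (Finset ℕ)) : ℝ :=
  totalBad (fun T p => LongEpoch F G C T (of β e p)) p + totalBad (EarlyRestart β e) p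
    + 8 * C * silence β e F G l₀ p

theorem waste_le_cons (hC : 0 ≤ C) (S : Finset ℕ) (p : List (Finset ℕ)) :
    waste β e F G C l₀ p ≤ waste β e F G C l₀ (S :: p) :=
  add_le_add (add_le_add (totalBad_le_cons _ _ _) (totalBad_le_cons _ _ _))
    (mul_le_mul_of_nonneg_left (totalBad_le_cons _ _ _) (by positivity))

theorem waste_drop_le (hC : 0 ≤ C) (i : ℕ) (p : List (Finset ℕ)) :
    waste β e F G C l₀ (p.drop i) ≤ waste β e F G C l₀ p :=
  add_le_add (add_le_add (totalBad_drop_le _ _ _) (totalBad_drop_le _ _ _))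
    (mul_le_mul_of_nonneg_left (totalBad_drop_le _ _ _) (by positivity))

/-- Cost of an epoch in terms of its first state. -/
theorem X_le_or (hC : 0 ≤ C) (p : List (Finset ℕ)) :
    ((of β e p).X : ℝ) ≤ C * ((of β e p).eP + F * ((of β e p).eJ + (of β e p).eArr) + G * (of β e p).eJam)
    ∨ waste β e F G C l₀ (p.drop (of β e p).X) + (of β e p).X ≤ waste β e F G C l₀ p := by
  by_cases h : C * ((of β e p).eP + F * ((of β e p).eJ + (of β e p).eArr) + G * (of β e p).eJam)
      < (of β e p).X
  · right
    rcases Nat.eq_zero_or_pos (of β e p).X with h0 | hpos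
    · rw [h0, List.drop_zero, Nat.cast_zero, add_zero]
    have h1 : LongEpoch F G C (of β e p).X (of β e p) := ⟨rfl, h⟩
    have h2 := drop_add_le_totalBad (Bad := fun T p => LongEpoch F G C T (of β e p)) hpos
      ((isClock_X (β := β) (e := e)).le_length p) hpos h1
    have h3 := totalBad_drop_le (EarlyRestart β e) (of β e p).X p
    have h4 : 8 * C * silence β e F G l₀ (p.drop (of β e p).X) ≤ 8 * C * silence β e F G l₀ p :=
      mul_le_mul_of_nonneg_left (totalBad_drop_le _ _ _) (by positivity)
    unfold waste
    linarith
  · exact Or.inl (not_lt.1 h)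

/-- After a control success all older nodes are synchronized; only nodes that were waiting, hence
arrived in the last gap, or that arrive in this very slot are left in backoff. -/
theorem eJ_restart_le {k : ℕ} {p : List (Finset ℕ)} (hp : (tree β e).Ext [] k p) {S : Finset ℕ}
    (hR : (of β e p).Restart e S) : (of β e (S :: p)).eJ ≤ (of β e p).eArr + (of β e p).inj e := by
  classical
  have hI := inv_of hp
  have e1 : (of β e (S :: p)).eJ = (((of β e p).present' e S).filter
      fun j => (of β e p).st' β e S j = back true true 1 false).card := by
    rw [of_cons]; simp only [step]; rw [if_pos hR]
  rw [e1]
  rcases hR with h | ⟨ho, hX⟩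
  · rw [h]; simp
  · have hsub : (((of β e p).present' e S).filter
        fun j => (of β e p).st' β e S j = back true true 1 false) ⊆
        waits (of β e p) ∪ Finset.Ico (of β e p).arrived ((of β e p).arrived + (of β e p).inj e) := by
      intro j hj
      obtain ⟨hj, hst⟩ := Finset.mem_filter.1 hj
      have hV := (mem_present'.1 hj).1
      rw [hI.st'_eq hV, ho] at hst
      rcases hI.next_of_control hV hX (β := β) (decide (j ∈ S)) with h | h
      · rw [h.1] at hst; simp at hst
      · exact Finset.mem_union.2 h.2
    refine (Finset.card_le_card hsub).trans ((Finset.card_union_le _ _).trans ?_)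
    have h1 := hI.waits_le
    have h2 := hI.gArr_le
    rw [Nat.card_Ico]
    omega

/-- Number of active slots, apart from those of the present epoch. -/
theorem active_le (hF : 1 ≤ F) (hG : 0 ≤ G) (hC : 0 ≤ C) {p : List (Finset ℕ)}
    (hp : (tree β e).Ext [] p.length p) :
    ((of β e p).active : ℝ) + C * F * (of β e p).eJ ≤ (of β e p).X
      + (2 * C + 8 * C * 2 ^ 28) * F * ((of β e p).arrived - (of β e p).eArr)
      + (C + 8 * C * 2 ^ 28) * G * ((of β e p).jammed - (of β e p).eJam)
      + (8 * C * (l₀ + 1) + 3 * C + 1)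
        * ((of β e p).arrived - (of β e p).present.card - (of β e p).eSucc)
      + waste β e F G C l₀ (p.drop (of β e p).X) := by
  classical
  generalize hk : p.length = k at hp
  clear hk
  -- The term `C * F * eJ` is a reserve for the present epoch, laid aside when its initial backoff
  -- nodes arrived. Thus an arrival pays `C * F` for its own epoch and `C * F` for the next one,
  -- besides its share in the data phase.
  induction hp with
  | refl =>
    simp [of, init, waste, silence, totalBad]
  | @step k p S hp hS ih =>
    have hI := inv_of hp
    have hV := hI.card_V (e := e)
    have hcard := card_present' (σ := of β e p) (e := e) (S := S) hS.1
    have e1 : (of β e (S :: p)).arrived = (of β e p).arrived + (of β e p).inj e := rfl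
    have e2 : (of β e (S :: p)).present = (of β e p).present' e S := rfl
    have e3 : (of β e (S :: p)).jammed = (of β e p).jammed + if (of β e p).jam e = true then 1 else 0 := rfl
    have e4 : (of β e (S :: p)).active =
        (of β e p).active + if ((of β e p).V e).Nonempty then 1 else 0 := rfl
    by_cases hR : (of β e p).Restart e S
    swap
    · obtain ⟨s1, s2, s3, s4, s5, s6⟩ := step_of_not_restart (β := β) hR
      rw [← of_cons] at s1 s2 s3 s4 s5 s6
      rw [if_pos (V_nonempty_of_not_restart hR)] at e4
      rw [e1, e2, e3, e4, s1, s3, s4, s5, s6, List.drop_succ_cons]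
      have hc : (((of β e p).present' e S).card : ℝ) +
          ((if ((of β e p).out e S).isSome = true then 1 else 0 : ℕ) : ℝ)
          = (of β e p).present.card + (of β e p).inj e := by
        exact_mod_cast hcard.trans hV
      have hc' : (((of β e p).present' e S).card : ℝ) = (of β e p).present.card + (of β e p).inj e
          - ((if ((of β e p).out e S).isSome = true then 1 else 0 : ℕ) : ℝ) := by linarith
      rw [hc']
      push_cast at ih ⊢
      linarith
    have t1 : (of β e (S :: p)).X = 0 := by rw [of_cons]; simp [step, hR]
    have t2 : (of β e (S :: p)).eSucc = 0 := by rw [of_cons]; simp [step, hR]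
    have t3 : (of β e (S :: p)).eArr = 0 := by rw [of_cons]; simp [step, hR]
    have t4 : (of β e (S :: p)).eJam = 0 := by rw [of_cons]; simp [step, hR]
    have t5 := eJ_restart_le hp hR
    have hCF : 0 ≤ C * F := by positivity
    have t6 : C * F * ((of β e (S :: p)).eJ : ℝ) ≤ C * F * ((of β e p).eArr + (of β e p).inj e) :=
      mul_le_mul_of_nonneg_left (by exact_mod_cast t5) hCF
    have w1 : waste β e F G C l₀ p ≤ waste β e F G C l₀ (S :: p) := waste_le_cons hC S p
    have w2 : waste β e F G C l₀ (p.drop (of β e p).X) ≤ waste β e F G C l₀ p := waste_drop_le hC _ _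
    have n1 : 0 ≤ C * F * (of β e p).eArr := by positivity
    have n2 : 0 ≤ C * G * (of β e p).eJam := by positivity
    have n3 : 0 ≤ C * (of β e p).eSucc := by positivity
    have n4 : 0 ≤ C * (l₀ * ((of β e p).eSucc + 1)) := by positivity
    have n5 : 0 ≤ C * F * (of β e p).eJ := by positivity
    have n6 : 0 ≤ C * F * (of β e p).inj e := by positivity
    have n7 : (0 : ℝ) ≤ (of β e p).eSucc := Nat.cast_nonneg _
    have n8 : 0 ≤ C * G * ((if (of β e p).jam e = true then 1 else 0 : ℕ) : ℝ) := by positivity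
    rw [e1, e2, e3, e4, t1, t2, t3, t4, List.drop_zero]
    rcases Finset.eq_empty_or_nonempty ((of β e p).V e) with hVe | hVn
    · obtain ⟨v1, v2⟩ := inj_eq_zero_of_V hVe
      have hX := hI.X_eq v2
      have h0 : (of β e p).present' e S = ∅ := by rw [present', hVe]; simp
      have h1 := hI.eSucc_zero hX
      have h2 := hI.eArr_zero hX
      have h3 := hI.eJam_zero hX
      have t7 : (of β e (S :: p)).eJ = 0 := by omega
      rw [h0, v1, t7, if_neg (by rw [hVe]; simp)]
      rw [hX, h1, h2, h3, v2, List.drop_zero] at ih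
      simp only [Finset.card_empty, Nat.cast_zero, mul_zero, add_zero, sub_zero, zero_add] at ih ⊢
      push_cast at n8 ⊢
      linarith
    have ho : ((of β e p).out e S).isSome = true := by
      rcases hR with h | h
      · by_contra ho
        rw [if_neg ho, h] at hcard
        have := hVn.card_pos
        simp at hcard
        omega
      · exact h.1
    rw [if_pos ho] at hcard
    have hc : (((of β e p).present' e S).card : ℝ) = (of β e p).present.card + (of β e p).inj e - 1 := by
      have : (((of β e p).present' e S).card : ℝ) + 1 = (of β e p).present.card + (of β e p).inj e := by
        exact_mod_cast hcard.trans hV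
      linarith
    rw [if_pos hVn, hc]
    push_cast at n8 ⊢
    -- What remains is to pay for the `X + 1` slots of the epoch that ends here.
    suffices hmain : ((of β e p).X : ℝ) + 1 ≤ C * F * (of β e p).eJ
        + (C + 8 * C * 2 ^ 28) * F * (of β e p).eArr + (C + 8 * C * 2 ^ 28) * G * (of β e p).eJam
        + (8 * C * (l₀ + 1) + 3 * C + 1) * ((of β e p).eSucc + 1)
        + (waste β e F G C l₀ (S :: p) - waste β e F G C l₀ (p.drop (of β e p).X)) by
      linarith
    by_cases hearly : (of β e p).X % 2 = 0 ∧ 2 * ((of β e p).X + 1) ≤ (of β e p).eP ∧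
        2 * (of β e p).eSucc ≤ (of β e p).eP
    · have hE : EarlyRestart β e ((of β e p).X + 1) (S :: p) :=
        ⟨rfl, hearly.1, ho, hearly.2.1, hearly.2.2, hVn⟩
      have h1 := add_le_totalBad_cons (p := p) (S := S) (Bad := EarlyRestart β e)
        (T := (of β e p).X + 1) (by omega)
        (by have := (isClock_X (β := β) (e := e)).le_length p; omega) hE
      have h2 : waste β e F G C l₀ p + ((of β e p).X + 1 : ℕ) ≤ waste β e F G C l₀ (S :: p) := by
        have h3 := totalBad_le_cons (fun T p => LongEpoch F G C T (of β e p)) S p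
        have h4 : 8 * C * silence β e F G l₀ p ≤ 8 * C * silence β e F G l₀ (S :: p) :=
          mul_le_mul_of_nonneg_left (totalBad_le_cons _ _ _) (by positivity)
        unfold waste
        linarith
      push_cast at h2
      linarith
    rcases X_le_or (F := F) (G := G) (l₀ := l₀) (β := β) (e := e) hC p with hx | hx
    swap
    · linarith
    -- The epoch is not too long, so everything but its initial batch is already paid.
    suffices hsuff : C * ((of β e p).eP : ℝ) + 1 ≤ 8 * C * 2 ^ 28 * F * (of β e p).eArr
        + 8 * C * 2 ^ 28 * G * (of β e p).eJam + (8 * C * (l₀ + 1) + 3 * C + 1) * ((of β e p).eSucc + 1)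
        + (waste β e F G C l₀ (S :: p) - waste β e F G C l₀ (p.drop (of β e p).X)) by
      linarith
    -- If about half of the batch has left, the successes pay for it.
    have few : (of β e p).eP ≤ 2 * (of β e p).eSucc + 1 → C * ((of β e p).eP : ℝ) + 1 ≤
        8 * C * 2 ^ 28 * F * (of β e p).eArr
        + 8 * C * 2 ^ 28 * G * (of β e p).eJam + (8 * C * (l₀ + 1) + 3 * C + 1) * ((of β e p).eSucc + 1)
        + (waste β e F G C l₀ (S :: p) - waste β e F G C l₀ (p.drop (of β e p).X)) := by
      intro h
      have h' : C * ((of β e p).eP : ℝ) ≤ C * (2 * (of β e p).eSucc + 1) :=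
        mul_le_mul_of_nonneg_left (by exact_mod_cast h) hC
      linarith
    rcases hR with hemp | ⟨-, hX⟩
    · refine few ?_
      rw [hemp, Finset.card_empty] at hcard
      have h1 := hI.eP_le
      have h2 : (syncs (of β e p)).card ≤ (of β e p).present.card :=
        Finset.card_le_card fun j hj => (mem_syncs.1 hj).1
      omega
    by_cases hs : 2 * (of β e p).eSucc ≤ (of β e p).eP
    swap
    · exact few (by omega)
    -- Fewer than half have left and the restart is not premature, so the epoch has outlived its
    -- data phase and the batch is bounded by what happened there.
    have h1 := eP_le_of_data_phase (l₀ := l₀) hG (by linarith : (0 : ℝ) ≤ F) (p := p)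
      (ext_nil_drop Ext.refl hp) hs (by omega)
    have h2 : ((of β e p).eP : ℝ) ≤ 4 * ((of β e p).eP / 4 : ℕ) + 3 := by
      exact_mod_cast (by omega : (of β e p).eP ≤ 4 * ((of β e p).eP / 4) + 3)
    have h3 : C * ((of β e p).eP : ℝ) ≤ C * (4 * (2 * ((l₀ + 1) * ((of β e p).eSucc + 1)
      + 2 ^ 28 * (F * (of β e p).eArr + G * (of β e p).eJam)
      + (silence β e F G l₀ p - silence β e F G l₀ (p.drop (of β e p).X)))) + 3) :=
      mul_le_mul_of_nonneg_left (by linarith) hC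
    have h4 : waste β e F G C l₀ (p.drop (of β e p).X) + 8 * C * (silence β e F G l₀ p
        - silence β e F G l₀ (p.drop (of β e p).X)) ≤ waste β e F G C l₀ p := by
      have h5 := totalBad_drop_le (fun T p => LongEpoch F G C T (of β e p)) (of β e p).X p
      have h6 := totalBad_drop_le (EarlyRestart β e) (of β e p).X p
      unfold waste
      linarith
    linarith

/-- Bound on the number of active slots. -/
theorem active_le_of_waste (hF : 1 ≤ F) (hG : 0 ≤ G) (hC : 0 ≤ C) {p : List (Finset ℕ)}
    (hp : (tree β e).Ext [] p.length p) :
    ((of β e p).active : ℝ) ≤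
      ((2 * C + 8 * C * 2 ^ 28) * F + (8 * C * (l₀ + 1) + 3 * C + 1)) * (of β e p).arrived
      + (C + 8 * C * 2 ^ 28) * G * (of β e p).jammed + waste β e F G C l₀ p := by
  have hI := inv_of hp
  have h1 := active_le (l₀ := l₀) hF hG hC hp
  have n1 : 0 ≤ C * F * (of β e p).eArr := by positivity
  have n2 : 0 ≤ C * G * (of β e p).eJam := by positivity
  have n5 : 0 ≤ C * F * (of β e p).eJ := by positivity
  have n6 : 0 ≤ C * ((of β e p).present.card : ℝ) := by positivity
  have n7 : 0 ≤ C * ((of β e p).eSucc : ℝ) := by positivity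
  have n8 : 0 ≤ C * (l₀ * ((of β e p).eSucc : ℝ)) := by positivity
  have n9 : 0 ≤ C * (l₀ * ((of β e p).present.card : ℝ)) := by positivity
  have n10 : (0 : ℝ) ≤ (of β e p).present.card := Nat.cast_nonneg _
  have n11 : (0 : ℝ) ≤ (of β e p).eSucc := Nat.cast_nonneg _
  have w : waste β e F G C l₀ (p.drop (of β e p).X) ≤ waste β e F G C l₀ p := waste_drop_le hC _ _
  -- The unfinished epoch is paid by nodes not charged so far: its batch consists of nodes still
  -- present or successful in it.
  rcases X_le_or (F := F) (G := G) (l₀ := l₀) (β := β) (e := e) hC p with hx | hx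
  · have h2 : C * ((of β e p).eP : ℝ) ≤ C * ((of β e p).present.card + (of β e p).eSucc) := by
      refine mul_le_mul_of_nonneg_left ?_ hC
      have h3 : (syncs (of β e p)).card ≤ (of β e p).present.card :=
        Finset.card_le_card fun j hj => (mem_syncs.1 hj).1
      exact_mod_cast hI.eP_le.trans (Nat.add_le_add_right h3 _)
    linarith
  · linarith

/-- With `m₀ = n` and `κ = 4 * (A + 1)` the tail is `A / (4 * (A + 1) * n)`. When at least `n` nodes
have arrived, `m₀` and the number of starts are at most one and two times the arrivals, which gives
`12 * (A + 1) + 4 * A`. -/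
theorem Pr_totalBad_le_of_starts {A : ℝ} (hA : 0 ≤ A) {t n : ℕ} (hn : 1 ≤ n)
    {start : List (Finset ℕ) → Prop} {Bad : ℕ → List (Finset ℕ) → Prop}
    (hm : ∀ k p, (tree β e).Ext [] k p → numStarts start p ≤ 2 * (of β e p).arrived)
    (hP : ∀ p T, (tree β e).Ext [] p.length p → start p → 1 ≤ T → p.length + T ≤ t →
      (tree β e).Pr T (Bad T) p ≤ A / (T : ℝ) ^ 6)
    (hS : ∀ p T, 1 ≤ T → Bad T p → ∀ i, 0 < i → i < T → ¬ start (p.drop i))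
    (hS' : ∀ p T, 1 ≤ T → T ≤ p.length → Bad T p → start (p.drop T)) :
    (tree β e).Pr t (fun p => n ≤ (of β e p).arrived ∧
      (16 * A + 12) * (of β e p).arrived < totalBad Bad p) [] ≤ 1 / (3 * n) := by
  have hn0 : (0 : ℝ) < n := by exact_mod_cast hn
  have h1 := Pr_totalBad_le (τ := tree β e) (m₀ := (n : ℝ)) (A := A) (κ := 4 * (A + 1)) (t := t) hn0 hA
    (by linarith) hP hS hS'
  refine le_trans ((tree β e).Pr_mono ?_) (h1.trans ?_)
  · rintro p hp ⟨h2, h3⟩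
    have h4 : (numStarts start p : ℝ) ≤ 2 * (of β e p).arrived := by exact_mod_cast hm _ _ hp
    have h5 : (n : ℝ) ≤ (of β e p).arrived := by exact_mod_cast h2
    nlinarith
  · rw [div_le_div_iff₀ (by positivity) (by positivity)]
    nlinarith [mul_nonneg hn0.le hA]

/-- Bound on the number of active slots with high probability. -/
theorem Pr_active_le (hF : 1 ≤ F) (hG : 0 ≤ G) (hC : 0 ≤ C) {A : ℝ} (hA : 2 ^ 24 ≤ A) {t : ℕ}
    (hE : ∀ p T, (tree β e).Ext [] p.length p → EpochStart β e p → 1 ≤ T → T ≤ t →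
      (tree β e).Pr T (fun p => LongEpoch F G C T (of β e p)) p ≤ A / (T : ℝ) ^ 6)
    (hQ : ∀ p T, (tree β e).Ext [] p.length p → GapStart β e p → 1 ≤ T → T ≤ t →
      (tree β e).Pr T (fun p => SilentGap F G l₀ T (of β e p)) p ≤ A / (T : ℝ) ^ 6)
    {n : ℕ} (hn : 1 ≤ n) :
    (tree β e).Pr t (fun p => n ≤ (of β e p).arrived ∧
      ((2 * C + 8 * C * 2 ^ 28) + (8 * C * (l₀ + 1) + 3 * C + 1) + (2 + 8 * C) * (16 * A + 12)) * F
        * (of β e p).arrived + (C + 8 * C * 2 ^ 28) * G * (of β e p).jammed < (of β e p).active) []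
      ≤ 1 / n := by
  have hA0 : 0 ≤ A := by linarith
  have hn0 : (0 : ℝ) < n := by exact_mod_cast hn
  have mG : ∀ k p, (tree β e).Ext [] k p → numStarts (GapStart β e) p ≤ 2 * (of β e p).arrived :=
    fun k p hp => by have := numStarts_gapStart_le hp; omega
  have mE : ∀ k p, (tree β e).Ext [] k p → numStarts (EpochStart β e) p ≤ 2 * (of β e p).arrived :=
    fun k p hp => (numStarts_epochStart_le hp).trans (mG k p hp)
  have b1 := Pr_totalBad_le_of_starts (t := t) hA0 hn mE (Bad := fun T p => LongEpoch F G C T (of β e p))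
    (fun p T h1 h2 h3 h4 => hE p T h1 h2 h3 (by omega))
    (fun p T h1 h2 i hi hiT hs => not_start_of_clock (isClock_X (β := β) (e := e)) h2.1 hiT hs.1)
    (fun p T h1 _ h3 => epochStart_drop h1 h3.1)
  have b2 := Pr_totalBad_le_of_starts (t := t) hA0 hn mE (Bad := EarlyRestart β e)
    (fun p T h1 h2 h3 h4 => (Pr_earlyRestart_le h1 h3).trans (by gcongr))
    (fun p T h1 h2 i hi hiT => h2.not_epochStart hi hiT)
    (fun p T h1 _ h3 => h3.epochStart)
  have b3 := Pr_totalBad_le_of_starts (t := t) hA0 hn mG (Bad := fun T p => SilentGap F G l₀ T (of β e p))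
    (fun p T h1 h2 h3 h4 => hQ p T h1 h2 h3 (by omega))
    (fun p T h1 h2 i hi hiT hs => not_start_of_clock (isClock_gL (β := β) (e := e)) h2.1 hiT hs.1)
    (fun p T h1 _ h3 => gapStart_drop h1 h3.1)
  have b4 := (tree β e).Pr_or_le b1 ((tree β e).Pr_or_le b2 b3)
  refine le_trans ((tree β e).Pr_mono ?_) (b4.trans (le_of_eq (by field_simp; norm_num)))
  rintro p hp ⟨h1, h2⟩
  by_contra hcon
  rw [not_or, not_or] at hcon
  obtain ⟨c1, c2, c3⟩ := hcon
  have c1 := not_lt.1 fun h => c1 ⟨h1, h⟩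
  have c2 := not_lt.1 fun h => c2 ⟨h1, h⟩
  have c3 := not_lt.1 fun h => c3 ⟨h1, h⟩
  have h3 := active_le_of_waste (l₀ := l₀) hF hG hC (p := p) (ext_nil_drop Ext.refl hp)
  have h4 : waste β e F G C l₀ p ≤ (2 + 8 * C) * (16 * A + 12) * (of β e p).arrived := by
    have h5 : 8 * C * silence β e F G l₀ p ≤ 8 * C * ((16 * A + 12) * (of β e p).arrived) :=
      mul_le_mul_of_nonneg_left c3 (by positivity)
    unfold waste
    linarith
  have h5 : ((8 * C * (l₀ + 1) + 3 * C + 1) + (2 + 8 * C) * (16 * A + 12)) * (of β e p).arrived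
      ≤ ((8 * C * (l₀ + 1) + 3 * C + 1) + (2 + 8 * C) * (16 * A + 12)) * (of β e p).arrived * F :=
    le_mul_of_one_le_right (by positivity) hF
  linarith

end Chan

/-! ### Size of the credits -/

namespace NodeState

variable {β : ℕ → ℕ}

theorem starts_le_sum (hβ : ∀ k, β k ≤ k) (l : ℕ) :
    starts β l ≤ ∑ k ∈ Finset.range (Nat.log 2 l + 1), 2 ^ β k := by
  have h := remaining_eq_sum hβ (k0 := 0) (k1 := Nat.log 2 l + 1) (y := 0) (Nat.zero_le _) (by norm_num)
  rw [Finset.range_eq_Ico, ← h]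
  refine Finset.card_le_card fun i hi => ?_
  simp only [Finset.mem_filter, Finset.mem_Icc, Finset.mem_Ico] at hi ⊢
  exact ⟨⟨by simpa using hi.1.1, hi.1.2.trans_lt (Nat.lt_pow_succ_log_self (by norm_num) l)⟩, hi.2, by omega⟩

theorem natLog_le_log (l : ℕ) (hl : 1 ≤ l) : (Nat.log 2 l : ℝ) * Real.log 2 ≤ Real.log l := by
  rw [← Real.log_pow]
  refine Real.log_le_log (by positivity) ?_
  exact_mod_cast Nat.pow_log_le_self 2 (by omega)

theorem log_le_natLog (l : ℕ) : Real.log l ≤ (Nat.log 2 l + 1) * Real.log 2 := by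
  rcases Nat.eq_zero_or_pos l with rfl | hl
  · simp; exact Real.log_nonneg (by norm_num)
  have : ((Nat.log 2 l + 1 : ℕ) : ℝ) * Real.log 2 = (Nat.log 2 l + 1) * Real.log 2 := by push_cast; rfl
  rw [← this, ← Real.log_pow]
  refine Real.log_le_log (by positivity) ?_
  exact_mod_cast (Nat.lt_pow_succ_log_self (by norm_num) l).le

/-- There are `O(log l)` octaves with at most `2 ^ β K` blocks each, by monotonicity; the harmonic
number adds only `O(log l)`. -/
theorem cap_succ_le (hβ : ∀ k, β k ≤ k) (hm : Monotone β) {l K : ℕ} (hl : 4 ≤ l)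
    (hK : Nat.log 2 l ≤ K) : cap β (l + 1) ≤ 2 ^ β K * (8 * Real.log l) := by
  have hl0 : (0 : ℝ) < l := by exact_mod_cast (by omega : 0 < l)
  have hb : (1 : ℝ) ≤ 2 ^ β K := one_le_pow₀ (by norm_num)
  have h1 : (starts β (l + 1) : ℝ) ≤ (Nat.log 2 l + 1) * 2 ^ β K + 1 := by
    have h2 : starts β (l + 1) ≤ starts β l + 1 := by
      rw [starts_succ]; split_ifs <;> omega
    have h3 : starts β l ≤ (Nat.log 2 l + 1) * 2 ^ β K := by
      refine (starts_le_sum hβ l).trans ?_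
      have := Finset.sum_le_card_nsmul (Finset.range (Nat.log 2 l + 1)) (fun k => 2 ^ β k) (2 ^ β K)
        fun k hk => Nat.pow_le_pow_right (by norm_num) (hm (by have := Finset.mem_range.1 hk; omega))
      simpa using this
    exact_mod_cast h2.trans (Nat.add_le_add_right h3 1)
  have h4 : (harmonic (l + 1) : ℝ) ≤ 1 + Real.log (l + 1 : ℕ) := harmonic_le_one_add_log (l + 1)
  have hlog1 : 1 ≤ Real.log l := by
    rw [Real.le_log_iff_exp_le hl0]
    have : (4 : ℝ) ≤ l := by exact_mod_cast hl
    linarith [Real.exp_one_lt_d9]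
  have h5 : Real.log (l + 1 : ℕ) ≤ Real.log l + Real.log 2 := by
    rw [← Real.log_mul hl0.ne' (by norm_num)]
    refine Real.log_le_log (by positivity) ?_
    push_cast
    have : (4 : ℝ) ≤ l := by exact_mod_cast hl
    linarith
  have h6 := natLog_le_log l (by omega)
  have h7 := Real.log_two_gt_d9
  have h8 := Real.log_two_lt_d9
  have h9 : (Nat.log 2 l : ℝ) ≤ 1.5 * Real.log l := by nlinarith [Nat.cast_nonneg (α := ℝ) (Nat.log 2 l)]
  unfold cap
  nlinarith

end NodeState

/-! ### Choice of the scales -/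

namespace Chan

open CoinTree

variable {β : ℕ → ℕ}

/-- With `y` the fourth root, `log x = 4 * log y ≤ 4 * y`, and `2 ^ 12 * y ≤ y ^ 2` as `y ≥ 2 ^ 12`.
-/
theorem log_le_sqrt_of_large {x : ℕ} (hx : 2 ^ 48 ≤ x) : 1024 * Real.log x ≤ √x := by
  have hx0 : (0 : ℝ) < x := by exact_mod_cast (by omega : 0 < x)
  have hxr : (2 : ℝ) ^ 48 ≤ x := by exact_mod_cast hx
  set y := √(√(x : ℝ)) with hy
  have hs : √(x : ℝ) = y * y := (Real.mul_self_sqrt (Real.sqrt_nonneg _)).symm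
  have hy0 : 0 < y := Real.sqrt_pos.2 (Real.sqrt_pos.2 hx0)
  have hy2 : 2 ^ 12 ≤ y := by
    refine Real.le_sqrt_of_sq_le (Real.le_sqrt_of_sq_le ?_)
    linarith
  have hlog : Real.log x = 4 * Real.log y := by
    have : (x : ℝ) = y ^ 4 := by
      rw [show y ^ 4 = (y * y) * (y * y) by ring, ← hs, Real.mul_self_sqrt hx0.le]
    rw [this, Real.log_pow]; norm_num
  have := Real.log_le_sub_one_of_pos hy0
  rw [hlog, hs]
  nlinarith

/-- The nodes in backoff make little noise in the first `T / 4` slots of a cheap epoch. -/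
theorem noise_budget {F C cp : ℝ} {T : ℕ} (hC : 2 ^ 22 ≤ C) (hF0 : 0 < F) (hT : 2 ^ 30 ≤ T)
    (hcap : cp ≤ F * (8 * Real.log T)) :
    (4 * cp * (T / (C * F)) + 12 * Real.log T) * 2 ^ 10 ≤ (T / 4 : ℕ) * Real.log (T / 4 : ℕ) := by
  have hC0 : 0 < C := lt_of_lt_of_le (by norm_num) hC
  have hTr : (2 : ℝ) ^ 30 ≤ T := by exact_mod_cast hT
  have hT0 : (0 : ℝ) < T := lt_of_lt_of_le (by norm_num) hTr
  have hlog0 : 0 ≤ Real.log T := Real.log_natCast_nonneg T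
  obtain ⟨q, hq⟩ : ∃ q, q = T / 4 := ⟨_, rfl⟩
  rw [← hq]
  have hqr : (T : ℝ) ≤ 8 * q := by exact_mod_cast (by omega : T ≤ 8 * q)
  have hq8 : (8 : ℝ) ≤ q := by exact_mod_cast (by omega : 8 ≤ q)
  have hlq : Real.log T ≤ 2 * Real.log q := by
    have h2 := Real.log_le_log hT0 (show (T : ℝ) ≤ (q : ℝ) ^ 2 by nlinarith)
    rwa [Real.log_pow] at h2
  have h1 : (4 * cp) * (T / (C * F)) ≤ T * Real.log T / 2 ^ 17 := by
    have h2 : (4 * cp) * (T / (C * F)) ≤ (4 * (F * (8 * Real.log T))) * (T / (C * F)) := by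
      gcongr
    refine h2.trans ?_
    have h3 : (4 * (F * (8 * Real.log T))) * (T / (C * F)) = 32 * (T * Real.log T) / C := by
      field_simp; ring
    rw [h3, div_le_div_iff₀ hC0 (by norm_num)]
    have : 0 ≤ T * Real.log T := by positivity
    nlinarith
  have h3 : (T : ℝ) * Real.log T ≤ 16 * (q * Real.log q) := by
    have : (T : ℝ) * Real.log T ≤ (8 * q) * (2 * Real.log q) :=
      mul_le_mul hqr hlq hlog0 (by positivity)
    linarith
  have h4 : 2 ^ 30 * Real.log T ≤ T * Real.log T := mul_le_mul_of_nonneg_right hTr hlog0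
  norm_num at h1 h4 ⊢
  linarith

set_option maxHeartbeats 800000 in
/-- Parameters for an epoch of length `T`. -/
theorem exists_epochScale {F G C : ℝ} {T j k : ℕ} (hk : k = Nat.log 2 T) (hhalf : ∀ i, β i ≤ i / 2)
    (hm : Monotone β) (hj : 4 ≤ j) (hjk : 64 * j + 200 ≤ k)
    (hb : 2 ^ β k * (k + 1) ^ 2 * 2 ^ 60 ≤ 2 ^ (k / 2)) (h4 : ∀ i, k ≤ 2 * i → i ≤ k → β k ≤ β i + 2)
    (hsum : ∀ i, k ≤ 2 * i → i ≤ k → 64 * k ≤ 2 ^ β i * j ^ 2)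
    (hC : 2 ^ 22 ≤ C) (hF : 2 ^ β k ≤ F) (hG : 2 ^ (4 * j + 18) ≤ C * G) :
    ∃ ρ D k0 k1 s, EpochScale β F G C ρ D T j k0 k1 s := by
  have hT0 : T ≠ 0 := by rintro rfl; simp at hk; omega
  have hT1 : 2 ^ k ≤ T := by rw [hk]; exact Nat.pow_log_le_self 2 hT0
  have hT2 : T < 2 ^ (k + 1) := by rw [hk]; exact Nat.lt_pow_succ_log_self (by norm_num) T
  have hT200 : 2 ^ 200 ≤ T := (Nat.pow_le_pow_right (by norm_num) (by omega)).trans hT1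
  have hβ : ∀ i, β i ≤ i := fun i => (hhalf i).trans (Nat.div_le_self _ _)
  have hTr : (0 : ℝ) < T := by exact_mod_cast (by omega : 0 < T)
  have hC0 : 0 < C := lt_of_lt_of_le (by norm_num) hC
  have hbk : (1 : ℝ) ≤ 2 ^ β k := one_le_pow₀ (by norm_num)
  have hF0 : 0 < F := by linarith
  have hG0 : 0 < G := by
    have : 0 < C * G := lt_of_lt_of_le (by positivity) hG
    exact pos_of_mul_pos_right this hC0.le
  have l2a := Real.log_two_gt_d9
  have l2b := Real.log_two_lt_d9
  have hkr : (200 : ℝ) ≤ k := by exact_mod_cast (by omega : 200 ≤ k)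
  have hlogT : Real.log T ≤ k + 1 := by
    have := log_le_natLog T
    rw [← hk] at this
    nlinarith
  have hlogT1 : 100 ≤ Real.log T := by
    have := natLog_le_log T (by omega)
    rw [← hk] at this
    nlinarith
  have hcap : cap β (T + 1) ≤ 2 ^ β k * (8 * Real.log T) :=
    cap_succ_le hβ hm (by omega) (by omega)
  have hcap0 := cap_nonneg β (T + 1)
  have hsn : smallNoise β T * 2 ^ 44 ≤ 2 ^ (k / 2) := by
    have h1 : smallNoise β T ≤ 2 ^ β k * ((k : ℝ) + 1) ^ 2 * 2 ^ 16 := by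
      unfold smallNoise
      have h2 : 4 * cap β (T + 1) * (1024 * Real.log T) ≤ 4 * (2 ^ β k * (8 * Real.log T)) * (1024 * Real.log T) := by
        gcongr
      have h3 : Real.log T ^ 2 ≤ ((k : ℝ) + 1) ^ 2 := by gcongr
      have h4 : 12 * Real.log T ≤ 2 ^ β k * Real.log T ^ 2 * 2 ^ 10 := by nlinarith
      have h5 : (2 : ℝ) ^ β k * Real.log T ^ 2 ≤ 2 ^ β k * ((k : ℝ) + 1) ^ 2 := by gcongr
      nlinarith
    have h2 : (2 : ℝ) ^ β k * ((k : ℝ) + 1) ^ 2 * 2 ^ 60 ≤ 2 ^ (k / 2) := by exact_mod_cast hb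
    nlinarith
  have hsn0 : 0 ≤ smallNoise β T := by
    unfold smallNoise
    have : 0 ≤ Real.log T := by linarith
    positivity
  -- The window ends at `2 ^ k1 ≤ T / 64`, to be traversed early in the epoch, and has `2 * j`
  -- octaves. By `hjk` it lies in the upper half of the octaves below `k`.
  set k1 := k - 6 with hk1
  set k0 := k1 - 2 * j with hk0
  set s := 2 ^ k0 - 1 with hs
  have hs1 : 2 ^ (k0 - 1) ≤ s := by
    have : 2 ^ k0 = 2 * 2 ^ (k0 - 1) := by rw [← pow_succ']; congr 1; omega
    have := Nat.one_le_two_pow (n := k0 - 1)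
    omega
  have hs1r : (2 : ℝ) ^ (k0 - 1) ≤ s := by exact_mod_cast hs1
  have hs2 : 2 ^ 48 ≤ s := (Nat.pow_le_pow_right (by norm_num) (by omega)).trans hs1
  have hs0 : (0 : ℝ) < s := by exact_mod_cast (by omega : 0 < s)
  have hlogs : ((k0 - 1 : ℕ) : ℝ) * Real.log 2 ≤ Real.log s := by
    rw [← Real.log_pow]; exact Real.log_le_log (by positivity) hs1r
  have hTk : (T : ℝ) ≤ 2 ^ (k + 1) := by exact_mod_cast hT2.le
  -- Blocks in the window have length at least `2 ^ k0 / 2 ^ β k`.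
  set ρ : ℝ := 2 ^ j * 2 ^ β k / 2 ^ k0 with hρ
  have hρ0 : 0 ≤ ρ := by positivity
  -- Up to a constant factor `ρ * T` is `2 ^ (3 * j) * 2 ^ β k`, and `C * G ≥ 2 ^ (4 * j + 18)`
  -- takes care of the jams. The noise is at most `2 ^ (k / 2)`, far below the block lengths.
  have hD : ρ * (T / (C * G) + smallNoise β T) ≤ 2 * 2 ^ β k := by
    have h1 : ρ * (T / (C * G)) ≤ 2 ^ β k := by
      have h2 : (T : ℝ) / (C * G) ≤ 2 ^ (k + 1) / 2 ^ (4 * j + 18) := by gcongr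
      refine (mul_le_mul_of_nonneg_left h2 hρ0).trans ?_
      rw [hρ, div_mul_div_comm, div_le_iff₀ (by positivity)]
      have h3 : (2 : ℝ) ^ j * 2 ^ (k + 1) ≤ 2 ^ k0 * 2 ^ (4 * j + 18) := by
        rw [← pow_add, ← pow_add]
        exact pow_le_pow_right₀ (by norm_num) (by omega)
      nlinarith
    have h2 : ρ * smallNoise β T ≤ 2 ^ β k := by
      have h3 : smallNoise β T ≤ 2 ^ (k / 2) := by nlinarith
      refine (mul_le_mul_of_nonneg_left h3 hρ0).trans ?_
      rw [hρ, div_mul_eq_mul_div, div_le_iff₀ (by positivity)]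
      have h3 : (2 : ℝ) ^ j * 2 ^ (k / 2) ≤ 2 ^ k0 := by
        rw [← pow_add]
        exact pow_le_pow_right₀ (by norm_num) (by omega)
      nlinarith
    linarith
  refine ⟨ρ, ρ * (T / (C * G) + smallNoise β T), k0, k1, s, hβ, by omega, hF0, hG0, by linarith, ?_, by omega,
    by omega, ?_, hρ0, ?_, ?_, ?_, by omega, fun x hx => log_le_sqrt_of_large (by omega), ?_, ?_, ?_, le_rfl, ?_⟩
  · refine le_trans (le_of_eq ?_) hT1
    rw [show 64 = 2 ^ 6 by norm_num, ← pow_add]; congr 1; omega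
  · intro y hy1 hy2
    have e1 : k0 ≤ Nat.log 2 y := by
      have := Nat.log_mono_right (b := 2) hy1
      rwa [Nat.log_pow (by norm_num)] at this
    have := hhalf (Nat.log 2 y)
    exact Nat.pow_le_pow_right (by norm_num) (by omega)
  · intro y hy1 hy2
    have e1 : k0 ≤ Nat.log 2 y := by
      have := Nat.log_mono_right (b := 2) hy1
      rwa [Nat.log_pow (by norm_num)] at this
    have e2 : Nat.log 2 y < k1 := Nat.log_lt_of_lt_pow (by have := Nat.one_le_two_pow (n := k0); omega) hy2
    have e3 := hhalf (Nat.log 2 y)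
    have e4 : β (Nat.log 2 y) ≤ β k := hm (by omega)
    rw [rate, hρ, blockLen, div_le_div_iff₀ (by positivity) (by positivity)]
    push_cast
    rw [← pow_add, ← pow_add, ← pow_add]
    exact pow_le_pow_right₀ (by norm_num) (by omega)
  · have := Nat.one_le_two_pow (n := k0); omega
  · have h1 := log_le_natLog T
    rw [← hk] at h1
    have h2 : (7 : ℝ) * (k + 1) ≤ 8 * ((k0 - 1 : ℕ) : ℝ) := by
      exact_mod_cast (by omega : 7 * (k + 1) ≤ 8 * (k0 - 1))
    nlinarith
  · have h1 : (2 : ℝ) ^ (k + 1) * 2 ^ 10 ≤ 2 ^ (4 * j + 18) * 2 ^ (k0 - 1) := by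
      rw [← pow_add, ← pow_add]
      exact pow_le_pow_right₀ (by norm_num) (by omega)
    have h2 : (2 : ℝ) ^ (4 * j + 18) * 2 ^ (k0 - 1) ≤ C * G * s :=
      mul_le_mul hG hs1r (by positivity) (by positivity)
    nlinarith
  · exact noise_budget hC hF0 (le_trans (Nat.pow_le_pow_right (by norm_num) (by norm_num)) hT200)
      (hcap.trans (mul_le_mul_of_nonneg_right hF (by linarith)))
  · have h1 : (2 : ℝ) ^ (k / 2) ≤ 2 ^ (k0 - 1) := pow_le_pow_right₀ (by norm_num) (by omega)
    have h2 : 1 ≤ Real.log s := by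
      have : (2 : ℝ) ≤ (k0 - 1 : ℕ) := by exact_mod_cast (by omega : 2 ≤ k0 - 1)
      nlinarith
    have h3 : (s : ℝ) ≤ s * Real.log s := le_mul_of_one_le_right hs0.le h2
    nlinarith
  · set N := ∑ i ∈ Finset.Ico k0 k1, 2 ^ β i with hN
    have hj0 : (0 : ℝ) < j := by exact_mod_cast (by omega : 0 < j)
    have hj4 : (4 : ℝ) ≤ j := by exact_mod_cast hj
    -- The average of the two lower bounds `2 ^ β k / 4` and `64 * k / j ^ 2`.
    have hlow : ∀ i ∈ Finset.Ico k0 k1, ((2 : ℝ) ^ β k / 8 + 32 * k / j ^ 2) ≤ 2 ^ β i := by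
      intro i hi
      obtain ⟨hi1, hi2⟩ := Finset.mem_Ico.1 hi
      have h1 := h4 i (by omega) (by omega)
      have h2 := hsum i (by omega) (by omega)
      have h1' : (2 : ℝ) ^ β k ≤ 2 ^ β i * 4 := by
        calc (2 : ℝ) ^ β k ≤ 2 ^ (β i + 2) := pow_le_pow_right₀ (by norm_num) h1
          _ = 2 ^ β i * 4 := by rw [pow_add]; norm_num
      have h2' : 64 * (k : ℝ) ≤ 2 ^ β i * (j : ℝ) ^ 2 := by exact_mod_cast h2
      have h3 : 64 * (k : ℝ) / j ^ 2 ≤ 2 ^ β i := by rw [div_le_iff₀ (by positivity)]; exact h2'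
      have h5 : 32 * (k : ℝ) / j ^ 2 = 64 * (k : ℝ) / j ^ 2 / 2 := by ring
      linarith
    have hN1 := Finset.card_nsmul_le_sum _ _ _ hlow
    rw [Nat.card_Ico, show k1 - k0 = 2 * j by omega, nsmul_eq_mul] at hN1
    have hN2 : (N : ℝ) = ∑ i ∈ Finset.Ico k0 k1, (2 : ℝ) ^ β i := by rw [hN]; push_cast; rfl
    rw [← hN2] at hN1
    -- Each of `N` blocks gives a factor `2 ^ (-j)`. Over `2 * j` octaves the first half of the
    -- average beats the tolls, since `j ≥ 4`, and the second yields `T ^ (-7)`.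
    have hmain : 2 * 2 ^ β k + 7 * (k + 1) ≤ j * Real.log 2 * N := by
      have h1 : j * Real.log 2 * (((2 * j : ℕ) : ℝ) * ((2 : ℝ) ^ β k / 8 + 32 * k / j ^ 2))
          ≤ j * Real.log 2 * N := mul_le_mul_of_nonneg_left hN1 (by positivity)
      have h2 : j * Real.log 2 * (((2 * j : ℕ) : ℝ) * ((2 : ℝ) ^ β k / 8 + 32 * k / j ^ 2))
          = Real.log 2 * (j ^ 2 * 2 ^ β k / 4 + 64 * k) := by
        push_cast; field_simp; ring
      rw [h2] at h1
      have h3 : 16 * (2 : ℝ) ^ β k ≤ j ^ 2 * 2 ^ β k := by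
        have : (16 : ℝ) ≤ j ^ 2 := by nlinarith
        nlinarith
      nlinarith
    have e1 : (1 / 2 ^ j : ℝ) ^ N = Real.exp (-(j * Real.log 2 * N)) := by
      rw [show -(j * Real.log 2 * (N : ℝ)) = (N : ℝ) * -(j * Real.log 2) by ring, Real.exp_nat_mul,
        Real.exp_neg, Real.exp_nat_mul, Real.exp_log (by norm_num), one_div]
    rw [e1, ← Real.exp_add]
    refine Real.exp_le_exp.2 ?_
    linarith

end Chan

/-! ### Numbers of blocks and lengths of gaps -/

theorem exists_cube_le_two_pow (C : ℝ) : ∃ N : ℕ, ∀ k ≥ N, C * ((k : ℝ) + 1) ^ 3 ≤ 2 ^ (k / 2) := by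
  have h := tendsto_pow_const_mul_const_pow_of_abs_lt_one 3 (r := (1 / 2 : ℝ)) (by norm_num [abs_of_pos])
  have hC : (0 : ℝ) < 1 / (64 * (|C| + 1)) := by positivity
  obtain ⟨N, hN⟩ := eventually_atTop.1 (h.eventually (eventually_lt_nhds hC))
  refine ⟨2 * N + 2, fun k hk => ?_⟩
  have h1 := hN (k / 2) (by omega)
  have h2 : ((k : ℝ) + 1) ≤ 4 * (k / 2 : ℕ) := by exact_mod_cast (by omega : k + 1 ≤ 4 * (k / 2))
  generalize k / 2 = m at h1 h2
  have h3 : (0 : ℝ) < 2 ^ m := by positivity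
  rw [one_div_pow, mul_one_div, div_lt_div_iff₀ h3 (by positivity), one_mul] at h1
  have h4 : ((k : ℝ) + 1) ^ 3 ≤ (4 * m) ^ 3 := by gcongr
  have h5 : C * ((k : ℝ) + 1) ^ 3 ≤ (|C| + 1) * ((k : ℝ) + 1) ^ 3 :=
    mul_le_mul_of_nonneg_right (by linarith [le_abs_self C]) (by positivity)
  have h6 : (|C| + 1) * ((k : ℝ) + 1) ^ 3 ≤ (|C| + 1) * (4 * m) ^ 3 :=
    mul_le_mul_of_nonneg_left h4 (by positivity)
  have h7 : (|C| + 1) * (4 * (m : ℝ)) ^ 3 = m ^ 3 * (64 * (|C| + 1)) := by ring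
  linarith

/-- Numbers of blocks in the octaves. -/
theorem exists_blocks {u : ℕ → ℝ} {i₁ : ℕ} {K c : ℝ} (hc : 0 < c)
    (h1 : ∀ i, i₁ ≤ i → c ≤ u i ∧ u i ≤ i) (h2 : ∀ i i', i₁ ≤ i → i ≤ i' → i' ≤ 2 * i → u i' ≤ 2 * u i)
    (h3 : ∀ i i', i₁ ≤ i → i ≤ i' → u i ≤ K * u i') :
    ∃ β : ℕ → ℕ, Monotone β ∧ (∀ i, β i ≤ i / 2) ∧ ∃ (k₂ : ℕ) (C₃ : ℝ), ∀ k ≥ k₂,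
      2 ^ 15 * u k ≤ 2 ^ β k ∧ 2 ^ β k ≤ C₃ * u k ∧ ∀ i, k ≤ 2 * i → i ≤ k → β k ≤ β i + 2 := by
  -- Rounding up to a power of two costs a factor two; `2 ^ 15` is what the sum over the window
  -- requires later.
  set b : ℕ → ℕ := fun i => Nat.clog 2 ⌈2 ^ 15 * u i⌉₊ with hb
  have hb1 : ∀ i, 2 ^ 15 * u i ≤ 2 ^ b i := fun i => by
    refine (Nat.le_ceil _).trans ?_
    have h := (Nat.cast_le (α := ℝ)).2 (Nat.le_pow_clog (b := 2) (by norm_num) ⌈2 ^ 15 * u i⌉₊)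
    rwa [Nat.cast_pow, Nat.cast_ofNat] at h
  have hb2 : ∀ i, i₁ ≤ i → (2 : ℝ) ^ b i ≤ 2 * (2 ^ 15 * u i + 1) := by
    intro i hi
    have hu : 0 < u i := hc.trans_le (h1 i hi).1
    have h4 : (⌈2 ^ 15 * u i⌉₊ : ℝ) < 2 ^ 15 * u i + 1 := Nat.ceil_lt_add_one (by positivity)
    by_cases h5 : 1 < ⌈2 ^ 15 * u i⌉₊
    · have h6 := Nat.pow_pred_clog_lt_self (b := 2) (by norm_num) h5
      have h7 : 0 < b i := Nat.clog_pos (by norm_num) h5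
      have h8 : 2 ^ b i < 2 * ⌈2 ^ 15 * u i⌉₊ := by
        have : 2 ^ b i = 2 * 2 ^ (b i).pred := by rw [← pow_succ']; congr 1; simp only [Nat.pred_eq_sub_one]; omega
        rw [this]
        exact Nat.mul_lt_mul_of_pos_left h6 (by norm_num)
      have h9 : (2 : ℝ) ^ b i < 2 * (⌈2 ^ 15 * u i⌉₊ : ℝ) := by exact_mod_cast h8
      linarith
    · have h6 : b i = 0 := Nat.clog_of_right_le_one (by omega) 2
      rw [h6, pow_zero]
      linarith
  have hb3 : ∀ i i', i₁ ≤ i → i ≤ i' → i' ≤ 2 * i → b i' ≤ b i + 2 := by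
    intro i i' hi hii hi'
    have h4 : ⌈2 ^ 15 * u i'⌉₊ ≤ 2 ^ (b i + 2) := by
      refine Nat.ceil_le.2 ?_
      have h5 := h2 i i' hi hii hi'
      have h6 := hb1 i
      push_cast
      rw [pow_add]
      have : (0 : ℝ) < 2 ^ b i := by positivity
      linarith
    exact Nat.clog_le_of_le_pow h4
  -- The running maximum makes the exponent monotone, and by `h3` it still gives `O(u k)` blocks.
  set sp : ℕ → ℕ := fun k => (Finset.Icc i₁ k).sup b with hsp
  have sp_mono : Monotone sp := fun k k' h => Finset.sup_mono (Finset.Icc_subset_Icc_right h)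
  have le_sp : ∀ k, i₁ ≤ k → b k ≤ sp k := fun k hk =>
    Finset.le_sup (f := b) (Finset.mem_Icc.2 ⟨hk, le_rfl⟩)
  have sp_le : ∀ k, i₁ ≤ k → (2 : ℝ) ^ sp k ≤ (2 ^ 16 * K + 2 / c) * u k := by
    intro k hk
    obtain ⟨i, hi, he⟩ := Finset.exists_mem_eq_sup (Finset.Icc i₁ k) ⟨k, Finset.mem_Icc.2 ⟨hk, le_rfl⟩⟩ b
    have hi := Finset.mem_Icc.1 hi
    change (2 : ℝ) ^ (Finset.Icc i₁ k).sup b ≤ _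
    rw [he]
    have h4 := hb2 i hi.1
    have h5 := h3 i k hi.1 hi.2
    have h6 : 1 ≤ u k / c := by rw [le_div_iff₀ hc, one_mul]; exact (h1 k hk).1
    have h7 : 2 / c * u k = 2 * (u k / c) := by ring
    linarith
  obtain ⟨N, hN⟩ := exists_cube_le_two_pow |2 ^ 16 * K + 2 / c|
  have sp_half : ∀ k, N ≤ k → i₁ ≤ k → sp k ≤ k / 2 := by
    intro k hk hk'
    have h4 := sp_le k hk'
    have h5 := hN k hk
    have h6 := h1 k hk'
    have hk0 : (0 : ℝ) ≤ k := Nat.cast_nonneg k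
    have hu : 0 ≤ u k := hc.le.trans h6.1
    have h7 : (2 ^ 16 * K + 2 / c) * u k ≤ |2 ^ 16 * K + 2 / c| * ((k : ℝ) + 1) ^ 3 := by
      refine mul_le_mul (le_abs_self _) ?_ hu (abs_nonneg _)
      nlinarith [mul_nonneg hk0 hk0, mul_nonneg (mul_nonneg hk0 hk0) hk0]
    have h8 : (2 : ℝ) ^ sp k ≤ 2 ^ (k / 2) := by linarith
    exact (pow_le_pow_iff_right₀ (by norm_num)).1 h8
  -- The cap `k / 2` is active only for small `k`, because `u k ≤ k` grows more slowly than `2 ^ (k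
  -- / 2)`.
  refine ⟨fun k => min (k / 2) (sp k), fun k k' h => min_le_min (Nat.div_le_div_right h) (sp_mono h),
    fun i => min_le_left _ _, 2 * (N + i₁), 2 ^ 16 * K + 2 / c, fun k hk => ?_⟩
  have e : ∀ i, k ≤ 2 * i → min (i / 2) (sp i) = sp i := fun i hi =>
    min_eq_right (sp_half i (by omega) (by omega))
  simp only
  rw [e k (by omega)]
  refine ⟨(hb1 k).trans (pow_le_pow_right₀ (by norm_num) (le_sp k (by omega))), sp_le k (by omega), ?_⟩
  intro i hi hik
  rw [e i hi]
  refine Finset.sup_le fun i' hi' => ?_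
  have hi' := Finset.mem_Icc.1 hi'
  by_cases h : i' ≤ i
  · have : b i' ≤ sp i := Finset.le_sup (f := b) (Finset.mem_Icc.2 ⟨hi'.1, h⟩)
    omega
  · have h5 := hb3 i i' (by omega) (by omega) (by omega)
    have h6 := le_sp i (by omega)
    omega

/-- The right side is a constant times `l ^ (7 / 8)`, which dominates the logarithm. -/
theorem exists_gap_scale : ∃ l₀ : ℕ, 2 ^ 28 ≤ l₀ ∧ ∀ l : ℕ, l₀ ≤ l →
    6 * Real.log l ≤ Real.exp (-(8 + Real.log l / 8)) * (l / 2 ^ 19) := by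
  set δ : ℝ := Real.exp (-8) / (6 * 2 ^ 19) with hδ
  have hδ0 : 0 < δ := by positivity
  have h := (isLittleO_log_rpow_atTop (r := 7 / 8) (by norm_num)).bound hδ0
  obtain ⟨x₀, hx₀⟩ := eventually_atTop.1 h
  refine ⟨2 ^ 28 + ⌈x₀⌉₊, by omega, fun l hl => ?_⟩
  have hl0 : (0 : ℝ) < l := by exact_mod_cast (by omega : 0 < l)
  have h1 := hx₀ l ((Nat.le_ceil x₀).trans (by exact_mod_cast (by omega : ⌈x₀⌉₊ ≤ l)))
  rw [Real.norm_of_nonneg (Real.log_natCast_nonneg l), Real.norm_of_nonneg (by positivity)] at h1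
  have h2 : Real.exp (-(8 + Real.log l / 8)) * l = Real.exp (-8) * (l : ℝ) ^ (7 / 8 : ℝ) := by
    rw [Real.rpow_def_of_pos hl0]
    nth_rewrite 2 [← Real.exp_log hl0]
    rw [← Real.exp_add, ← Real.exp_add]
    congr 1; ring
  rw [mul_div_assoc', h2]
  have h3 : δ * (l : ℝ) ^ (7 / 8 : ℝ) = Real.exp (-8) * (l : ℝ) ^ (7 / 8 : ℝ) / 2 ^ 19 / 6 := by
    rw [hδ]; ring
  linarith

/-! ### From scales to throughput -/

namespace Chan

open CoinTree

variable {β : ℕ → ℕ}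

theorem active_le_length {e : List (Option ℕ) → ℕ × Bool} (p : List (Finset ℕ)) :
    (of β e p).active ≤ p.length := by
  induction p with
  | nil => exact le_rfl
  | cons S p ih =>
    have e4 : (of β e (S :: p)).active =
        (of β e p).active + if ((of β e p).V e).Nonempty then 1 else 0 := by
      rw [of_cons]; simp only [step]
    rw [e4, List.length_cons]
    split_ifs <;> omega

/-- The algorithm with few blocks works if its parameters fit. -/
theorem achievesThroughput_of_scale {g : ℝ → ℝ} {T₀ : ℕ} (hT₀ : 1 ≤ T₀) (hm : Monotone β)
    (hhalf : ∀ i, β i ≤ i / 2) (hg0 : ∀ x, 0 < x → 0 < g x)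
    (hg : ∀ t : ℕ, T₀ ≤ t → (2 : ℝ) ^ 22 * (1 + 2 ^ 31) ≤ g t)
    (hscale : ∀ t T : ℕ, T₀ ≤ T → T ≤ t → ∃ j ρ D k0 k1 s, EpochScale β (2 ^ β (Nat.log 2 t))
      (g t / (2 ^ 22 * (1 + 2 ^ 31))) (2 ^ 22) ρ D T j k0 k1 s) :
    ∃ K : ℝ, 0 < K ∧ AchievesThroughput (backoffAlgorithm β)
      (fun x => if x < T₀ then (T₀ : ℝ) else K * 2 ^ β (Nat.log 2 ⌊x⌋₊)) g := by
  obtain ⟨l₀, hl₀, hlog⟩ := exists_gap_scale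
  have hβ : ∀ i, β i ≤ i := fun i => (hhalf i).trans (Nat.div_le_self _ _)
  set C : ℝ := 2 ^ 22 with hC
  have hC0 : 0 < C := by positivity
  -- The summand `T₀ ^ 6` makes the tail bound trivial for lengths below `T₀`.
  set A : ℝ := 2 ^ 24 + (T₀ : ℝ) ^ 6 with hA
  have hA1 : 2 ^ 24 ≤ A := le_add_of_nonneg_right (by positivity)
  set K : ℝ := (2 * C + 8 * C * 2 ^ 28) + (8 * C * (l₀ + 1) + 3 * C + 1) + (2 + 8 * C) * (16 * A + 12) with hK
  have hA0 : 0 ≤ A := le_trans (by norm_num) hA1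
  refine ⟨K, by positivity, achievesThroughput_of_Pr β _ g fun e t ht n hn => ?_⟩
  have hn0 : (0 : ℝ) < n := by exact_mod_cast hn
  have hgt : 0 < g t := hg0 t (by exact_mod_cast ht)
  simp only [Nat.cast_lt, Nat.floor_natCast]
  -- For small `t` even a single arrival pays for all `t` slots.
  by_cases htT : t < T₀
  · refine le_trans ((tree β e).Pr_mono (Q' := fun _ => False) ?_)
      (((tree β e).Pr_false _ _).le.trans (by positivity))
    rintro p hp ⟨h1, h2⟩
    rw [if_pos htT] at h2
    have h3 := active_le_length (β := β) (e := e) p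
    rw [hp.length_eq, List.length_nil, zero_add] at h3
    have h4 : ((of β e p).active : ℝ) ≤ t := by exact_mod_cast h3
    have h5 : (t : ℝ) ≤ T₀ := by exact_mod_cast htT.le
    have h6 : (1 : ℝ) ≤ (of β e p).arrived := by exact_mod_cast hn.trans h1
    have h7 : 0 ≤ ((of β e p).jammed : ℝ) * g t := by positivity
    have h8 : (T₀ : ℝ) ≤ (of β e p).arrived * T₀ := le_mul_of_one_le_left (Nat.cast_nonneg _) h6
    linarith
  have hT : T₀ ≤ t := not_lt.1 htT
  have hF : (1 : ℝ) ≤ 2 ^ β (Nat.log 2 t) := one_le_pow₀ (by norm_num)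
  have hG : 1 ≤ g t / (2 ^ 22 * (1 + 2 ^ 31)) := by
    rw [le_div_iff₀ (by positivity), one_mul]; exact hg t hT
  have hpow : ∀ T : ℕ, 1 ≤ T → Real.exp (-(6 * Real.log T)) = 1 / (T : ℝ) ^ 6 := by
    intro T hT1
    have : (0 : ℝ) < T := by exact_mod_cast hT1
    rw [Real.exp_neg, show (6 : ℝ) * Real.log T = ((6 : ℕ) : ℝ) * Real.log T by norm_num,
      Real.exp_nat_mul, Real.exp_log this, one_div]
  have hmain := Pr_active_le (β := β) (e := e) (F := 2 ^ β (Nat.log 2 t))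
    (G := g t / (2 ^ 22 * (1 + 2 ^ 31))) (C := C) (l₀ := l₀) (A := A) (t := t) hF (by linarith) hC0.le hA1
    ?_ ?_ hn
  · refine le_trans ((tree β e).Pr_mono ?_) hmain
    rintro p - ⟨h1, h2⟩
    rw [if_neg htT] at h2
    refine ⟨h1, lt_of_le_of_lt (le_of_eq ?_) h2⟩
    -- The scaling of `G` is chosen so that a jam costs exactly `g t`, without a constant.
    have e1 : (C + 8 * C * 2 ^ 28) * (g t / (2 ^ 22 * (1 + 2 ^ 31))) = g t := by
      have : C + 8 * C * 2 ^ 28 = 2 ^ 22 * (1 + 2 ^ 31) := by rw [hC]; norm_num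
      rw [this, mul_div_cancel₀ _ (by positivity)]
    rw [e1, ← hK]
    ring
  · intro p T hp hs hT1 hTt
    have hTr : (0 : ℝ) < T := by exact_mod_cast hT1
    by_cases h : T₀ ≤ T
    · obtain ⟨j, ρ, D, k0, k1, s, H⟩ := hscale t T h hTt
      refine (Pr_longEpoch_le H hp hs.1 hs.2).trans ?_
      rw [hpow T hT1, mul_one_div]
      gcongr
      linarith
    · refine ((tree β e).Pr_le_one _ _ _).trans ?_
      rw [le_div_iff₀ (by positivity), one_mul]
      have : (T : ℝ) ^ 6 ≤ (T₀ : ℝ) ^ 6 := by gcongr; omega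
      rw [hA]
      linarith
  · intro p T hp hs hT1 hTt
    have hTr : (0 : ℝ) < T := by exact_mod_cast hT1
    by_cases h : l₀ ≤ T
    · refine (Pr_silentGap_le (by linarith) hG (cap_succ_le hβ hm (by omega) (Nat.log_mono_right hTt))
        hl₀ (hlog T h) hp hs.1).trans ?_
      rw [hpow T hT1, mul_one_div]
      gcongr
      linarith
    · refine le_trans ((tree β e).Pr_mono (Q' := fun _ => False) fun p' _ hB => h hB.2.1)
        (((tree β e).Pr_false _ _).le.trans (by positivity))

end Chan

/-! ### Consequences of the hypotheses on `g` -/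

/-- A positive function of the order of a monotone function is quasi-monotone if it is bounded below. -/
theorem exists_quasiMono {h φ : ℝ → ℝ} {c : ℝ} (hc : 0 < c) (hφ : MonotoneOn φ (Set.Ioi 0))
    (hθ : φ =Θ[atTop] h) (hh : ∀ᶠ x in atTop, c ≤ h x) :
    ∃ K x₁ : ℝ, 0 < K ∧ ∀ x y, x₁ ≤ x → x ≤ y → h x ≤ K * h y := by
  obtain ⟨a, ha0, ha⟩ := hθ.1.exists_pos
  obtain ⟨b, hb0, hb⟩ := hθ.2.exists_pos
  obtain ⟨x₁, hx₁⟩ := eventually_atTop.1 ((ha.bound.and hb.bound).and (hh.and (eventually_gt_atTop 0)))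
  by_cases hpos : ∃ x₂ > 0, 0 ≤ φ x₂
  · obtain ⟨x₂, hx₂, hφ₂⟩ := hpos
    refine ⟨b * a, max x₁ x₂, by positivity, fun x y hx hxy => ?_⟩
    obtain ⟨⟨-, h1⟩, h2, h3⟩ := hx₁ x ((le_max_left _ _).trans hx)
    obtain ⟨⟨h4, -⟩, h5, h6⟩ := hx₁ y ((le_max_left _ _).trans (hx.trans hxy))
    have h7 : φ x₂ ≤ φ x := hφ hx₂ h3 ((le_max_right _ _).trans hx)
    have h8 : φ x ≤ φ y := hφ h3 h6 hxy
    rw [Real.norm_of_nonneg (hc.le.trans h2), Real.norm_of_nonneg (hφ₂.trans h7)] at h1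
    rw [Real.norm_of_nonneg (hc.le.trans h5), Real.norm_of_nonneg (hφ₂.trans (h7.trans h8))] at h4
    calc h x ≤ b * φ x := h1
      _ ≤ b * (a * h y) := by gcongr; exact h8.trans h4
      _ = b * a * h y := by ring
  -- Comparison up to constants does not see the sign of `φ`. If `φ` is negative everywhere, its
  -- absolute value is non-increasing, so `h` is bounded as well as bounded below.
  · push Not at hpos
    refine ⟨b * (|φ x₁| + 1) / c, x₁, by positivity, fun x y hx hxy => ?_⟩
    obtain ⟨⟨-, h1⟩, h2, h3⟩ := hx₁ x hx
    obtain ⟨-, h5, -⟩ := hx₁ y (hx.trans hxy)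
    obtain ⟨-, -, h6⟩ := hx₁ x₁ le_rfl
    have h7 : φ x₁ ≤ φ x := hφ h6 h3 hx
    rw [Real.norm_of_nonneg (hc.le.trans h2), Real.norm_of_nonpos (hpos x h3).le] at h1
    calc h x ≤ b * -φ x := h1
      _ ≤ b * (|φ x₁| + 1) := by gcongr; rw [abs_of_neg (hpos x₁ h6)]; linarith
      _ = b * (|φ x₁| + 1) / c * c := by field_simp
      _ ≤ b * (|φ x₁| + 1) / c * h y := by gcongr

/-- What the hypotheses on `g` say from some point on, in terms of `log g`. -/
theorem exists_log_bounds {g φ : ℝ → ℝ}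
    (hg1 : ∀ᶠ x : ℝ in atTop, 1 ≤ g x)
    (hs : SubLogarithmic (10 ^ 4) (fun x => Real.log (g x) ^ 2)) (hφ : MonotoneOn φ (Set.Ioi 0))
    (hθ : φ =Θ[atTop] fun x => Real.log x / Real.log (g x) ^ 2) :
    ∃ x₁ c K : ℝ, 1 ≤ x₁ ∧ 0 < c ∧ 0 < K ∧
      (∀ x, x₁ ≤ x → 100 ≤ Real.log (g x) ∧ c * Real.log (g x) ^ 2 ≤ Real.log x) ∧
      (∀ x y, x₁ ≤ x → x ≤ y → Real.log (g x) ≤ Real.log (g y)) ∧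
      ∀ x y, x₁ ≤ x → x ≤ y →
        Real.log x / Real.log (g x) ^ 2 ≤ K * (Real.log y / Real.log (g y) ^ 2) := by
  obtain ⟨k, hk0, hk⟩ := hs.isBigO_log.exists_pos
  obtain ⟨x₀, hx₀⟩ := hs.eventually_large
  have hA : ∀ᶠ x : ℝ in atTop, 100 ≤ Real.log (g x) ∧ 1 / k * Real.log (g x) ^ 2 ≤ Real.log x := by
    filter_upwards [hk.bound, hg1, eventually_ge_atTop x₀, eventually_ge_atTop 1] with x h1 h2 h3 h4
    have h5 := Real.log_nonneg h2
    rw [Real.norm_of_nonneg (by positivity), Real.norm_of_nonneg (Real.log_nonneg h4)] at h1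
    refine ⟨(pow_le_pow_iff_left₀ (by norm_num) h5 two_ne_zero).1 (le_trans (by norm_num) (hx₀ x h3)), ?_⟩
    rw [one_div, inv_mul_le_iff₀ hk0]
    exact h1
  have hB : ∀ᶠ x : ℝ in atTop, 1 / k ≤ Real.log x / Real.log (g x) ^ 2 := by
    filter_upwards [hA] with x hx
    rw [le_div_iff₀ (by have := hx.1; positivity)]
    exact hx.2
  obtain ⟨K, x₂, hK0, hK⟩ := exists_quasiMono (by positivity) hφ hθ hB
  obtain ⟨x₃, hx₃⟩ := eventually_atTop.1 hA
  refine ⟨max 1 (max x₂ x₃), 1 / k, K, le_max_left _ _, by positivity, hK0,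
    fun x hx => hx₃ x ((le_max_right _ _).trans ((le_max_right _ _).trans hx)), fun x y hx hxy => ?_,
    fun x y hx hxy => hK x y ((le_max_left _ _).trans ((le_max_right _ _).trans hx)) hxy⟩
  have h1 : (0 : ℝ) < x := lt_of_lt_of_le one_pos ((le_max_left _ _).trans hx)
  have h2 : ∀ z, x ≤ z → 0 ≤ Real.log (g z) := fun z hz =>
    le_trans (by norm_num) (hx₃ z ((le_max_right _ _).trans ((le_max_right _ _).trans (hx.trans hz)))).1
  exact (pow_le_pow_iff_left₀ (h2 x le_rfl) (h2 y hxy) two_ne_zero).1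
    (hs.monotone h1 (h1.trans_le hxy) hxy)

/-- The values of `log x / log² g(x)` at powers of two. -/
theorem exists_pow_two_bounds {g : ℝ → ℝ} {x₁ c K : ℝ}
    (h1 : ∀ x, x₁ ≤ x → 100 ≤ Real.log (g x) ∧ c * Real.log (g x) ^ 2 ≤ Real.log x)
    (h2 : ∀ x y, x₁ ≤ x → x ≤ y → Real.log (g x) ≤ Real.log (g y))
    (h3 : ∀ x y, x₁ ≤ x → x ≤ y →
        Real.log x / Real.log (g x) ^ 2 ≤ K * (Real.log y / Real.log (g y) ^ 2)) :
    ∃ i₁ : ℕ, x₁ ≤ 2 ^ i₁ ∧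
      (∀ i, i₁ ≤ i → c ≤ i * Real.log 2 / Real.log (g (2 ^ i)) ^ 2 ∧
        i * Real.log 2 / Real.log (g (2 ^ i)) ^ 2 ≤ i) ∧
      (∀ i i' : ℕ, i₁ ≤ i → i ≤ i' → i' ≤ 2 * i →
        i' * Real.log 2 / Real.log (g (2 ^ i')) ^ 2 ≤ 2 * (i * Real.log 2 / Real.log (g (2 ^ i)) ^ 2)) ∧
      ∀ i i' : ℕ, i₁ ≤ i → i ≤ i' →
        i * Real.log 2 / Real.log (g (2 ^ i)) ^ 2 ≤ K * (i' * Real.log 2 / Real.log (g (2 ^ i')) ^ 2) := by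
  obtain ⟨i₁, hi₁⟩ := pow_unbounded_of_one_lt x₁ (one_lt_two (α := ℝ))
  have hx : ∀ i, i₁ ≤ i → x₁ ≤ 2 ^ i := fun i hi => hi₁.le.trans (pow_le_pow_right₀ (by norm_num) hi)
  have hl2 := Real.log_pos (one_lt_two (α := ℝ))
  refine ⟨i₁, hi₁.le, fun i hi => ?_, fun i i' hi hii h => ?_, fun i i' hi hii => ?_⟩
  · obtain ⟨h4, h5⟩ := h1 _ (hx i hi)
    rw [Real.log_pow] at h5
    refine ⟨(le_div_iff₀ (by positivity)).2 h5, div_le_of_le_mul₀ (by positivity) (by positivity) ?_⟩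
    have : Real.log 2 ≤ 1 := Real.log_two_lt_d9.le.trans (by norm_num)
    gcongr
    nlinarith
  · have h4 := (h1 _ (hx i hi)).1
    have h5 := h2 (2 ^ i) (2 ^ i') (hx i hi) (pow_le_pow_right₀ (by norm_num) hii)
    have h6 : (i' : ℝ) ≤ 2 * i := by exact_mod_cast h
    calc (i' : ℝ) * Real.log 2 / Real.log (g (2 ^ i')) ^ 2
        ≤ 2 * i * Real.log 2 / Real.log (g (2 ^ i)) ^ 2 := by gcongr
      _ = _ := by ring
  · have := h3 (2 ^ i) (2 ^ i') (hx i hi) (pow_le_pow_right₀ (by norm_num) hii)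
    rwa [Real.log_pow, Real.log_pow] at this

/-- The parameters of the epochs for a function `g` with the properties above. -/
theorem exists_scale_parameters {g : ℝ → ℝ} {β : ℕ → ℕ} {x₁ c C₃ : ℝ} {i₁ k₂ : ℕ} (hc : 0 < c)
    (hg0 : ∀ x : ℝ, 0 < x → 0 < g x) (hi₁ : x₁ ≤ 2 ^ i₁)
    (h1 : ∀ x, x₁ ≤ x → 100 ≤ Real.log (g x) ∧ c * Real.log (g x) ^ 2 ≤ Real.log x)
    (h2 : ∀ x y, x₁ ≤ x → x ≤ y → Real.log (g x) ≤ Real.log (g y))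
    (hu : ∀ i : ℕ, i₁ ≤ i → i * Real.log 2 / Real.log (g (2 ^ i)) ^ 2 ≤ i)
    (hm : Monotone β) (hhalf : ∀ i, β i ≤ i / 2)
    (hβ : ∀ k : ℕ, k₂ ≤ k → 2 ^ 15 * (k * Real.log 2 / Real.log (g (2 ^ k)) ^ 2) ≤ 2 ^ β k ∧
      2 ^ β k ≤ C₃ * (k * Real.log 2 / Real.log (g (2 ^ k)) ^ 2) ∧
      ∀ i, k ≤ 2 * i → i ≤ k → β k ≤ β i + 2) :
    ∃ k₀ : ℕ, (∀ t : ℕ, 2 ^ k₀ ≤ t → (2 : ℝ) ^ 22 * (1 + 2 ^ 31) ≤ g t) ∧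
      ∀ t T : ℕ, 2 ^ k₀ ≤ T → T ≤ t → ∃ j ρ D k0 k1 s, Chan.EpochScale β (2 ^ β (Nat.log 2 t))
        (g t / (2 ^ 22 * (1 + 2 ^ 31))) (2 ^ 22) ρ D T j k0 k1 s := by
  obtain ⟨N, hN⟩ := exists_cube_le_two_pow (|C₃| * 2 ^ 60)
  have hl2 : 0 < Real.log 2 := Real.log_pos one_lt_two
  have hl2' : Real.log 2 < 1 := Real.log_two_lt_d9.trans (by norm_num)
  have hl2'' : 0.69 < Real.log 2 := lt_trans (by norm_num) Real.log_two_gt_d9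
  have hexp : ∀ (γ : ℝ) (m : ℕ), m * Real.log 2 ≤ γ → (2 : ℝ) ^ m ≤ Real.exp γ := by
    intro γ m h
    calc (2 : ℝ) ^ m = Real.exp (m * Real.log 2) := by
          rw [Real.exp_nat_mul, Real.exp_log zero_lt_two]
      _ ≤ _ := Real.exp_le_exp.2 h
  refine ⟨N + 2 * i₁ + 2 * k₂ + ⌈170 / c⌉₊ + 400, fun t ht => ?_, fun t T hT hTt => ?_⟩
  · have ht' : (2 : ℝ) ^ i₁ ≤ t := by
      exact_mod_cast (Nat.pow_le_pow_right (by norm_num) (by omega)).trans ht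
    have ht0 : (0 : ℝ) < t := lt_of_lt_of_le (by positivity) ht'
    have h3 := hexp (Real.log (g t)) 54 (by have := (h1 t (hi₁.trans ht')).1; push_cast; linarith)
    rw [Real.exp_log (hg0 t ht0)] at h3
    refine le_trans (by norm_num) h3
  obtain ⟨k, hk⟩ : ∃ k, k = Nat.log 2 T := ⟨_, rfl⟩
  have hkk : N + 2 * i₁ + 2 * k₂ + ⌈170 / c⌉₊ + 400 ≤ k := by
    rw [hk]; exact Nat.le_log_of_pow_le (by norm_num) hT
  have hT0 : T ≠ 0 := by rintro rfl; simp at hT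
  have hkT : 2 ^ k ≤ T := hk ▸ Nat.pow_log_le_self 2 hT0
  have hxi : ∀ i, i₁ ≤ i → x₁ ≤ 2 ^ i := fun i hi => hi₁.trans (pow_le_pow_right₀ (by norm_num) hi)
  obtain ⟨h3, h4⟩ := h1 (2 ^ k) (hxi k (by omega))
  have h5 : Real.log (g (2 ^ k)) ≤ Real.log (g t) :=
    h2 _ _ (hxi k (by omega)) (by exact_mod_cast hkT.trans hTt)
  rw [Real.log_pow] at h4
  have hγi : ∀ i, k ≤ 2 * i → i ≤ k → Real.log (g (2 ^ i)) ≤ Real.log (g (2 ^ k)) := fun i _ hi' =>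
    h2 _ _ (hxi i (by omega)) (pow_le_pow_right₀ (by norm_num) hi')
  generalize Real.log (g (2 ^ k)) = γ at h3 h4 h5 hγi
  have ht0 : (0 : ℝ) < t := by exact_mod_cast (by omega : 0 < t)
  -- Thus `2 ^ (8 * j) ≤ g`, while `j` is still a constant fraction of `log g`.
  set j : ℕ := ⌊γ / (8 * Real.log 2)⌋₊ with hj
  have hj1 : (j : ℝ) * (8 * Real.log 2) ≤ γ :=
    (le_div_iff₀ (by positivity)).1 (Nat.floor_le (by positivity))
  have hj2 : γ < (j + 1) * (8 * Real.log 2) := (div_lt_iff₀ (by positivity)).1 (Nat.lt_floor_add_one _)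
  have hj12 : 13 ≤ j := by
    by_contra h
    have : (j : ℝ) + 1 ≤ 13 := by exact_mod_cast (by omega : j + 1 ≤ 13)
    have : ((j : ℝ) + 1) * (8 * Real.log 2) ≤ 13 * (8 * Real.log 2) := by gcongr
    linarith [Real.log_two_lt_d9]
  have hj13 : (13 : ℝ) ≤ j := by exact_mod_cast hj12
  have hj3 : γ ≤ 16 * j * Real.log 2 := by nlinarith
  have hkr : 170 / c + 400 ≤ k :=
    (add_le_add_left (Nat.le_ceil _) 400).trans (by exact_mod_cast (by omega : ⌈170 / c⌉₊ + 400 ≤ k))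
  refine ⟨j, Chan.exists_epochScale hk hhalf hm (by omega) ?_ ?_ (hβ k (by omega)).2.2 ?_ le_rfl ?_ ?_⟩
  -- As `c * γ ^ 2 ≤ k * log 2`, the number `j` is `O(√k)`; completing the square makes this a
  -- linear bound with the constants needed.
  · have h6 : 13 * γ ≤ c * γ ^ 2 / 2 + 85 / c := by
      have : c * γ ^ 2 / 2 + 85 / c - 13 * γ = ((c * γ - 13) ^ 2 + 1) / (2 * c) := by field_simp; ring
      have : 0 ≤ ((c * γ - 13) ^ 2 + 1) / (2 * c) := by positivity
      linarith
    have h7 : 170 / c = 2 * (85 / c) := by ring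
    have h8 : (k : ℝ) * Real.log 2 ≤ k := mul_le_of_le_one_right (by positivity) hl2'.le
    have h9 : (5 : ℝ) * j ≤ γ := by nlinarith
    have : (64 : ℝ) * j + 200 ≤ k := by linarith
    exact_mod_cast this
  · have h6 := (hβ k (by omega)).2.1
    have h7 := hu k (by omega)
    have h8 : C₃ * (k * Real.log 2 / Real.log (g (2 ^ k)) ^ 2) ≤ |C₃| * (k + 1) :=
      mul_le_mul (le_abs_self _) (by linarith) (by positivity) (abs_nonneg _)
    have h9 : (2 : ℝ) ^ β k * (k + 1) ^ 2 * 2 ^ 60 ≤ 2 ^ (k / 2) := by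
      refine le_trans ?_ (hN k (by omega))
      calc (2 : ℝ) ^ β k * (k + 1) ^ 2 * 2 ^ 60 ≤ (|C₃| * (k + 1)) * (k + 1) ^ 2 * 2 ^ 60 := by
            gcongr; exact h6.trans h8
        _ = _ := by ring
    exact_mod_cast h9
  · intro i hki hik
    have h6 := (hβ i (by omega)).1
    have h7 := hγi i hki hik
    have h8 : 0 < Real.log (g (2 ^ i)) := lt_of_lt_of_le (by norm_num) (h1 _ (hxi i (by omega))).1
    have h9 : (k : ℝ) ≤ 2 * i := by exact_mod_cast hki
    have h10 : Real.log (g (2 ^ i)) ^ 2 ≤ (16 * j) ^ 2 * Real.log 2 := by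
      calc Real.log (g (2 ^ i)) ^ 2 ≤ (16 * j * Real.log 2) ^ 2 := by gcongr; exact h7.trans hj3
        _ = (16 * j) ^ 2 * Real.log 2 * Real.log 2 := by ring
        _ ≤ (16 * j) ^ 2 * Real.log 2 * 1 := by gcongr
        _ = _ := by ring
    -- Here the order of `f` is decided: `2 ^ β` must be at least of order `k / j ^ 2`, that is,
    -- `log T / log² g`.
    have h11 : (64 : ℝ) * k ≤ 2 ^ β i * j ^ 2 := by
      calc (64 : ℝ) * k ≤ 64 * (2 * i) := by gcongr
        _ = 2 ^ 15 * (i * Real.log 2 / ((16 * j) ^ 2 * Real.log 2)) * j ^ 2 := by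
          field_simp; ring
        _ ≤ 2 ^ 15 * (i * Real.log 2 / Real.log (g (2 ^ i)) ^ 2) * j ^ 2 := by gcongr
        _ ≤ 2 ^ β i * j ^ 2 := by gcongr
    exact_mod_cast h11
  · exact pow_le_pow_right₀ (by norm_num) (hm (hk ▸ Nat.log_mono_right hTt))
  · have h6 : (2 : ℝ) ^ (8 * j) ≤ g t := by
      rw [← Real.exp_log (hg0 t ht0)]
      exact hexp _ _ (by push_cast; linarith)
    -- The surplus `2 ^ (4 * j)` absorbs all absolute constants because `4 * j ≥ 50`.
    have h7 : (2 : ℝ) ^ (4 * j + 18) * (1 + 2 ^ 31) ≤ 2 ^ (8 * j) := by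
      calc (2 : ℝ) ^ (4 * j + 18) * (1 + 2 ^ 31) ≤ 2 ^ (4 * j + 18) * 2 ^ 32 := by gcongr; norm_num
        _ = 2 ^ (4 * j + 50) := by rw [← pow_add]
        _ ≤ _ := pow_le_pow_right₀ (by norm_num) (by omega)
    rw [mul_div_assoc', mul_div_mul_left _ _ (by positivity), le_div_iff₀ (by positivity)]
    exact h7.trans h6

/-- A function that is constant up to some point and depends on the octave after it. -/
theorem isTheta_octaves {h w : ℝ → ℝ} {v : ℕ → ℝ} {a b T₀ : ℝ} (ha : 0 < a)
    (hv : ∀ k x, T₀ ≤ x → (2 : ℝ) ^ k ≤ x → x < 2 ^ (k + 1) → 0 ≤ h x ∧ a * h x ≤ v k ∧ v k ≤ b * h x)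
    (hw : ∀ x, T₀ ≤ x → w x = v (Nat.log 2 ⌊x⌋₊)) : w =Θ[atTop] h := by
  have key : ∀ᶠ x in atTop, 0 ≤ h x ∧ a * h x ≤ w x ∧ w x ≤ b * h x := by
    filter_upwards [eventually_ge_atTop T₀, eventually_ge_atTop 1] with x h1 h2
    rw [hw x h1]
    have h3 : ⌊x⌋₊ ≠ 0 := (Nat.floor_pos.2 h2).ne'
    refine hv _ x h1 ?_ ?_
    · exact le_trans (by exact_mod_cast Nat.pow_log_le_self 2 h3) (Nat.floor_le (by linarith))
    · exact lt_of_lt_of_le (Nat.lt_floor_add_one x)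
        (by exact_mod_cast Nat.lt_pow_succ_log_self (by norm_num) ⌊x⌋₊)
  refine ⟨IsBigO.of_bound b ?_, IsBigO.of_bound (1 / a) ?_⟩
  · filter_upwards [key] with x hx
    rw [Real.norm_of_nonneg hx.1, Real.norm_of_nonneg (le_trans (by have := hx.1; positivity) hx.2.1)]
    exact hx.2.2
  · filter_upwards [key] with x hx
    rw [Real.norm_of_nonneg hx.1, Real.norm_of_nonneg (le_trans (by have := hx.1; positivity) hx.2.1),
      one_div, le_inv_mul_iff₀ ha]
    exact hx.2.1

theorem theorem1 :
    ∃ y₀ : ℝ, 0 < y₀ ∧ ∀ g : ℝ → ℝ,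
      (∀ x : ℝ, 0 < x → 0 < g x) →
      (∀ᶠ x : ℝ in atTop, 1 ≤ g x) →
      SubLogarithmic y₀ (fun x => Real.log (g x) ^ 2) →
      (∃ φ : ℝ → ℝ, MonotoneOn φ (Set.Ioi 0) ∧
        φ =Θ[atTop] fun x => Real.log x / Real.log (g x) ^ 2) →
      ∃ f : ℝ → ℝ, (∀ x : ℝ, 0 < x → 0 < f x) ∧
        (f =Θ[atTop] fun x => Real.log x / Real.log (g x) ^ 2) ∧
        ∃ A : Algorithm, AchievesThroughput A f g := by
  -- The value `10 ^ 4` makes `log g ≥ 100` from some point on, large enough for `j ≥ 13`.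
  refine ⟨10 ^ 4, by norm_num, fun g hg0 hg1 hs ⟨φ, hφ, hθ⟩ => ?_⟩
  obtain ⟨x₁, c, K, hx₁, hc, hK, h1, h2, h3⟩ := exists_log_bounds hg1 hs hφ hθ
  obtain ⟨i₁, hi₁, hu1, hu2, hu3⟩ := exists_pow_two_bounds h1 h2 h3
  obtain ⟨β, hm, hhalf, k₂, C₃, hβ⟩ := exists_blocks hc hu1 hu2 hu3
  obtain ⟨k₀, hgt, hscale⟩ := exists_scale_parameters hc hg0 hi₁ h1 h2 (fun i hi => (hu1 i hi).2)
    hm hhalf hβ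
  have hT₀ : 1 ≤ 2 ^ (k₀ + i₁ + k₂) := Nat.one_le_two_pow
  have hle : 2 ^ k₀ ≤ 2 ^ (k₀ + i₁ + k₂) := Nat.pow_le_pow_right (by norm_num) (by omega)
  obtain ⟨B, hB, hA⟩ := Chan.achievesThroughput_of_scale hT₀ hm hhalf hg0
    (fun t ht => hgt t (hle.trans ht)) (fun t T hT => hscale t T (hle.trans hT))
  refine ⟨_, fun x _ => ?_, ?_, _, hA⟩
  · split_ifs <;> positivity
  have hC₃ : 0 ≤ C₃ := by
    obtain ⟨-, h4, -⟩ := hβ (k₂ + i₁) (by omega)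
    have h5 := (hu1 (k₂ + i₁) (by omega)).1
    by_contra h
    have h6 := mul_neg_of_neg_of_pos (not_le.1 h) (hc.trans_le h5)
    have : (0 : ℝ) < 2 ^ β (k₂ + i₁) := by positivity
    linarith
  -- Within an octave `log x` at most doubles, which turns `2 ^ 15` into `2 ^ 14`; the upper
  -- constant uses quasi-monotonicity from `2 ^ k` to `x`.
  refine isTheta_octaves (v := fun k => B * 2 ^ β k) (a := B * 2 ^ 14) (b := B * C₃ * K)
    (T₀ := ((2 ^ (k₀ + i₁ + k₂) : ℕ) : ℝ)) (by positivity) (fun k x hx hkx hxk => ?_) (fun x hx => ?_)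
  · rw [Nat.cast_pow, Nat.cast_ofNat] at hx
    have hk : k₀ + i₁ + k₂ ≤ k := by
      have := (pow_lt_pow_iff_right₀ (one_lt_two (α := ℝ))).1 (hx.trans_lt hxk)
      omega
    have hk0 : x₁ ≤ 2 ^ k := hi₁.trans (pow_le_pow_right₀ (by norm_num) (by omega))
    obtain ⟨h4, h5, -⟩ := hβ k (by omega)
    have h6 : 100 ≤ Real.log (g (2 ^ k)) := (h1 _ hk0).1
    have h7 := h2 _ _ hk0 hkx
    have hx0 : 1 ≤ x := hx₁.trans (hk0.trans hkx)
    have h8 : Real.log x ≤ 2 * (k * Real.log 2) := by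
      have h9 := Real.log_le_log (by linarith) hxk.le
      rw [Real.log_pow, Nat.cast_add_one] at h9
      have h10 : (1 : ℝ) ≤ k := by
        by_contra h
        have h11 : k = 0 := by
          rw [not_le] at h
          exact_mod_cast Nat.lt_one_iff.1 (by exact_mod_cast h)
        have h12 := (h1 _ hk0).2
        rw [h11, pow_zero, Real.log_one] at h12
        rw [h11, pow_zero] at h6
        have : 0 < c * Real.log (g 1) ^ 2 := by positivity
        linarith
      have := Real.log_pos (one_lt_two (α := ℝ))
      nlinarith
    have h9 := h3 _ _ hk0 hkx
    rw [Real.log_pow] at h9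
    refine ⟨div_nonneg (Real.log_nonneg hx0) (by positivity), ?_, ?_⟩
    · have h10 : Real.log x / Real.log (g x) ^ 2 ≤ 2 * (k * Real.log 2 / Real.log (g (2 ^ k)) ^ 2) := by
        calc Real.log x / Real.log (g x) ^ 2 ≤ 2 * (k * Real.log 2) / Real.log (g (2 ^ k)) ^ 2 := by
              gcongr
          _ = _ := by ring
      calc B * 2 ^ 14 * (Real.log x / Real.log (g x) ^ 2)
          ≤ B * 2 ^ 14 * (2 * (k * Real.log 2 / Real.log (g (2 ^ k)) ^ 2)) := by gcongr
        _ = B * (2 ^ 15 * (k * Real.log 2 / Real.log (g (2 ^ k)) ^ 2)) := by ring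
        _ ≤ B * 2 ^ β k := by gcongr
    · calc B * 2 ^ β k ≤ B * (C₃ * (K * (Real.log x / Real.log (g x) ^ 2))) := by
            gcongr; exact h5.trans (by gcongr)
        _ = _ := by ring
  · rw [if_neg (not_lt.2 hx)]
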